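/- Let $\eta=\mathrm{diag}(-1,1,1)$, let $\mathbb H^2=\{v\in\mathbb R^3:\langle v,\eta v\rangle=-v_0^2+v_1^2+v_2^2=-1,\ v_0>0\}$, let $\times$ be the usual cross product on $\mathbb R^3$, and for a map $u$ into $\mathbb H^2$ with weak spatial derivatives $\partial_1u,\partial_2u$ put $\|\nabla u\|^2=\sum_{\ell=1}^2|\langle\partial_\ell u,\eta\,\partial_\ell u\rangle|$. Let $u_*\in\dot H^1(\mathbb R^2,\mathbb H^2)$, that is, $u_*:\mathbb R^2\to\mathbb R^3$ is locally integrable with $u_*(x)\in\mathbb H^2$ for a.e. $x$, has a locally integrable weak gradient, and $\|\nabla u_*\|\in L^2(\mathbb R^2)$. Suppose that $\int_{\mathbb R^2}(u_{*0}-1)\,dx<\infty$. Then the Schrödinger map system $$\partial_t u=\eta\,\sum_{\ell=1}^2\partial_\ell(u\times\partial_\ell u),\qquad u(0)=u_*,$$ has a global weak solution $u:\mathbb R\times\mathbb R^2\to\mathbb H^2$: for every $t\in\mathbb R$, $u(t,x)\in\mathbb H^2$ for a.e. $x$; $u$, $\partial_\ell u$ and $u\times\partial_\ell u$ are locally integrable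 on $\mathbb R\times\mathbb R^2$; and the equation holds in the sense of distributions on $\mathbb R\times\mathbb R^2$. Moreover $\|\nabla u\|\in L^\infty(\mathbb R;L^2(\mathbb R^2))$, $u\in C(\mathbb R;L^2_{\rm loc}(\mathbb R^2))$, $u_0-1\in C(\mathbb R;L^1(\mathbb R^2))$, and $u(0)=u_*$ a.e. on $\mathbb R^2$. -/

import Mathlib

open MeasureTheory Filter Topology
open scoped Matrix ContDiff

/-- The plane `ℝ²`, the spatial domain. -/
abbrev Plane : Type := EuclideanSpace ℝ (Fin 2)

/-- The vector space `ℝ³` carrying the Lorentz form. Only its topology and the class of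
integrable functions with values in it are used, so the choice of norm is immaterial. -/
abbrev Lor : Type := Fin 3 → ℝ

/-- The matrix `η = diag(-1, 1, 1)`. -/
def eta : Matrix (Fin 3) (Fin 3) ℝ := Matrix.diagonal ![-1, 1, 1]

/-- The Lorentz form `⟨v, η w⟩`. -/
def lorentzForm (v w : Lor) : ℝ := v ⬝ᵥ (eta *ᵥ w)

/-- The hyperboloid model `ℍ² = {u : -u₀² + u₁² + u₂² = -1, u₀ > 0}`. -/
def hyperbolicPlane : Set Lor := {u | lorentzForm u u = -1 ∧ 0 < u 0}

/-- For a gradient `G = (∂₁u, ∂₂u)` of a map into `ℍ²`, the length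
`‖∇u‖ = (∑ₖ ‖∂ₖu‖²)^(1/2)` with `‖v‖² = |⟨v, η v⟩|`. -/
noncomputable def gradNorm (G : Fin 2 → Lor) : ℝ :=
  √(∑ k, |lorentzForm (G k) (G k)|)

/-- `G = (∂₁f, ∂₂f)` in the sense of distributions on `ℝ²`, with `f`, `∂₁f`, `∂₂f` locally
integrable. -/
def HasWeakGradient (f : Plane → Lor) (G : Plane → Fin 2 → Lor) : Prop :=
  LocallyIntegrable f ∧ (∀ k, LocallyIntegrable (fun x => G x k)) ∧
    ∀ φ : Plane → ℝ, ContDiff ℝ ∞ φ → HasCompactSupport φ → ∀ k : Fin 2,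
      ∫ x, fderiv ℝ φ x (EuclideanSpace.single k 1) • f x = -∫ x, φ x • G x k

/-- `f ∈ Ḣ¹(ℝ², ℍ²)`: `f` takes values in `ℍ²` almost everywhere, and it has a weak gradient
with `‖∇f‖ ∈ L²(ℝ²)`. -/
def InHomogeneousH1 (f : Plane → Lor) : Prop :=
  (∀ᵐ x, f x ∈ hyperbolicPlane) ∧
    ∃ G : Plane → Fin 2 → Lor, HasWeakGradient f G ∧ MemLp (fun x => gradNorm (G x)) 2

/-- `t ↦ f t` is a continuous map from `ℝ` to `Lᵖ(μ)`. -/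
def ContinuousInLp {X E : Type*} [MeasurableSpace X] [NormedAddCommGroup E]
    (p : ENNReal) (μ : Measure X) (f : ℝ → X → E) : Prop :=
  (∀ t, MemLp (f t) p μ) ∧
    ∀ s, Tendsto (fun t => eLpNorm (fun x => f t x - f s x) p μ) (𝓝 s) (𝓝 0)

/-- The vector `η (u × ∂ₗu)`, where `G = (∂₁u, ∂₂u)`. -/
def flux (u : Lor) (G : Fin 2 → Lor) (l : Fin 2) : Lor := eta *ᵥ (u ⨯₃ G l)

/-- `u : ℝ × ℝ² → ℍ²`, with spatial gradient `G`, is a global weak solution of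
`∂ₜu = η ∂ₗ(u × ∂ₗu)`: the maps `u`, `∂ₗu` and `u × ∂ₗu` are locally integrable on space-time,
and the equation holds in the sense of distributions on `ℝ × ℝ²`. -/
structure IsGlobalWeakSolution (u : ℝ → Plane → Lor) (G : ℝ → Plane → Fin 2 → Lor) : Prop where
  mem : ∀ t, ∀ᵐ x, u t x ∈ hyperbolicPlane
  locallyIntegrable : LocallyIntegrable (fun z : ℝ × Plane => u z.1 z.2)
  locallyIntegrable_gradient :
    ∀ l, LocallyIntegrable (fun z : ℝ × Plane => G z.1 z.2 l)
  hasWeakGradient : ∀ᵐ t, HasWeakGradient (u t) (G t)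
  locallyIntegrable_flux :
    ∀ l, LocallyIntegrable (fun z : ℝ × Plane => flux (u z.1 z.2) (G z.1 z.2) l)
  equation : ∀ φ : ℝ × Plane → ℝ, ContDiff ℝ ∞ φ → HasCompactSupport φ →
    ∫ z, fderiv ℝ φ z (1, 0) • u z.1 z.2 =
      ∫ z, ∑ l, fderiv ℝ φ z (0, EuclideanSpace.single l 1) • flux (u z.1 z.2) (G z.1 z.2) l

/-!
The solution is the limit of Schrödinger map flows on square lattices of mesh `h → 0`.

On a lattice the flow `∂ₜuᵢ = h⁻² η (uᵢ × ∑ⱼ uⱼ)`, the sum running over the four neighbours of `i`,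
is an ordinary differential equation. For data equal to the centre of `ℍ²` outside of a finite set
it preserves `ℍ²`, the mass `∑ (u₀ - 1)` and the energy, which is the sum of the squared Lorentz
lengths of the chords between neighbours (`lattice_conservation`); conservation of mass makes it
exist for as long as desired (`exists_latticeFlow`). Maps of finite energy and mass are approximated
by such data in the disc model of `ℍ²`, where one can mollify, contract towards the centre, cut off
and sample with control of mass and energy (`IsDiscMap.exists_lattice_data`).

The target is not compact, and bounds in terms of the energy have to be supplemented by bounds for
the size of `u`. They come from the mass: `log u₀` has Dirichlet energy at most that of `u`, and a
Gagliardo-Nirenberg inequality applied to its layers shows that its distribution function decays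
faster than any exponential. Thus mass and energy control the eighth moment of `u₀ - 1`
(`sum_moment_le`), uniformly in the mesh and in time.

With these bounds spatial translations are uniformly continuous in `L¹` on bounded sets, and the
equation gives equicontinuity in time of the mollified maps. A subsequence therefore converges at
every time almost everywhere in space, and the limit is continuous in time with values in `L¹_loc`
(`exists_subseq_tendsto`).

The nonlinearity `u × ∂u` passes to the limit because it is linear in the derivative once the latter
is written in a frame. The chord between two points of `ℍ²` is tangent at their geodesic midpoint, so
the difference quotients have coordinates in an orthonormal frame there whose squares add up to the
energy density. These coordinates converge weakly in `L²`, while the frame and its cross product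
with `u` have quadratic growth, so that they converge strongly in `L²_loc` by virtue of the moments
(`exists_coord`). The products of the two limits are the gradient and the flux of the limit map
(`exists_gradient`). The identity for the gradient, so far one on space-time, holds at almost every
time by testing with a countable dense family (`ae_hasWeakGradient`).

Continuity in `L²_loc` follows by interpolation with the moments (`continuousInLp_two`). For the
continuity of `u₀ - 1` in `L¹` of the whole plane the mass must not escape to infinity: the flux of
`u₀` vanishes where `u` is at the centre of `ℍ²`, hence is integrable over the plane, and the mass of
the limit is conserved (`integral_mass_eq`, `continuousInLp_one`).
-/

/-! ### Geometry of the hyperboloid -/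

theorem lorentzForm_eq (v w : Lor) :
    lorentzForm v w = -(v 0 * w 0) + v 1 * w 1 + v 2 * w 2 := by
  simp [lorentzForm, eta, Matrix.mulVec_diagonal, dotProduct, Fin.sum_univ_three]

theorem mem_hyperbolicPlane {u : Lor} :
    u ∈ hyperbolicPlane ↔ u 0 ^ 2 = 1 + u 1 ^ 2 + u 2 ^ 2 ∧ 0 < u 0 := by
  rw [hyperbolicPlane, Set.mem_ofPred_eq, lorentzForm_eq]
  constructor <;> rintro ⟨h, h0⟩ <;> exact ⟨by linarith, h0⟩

theorem one_le_of_mem {u : Lor} (hu : u ∈ hyperbolicPlane) : 1 ≤ u 0 := by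
  obtain ⟨h, h0⟩ := mem_hyperbolicPlane.1 hu
  nlinarith [sq_nonneg (u 1), sq_nonneg (u 2)]

theorem norm_le_of_mem {u : Lor} (hu : u ∈ hyperbolicPlane) : ‖u‖ ≤ u 0 := by
  obtain ⟨h, h0⟩ := mem_hyperbolicPlane.1 hu
  refine (pi_norm_le_iff_of_nonneg h0.le).2 fun i => ?_
  rw [Real.norm_eq_abs]
  fin_cases i
  · exact (abs_of_pos h0).le
  · exact abs_le_of_sq_le_sq (show u 1 ^ 2 ≤ u 0 ^ 2 by nlinarith [sq_nonneg (u 2)]) h0.le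
  · exact abs_le_of_sq_le_sq (show u 2 ^ 2 ≤ u 0 ^ 2 by nlinarith [sq_nonneg (u 1)]) h0.le

/-- The centre `(1, 0, 0)` of the hyperboloid. -/
def origin : Lor := ![1, 0, 0]

theorem origin_mem : origin ∈ hyperbolicPlane := by
  rw [mem_hyperbolicPlane]; simp [origin]

theorem isClosed_hyperbolicPlane : IsClosed hyperbolicPlane := by
  have : hyperbolicPlane = {u : Lor | u 0 ^ 2 = 1 + u 1 ^ 2 + u 2 ^ 2 ∧ 1 ≤ u 0} := by
    ext u
    constructor
    · intro hu; exact ⟨(mem_hyperbolicPlane.1 hu).1, one_le_of_mem hu⟩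
    · rintro ⟨h1, h2⟩; exact mem_hyperbolicPlane.2 ⟨h1, by linarith⟩
  rw [this]
  have hc : ∀ i, Continuous fun u : Lor => u i := fun i => continuous_apply i
  exact (isClosed_eq ((hc 0).pow 2) ((continuous_const.add ((hc 1).pow 2)).add
    ((hc 2).pow 2))).inter (isClosed_le continuous_const (hc 0))

/-- The reverse Cauchy-Schwarz inequality on the hyperboloid. -/
theorem lorentzForm_le_neg_one {u w : Lor} (hu : u ∈ hyperbolicPlane) (hw : w ∈ hyperbolicPlane) :
    lorentzForm u w ≤ -1 := by
  obtain ⟨h, h0⟩ := mem_hyperbolicPlane.1 hu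
  obtain ⟨k, k0⟩ := mem_hyperbolicPlane.1 hw
  rw [lorentzForm_eq]
  have : (1 + u 1 * w 1 + u 2 * w 2) ^ 2 ≤ (u 0 * w 0) ^ 2 := by
    rw [mul_pow, h, k]
    nlinarith [sq_nonneg (u 1 - w 1), sq_nonneg (u 2 - w 2), sq_nonneg (u 1 * w 2 - u 2 * w 1)]
  have := abs_le_of_sq_le_sq this (by positivity)
  linarith [(abs_le.1 this).2]

/-- The squared Lorentz length of the chord `w - u`; it equals `4 sinh²(d/2)` for two points of the
hyperboloid at distance `d`. -/
def chordSq (u w : Lor) : ℝ := lorentzForm (w - u) (w - u)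

theorem chordSq_eq {u w : Lor} (hu : u ∈ hyperbolicPlane) (hw : w ∈ hyperbolicPlane) :
    chordSq u w = 2 * (-lorentzForm u w - 1) := by
  obtain ⟨h, h0⟩ := mem_hyperbolicPlane.1 hu
  obtain ⟨k, k0⟩ := mem_hyperbolicPlane.1 hw
  simp only [chordSq, lorentzForm_eq, Pi.sub_apply]
  nlinarith

theorem chordSq_nonneg {u w : Lor} (hu : u ∈ hyperbolicPlane) (hw : w ∈ hyperbolicPlane) :
    0 ≤ chordSq u w := by
  rw [chordSq_eq hu hw]; linarith [lorentzForm_le_neg_one hu hw]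

/-- The midpoint of the geodesic joining two points of the hyperboloid. -/
noncomputable def midpt (u w : Lor) : Lor := (√(2 - 2 * lorentzForm u w))⁻¹ • (u + w)

theorem midpt_mem {u w : Lor} (hu : u ∈ hyperbolicPlane) (hw : w ∈ hyperbolicPlane) :
    midpt u w ∈ hyperbolicPlane := by
  obtain ⟨h, h0⟩ := mem_hyperbolicPlane.1 hu
  obtain ⟨k, k0⟩ := mem_hyperbolicPlane.1 hw
  have hl := lorentzForm_le_neg_one hu hw
  have hpos : 0 < 2 - 2 * lorentzForm u w := by linarith
  have hs : 0 < √(2 - 2 * lorentzForm u w) := Real.sqrt_pos.2 hpos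
  have hsq := Real.sq_sqrt hpos.le
  rw [mem_hyperbolicPlane]
  constructor
  · simp only [midpt, Pi.smul_apply, Pi.add_apply, smul_eq_mul, mul_pow, inv_pow, hsq]
    have h1 : (u 0 + w 0) ^ 2 =
        (2 - 2 * lorentzForm u w) + (u 1 + w 1) ^ 2 + (u 2 + w 2) ^ 2 := by
      rw [lorentzForm_eq]; linear_combination h + k
    rw [h1, mul_add, mul_add, inv_mul_cancel₀ hpos.ne']
  · simp only [midpt, Pi.smul_apply, Pi.add_apply, smul_eq_mul]
    positivity

theorem midpt_zero_le {u w : Lor} (hu : u ∈ hyperbolicPlane) (hw : w ∈ hyperbolicPlane) :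
    midpt u w 0 ≤ u 0 + w 0 := by
  have hl := lorentzForm_le_neg_one hu hw
  have h1 : 1 ≤ √(2 - 2 * lorentzForm u w) := Real.one_le_sqrt.2 (by linarith)
  simp only [midpt, Pi.smul_apply, Pi.add_apply, smul_eq_mul]
  have := one_le_of_mem hu
  have := one_le_of_mem hw
  exact mul_le_of_le_one_left (by linarith) (inv_le_one_of_one_le₀ h1)

theorem midpt_self {u : Lor} (hu : u ∈ hyperbolicPlane) : midpt u u = u := by
  have h : lorentzForm u u = -1 := hu.1
  have : √(2 - 2 * (-1 : ℝ)) = 2 := by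
    rw [show (2 - 2 * (-1 : ℝ)) = 2 ^ 2 by norm_num]; exact Real.sqrt_sq (by norm_num)
  rw [midpt, h, this, ← two_smul ℝ u, smul_smul]; norm_num

theorem continuous_lorentzForm : Continuous fun q : Lor × Lor => lorentzForm q.1 q.2 := by
  simp only [lorentzForm_eq]; fun_prop

theorem tendsto_midpt {ι : Type*} {l : Filter ι} {a b : ι → Lor} {u : Lor}
    (hu : u ∈ hyperbolicPlane) (ha : Tendsto a l (𝓝 u)) (hb : Tendsto b l (𝓝 u)) :
    Tendsto (fun i => midpt (a i) (b i)) l (𝓝 u) := by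
  have h2 : Tendsto (fun i => √(2 - 2 * lorentzForm (a i) (b i))) l
      (𝓝 √(2 - 2 * lorentzForm u u)) :=
    ((tendsto_const_nhds.sub (((continuous_lorentzForm.tendsto (u, u)).comp
      (ha.prodMk_nhds hb)).const_mul 2))).sqrt
  have hne : √(2 - 2 * lorentzForm u u) ≠ 0 := by
    have h : lorentzForm u u = -1 := hu.1
    rw [h]; norm_num
  have := (h2.inv₀ hne).smul (ha.add hb)
  rw [← midpt, midpt_self hu] at this
  exact this

/-- The orthonormal frame of the tangent plane at `m` obtained by boosting the standard frame at the
centre of the hyperboloid to `m`. -/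
noncomputable def frame (m : Lor) (a : Fin 2) : Lor :=
  m a.succ • ![1, m 1 / (1 + m 0), m 2 / (1 + m 0)] + Pi.single a.succ 1

/-- The coordinates of a tangent vector in the frame `frame m`. -/
noncomputable def frameCoord (m ξ : Lor) (a : Fin 2) : ℝ :=
  ξ a.succ - m a.succ * ξ 0 / (1 + m 0)

theorem lorentzForm_frame {m : Lor} (hm : m ∈ hyperbolicPlane) (y : Fin 2 → ℝ) :
    lorentzForm (∑ a, y a • frame m a) (∑ a, y a • frame m a) = ∑ a, y a ^ 2 := by
  obtain ⟨h, h0⟩ := mem_hyperbolicPlane.1 hm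
  have hne : 1 + m 0 ≠ 0 := by positivity
  have h' : m 2 ^ 2 = m 0 ^ 2 - 1 - m 1 ^ 2 := by linarith
  simp only [lorentzForm_eq, Fin.sum_univ_two, frame, Pi.add_apply, Pi.smul_apply, smul_eq_mul]
  simp
  field_simp
  grind

theorem sum_frameCoord_smul {m ξ : Lor} (hm : m ∈ hyperbolicPlane) (hξ : lorentzForm m ξ = 0) :
    ∑ a, frameCoord m ξ a • frame m a = ξ := by
  obtain ⟨h, h0⟩ := mem_hyperbolicPlane.1 hm
  have hne : 1 + m 0 ≠ 0 := by positivity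
  rw [lorentzForm_eq] at hξ
  ext i
  fin_cases i <;>
  · simp only [Fin.sum_univ_two, frame, frameCoord, Pi.add_apply, Pi.smul_apply, smul_eq_mul]
    simp
    field_simp
    grind

theorem sum_frameCoord_sq {m ξ : Lor} (hm : m ∈ hyperbolicPlane) (hξ : lorentzForm m ξ = 0) :
    ∑ a, frameCoord m ξ a ^ 2 = lorentzForm ξ ξ := by
  rw [← lorentzForm_frame hm, sum_frameCoord_smul hm hξ]

theorem norm_frame_le {m : Lor} (hm : m ∈ hyperbolicPlane) (a : Fin 2) :
    ‖frame m a‖ ≤ 2 * m 0 := by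
  obtain ⟨h, h0⟩ := mem_hyperbolicPlane.1 hm
  have h1 := one_le_of_mem hm
  have hk : ∀ i, |m i| ≤ m 0 := fun i => (norm_le_pi_norm m i).trans (norm_le_of_mem hm)
  have hd : ∀ i, |m i / (1 + m 0)| ≤ 1 := fun i => by
    rw [abs_div, abs_of_pos (by linarith : 0 < 1 + m 0), div_le_one (by linarith)]
    linarith [hk i]
  have hv : ‖(![1, m 1 / (1 + m 0), m 2 / (1 + m 0)] : Lor)‖ ≤ 1 := by
    refine (pi_norm_le_iff_of_nonneg zero_le_one).2 fun i => ?_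
    fin_cases i
    · simp
    · exact hd 1
    · exact hd 2
  have hs : ‖(Pi.single a.succ 1 : Lor)‖ ≤ 1 := by
    refine (pi_norm_le_iff_of_nonneg zero_le_one).2 fun i => ?_
    by_cases hi : i = a.succ
    · subst hi; simp
    · simp [hi]
  calc ‖frame m a‖ ≤ ‖m a.succ • (![1, m 1 / (1 + m 0), m 2 / (1 + m 0)] : Lor)‖
        + ‖(Pi.single a.succ 1 : Lor)‖ := norm_add_le _ _
    _ ≤ m 0 * 1 + 1 := by
        rw [norm_smul]
        gcongr
        exact hk _
    _ ≤ 2 * m 0 := by linarith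

theorem continuousAt_frame {m : Lor} (hm : m ∈ hyperbolicPlane) (a : Fin 2) :
    ContinuousAt (fun m => frame m a) m := by
  have h1 := one_le_of_mem hm
  have hne : 1 + m 0 ≠ 0 := by linarith
  have hc : ∀ i, ContinuousAt (fun m : Lor => m i) m := fun i => (continuous_apply i).continuousAt
  have hd : ∀ i, ContinuousAt (fun m : Lor => m i / (1 + m 0)) m := fun i =>
    (hc i).div (continuousAt_const.add (hc 0)) hne
  refine ((hc _).smul (continuousAt_pi.2 fun i => ?_)).add continuousAt_const
  fin_cases i
  · exact continuousAt_const
  · exact hd 1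
  · exact hd 2

/-- The chord between two points is tangent to the hyperboloid at their geodesic midpoint. This is
what makes the frame coordinates of a difference quotient exact rather than approximate. -/
theorem lorentzForm_midpt_sub {u w : Lor} (hu : u ∈ hyperbolicPlane) (hw : w ∈ hyperbolicPlane)
    (c : ℝ) : lorentzForm (midpt u w) (c • (w - u)) = 0 := by
  obtain ⟨h, h0⟩ := mem_hyperbolicPlane.1 hu
  obtain ⟨k, k0⟩ := mem_hyperbolicPlane.1 hw
  simp only [midpt]
  set r := (√(2 - 2 * lorentzForm u w))⁻¹
  simp only [lorentzForm_eq, Pi.smul_apply, Pi.add_apply, Pi.sub_apply, smul_eq_mul]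
  linear_combination (-(r * c)) * (k - h)

theorem sq_sub_zero_le {u w : Lor} (hu : u ∈ hyperbolicPlane) (hw : w ∈ hyperbolicPlane) :
    (w 0 - u 0) ^ 2 ≤ u 0 * w 0 * chordSq u w := by
  rw [chordSq_eq hu hw]
  have hl := lorentzForm_le_neg_one hu hw
  obtain ⟨h, h0⟩ := mem_hyperbolicPlane.1 hu
  obtain ⟨k, k0⟩ := mem_hyperbolicPlane.1 hw
  rw [lorentzForm_eq] at *
  -- With `u·w` the spatial inner product this is `(u·w)² ≤ |u|²|w|²` up to a square.
  have h1 : (u 1 * w 1 + u 2 * w 2) ^ 2 ≤ (u 0 ^ 2 - 1) * (w 0 ^ 2 - 1) := by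
    rw [h, k]; nlinarith [sq_nonneg (u 1 * w 2 - u 2 * w 1)]
  set d := u 1 * w 1 + u 2 * w 2
  have : -(-(u 0 * w 0) + u 1 * w 1 + u 2 * w 2) - 1 = u 0 * w 0 - d - 1 := by ring
  rw [this]
  nlinarith [sq_nonneg (d - (u 0 * w 0 - 1)), mul_pos h0 k0, sq_nonneg d]

/-- `2 sinh (y/2) ≥ y`, in the form of a comparison of the logarithm with the chord. -/
theorem log_sub_log_sq_le {x y : ℝ} (hx : 0 < x) (hy : 0 < y) :
    (Real.log y - Real.log x) ^ 2 * (x * y) ≤ (y - x) ^ 2 := by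
  have key : ∀ s : ℝ, s ^ 2 ≤ (Real.exp (s / 2) - Real.exp (-(s / 2))) ^ 2 := by
    intro s
    have h := Real.abs_sinh (s / 2)
    have h2 : |s / 2| ≤ |Real.sinh (s / 2)| := by
      rw [h]; exact Real.self_le_sinh_iff.2 (abs_nonneg _)
    have h3 := sq_le_sq.2 h2
    rw [Real.sinh_eq] at h3
    nlinarith
  have hk := key (Real.log y - Real.log x)
  have ha := Real.exp_log hx
  have hb := Real.exp_log hy
  set p := Real.exp (Real.log x / 2)
  set q := Real.exp (Real.log y / 2)
  have hp : p ^ 2 = x := by rw [← ha, ← Real.exp_nat_mul]; congr 1; push_cast; ring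
  have hq : q ^ 2 = y := by rw [← hb, ← Real.exp_nat_mul]; congr 1; push_cast; ring
  have hp0 : 0 < p := Real.exp_pos _
  have hq0 : 0 < q := Real.exp_pos _
  have e1 : Real.exp ((Real.log y - Real.log x) / 2) = q / p := by
    rw [sub_div, Real.exp_sub]
  have e2 : Real.exp (-((Real.log y - Real.log x) / 2)) = p / q := by
    rw [sub_div, neg_sub, Real.exp_sub]
  rw [e1, e2] at hk
  calc _ ≤ (q / p - p / q) ^ 2 * (x * y) := by gcongr
    _ = (y - x) ^ 2 := by rw [← hp, ← hq]; field_simp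

theorem log_sub_log_sq_le_chordSq {u w : Lor} (hu : u ∈ hyperbolicPlane)
    (hw : w ∈ hyperbolicPlane) : (Real.log (w 0) - Real.log (u 0)) ^ 2 ≤ chordSq u w := by
  have h0 : 0 < u 0 := hu.2
  have k0 : 0 < w 0 := hw.2
  have h1 := log_sub_log_sq_le h0 k0
  have h2 := sq_sub_zero_le hu hw
  have h3 : 0 < u 0 * w 0 := mul_pos h0 k0
  nlinarith

/-! ### The lattice Schrödinger map flow -/

/-- The unit steps of the square lattice. -/
def step : Fin 2 → ℤ × ℤ := ![(1, 0), (0, 1)]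

/-- The sum of a lattice configuration over the four neighbours of a site. -/
def nbSum (U : ℤ × ℤ → Lor) (i : ℤ × ℤ) : Lor := ∑ l, (U (i + step l) + U (i - step l))

theorem eta_mulVec_cross (v w : Lor) : eta *ᵥ (v ⨯₃ w) =
    ![-(v 1 * w 2 - v 2 * w 1), v 2 * w 0 - v 0 * w 2, v 0 * w 1 - v 1 * w 0] := by
  ext i
  fin_cases i <;> simp [eta, Matrix.mulVec_diagonal, cross_apply]

theorem lorentzForm_comm (v w : Lor) : lorentzForm v w = lorentzForm w v := by
  simp only [lorentzForm_eq]; ring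

theorem lorentzForm_left_eta_cross (v w : Lor) : lorentzForm v (eta *ᵥ (v ⨯₃ w)) = 0 := by
  rw [eta_mulVec_cross, lorentzForm_eq]; simp; ring

/-- The velocity `η (v × w)` is Lorentz-orthogonal to `w`; with `w` the sum of the neighbours this
is conservation of energy, and the preceding orthogonality to `v` keeps the flow on the
hyperboloid. -/
theorem lorentzForm_eta_cross_right (v w : Lor) : lorentzForm (eta *ᵥ (v ⨯₃ w)) w = 0 := by
  rw [eta_mulVec_cross, lorentzForm_eq]; simp; ring

theorem lorentzForm_add_right (v w z : Lor) :
    lorentzForm v (w + z) = lorentzForm v w + lorentzForm v z := by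
  simp only [lorentzForm_eq, Pi.add_apply]; ring

theorem lorentzForm_smul_left (c : ℝ) (v w : Lor) :
    lorentzForm (c • v) w = c * lorentzForm v w := by
  simp only [lorentzForm_eq, Pi.smul_apply, smul_eq_mul]; ring

theorem HasDerivAt.lorentzForm {f g : ℝ → Lor} {f' g' : Lor} {t : ℝ} (hf : HasDerivAt f f' t)
    (hg : HasDerivAt g g' t) : HasDerivAt (fun s => lorentzForm (f s) (g s))
      (_root_.lorentzForm f' (g t) + _root_.lorentzForm (f t) g') t := by
  simp only [lorentzForm_eq]
  have hf' := hasDerivAt_pi.1 hf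
  have hg' := hasDerivAt_pi.1 hg
  refine (((((hf' 0).mul (hg' 0)).neg).add ((hf' 1).mul (hg' 1))).add
    ((hf' 2).mul (hg' 2))).congr_deriv ?_
  ring

/-- Translation invariance of sums of finitely supported functions. -/
theorem sum_shift_eq {G : Type*} [AddGroup G] [DecidableEq G] {V W : Finset G} (g : G → ℝ) (s : G)
    (hV : ∀ i ∉ V, g i = 0) (hW : ∀ i ∉ W, g (i + s) = 0) :
    ∑ i ∈ W, g (i + s) = ∑ i ∈ V, g i := by
  rw [← tsum_eq_sum (L := .unconditional G) hV, ← tsum_eq_sum (L := .unconditional G) hW]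
  exact (Equiv.addRight s).tsum_eq g

/-- The time component of the flux between two sites is antisymmetric and vanishes when one of the
sites is at the centre, so that the total mass is conserved. -/
theorem sum_eta_cross_zero {V : Finset (ℤ × ℤ)} {U : ℤ × ℤ → Lor} (hU : ∀ i ∉ V, U i = origin) :
    ∑ i ∈ V, (eta *ᵥ (U i ⨯₃ nbSum U i)) 0 = 0 := by
  set c : ℤ × ℤ → ℤ × ℤ → ℝ := fun i j => U i 1 * U j 2 - U i 2 * U j 1
  have hc : ∀ i j, (i ∉ V ∨ j ∉ V) → c i j = 0 := by
    rintro i j (h | h) <;> simp [c, hU _ h, origin]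
  have h1 : ∀ i, (eta *ᵥ (U i ⨯₃ nbSum U i)) 0 =
      -∑ l, (c i (i + step l) + c i (i - step l)) := by
    intro i
    simp only [eta_mulVec_cross, nbSum, Fin.sum_univ_two, Matrix.cons_val_zero, Pi.add_apply, c]
    ring
  simp only [h1, Finset.sum_neg_distrib, neg_eq_zero]
  rw [Finset.sum_comm]
  refine Finset.sum_eq_zero fun l _ => ?_
  rw [Finset.sum_add_distrib]
  have := sum_shift_eq (V := V) (W := V) (fun i => c (i + step l) i) (-step l)
    (fun i hi => hc _ _ (Or.inr hi)) (fun i hi => hc _ _ (Or.inl (by simpa using hi)))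
  simp only [← sub_eq_add_neg, sub_add_cancel] at this
  rw [this, ← Finset.sum_add_distrib]
  refine Finset.sum_eq_zero fun i _ => ?_
  simp only [c]; ring

/-- A vector field that is cut off outside of a ball is bounded and globally Lipschitz, so that the
Picard-Lindelöf theorem gives solutions on every bounded time interval. -/
theorem exists_solution_cutoff {E : Type*} [NormedAddCommGroup E] [NormedSpace ℝ E]
    [FiniteDimensional ℝ E] (F : E → E) (hF : ContDiff ℝ 1 F) (x₀ : E) (R T : ℝ) (hR : 0 < R)
    (hT : 0 < T) : ∃ (ψ : E → ℝ) (α : ℝ → E), (∀ x, ‖x‖ ≤ R → ψ x = 1) ∧ α 0 = x₀ ∧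
      ∀ t ∈ Set.Ioo (-T) T, HasDerivAt α (ψ (α t) • F (α t)) t := by
  let b : ContDiffBump (0 : E) := ⟨R, R + 1, hR, by linarith⟩
  set f : E → E := fun x => b x • F x
  have hf : ContDiff ℝ 1 f := b.contDiff.smul hF
  have hfc : HasCompactSupport f := b.hasCompactSupport.smul_right
  obtain ⟨K, hK⟩ : ∃ K, LipschitzWith K f :=
    hf.lipschitzWith_of_hasCompactSupport hfc one_ne_zero
  obtain ⟨L, hL⟩ := hfc.exists_bound_of_continuous hf.continuous
  have hP : IsPicardLindelof (fun _ : ℝ => f) (tmin := -T) (tmax := T) ⟨0, by simp [hT.le]⟩ x₀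
      (L.toNNReal * T.toNNReal) 0 L.toNNReal K := by
    refine .of_time_independent (fun x _ => (hL x).trans (Real.le_coe_toNNReal L))
      hK.lipschitzOnWith ?_
    simp [hT.le]
  obtain ⟨α, h0, hα⟩ := hP.exists_eq_forall_mem_Icc_hasDerivWithinAt₀
  refine ⟨b, α, fun x hx => b.one_of_mem_closedBall (by simpa using hx), h0, fun t ht => ?_⟩
  exact (hα t (Set.Ioo_subset_Icc_self ht)).hasDerivAt (Icc_mem_nhds ht.1 ht.2)

theorem eq_of_hasDerivAt_zero {f : ℝ → ℝ} {T : ℝ} (hf : ∀ t ∈ Set.Ioo (-T) T, HasDerivAt f 0 t)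
    {s t : ℝ} (hs : s ∈ Set.Ioo (-T) T) (ht : t ∈ Set.Ioo (-T) T) : f s = f t :=
  isOpen_Ioo.is_const_of_deriv_eq_zero isPreconnected_Ioo
    (fun x hx => (hf x hx).differentiableAt.differentiableWithinAt)
    (fun x hx => (hf x hx).deriv) hs ht

/-- Extension of a configuration on a finite set of sites by the centre of the hyperboloid. -/
def extendByOrigin (V : Finset (ℤ × ℤ)) (w : V → Lor) (i : ℤ × ℤ) : Lor :=
  if h : i ∈ V then w ⟨i, h⟩ else origin

theorem contDiff_extendByOrigin (V : Finset (ℤ × ℤ)) (i : ℤ × ℤ) (j : Fin 3) :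
    ContDiff ℝ 1 fun w => extendByOrigin V w i j := by
  by_cases h : i ∈ V
  · simp only [extendByOrigin, h, dif_pos]
    exact contDiff_pi.1 (contDiff_apply ℝ Lor (⟨i, h⟩ : V)) j
  · simp only [extendByOrigin, h, dif_neg, not_false_iff]
    exact contDiff_const

theorem contDiff_latticeField (V : Finset (ℤ × ℤ)) (κ : ℝ) :
    ContDiff ℝ 1 fun (w : V → Lor) (i : V) => κ •
      eta *ᵥ (extendByOrigin V w i ⨯₃ nbSum (extendByOrigin V w) i) := by
  refine contDiff_pi.2 fun i => contDiff_pi.2 fun j => ?_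
  have h := contDiff_extendByOrigin V
  have hn : ∀ j, ContDiff ℝ 1 fun w => nbSum (extendByOrigin V w) i j := by
    intro j
    simp only [nbSum, Finset.sum_apply, Pi.add_apply]
    exact ContDiff.sum fun l _ => (h _ _).add (h _ _)
  simp only [eta_mulVec_cross, Pi.smul_apply, smul_eq_mul]
  refine contDiff_const.mul ?_
  fin_cases j
  · exact (((h i 1).mul (hn 2)).sub ((h i 2).mul (hn 1))).neg
  · exact ((h i 2).mul (hn 0)).sub ((h i 0).mul (hn 2))
  · exact ((h i 0).mul (hn 1)).sub ((h i 1).mul (hn 0))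

/-- The conservation laws of the lattice flow, for a velocity multiplied by an arbitrary scalar. -/
theorem lattice_conservation {V : Finset (ℤ × ℤ)} {T : ℝ} (hT : 0 < T) {U : ℝ → ℤ × ℤ → Lor}
    {c : ℝ → ℝ} (hV : ∀ t, ∀ i ∉ V, U t i = origin) (h0 : ∀ i, U 0 i ∈ hyperbolicPlane)
    (hd : ∀ t ∈ Set.Ioo (-T) T, ∀ i ∈ V,
      HasDerivAt (fun s => U s i) (c t • eta *ᵥ (U t i ⨯₃ nbSum (U t) i)) t) :
    (∀ t ∈ Set.Ioo (-T) T, ∀ i, U t i ∈ hyperbolicPlane) ∧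
    (∀ t ∈ Set.Ioo (-T) T, ∑ i ∈ V, (U t i 0 - 1) = ∑ i ∈ V, (U 0 i 0 - 1)) ∧
    (∀ t ∈ Set.Ioo (-T) T, ∀ W : Finset (ℤ × ℤ), (∀ i ∉ W, i ∉ V ∧ ∀ l, i + step l ∉ V) →
      ∑ i ∈ W, ∑ l, chordSq (U t i) (U t (i + step l)) =
        ∑ i ∈ W, ∑ l, chordSq (U 0 i) (U 0 (i + step l))) := by
  have hz : (0 : ℝ) ∈ Set.Ioo (-T) T := by simp [hT]
  set D : ℝ → ℤ × ℤ → Lor := fun t i =>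
    if i ∈ V then c t • eta *ᵥ (U t i ⨯₃ nbSum (U t) i) else 0
  have hD : ∀ t ∈ Set.Ioo (-T) T, ∀ i, HasDerivAt (fun s => U s i) (D t i) t := by
    intro t ht i
    by_cases hi : i ∈ V
    · simpa only [D, hi, if_true] using hd t ht i hi
    · simp only [D, hi, if_false, hV _ i hi]
      exact hasDerivAt_const _ _
  -- the velocity is Lorentz-orthogonal to `U`
  have hform : ∀ t ∈ Set.Ioo (-T) T, ∀ i, lorentzForm (U t i) (U t i) = -1 := by
    intro t ht i
    rw [← (h0 i).1]
    refine eq_of_hasDerivAt_zero (f := fun s => lorentzForm (U s i) (U s i)) (T := T)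
      (fun s hs => ?_) ht hz
    refine ((hD s hs i).lorentzForm (hD s hs i)).congr_deriv ?_
    rw [lorentzForm_comm (D s i)]
    by_cases hi : i ∈ V
    · simp only [D, hi, if_true]
      rw [lorentzForm_comm, lorentzForm_smul_left, lorentzForm_comm, lorentzForm_left_eta_cross]
      simp
    · simp [D, hi, lorentzForm_eq]
  have hmem : ∀ t ∈ Set.Ioo (-T) T, ∀ i, U t i ∈ hyperbolicPlane := by
    intro t ht i
    refine ⟨hform t ht i, ?_⟩
    -- the sign of `U₀` cannot change, because `U₀ = 0` is impossible when `⟨U, η U⟩ = -1`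
    by_contra hneg
    push Not at hneg
    have hcont : ContinuousOn (fun s => U s i 0) (Set.uIcc 0 t) := by
      intro s hs
      have hs' : s ∈ Set.Ioo (-T) T := (Set.ordConnected_Ioo.uIcc_subset hz ht) hs
      exact ((hasDerivAt_pi.1 (hD s hs' i)) 0).continuousAt.continuousWithinAt
    obtain ⟨s, hs, hs0⟩ := intermediate_value_uIcc hcont
      (show (0 : ℝ) ∈ Set.uIcc (U 0 i 0) (U t i 0) from
        Set.mem_uIcc.2 (Or.inr ⟨hneg, (h0 i).2.le⟩))
    have := hform s ((Set.ordConnected_Ioo.uIcc_subset hz ht) hs) i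
    simp only [lorentzForm_eq] at this
    simp only at hs0
    rw [hs0] at this
    nlinarith [sq_nonneg (U s i 1), sq_nonneg (U s i 2)]
  refine ⟨hmem, fun t ht => ?_, fun t ht W hW => ?_⟩
  · refine eq_of_hasDerivAt_zero (f := fun s => ∑ i ∈ V, (U s i 0 - 1)) (T := T)
      (fun s hs => ?_) ht hz
    refine (HasDerivAt.fun_sum fun i (_ : i ∈ V) =>
      ((hasDerivAt_pi.1 (hD s hs i)) 0).sub_const 1).congr_deriv ?_
    have : ∀ i ∈ V, D s i 0 = c s * (eta *ᵥ (U s i ⨯₃ nbSum (U s) i)) 0 := by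
      intro i hi; simp [D, hi]
    rw [Finset.sum_congr rfl this, ← Finset.mul_sum, sum_eta_cross_zero (hV s), mul_zero]
  -- On the hyperboloid `chordSq u w = -2 ⟨u, η w⟩ - 2`, so the sum of the pairings has to be
  -- constant. Its derivative is brought to the form `∑ ⟨D i, η nbSum i⟩` by shifting the sum in
  -- which the derivative falls on the neighbour.
  · have hH : ∑ i ∈ W, ∑ l, lorentzForm (U t i) (U t (i + step l)) =
        ∑ i ∈ W, ∑ l, lorentzForm (U 0 i) (U 0 (i + step l)) := by
      refine eq_of_hasDerivAt_zero (T := T)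
        (f := fun s => ∑ i ∈ W, ∑ l, lorentzForm (U s i) (U s (i + step l))) (fun s hs => ?_) ht hz
      refine (HasDerivAt.fun_sum fun i (_ : i ∈ W) => HasDerivAt.fun_sum fun l
        (_ : l ∈ (Finset.univ : Finset (Fin 2))) =>
          (hD s hs i).lorentzForm (hD s hs (i + step l))).congr_deriv ?_
      simp only [Finset.sum_add_distrib]
      have hVW : V ⊆ W := fun i hi => by
        by_contra hc; exact (hW i hc).1 hi
      have e1 : ∑ i ∈ W, ∑ l, lorentzForm (D s i) (U s (i + step l)) =
          ∑ i ∈ V, ∑ l, lorentzForm (D s i) (U s (i + step l)) := by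
        refine (Finset.sum_subset hVW fun i _ hi => ?_).symm
        simp [D, hi, lorentzForm_eq]
      have e2 : ∑ i ∈ W, ∑ l, lorentzForm (U s i) (D s (i + step l)) =
          ∑ i ∈ V, ∑ l, lorentzForm (D s i) (U s (i - step l)) := by
        rw [Finset.sum_comm, Finset.sum_comm (s := V)]
        refine Finset.sum_congr rfl fun l _ => ?_
        rw [← sum_shift_eq (W := W) (fun i => lorentzForm (D s i) (U s (i - step l))) (step l)]
        · simp only [add_sub_cancel_right]
          exact Finset.sum_congr rfl fun i _ => lorentzForm_comm _ _
        · intro i hi; simp [D, hi, lorentzForm_eq]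
        · intro i hi; simp [D, (hW i hi).2 l, lorentzForm_eq]
      rw [e1, e2, ← Finset.sum_add_distrib]
      refine Finset.sum_eq_zero fun i hi => ?_
      rw [← Finset.sum_add_distrib]
      simp only [← lorentzForm_add_right]
      have : ∑ l, lorentzForm (D s i) (U s (i + step l) + U s (i - step l)) =
          lorentzForm (D s i) (nbSum (U s) i) := by
        simp only [nbSum, Fin.sum_univ_two, lorentzForm_add_right]
      rw [this]
      simp only [D, hi, if_true]
      rw [lorentzForm_smul_left, lorentzForm_eta_cross_right, mul_zero]
    have hS : ∀ s ∈ Set.Ioo (-T) T, ∑ i ∈ W, ∑ l, chordSq (U s i) (U s (i + step l)) =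
        -2 * (∑ i ∈ W, ∑ l, lorentzForm (U s i) (U s (i + step l))) - ∑ i ∈ W, 4 := by
      intro s hs
      rw [Finset.mul_sum, ← Finset.sum_sub_distrib]
      refine Finset.sum_congr rfl fun i _ => ?_
      simp only [Fin.sum_univ_two, chordSq_eq (hmem s hs _) (hmem s hs _)]
      ring
    rw [hS t ht, hS 0 hz, hH]

/-- The lattice flow exists for an arbitrarily long time: conservation of mass confines it to a
bounded set, where the cut-off of the vector field is not felt. Beyond the time interval it is
continued as a constant. -/
theorem exists_latticeFlow (V : Finset (ℤ × ℤ)) (a : ℤ × ℤ → Lor)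
    (ha : ∀ i, a i ∈ hyperbolicPlane) (haV : ∀ i ∉ V, a i = origin) (κ T : ℝ) (hT : 0 < T) :
    ∃ U : ℝ → ℤ × ℤ → Lor, U 0 = a ∧ (∀ t i, U t i ∈ hyperbolicPlane) ∧
      (∀ t, ∀ i ∉ V, U t i = origin) ∧ (∀ i, Continuous fun t => U t i) ∧
      (∀ t ∈ Set.Ioo (-T) T, ∀ i ∈ V,
        HasDerivAt (fun s => U s i) (κ • eta *ᵥ (U t i ⨯₃ nbSum (U t) i)) t) ∧
      (∀ t, ∑ i ∈ V, (U t i 0 - 1) = ∑ i ∈ V, (a i 0 - 1)) ∧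
      (∀ t, ∀ W : Finset (ℤ × ℤ), (∀ i ∉ W, i ∉ V ∧ ∀ l, i + step l ∉ V) →
        ∑ i ∈ W, ∑ l, chordSq (U t i) (U t (i + step l)) =
          ∑ i ∈ W, ∑ l, chordSq (a i) (a (i + step l))) := by
  set M := ∑ i ∈ V, (a i 0 - 1)
  have hM : 0 ≤ M := Finset.sum_nonneg fun i _ => by linarith [one_le_of_mem (ha i)]
  -- `1 + M` bounds every configuration of mass `M`, and a time interval larger than needed makes the
  -- derivative available up to the endpoints `±T`
  obtain ⟨ψ, α, hψ, hα0, hα⟩ := exists_solution_cutoff _ (contDiff_latticeField V κ)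
    (fun i : V => a i) (1 + M) (T + 1) (by linarith) (by linarith)
  set Y : ℝ → ℤ × ℤ → Lor := fun t => extendByOrigin V (α t)
  have hY0 : Y 0 = a := by
    ext1 i
    by_cases hi : i ∈ V
    · simp [Y, extendByOrigin, hi, hα0]
    · simp [Y, extendByOrigin, hi, haV i hi]
  have hYV : ∀ t, ∀ i ∉ V, Y t i = origin := fun t i hi => by simp [Y, extendByOrigin, hi]
  have hYd : ∀ t ∈ Set.Ioo (-(T + 1)) (T + 1), ∀ i ∈ V,
      HasDerivAt (fun s => Y s i) ((ψ (α t) * κ) • eta *ᵥ (Y t i ⨯₃ nbSum (Y t) i)) t := by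
    intro t ht i hi
    have := (hasDerivAt_pi.1 (hα t ht)) ⟨i, hi⟩
    simp only [Pi.smul_apply, smul_smul] at this
    have e : (fun s => Y s i) = fun s => α s ⟨i, hi⟩ := by
      ext1 s; simp [Y, extendByOrigin, hi]
    rw [e]
    exact this
  obtain ⟨c1, c2, c3⟩ := lattice_conservation (by linarith) hYV (by rw [hY0]; exact ha) hYd
  -- by conservation of mass the solution stays where the cut-off of the field equals one
  have hψ1 : ∀ t ∈ Set.Ioo (-(T + 1)) (T + 1), ψ (α t) = 1 := by
    intro t ht
    refine hψ _ ((pi_norm_le_iff_of_nonneg (by linarith)).2 fun i => ?_)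
    have e : α t i = Y t i := by simp [Y, extendByOrigin]
    rw [e]
    refine (norm_le_of_mem (c1 t ht i)).trans ?_
    have := Finset.single_le_sum (f := fun j => Y t j 0 - 1)
      (fun j _ => by linarith [one_le_of_mem (c1 t ht j)]) i.2
    simp only [c2 t ht, hY0] at this
    linarith
  -- the flow is stopped at the times `±T`
  have hcl : ∀ t, max (-T) (min T t) ∈ Set.Ioo (-(T + 1)) (T + 1) := by
    intro t
    constructor
    · exact lt_max_of_lt_left (by linarith)
    · exact max_lt (by linarith) ((min_le_left _ _).trans_lt (by linarith))
  have hin : ∀ t ∈ Set.Ioo (-T) T, max (-T) (min T t) = t := by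
    intro t ht
    rw [min_eq_right ht.2.le, max_eq_right ht.1.le]
  refine ⟨fun t => Y (max (-T) (min T t)), ?_, fun t i => c1 _ (hcl t) i, fun t i hi => hYV _ i hi,
    fun i => ?_, fun t ht i hi => ?_, fun t => ?_, fun t W hW => ?_⟩
  · simp only [hin 0 (by simp [hT]), hY0]
  · rw [continuous_iff_continuousAt]
    intro t
    by_cases hi : i ∈ V
    · exact ContinuousAt.comp (f := fun t => max (-T) (min T t)) (g := fun s => Y s i)
        (hYd _ (hcl t) i hi).continuousAt (by fun_prop)
    · simp only [hYV _ i hi]; exact continuousAt_const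
  · have h1 := hYd t ⟨by linarith [ht.1], by linarith [ht.2]⟩ i hi
    rw [hψ1 t ⟨by linarith [ht.1], by linarith [ht.2]⟩, one_mul] at h1
    simp only [hin t ht]
    refine h1.congr_of_eventuallyEq ?_
    filter_upwards [isOpen_Ioo.mem_nhds ht] with s hs
    rw [hin s hs]
  · rw [c2 _ (hcl t), hY0]
  · rw [c3 _ (hcl t) W hW, hY0]

/-! ### Exponential integrability on the lattice -/

/-- A function on `ℤ` that vanishes far to the right is bounded by its total variation. -/
theorem ofReal_abs_le_tsum_diff (g : ℤ → ℝ) (N : ℤ) (hg : ∀ k, N ≤ k → g k = 0) (x : ℤ) :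
    ENNReal.ofReal |g x| ≤ ∑' k, ENNReal.ofReal |g (k + 1) - g k| := by
  set n := (N - x).toNat
  have hn : g (x + n) = 0 := hg _ (by omega)
  have h1 : ∑ k ∈ Finset.range n, (g (x + k + 1) - g (x + k)) = -g x := by
    have := Finset.sum_range_sub (fun k : ℕ => g (x + k)) n
    simp only [hn, Nat.cast_add, Nat.cast_one, Nat.cast_zero, add_zero, zero_sub, ← add_assoc]
      at this
    exact this
  calc ENNReal.ofReal |g x| = ENNReal.ofReal |∑ k ∈ Finset.range n, (g (x + k + 1) - g (x + k))| := by
        rw [h1, abs_neg]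
    _ ≤ ENNReal.ofReal (∑ k ∈ Finset.range n, |g (x + k + 1) - g (x + k)|) :=
        ENNReal.ofReal_le_ofReal (Finset.abs_sum_le_sum_abs _ _)
    _ = ∑ k ∈ Finset.range n, ENNReal.ofReal |g (x + k + 1) - g (x + k)| :=
        ENNReal.ofReal_sum_of_nonneg fun _ _ => abs_nonneg _
    _ ≤ ∑' k : ℕ, ENNReal.ofReal |g (x + k + 1) - g (x + k)| := ENNReal.sum_le_tsum _
    _ ≤ _ := ENNReal.tsum_comp_le_tsum_of_injective (f := fun k : ℕ => x + k)
        (fun a b h => by simpa using h) fun k => ENNReal.ofReal |g (k + 1) - g k|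

/-- The discrete Gagliardo-Nirenberg inequality `‖φ‖²_{ℓ²} ≤ ‖∂₁φ‖_{ℓ¹} ‖∂₂φ‖_{ℓ¹}` on the square
lattice. -/
theorem lattice_gagliardo_nirenberg {S : Finset (ℤ × ℤ)} (φ : ℤ × ℤ → ℝ)
    (hφ : ∀ i ∉ S, φ i = 0 ∧ ∀ l, φ (i + step l) = 0) :
    ∑ i ∈ S, φ i ^ 2 ≤
      (∑ i ∈ S, |φ (i + step 0) - φ i|) * ∑ i ∈ S, |φ (i + step 1) - φ i| := by
  obtain ⟨N, hN⟩ : ∃ N : ℤ, ∀ i ∈ S, i.1 < N ∧ i.2 < N := by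
    obtain ⟨B, hB⟩ := (S.image fun i => max i.1 i.2).bddAbove
    refine ⟨B + 1, fun i hi => ?_⟩
    have : max i.1 i.2 ≤ B :=
      hB (Finset.mem_coe.2 (Finset.mem_image_of_mem (fun i : ℤ × ℤ => max i.1 i.2) hi))
    omega
  have hz1 : ∀ y k, N ≤ k → φ (k, y) = 0 := fun y k hk =>
    (hφ _ fun h => by have := (hN _ h).1; simp only at this; omega).1
  have hz2 : ∀ x k, N ≤ k → φ (x, k) = 0 := fun x k hk =>
    (hφ _ fun h => by have := (hN _ h).2; simp only at this; omega).1
  -- `|φ i|` is bounded both by the variation of `φ` along the row and along the column of `i`; the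
  -- product of the two bounds separates the variables
  have key : ∑' i, ENNReal.ofReal (φ i ^ 2) ≤
      (∑' i, ENNReal.ofReal |φ (i + step 0) - φ i|) *
        ∑' i, ENNReal.ofReal |φ (i + step 1) - φ i| := by
    set A : ℤ → ENNReal := fun y => ∑' k, ENNReal.ofReal |φ (k + 1, y) - φ (k, y)|
    set B : ℤ → ENNReal := fun x => ∑' k, ENNReal.ofReal |φ (x, k + 1) - φ (x, k)|
    have e0 : ∑' i, ENNReal.ofReal |φ (i + step 0) - φ i| = ∑' y, A y := by
      rw [← (Equiv.prodComm ℤ ℤ).tsum_eq, ENNReal.tsum_prod']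
      simp [A, step]
    have e1 : ∑' i, ENNReal.ofReal |φ (i + step 1) - φ i| = ∑' x, B x := by
      rw [ENNReal.tsum_prod']
      simp [B, step]
    rw [e0, e1]
    calc ∑' i, ENNReal.ofReal (φ i ^ 2) ≤ ∑' i : ℤ × ℤ, A i.2 * B i.1 := by
          refine ENNReal.tsum_le_tsum fun i => ?_
          rw [← sq_abs, sq, ENNReal.ofReal_mul (abs_nonneg _)]
          exact mul_le_mul' (ofReal_abs_le_tsum_diff (fun k => φ (k, i.2)) N (hz1 _) i.1)
            (ofReal_abs_le_tsum_diff (fun k => φ (i.1, k)) N (hz2 _) i.2)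
      _ = (∑' y, A y) * ∑' x, B x := by
          rw [ENNReal.tsum_prod']
          simp only [ENNReal.tsum_mul_right, ENNReal.tsum_mul_left]
  have hfin : ∀ g : ℤ × ℤ → ℝ, (∀ i, 0 ≤ g i) → (∀ i ∉ S, g i = 0) →
      ∑' i, ENNReal.ofReal (g i) = ENNReal.ofReal (∑ i ∈ S, g i) := by
    intro g hg hgS
    rw [tsum_eq_sum (s := S) (fun i hi => by simp [hgS i hi]),
      ENNReal.ofReal_sum_of_nonneg fun i _ => hg i]
  rw [hfin _ (fun i => sq_nonneg _) (fun i hi => by simp [(hφ i hi).1]),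
    hfin _ (fun i => abs_nonneg _) (fun i hi => by simp [hφ i hi]),
    hfin _ (fun i => abs_nonneg _) (fun i hi => by simp [hφ i hi]),
    ← ENNReal.ofReal_mul (Finset.sum_nonneg fun i _ => abs_nonneg _)] at key
  exact (ENNReal.ofReal_le_ofReal_iff (mul_nonneg (Finset.sum_nonneg fun i _ => abs_nonneg _)
    (Finset.sum_nonneg fun i _ => abs_nonneg _))).1 key

/-- The part of `x` lying in the layer `[k, k + 1]`. -/
noncomputable def layer (k : ℕ) (x : ℝ) : ℝ := max 0 (min 1 (x - k))

theorem sum_layer (n : ℕ) (x : ℝ) (hx : 0 ≤ x) :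
    ∑ k ∈ Finset.range n, layer k x = min (n : ℝ) x := by
  induction n with
  | zero => simp [hx]
  | succ n ih =>
    rw [Finset.sum_range_succ, ih, layer]
    push_cast
    rcases le_total x n with h | h
    · rw [min_eq_right h, max_eq_left (min_le_of_right_le (by linarith)), min_eq_right (by linarith),
        add_zero]
    · rcases le_total x (n + 1) with h' | h'
      · rw [min_eq_left h, min_eq_right (by linarith : x - n ≤ 1), min_eq_right h',
          max_eq_right (by linarith)]; ring
      · rw [min_eq_left h, min_eq_left (by linarith : 1 ≤ x - n), min_eq_left h',
          max_eq_right (by linarith)]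

theorem layer_mono (k : ℕ) : Monotone (layer k) := fun x y h => by
  unfold layer; gcongr

theorem sum_layer_sub_sq_le (n : ℕ) {x y : ℝ} (hx : 0 ≤ x) (hy : 0 ≤ y) :
    ∑ k ∈ Finset.range n, (layer (k + 1) x - layer (k + 1) y) ^ 2 ≤ (x - y) ^ 2 := by
  wlog h : y ≤ x generalizing x y
  · have := this hy hx (by linarith)
    calc _ = ∑ k ∈ Finset.range n, (layer (k + 1) y - layer (k + 1) x) ^ 2 :=
          Finset.sum_congr rfl fun k _ => by ring
      _ ≤ _ := this
      _ = _ := by ring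
  have h0 : ∀ k, 0 ≤ layer k x - layer k y := fun k => sub_nonneg.2 (layer_mono k h)
  refine (Finset.sum_sq_le_sq_sum_of_nonneg fun k _ => h0 (k + 1)).trans ?_
  refine pow_le_pow_left₀ (Finset.sum_nonneg fun k _ => h0 (k + 1)) ?_ 2
  calc ∑ k ∈ Finset.range n, (layer (k + 1) x - layer (k + 1) y)
      ≤ ∑ k ∈ Finset.range (n + 1), (layer k x - layer k y) := by
        rw [Finset.sum_range_succ']; linarith [h0 0]
    _ = min ((n + 1 : ℕ) : ℝ) x - min ((n + 1 : ℕ) : ℝ) y := by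
        rw [Finset.sum_sub_distrib, sum_layer _ _ hx, sum_layer _ _ hy]
    _ ≤ x - y := by
        rcases le_total ((n + 1 : ℕ) : ℝ) y with h1 | h1
        · rw [min_eq_left h1, min_eq_left (h1.trans h)]; linarith
        · rw [min_eq_right h1]; linarith [min_le_right ((n + 1 : ℕ) : ℝ) x]

/-- A weak form of the inequality between the arithmetic and the geometric mean: up to the factor
`n!` the product of `n` nonnegative numbers is at most the `n`-th power of their sum. -/
theorem factorial_mul_prod_le (ε : ℕ → ℝ) (hε : ∀ k, 0 ≤ ε k) (n : ℕ) :
    (n.factorial : ℝ) * ∏ k ∈ Finset.range n, ε k ≤ (∑ k ∈ Finset.range n, ε k) ^ n := by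
  induction n with
  | zero => simp
  | succ n ih =>
    set s := ∑ k ∈ Finset.range n, ε k
    have hs : 0 ≤ s := Finset.sum_nonneg fun k _ => hε k
    rw [Finset.prod_range_succ, Finset.sum_range_succ, Nat.factorial_succ]
    push_cast
    calc ((n : ℝ) + 1) * n.factorial * ((∏ k ∈ Finset.range n, ε k) * ε n)
        = (n.factorial * ∏ k ∈ Finset.range n, ε k) * ((n + 1) * ε n) := by ring
      _ ≤ s ^ n * ((n + 1) * ε n) := by
          gcongr
          have := hε n
          positivity
      _ ≤ (s + ε n) ^ (n + 1) := by
          -- the first two terms of the binomial expansion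
          rw [add_pow]
          have h1 := Finset.single_le_sum (f := fun m => s ^ m * ε n ^ (n + 1 - m) * (n + 1).choose m)
            (fun m _ => by have := hε n; positivity) (Finset.mem_range.2 (by omega : n < n + 1 + 1))
          simp only [Nat.choose_succ_self_right] at h1
          refine le_trans (le_of_eq ?_) h1
          rw [show n + 1 - n = 1 by omega]
          push_cast; ring

/-- Super-exponential decay of the distribution function of `log u₀` for a finitely supported
configuration of finite energy. It is enough to estimate the number of sites in a layer by the
energy of that layer times the number of sites in the preceding one; the energies of the layers
add up to at most the total energy. -/
theorem card_superlevel_le {S : Finset (ℤ × ℤ)} {u : ℤ × ℤ → Lor}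
    (hu : ∀ i, u i ∈ hyperbolicPlane)
    (hS : ∀ i ∉ S, u i = origin ∧ ∀ l, u (i + step l) = origin) {E : ℝ}
    (hE : ∑ i ∈ S, ∑ l, chordSq (u i) (u (i + step l)) ≤ E) (n : ℕ) :
    ((S.filter fun i => ((n + 1 : ℕ) : ℝ) < Real.log (u i 0)).card : ℝ) ≤
      E ^ n / n.factorial * (S.filter fun i => (1 : ℝ) < Real.log (u i 0)).card := by
  set ρ : ℤ × ℤ → ℝ := fun i => Real.log (u i 0)
  have hρ : ∀ i, 0 ≤ ρ i := fun i => Real.log_nonneg (one_le_of_mem (hu i))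
  have hρS : ∀ i ∉ S, ρ i = 0 ∧ ∀ l, ρ (i + step l) = 0 := by
    intro i hi
    simp [ρ, (hS i hi).1, (hS i hi).2, origin]
  set m : ℕ → ℝ := fun k => (S.filter fun i => (k : ℝ) < ρ i).card
  set ε : ℕ → ℝ := fun k => ∑ i ∈ S, ∑ l, (layer k (ρ (i + step l)) - layer k (ρ i)) ^ 2
  have hε : ∀ k, 0 ≤ ε k := fun k => Finset.sum_nonneg fun i _ => Finset.sum_nonneg fun l _ =>
    sq_nonneg _
  have hlay : ∀ k : ℕ, layer k 0 = 0 := by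
    intro k; rw [layer, max_eq_left]; exact min_le_of_right_le (by simp)
  -- The layer `k` of `ρ` equals one where `ρ > k + 1`, and its difference across an edge can only be
  -- nonzero if `ρ > k` at one of the ends. Hence Gagliardo-Nirenberg and Cauchy-Schwarz on these
  -- edges give the decay from one level to the next.
  have hdecay : ∀ k, m (k + 1) ≤ ε k * m k := by
    intro k
    have hcount : ∀ l, (((S.filter fun i => layer k (ρ (i + step l)) - layer k (ρ i) ≠ 0).card : ℕ) : ℝ)
        ≤ 2 * m k := by
      intro l
      have hsub : (S.filter fun i => layer k (ρ (i + step l)) - layer k (ρ i) ≠ 0) ⊆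
          (S.filter fun i => (k : ℝ) < ρ i) ∪ (S.filter fun i => (k : ℝ) < ρ (i + step l)) := by
        intro i hi
        simp only [Finset.mem_filter, Finset.mem_union] at hi ⊢
        by_contra hc
        push Not at hc
        have h1 := hc.1 hi.1
        have h2 := hc.2 hi.1
        apply hi.2
        rw [layer, layer, max_eq_left (min_le_of_right_le (by linarith)),
          max_eq_left (min_le_of_right_le (by linarith)), sub_self]
      have hinj : (S.filter fun i => (k : ℝ) < ρ (i + step l)).card ≤
          (S.filter fun i => (k : ℝ) < ρ i).card := by
        refine Finset.card_le_card_of_injOn (fun i => i + step l) (fun i hi => ?_)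
          (fun a _ b _ h => by simpa using h)
        simp only [Finset.coe_filter] at hi ⊢
        refine ⟨?_, hi.2⟩
        by_contra hc
        have := hi.2
        rw [(hρS _ hc).1] at this
        exact absurd this (not_lt.2 (Nat.cast_nonneg k))
      have := (Finset.card_le_card hsub).trans (Finset.card_union_le _ _)
      have h3 : (S.filter fun i => layer k (ρ (i + step l)) - layer k (ρ i) ≠ 0).card ≤
          2 * (S.filter fun i => (k : ℝ) < ρ i).card := by omega
      calc _ ≤ ((2 * (S.filter fun i => (k : ℝ) < ρ i).card : ℕ) : ℝ) := Nat.cast_le.2 h3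
        _ = 2 * m k := by push_cast; rfl
    have hcs : ∀ l, (∑ i ∈ S, |layer k (ρ (i + step l)) - layer k (ρ i)|) ^ 2 ≤
        2 * m k * ∑ i ∈ S, (layer k (ρ (i + step l)) - layer k (ρ i)) ^ 2 := by
      intro l
      rw [← Finset.sum_filter_of_ne (p := fun i => layer k (ρ (i + step l)) - layer k (ρ i) ≠ 0)
        (fun i _ h => by simpa using h)]
      refine (sq_sum_le_card_mul_sum_sq).trans ?_
      simp only [sq_abs]
      refine mul_le_mul (hcount l) (Finset.sum_le_sum_of_subset_of_nonneg (Finset.filter_subset _ _)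
        fun i _ _ => sq_nonneg _) (Finset.sum_nonneg fun i _ => sq_nonneg _) ?_
      positivity
    have hgn := lattice_gagliardo_nirenberg (S := S) (fun i => layer k (ρ i)) (fun i hi => by
      simp [hρS i hi, hlay])
    have hlow : m (k + 1) ≤ ∑ i ∈ S, layer k (ρ i) ^ 2 := by
      calc m (k + 1) = ∑ i ∈ S.filter fun i => ((k + 1 : ℕ) : ℝ) < ρ i, (1 : ℝ) := by simp [m]
        _ ≤ ∑ i ∈ S.filter fun i => ((k + 1 : ℕ) : ℝ) < ρ i, layer k (ρ i) ^ 2 := by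
            refine Finset.sum_le_sum fun i hi => ?_
            have h1 := (Finset.mem_filter.1 hi).2
            push_cast at h1
            rw [layer, min_eq_left (by linarith)]
            norm_num
        _ ≤ _ := Finset.sum_le_sum_of_subset_of_nonneg (Finset.filter_subset _ _)
            fun i _ _ => sq_nonneg _
    have e : ε k = (∑ i ∈ S, (layer k (ρ (i + step 0)) - layer k (ρ i)) ^ 2) +
        ∑ i ∈ S, (layer k (ρ (i + step 1)) - layer k (ρ i)) ^ 2 := by
      simp only [ε, Fin.sum_univ_two, Finset.sum_add_distrib]
    have h0 := hcs 0
    have h1 := hcs 1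
    set a := ∑ i ∈ S, |layer k (ρ (i + step 0)) - layer k (ρ i)|
    set b := ∑ i ∈ S, |layer k (ρ (i + step 1)) - layer k (ρ i)|
    rw [e]
    nlinarith [sq_nonneg (a - b)]
  have henergy : ∑ k ∈ Finset.range n, ε (k + 1) ≤ E := by
    refine le_trans ?_ hE
    simp only [ε]
    rw [Finset.sum_comm]
    refine Finset.sum_le_sum fun i _ => ?_
    rw [Finset.sum_comm]
    refine Finset.sum_le_sum fun l _ => ?_
    exact (sum_layer_sub_sq_le n (hρ _) (hρ _)).trans (log_sub_log_sq_le_chordSq (hu _) (hu _))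
  have hprod : ∀ n, m (n + 1) ≤ (∏ k ∈ Finset.range n, ε (k + 1)) * m 1 := by
    intro n
    induction n with
    | zero => simp
    | succ n ih =>
      rw [Finset.prod_range_succ]
      calc m (n + 1 + 1) ≤ ε (n + 1) * m (n + 1) := hdecay _
        _ ≤ ε (n + 1) * ((∏ k ∈ Finset.range n, ε (k + 1)) * m 1) := by
            gcongr
        _ = _ := by ring
  have hfac : (0 : ℝ) < n.factorial := by positivity
  -- the arithmetic-geometric mean inequality, which is the source of the factorial
  have hprod_le : ∏ k ∈ Finset.range n, ε (k + 1) ≤ E ^ n / n.factorial := by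
    rw [le_div_iff₀ hfac, mul_comm]
    refine (factorial_mul_prod_le (fun k => ε (k + 1)) (fun k => hε _) n).trans ?_
    exact pow_le_pow_left₀ (Finset.sum_nonneg fun k _ => hε _) henergy n
  have h := (hprod n).trans (mul_le_mul_of_nonneg_right hprod_le (Nat.cast_nonneg _))
  simpa [m] using h

/-- The constant in the moment bound for configurations of energy at most `E`. -/
noncomputable def momentConst (E : ℝ) : ℝ := 129 + Real.exp 16 * Real.exp (Real.exp 8 * E)

/-- A discrete Moser-Trudinger inequality: for configurations of bounded energy the mass controls
the eighth moment of `u₀ - 1`. -/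
theorem sum_moment_le {S : Finset (ℤ × ℤ)} {u : ℤ × ℤ → Lor} (hu : ∀ i, u i ∈ hyperbolicPlane)
    (hS : ∀ i ∉ S, u i = origin ∧ ∀ l, u (i + step l) = origin) {E : ℝ} (hE0 : 0 ≤ E)
    (hE : ∑ i ∈ S, ∑ l, chordSq (u i) (u (i + step l)) ≤ E) :
    ∑ i ∈ S, ((u i 0 - 1) + (u i 0 - 1) ^ 8) ≤ momentConst E * ∑ i ∈ S, (u i 0 - 1) := by
  have h1 : ∀ i, 1 ≤ u i 0 := fun i => one_le_of_mem (hu i)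
  set ρ : ℤ × ℤ → ℝ := fun i => Real.log (u i 0)
  have hexp : ∀ i, Real.exp (ρ i) = u i 0 := fun i => Real.exp_log (by linarith [h1 i])
  obtain ⟨N, hN⟩ : ∃ N : ℕ, ∀ i ∈ S, ρ i ≤ N := by
    obtain ⟨B, hB⟩ := (S.image ρ).bddAbove
    obtain ⟨N, hN⟩ := exists_nat_ge B
    exact ⟨N, fun i hi => (hB (Finset.mem_coe.2 (Finset.mem_image_of_mem _ hi))).trans hN⟩
  have he2 : (2 : ℝ) ≤ Real.exp 1 := by linarith [Real.add_one_le_exp 1]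
  have he3 : Real.exp 1 ≤ 3 := by linarith [Real.exp_one_lt_d9]
  -- Where `ρ ≤ 1`, hence `u₀ - 1 ≤ 2`, the eighth power is at most `2⁷ (u₀ - 1)`, whence the constant
  -- `129 = 1 + 2⁷`. Elsewhere `n + 1 < ρ ≤ n + 2` for some `n`, and the eighth power is at most
  -- `exp (8 (n + 2))`.
  have hpt : ∀ i ∈ S, (u i 0 - 1) + (u i 0 - 1) ^ 8 ≤ 129 * (u i 0 - 1) +
      ∑ n ∈ Finset.range N, Real.exp (8 * (n + 2)) * if ((n + 1 : ℕ) : ℝ) < ρ i then 1 else 0 := by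
    intro i hi
    have hf : 0 ≤ u i 0 - 1 := by linarith [h1 i]
    have hnn : ∀ n ∈ Finset.range N, 0 ≤ Real.exp (8 * ((n : ℝ) + 2)) *
        if ((n + 1 : ℕ) : ℝ) < ρ i then (1 : ℝ) else 0 := by
      intro n _; split_ifs <;> positivity
    rcases le_or_gt (ρ i) 1 with h | h
    · have h2 : u i 0 - 1 ≤ 2 := by
        rw [← hexp i]; linarith [Real.exp_le_exp.2 h]
      have h3 : (u i 0 - 1) ^ 7 ≤ 2 ^ 7 := pow_le_pow_left₀ hf h2 7
      have h4 : (u i 0 - 1) ^ 8 ≤ 128 * (u i 0 - 1) := by nlinarith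
      linarith [Finset.sum_nonneg hnn]
    · set n := ⌈ρ i⌉₊ - 2
      have hc1 : 2 ≤ ⌈ρ i⌉₊ := Nat.lt_ceil.2 (by simpa using h)
      have hc2 : ⌈ρ i⌉₊ = n + 2 := by omega
      have hlow : ((n + 1 : ℕ) : ℝ) < ρ i := Nat.lt_ceil.1 (by omega)
      have hup : ρ i ≤ n + 2 := by
        have := Nat.le_ceil (ρ i); rw [hc2] at this; exact_mod_cast this
      have hnN : n ∈ Finset.range N := by
        have : ((n + 1 : ℕ) : ℝ) < N := hlow.trans_le (hN i hi)
        rw [Finset.mem_range]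
        have : n + 1 < N := by exact_mod_cast this
        omega
      have h5 := Finset.single_le_sum hnn hnN
      simp only [hlow, if_true, mul_one] at h5
      have h6 : (u i 0 - 1) ^ 8 ≤ Real.exp (8 * (n + 2)) := by
        calc (u i 0 - 1) ^ 8 ≤ (u i 0) ^ 8 := pow_le_pow_left₀ hf (by linarith) 8
          _ = Real.exp (8 * ρ i) := by
              rw [← hexp i, ← Real.exp_nat_mul]; norm_num
          _ ≤ _ := Real.exp_le_exp.2 (by linarith)
      linarith
  set m : ℝ := ((S.filter fun i => (1 : ℝ) < ρ i).card : ℝ)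
  -- a Chebyshev bound: `u₀ - 1 ≥ 1` where `log u₀ > 1`
  have hm : m ≤ ∑ i ∈ S, (u i 0 - 1) := by
    calc m = ∑ i ∈ S.filter fun i => (1 : ℝ) < ρ i, (1 : ℝ) := by simp [m]
      _ ≤ ∑ i ∈ S.filter fun i => (1 : ℝ) < ρ i, (u i 0 - 1) := by
          refine Finset.sum_le_sum fun i hi => ?_
          have := Real.exp_le_exp.2 (Finset.mem_filter.1 hi).2.le
          rw [hexp i] at this
          linarith
      _ ≤ _ := Finset.sum_le_sum_of_subset_of_nonneg (Finset.filter_subset _ _)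
          fun i _ _ => by linarith [h1 i]
  calc ∑ i ∈ S, ((u i 0 - 1) + (u i 0 - 1) ^ 8)
      ≤ ∑ i ∈ S, (129 * (u i 0 - 1) + ∑ n ∈ Finset.range N, Real.exp (8 * (n + 2)) *
          if ((n + 1 : ℕ) : ℝ) < ρ i then 1 else 0) := Finset.sum_le_sum hpt
    _ = 129 * ∑ i ∈ S, (u i 0 - 1) + ∑ n ∈ Finset.range N, Real.exp (8 * (n + 2)) *
          (S.filter fun i => ((n + 1 : ℕ) : ℝ) < ρ i).card := by
        rw [Finset.sum_add_distrib, ← Finset.mul_sum, Finset.sum_comm]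
        congr 1
        refine Finset.sum_congr rfl fun n _ => ?_
        rw [← Finset.mul_sum, Finset.sum_boole]
    _ ≤ 129 * ∑ i ∈ S, (u i 0 - 1) + ∑ n ∈ Finset.range N, Real.exp (8 * (n + 2)) *
          (E ^ n / n.factorial * m) := by
        gcongr with n _
        exact card_superlevel_le hu hS hE n
    _ = 129 * ∑ i ∈ S, (u i 0 - 1) + Real.exp 16 *
          (∑ n ∈ Finset.range N, (Real.exp 8 * E) ^ n / n.factorial) * m := by
        congr 1
        rw [Finset.mul_sum, Finset.sum_mul]
        refine Finset.sum_congr rfl fun n _ => ?_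
        rw [mul_pow, ← Real.exp_nat_mul, show 8 * ((n : ℝ) + 2) = 16 + n * 8 by ring, Real.exp_add]
        ring
    _ ≤ 129 * ∑ i ∈ S, (u i 0 - 1) + Real.exp 16 * Real.exp (Real.exp 8 * E) *
          ∑ i ∈ S, (u i 0 - 1) := by
        gcongr
        exact Real.sum_le_exp_of_nonneg (by positivity) N
    _ = _ := by rw [momentConst]; ring

/-! ### From the lattice to the plane -/

/-- The standard basis of the plane. -/
noncomputable def basisVec (l : Fin 2) : Plane := EuclideanSpace.single l 1

theorem norm_basisVec (l : Fin 2) : ‖basisVec l‖ = 1 := by simp [basisVec]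

/-- The label of the cell of side `h` containing the point `x`. -/
noncomputable def cell (h : ℝ) (x : Plane) : ℤ × ℤ := (⌊x 0 / h⌋, ⌊x 1 / h⌋)

theorem measurable_cell (h : ℝ) : Measurable (cell h) := by
  have hc : ∀ k, Measurable fun x : Plane => x k := fun k =>
    (EuclideanSpace.proj (𝕜 := ℝ) k).continuous.measurable
  exact (((hc 0).div_const h).floor).prodMk (((hc 1).div_const h).floor)

theorem cell_add_smul {h : ℝ} (hh : 0 < h) (x : Plane) (l : Fin 2) (k : ℤ) :
    cell h (x + (k * h) • basisVec l) = cell h x + k • step l := by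
  have e : ∀ y : ℝ, (y + k * h) / h = y / h + k := fun y => by field_simp
  fin_cases l <;> simp [cell, basisVec, step, e]

theorem cell_add {h : ℝ} (hh : 0 < h) (x : Plane) (l : Fin 2) :
    cell h (x + h • basisVec l) = cell h x + step l := by
  simpa using cell_add_smul hh x l 1

theorem cell_sub {h : ℝ} (hh : 0 < h) (x : Plane) (l : Fin 2) :
    cell h (x - h • basisVec l) = cell h x - step l := by
  have := cell_add_smul hh x l (-1)
  simpa [sub_eq_add_neg] using this

theorem volume_cell {h : ℝ} (hh : 0 < h) (i : ℤ × ℤ) :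
    volume (cell h ⁻¹' {i}) = ENNReal.ofReal (h ^ 2) := by
  have e : cell h ⁻¹' {i} = (fun x : Plane => (WithLp.ofLp x : Fin 2 → ℝ)) ⁻¹'
      Set.pi Set.univ fun k => Set.Ico (![i.1 * h, i.2 * h] k) (![(i.1 + 1) * h, (i.2 + 1) * h] k) := by
    ext x
    have hf : ∀ (y : ℝ) (n : ℤ), ⌊y / h⌋ = n ↔ n * h ≤ y ∧ y < (n + 1) * h := by
      intro y n
      rw [Int.floor_eq_iff, le_div_iff₀ hh, div_lt_iff₀ hh]
    simp [cell, Prod.ext_iff, hf]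
  rw [e, (PiLp.volume_preserving_ofLp (Fin 2)).measure_preimage
    (MeasurableSet.univ_pi fun _ => measurableSet_Ico).nullMeasurableSet, Real.volume_pi_Ico]
  simp only [Fin.prod_univ_two, Matrix.cons_val_zero, Matrix.cons_val_one]
  rw [← ENNReal.ofReal_mul (by linarith)]
  congr 1; ring

theorem lintegral_comp_cell {h : ℝ} (hh : 0 < h) (F : ℤ × ℤ → ENNReal) :
    ∫⁻ x, F (cell h x) = ENNReal.ofReal (h ^ 2) * ∑' i, F i := by
  rw [← lintegral_map (μ := volume) (measurable_of_countable F) (measurable_cell h),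
    lintegral_countable']
  rw [← ENNReal.tsum_mul_left]
  refine tsum_congr fun i => ?_
  rw [Measure.map_apply (measurable_cell h) (measurableSet_singleton i), volume_cell hh, mul_comm]

/-- A family of piecewise constant maps into the hyperboloid solving the lattice flow with mesh `h`
for times and positions of absolute value less than `T`, with energy at most `E` and moments at
most `C`. The field `path` is all that is needed of the maps being constant on the cells of the
mesh: a translation by `a` along an axis amounts to at most `⌈a / h⌉` translations by `h`. -/
structure IsLatticeApprox (E C h T : ℝ) (u : ℝ → Plane → Lor) : Prop where
  mesh_pos : 0 < h
  measurable : Measurable fun z : ℝ × Plane => u z.1 z.2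
  mem : ∀ t x, u t x ∈ hyperbolicPlane
  moment : ∀ t, ∫⁻ x, ENNReal.ofReal ((u t x 0 - 1) + (u t x 0 - 1) ^ 8) ≤ ENNReal.ofReal C
  energy : ∀ t, ∫⁻ x, ENNReal.ofReal (∑ l, chordSq (u t x) (u t (x + h • basisVec l))) ≤
    ENNReal.ofReal (h ^ 2 * E)
  bounded : ∃ B, ∀ t x, ‖u t x‖ ≤ B
  path : ∀ t x l a, 0 ≤ a → ‖u t (x + a • basisVec l) - u t x‖ ≤
    ∑ k ∈ Finset.range ⌈a / h⌉₊,
      ‖u t (x + (k * h) • basisVec l + h • basisVec l) - u t (x + (k * h) • basisVec l)‖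
  ode : ∀ t ∈ Set.Ioo (-T) T, ∀ x, ‖x‖ < T → HasDerivAt (fun s => u s x)
    ((h⁻¹ ^ 2) • eta *ᵥ (u t x ⨯₃ ∑ l, (u t (x + h • basisVec l) + u t (x - h • basisVec l)))) t

/-- The lattice flow started from finitely supported data, transplanted to the plane. -/
theorem exists_isLatticeApprox {h T E M : ℝ} (hh : 0 < h) (hT : 0 < T) (hE : 0 ≤ E)
    (hM : 0 ≤ M) {V₀ : Finset (ℤ × ℤ)} {a : ℤ × ℤ → Lor}
    (ha : ∀ i, a i ∈ hyperbolicPlane) (haV : ∀ i ∉ V₀, a i = origin)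
    (haM : ∫⁻ x, ENNReal.ofReal (a (cell h x) 0 - 1) ≤ ENNReal.ofReal M)
    (haE : ∫⁻ x, ENNReal.ofReal (∑ l, chordSq (a (cell h x)) (a (cell h x + step l))) ≤
      ENNReal.ofReal (h ^ 2 * E)) :
    ∃ u, IsLatticeApprox E (momentConst E * M) h T u ∧ u 0 = fun x => a (cell h x) := by
  have hh2 : 0 < h ^ 2 := by positivity
  -- the box of all cells meeting the ball of radius `T`
  obtain ⟨N, hN⟩ := exists_nat_ge (T / h + 1)
  set V : Finset (ℤ × ℤ) := V₀ ∪ Finset.Icc (-(N : ℤ)) N ×ˢ Finset.Icc (-(N : ℤ)) N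
  have hbox : ∀ x : Plane, ‖x‖ < T → cell h x ∈ V := by
    intro x hx
    refine Finset.mem_union_right _ (Finset.mem_product.2 ?_)
    have hk : ∀ k, ⌊x k / h⌋ ∈ Finset.Icc (-(N : ℤ)) N := by
      intro k
      have h1 : |x k| < T := (PiLp.norm_apply_le x k).trans_lt hx
      have h2 : |x k / h| < T / h := by rw [abs_div, abs_of_pos hh]; gcongr
      rw [abs_lt] at h2
      rw [Finset.mem_Icc]
      constructor
      · rw [Int.le_floor]; push_cast; linarith
      · have : (⌊x k / h⌋ : ℝ) ≤ N := (Int.floor_le _).trans (by linarith)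
        exact_mod_cast this
    exact ⟨hk 0, hk 1⟩
  have haV' : ∀ i ∉ V, a i = origin := fun i hi => haV i fun h => hi (Finset.mem_union_left _ h)
  obtain ⟨U, hU0, hUmem, hUV, hUc, hUd, hUM, hUE⟩ := exists_latticeFlow V a ha haV' (h⁻¹ ^ 2) T hT
  -- Outside of `S` a site and its forward neighbours all lie outside of `V`, so that the sums of mass,
  -- moments and energy over the lattice reduce to sums over `S`.
  set S : Finset (ℤ × ℤ) := V ∪ Finset.univ.biUnion fun l => V.image fun i => i - step l
  have hS : ∀ i ∉ S, i ∉ V ∧ ∀ l, i + step l ∉ V := by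
    intro i hi
    simp only [S, Finset.mem_union, Finset.mem_biUnion, Finset.mem_image, not_or, not_exists,
      not_and] at hi
    exact ⟨hi.1, fun l hl => hi.2 l (Finset.mem_univ _) _ hl (by simp)⟩
  have hfin : ∀ g : ℤ × ℤ → ℝ, (∀ i, 0 ≤ g i) → (∀ i ∉ S, g i = 0) →
      ∫⁻ x, ENNReal.ofReal (g (cell h x)) = ENNReal.ofReal (h ^ 2 * ∑ i ∈ S, g i) := by
    intro g hg hgS
    rw [lintegral_comp_cell hh fun i => ENNReal.ofReal (g i),
      tsum_eq_sum (s := S) (fun i hi => by simp [hgS i hi]),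
      ← ENNReal.ofReal_sum_of_nonneg fun i _ => hg i, ← ENNReal.ofReal_mul hh2.le]
  have hchord : ∀ t i, 0 ≤ ∑ l, chordSq (U t i) (U t (i + step l)) := fun t i =>
    Finset.sum_nonneg fun l _ => chordSq_nonneg (hUmem _ _) (hUmem _ _)
  have hoo : chordSq origin origin = 0 := by simp [chordSq, lorentzForm_eq]
  have hchordS : ∀ t, ∀ i ∉ S, ∑ l, chordSq (U t i) (U t (i + step l)) = 0 := by
    intro t i hi
    simp [hUV t _ (hS i hi).1, hUV t _ ((hS i hi).2 _), hoo]
  have hmassS : ∀ t, ∀ i ∉ S, U t i 0 - 1 = 0 := fun t i hi => by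
    simp [hUV t _ (hS i hi).1, origin]
  have h1 : ∀ t i, 0 ≤ U t i 0 - 1 := fun t i => by linarith [one_le_of_mem (hUmem t i)]
  have hES : ∀ t, ∑ i ∈ S, ∑ l, chordSq (U t i) (U t (i + step l)) ≤ E := by
    intro t
    rw [hUE t S hS, ← hU0]
    rw [← hU0, hfin (fun i => ∑ l, chordSq (U 0 i) (U 0 (i + step l))) (hchord 0) (hchordS 0),
      ENNReal.ofReal_le_ofReal_iff (by positivity)] at haE
    exact le_of_mul_le_mul_left haE hh2
  have hMS : ∀ t, h ^ 2 * ∑ i ∈ S, (U t i 0 - 1) ≤ M := by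
    intro t
    have e : ∀ t, ∑ i ∈ S, (U t i 0 - 1) = ∑ i ∈ V, (U t i 0 - 1) := fun t =>
      (Finset.sum_subset Finset.subset_union_left fun i _ hi => by simp [hUV t i hi, origin]).symm
    rw [e, hUM t, ← hU0, ← e]
    rw [← hU0, hfin (fun i => U 0 i 0 - 1) (h1 0) (hmassS 0)] at haM
    exact (ENNReal.ofReal_le_ofReal_iff hM).1 haM
  refine ⟨fun t x => U t (cell h x), ?_, by simp only [hU0]⟩
  refine ⟨hh, ?_, fun t x => hUmem _ _, fun t => ?_, fun t => ?_, ?_, fun t x l b hb => ?_,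
    fun t ht x hx => ?_⟩
  · have : Measurable fun z : ℝ × (ℤ × ℤ) => U z.1 z.2 :=
      measurable_from_prod_countable_left fun i => (hUc i).measurable
    exact this.comp (measurable_fst.prodMk ((measurable_cell h).comp measurable_snd))
  · rw [hfin (fun i => (U t i 0 - 1) + (U t i 0 - 1) ^ 8)
      (fun i => by have := h1 t i; positivity) (fun i hi => by simp [hmassS t i hi])]
    refine ENNReal.ofReal_le_ofReal ?_
    have := sum_moment_le (S := S) (hUmem t)
      (fun i hi => ⟨hUV t _ (hS i hi).1, fun l => hUV t _ ((hS i hi).2 l)⟩) hE (hES t)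
    calc _ ≤ h ^ 2 * (momentConst E * ∑ i ∈ S, (U t i 0 - 1)) := by gcongr
      _ = momentConst E * (h ^ 2 * ∑ i ∈ S, (U t i 0 - 1)) := by ring
      _ ≤ _ := by
        have : 0 ≤ momentConst E := by unfold momentConst; positivity
        exact mul_le_mul_of_nonneg_left (hMS t) this
  · simp only [cell_add hh]
    rw [hfin (fun i => ∑ l, chordSq (U t i) (U t (i + step l))) (hchord t) (hchordS t)]
    exact ENNReal.ofReal_le_ofReal (mul_le_mul_of_nonneg_left (hES t) hh2.le)
  · refine ⟨1 + M / h ^ 2, fun t x => (norm_le_of_mem (hUmem _ _)).trans ?_⟩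
    have h2 : U t (cell h x) 0 - 1 ≤ ∑ i ∈ S, (U t i 0 - 1) := by
      by_cases hi : cell h x ∈ S
      · exact Finset.single_le_sum (f := fun i => U t i 0 - 1) (fun i _ => h1 t i) hi
      · rw [hmassS t _ hi]; exact Finset.sum_nonneg fun i _ => h1 t i
    have h3 : ∑ i ∈ S, (U t i 0 - 1) ≤ M / h ^ 2 := by
      rw [le_div_iff₀ hh2, mul_comm]; exact hMS t
    linarith
  · -- the cells of `x` and `x + b e` are joined by a chain of at most `⌈b / h⌉` adjacent cells
    obtain ⟨j, hj, hje⟩ : ∃ j : ℕ, j ≤ ⌈b / h⌉₊ ∧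
        cell h (x + b • basisVec l) = cell h x + (j : ℤ) • step l := by
      have hfl : ∀ y : ℝ, ∃ j : ℕ, j ≤ ⌈b / h⌉₊ ∧ ⌊(y + b) / h⌋ = ⌊y / h⌋ + j := by
        intro y
        have hmono : ⌊y / h⌋ ≤ ⌊(y + b) / h⌋ := Int.floor_le_floor (by gcongr; linarith)
        have hup : ⌊(y + b) / h⌋ ≤ ⌊y / h⌋ + ⌈b / h⌉₊ := by
          rw [← Int.floor_add_natCast]
          refine Int.floor_le_floor ?_
          rw [add_div]
          gcongr
          exact Nat.le_ceil _
        refine ⟨(⌊(y + b) / h⌋ - ⌊y / h⌋).toNat, by omega, by omega⟩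
      obtain ⟨j, hj, e⟩ := hfl (x l)
      refine ⟨j, hj, ?_⟩
      revert e
      fin_cases l <;> intro e <;> simpa [cell, basisVec, step] using e
    have hcell : ∀ k : ℕ, cell h (x + (k * h) • basisVec l) = cell h x + (k : ℤ) • step l := by
      intro k; simpa using cell_add_smul hh x l k
    simp only [cell_add hh, hcell, hje]
    have tele := Finset.sum_range_sub (fun k : ℕ => U t (cell h x + (k : ℤ) • step l)) j
    simp only [Nat.cast_zero, zero_smul, add_zero] at tele
    rw [← tele]
    refine (norm_sum_le _ _).trans ?_
    refine (Finset.sum_le_sum_of_subset_of_nonneg (Finset.range_mono hj)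
      fun k _ _ => norm_nonneg _).trans (le_of_eq (Finset.sum_congr rfl fun k _ => ?_))
    congr 3
    rw [add_assoc]; congr 1
    push_cast
    rw [add_smul, one_smul]
  · simp only [cell_add hh, cell_sub hh]
    exact hUd t ht _ (hbox x hx)

/-! ### Uniform estimates for the approximations -/

/-- The Euclidean length of a chord is controlled by its Lorentz length and the height of its
endpoints. -/
theorem norm_sub_le_chordSq {u w : Lor} (hu : u ∈ hyperbolicPlane) (hw : w ∈ hyperbolicPlane) :
    ‖w - u‖ ≤ 4 * (u 0 + w 0) * √(chordSq u w) := by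
  have hm := midpt_mem hu hw
  have hξ : lorentzForm (midpt u w) (w - u) = 0 := by
    simpa using lorentzForm_midpt_sub hu hw 1
  have hs := sum_frameCoord_sq hm hξ
  have hY : ∀ a, |frameCoord (midpt u w) (w - u) a| ≤ √(chordSq u w) := by
    intro a
    rw [← Real.sqrt_sq_eq_abs]
    refine Real.sqrt_le_sqrt ?_
    rw [chordSq, ← hs]
    exact Finset.single_le_sum (f := fun a => frameCoord (midpt u w) (w - u) a ^ 2)
      (fun a _ => sq_nonneg _) (Finset.mem_univ a)
  have h0 : 0 ≤ √(chordSq u w) := Real.sqrt_nonneg _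
  have hm0 : 0 < midpt u w 0 := hm.2
  conv_lhs => rw [← sum_frameCoord_smul hm hξ]
  calc _ ≤ ∑ a, ‖frameCoord (midpt u w) (w - u) a • frame (midpt u w) a‖ := norm_sum_le _ _
    _ ≤ ∑ a : Fin 2, √(chordSq u w) * (2 * midpt u w 0) := by
        refine Finset.sum_le_sum fun a _ => ?_
        rw [norm_smul, Real.norm_eq_abs]
        exact mul_le_mul (hY a) (norm_frame_le hm a) (norm_nonneg _) h0
    _ = 4 * midpt u w 0 * √(chordSq u w) := by simp; ring
    _ ≤ _ := by
        have := midpt_zero_le hu hw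
        gcongr

theorem norm_eta_cross_le (v w : Lor) : ‖eta *ᵥ (v ⨯₃ w)‖ ≤ 2 * ‖v‖ * ‖w‖ := by
  rw [eta_mulVec_cross]
  have hb : ∀ i j, |v i * w j| ≤ ‖v‖ * ‖w‖ := fun i j => by
    rw [abs_mul]
    exact mul_le_mul (norm_le_pi_norm v i) (norm_le_pi_norm w j) (abs_nonneg _) (norm_nonneg _)
  have hd : ∀ i j k l, |v i * w j - v k * w l| ≤ 2 * ‖v‖ * ‖w‖ := fun i j k l =>
    (abs_sub _ _).trans (by linarith [hb i j, hb k l])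
  refine (pi_norm_le_iff_of_nonneg (by positivity)).2 fun i => ?_
  rw [Real.norm_eq_abs]
  fin_cases i
  · simpa [abs_sub_comm] using hd 1 2 2 1
  · exact hd _ _ _ _
  · exact hd _ _ _ _

/-- The density of the moments of `u₀ - 1` that are bounded along the approximations. -/
def momentDensity (u : Lor) : ℝ := (u 0 - 1) + (u 0 - 1) ^ 8

theorem momentDensity_nonneg {u : Lor} (hu : u ∈ hyperbolicPlane) : 0 ≤ momentDensity u := by
  have : 0 ≤ u 0 - 1 := by linarith [one_le_of_mem hu]
  unfold momentDensity; positivity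

theorem pow_le_add_pow_eight {x : ℝ} (hx : 0 ≤ x) {k : ℕ} (hk : 1 ≤ k) (hk' : k ≤ 8) :
    x ^ k ≤ x + x ^ 8 := by
  rcases le_total x 1 with h | h
  · have := pow_le_pow_of_le_one hx h hk
    have := pow_nonneg hx 8
    linarith [pow_one x]
  · have := pow_le_pow_right₀ h hk'
    linarith

theorem pow_zero_le_momentDensity {u : Lor} (hu : u ∈ hyperbolicPlane) :
    u 0 ^ 8 ≤ 128 * (1 + momentDensity u) := by
  have h1 := one_le_of_mem hu
  have := add_pow_le (zero_le_one' ℝ) (by linarith : 0 ≤ u 0 - 1) 8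
  norm_num at this
  unfold momentDensity
  linarith

/-- A density whose integral is controlled by measure, moments and energy, and which dominates the
flux and the difference quotients of an approximation. The constant `A` is the part that is
integrable only over sets of finite measure; it can be taken to be zero for the flux of the mass. -/
noncomputable def fluxDensity (A h : ℝ) (u w : Lor) : ℝ :=
  A + 200 * (momentDensity u + momentDensity w) + 4 * (chordSq u w / h ^ 2)

/-- Young's inequality, with the weights by which the mesh enters the energy. -/
theorem two_mul_sqrt_le {h : ℝ} (hh : 0 < h) (a : ℝ) {c : ℝ} (hc : 0 ≤ c) :
    2 * (a * √c) ≤ h * (a ^ 2 + c / h ^ 2) := by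
  have h1 : h * (a ^ 2 + c / h ^ 2) - 2 * (a * √c) = h * (a - √c / h) ^ 2 := by
    have := Real.sq_sqrt hc
    field_simp
    rw [sub_sq, this]; ring
  have : 0 ≤ h * (a - √c / h) ^ 2 := by positivity
  linarith

theorem norm_sub_le_fluxDensity {u w : Lor} {h : ℝ} (hh : 0 < h) (hu : u ∈ hyperbolicPlane)
    (hw : w ∈ hyperbolicPlane) : ‖w - u‖ ≤ h * fluxDensity 128 h u w := by
  refine (norm_sub_le_chordSq hu hw).trans ?_
  have h1 := two_mul_sqrt_le hh (u 0 + w 0) (chordSq_nonneg hu hw)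
  have h2 : (u 0 + w 0) ^ 2 ≤ 8 * (1 + momentDensity u + momentDensity w) := by
    have a1 := one_le_of_mem hu
    have a2 := one_le_of_mem hw
    have b1 := pow_le_add_pow_eight (by linarith : 0 ≤ u 0 - 1) (k := 2) (by norm_num) (by norm_num)
    have b2 := pow_le_add_pow_eight (by linarith : 0 ≤ w 0 - 1) (k := 2) (by norm_num) (by norm_num)
    unfold momentDensity
    nlinarith [sq_nonneg (u 0 - w 0), sq_nonneg (u 0 - 2), sq_nonneg (w 0 - 2)]
  have h3 := momentDensity_nonneg hu
  have h4 := momentDensity_nonneg hw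
  have h5 : 0 ≤ chordSq u w / h ^ 2 := div_nonneg (chordSq_nonneg hu hw) (by positivity)
  calc _ = 2 * (2 * ((u 0 + w 0) * √(chordSq u w))) := by ring
    _ ≤ 2 * (h * ((u 0 + w 0) ^ 2 + chordSq u w / h ^ 2)) := by gcongr
    _ = h * (2 * (u 0 + w 0) ^ 2 + 2 * (chordSq u w / h ^ 2)) := by ring
    _ ≤ _ := by
        unfold fluxDensity
        gcongr
        · linarith
        · norm_num

theorem cross_sub_self (u w : Lor) : u ⨯₃ (w - u) = u ⨯₃ w := by
  rw [map_sub, cross_self, sub_zero]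

/-- The flux is bounded by the product of a quadratic expression in the heights and the square root
of the energy density, hence by moments and energy. -/
theorem norm_flux_le_fluxDensity {u w : Lor} {h : ℝ} (hh : 0 < h) (hu : u ∈ hyperbolicPlane)
    (hw : w ∈ hyperbolicPlane) : ‖h⁻¹ • eta *ᵥ (u ⨯₃ w)‖ ≤ fluxDensity 128 h u w := by
  have a1 := one_le_of_mem hu
  have a2 := one_le_of_mem hw
  have h0 := chordSq_nonneg hu hw
  rw [← cross_sub_self, norm_smul, norm_inv, Real.norm_of_nonneg hh.le, inv_mul_le_iff₀ hh]
  have h1 := two_mul_sqrt_le hh (u 0 * (u 0 + w 0)) h0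
  have hp : (u 0 * (u 0 + w 0)) ^ 2 ≤ 32 * (1 + momentDensity u + momentDensity w) := by
    have key : ∀ g, 0 ≤ g → u 0 ≤ 1 + g → w 0 ≤ 1 + g →
        (u 0 * (u 0 + w 0)) ^ 2 ≤ 32 * (1 + (g + g ^ 8)) := by
      intro g hg h1 h2
      have b4 := pow_le_add_pow_eight hg (k := 4) (by norm_num) (by norm_num)
      have b5 := add_pow_le (zero_le_one' ℝ) hg 4
      norm_num at b5
      calc (u 0 * (u 0 + w 0)) ^ 2 ≤ ((1 + g) * ((1 + g) + (1 + g))) ^ 2 := by gcongr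
        _ = 4 * (1 + g) ^ 4 := by ring
        _ ≤ 4 * (8 * (1 + g ^ 4)) := by linarith
        _ ≤ _ := by linarith
    have h3 := momentDensity_nonneg hu
    have h4 := momentDensity_nonneg hw
    rcases le_total (u 0) (w 0) with h | h
    · have := key (w 0 - 1) (by linarith) (by linarith) (by linarith)
      rw [← momentDensity] at this; linarith
    · have := key (u 0 - 1) (by linarith) (by linarith) (by linarith)
      rw [← momentDensity] at this; linarith
  have h3 := momentDensity_nonneg hu
  have h4 := momentDensity_nonneg hw
  calc ‖eta *ᵥ (u ⨯₃ (w - u))‖ ≤ 2 * ‖u‖ * ‖w - u‖ := norm_eta_cross_le _ _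
    _ ≤ 2 * u 0 * (4 * (u 0 + w 0) * √(chordSq u w)) := by
        gcongr
        · exact norm_le_of_mem hu
        · exact norm_sub_le_chordSq hu hw
    _ = 4 * (2 * ((u 0 * (u 0 + w 0)) * √(chordSq u w))) := by ring
    _ ≤ 4 * (h * ((u 0 * (u 0 + w 0)) ^ 2 + chordSq u w / h ^ 2)) := by gcongr
    _ = h * (4 * (u 0 * (u 0 + w 0)) ^ 2 + 4 * (chordSq u w / h ^ 2)) := by ring
    _ ≤ _ := by unfold fluxDensity; gcongr; linarith

/-- The flux of the mass is integrable over the whole plane, since it vanishes where `u` is at the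
centre of the hyperboloid. -/
theorem abs_flux_zero_le_fluxDensity {u w : Lor} {h : ℝ} (hh : 0 < h) (hu : u ∈ hyperbolicPlane)
    (hw : w ∈ hyperbolicPlane) : |(h⁻¹ • eta *ᵥ (u ⨯₃ w)) 0| ≤ fluxDensity 0 h u w := by
  have a1 := one_le_of_mem hu
  have a2 := one_le_of_mem hw
  have h0 := chordSq_nonneg hu hw
  have hs := (mem_hyperbolicPlane.1 hu).1
  rw [Pi.smul_apply, smul_eq_mul, abs_mul, abs_inv, abs_of_pos hh, inv_mul_le_iff₀ hh,
    eta_mulVec_cross]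
  have e : (![-(u 1 * w 2 - u 2 * w 1), u 2 * w 0 - u 0 * w 2, u 0 * w 1 - u 1 * w 0] : Lor) 0 =
      u 2 * (w 1 - u 1) - u 1 * (w 2 - u 2) := by simp; ring
  rw [e]
  set r := |u 1| + |u 2|
  have hr0 : 0 ≤ r := by positivity
  have hr : r ^ 2 ≤ 2 * (u 0 ^ 2 - 1) := by
    have := sq_abs (u 1)
    have := sq_abs (u 2)
    nlinarith [sq_nonneg (|u 1| - |u 2|)]
  have hd : ∀ i, |w i - u i| ≤ 4 * (u 0 + w 0) * √(chordSq u w) := fun i =>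
    (norm_le_pi_norm (w - u) i).trans (norm_sub_le_chordSq hu hw)
  have h1 := two_mul_sqrt_le hh (r * (u 0 + w 0)) h0
  have hp : (r * (u 0 + w 0)) ^ 2 ≤ 96 * (momentDensity u + momentDensity w) := by
    have key : ∀ g, 0 ≤ g → u 0 ≤ 1 + g → w 0 ≤ 1 + g →
        (r * (u 0 + w 0)) ^ 2 ≤ 96 * (g + g ^ 8) := by
      intro g hg h1 h2
      have b2 := pow_le_add_pow_eight hg (k := 2) (by norm_num) (by norm_num)
      have b3 := pow_le_add_pow_eight hg (k := 3) (by norm_num) (by norm_num)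
      have b4 := pow_le_add_pow_eight hg (k := 4) (by norm_num) (by norm_num)
      have b8 := pow_nonneg hg 8
      calc (r * (u 0 + w 0)) ^ 2 = r ^ 2 * (u 0 + w 0) ^ 2 := by ring
        _ ≤ (2 * ((1 + g) ^ 2 - 1)) * ((1 + g) + (1 + g)) ^ 2 := by
            have hr' : r ^ 2 ≤ 2 * ((1 + g) ^ 2 - 1) := hr.trans (by gcongr)
            exact mul_le_mul hr' (by gcongr) (sq_nonneg _) ((sq_nonneg r).trans hr')
        _ = 8 * (2 * g + 5 * g ^ 2 + 4 * g ^ 3 + g ^ 4) := by ring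
        _ ≤ _ := by linarith
    have h3 := momentDensity_nonneg hu
    have h4 := momentDensity_nonneg hw
    rcases le_total (u 0) (w 0) with h | h
    · have := key (w 0 - 1) (by linarith) (by linarith) (by linarith)
      rw [← momentDensity] at this; linarith
    · have := key (u 0 - 1) (by linarith) (by linarith) (by linarith)
      rw [← momentDensity] at this; linarith
  have h3 := momentDensity_nonneg hu
  have h4 := momentDensity_nonneg hw
  have h5 : 0 ≤ chordSq u w / h ^ 2 := div_nonneg h0 (by positivity)
  calc |u 2 * (w 1 - u 1) - u 1 * (w 2 - u 2)| ≤ |u 2| * |w 1 - u 1| + |u 1| * |w 2 - u 2| := by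
        rw [← abs_mul, ← abs_mul]; exact abs_sub _ _
    _ ≤ |u 2| * (4 * (u 0 + w 0) * √(chordSq u w)) + |u 1| * (4 * (u 0 + w 0) * √(chordSq u w)) := by
        gcongr
        · exact hd 1
        · exact hd 2
    _ = 2 * (2 * ((r * (u 0 + w 0)) * √(chordSq u w))) := by simp only [r]; ring
    _ ≤ 2 * (h * ((r * (u 0 + w 0)) ^ 2 + chordSq u w / h ^ 2)) := by gcongr
    _ = h * (2 * (r * (u 0 + w 0)) ^ 2 + 2 * (chordSq u w / h ^ 2)) := by ring
    _ ≤ _ := by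
        unfold fluxDensity
        gcongr
        · linarith
        · norm_num

namespace IsLatticeApprox

variable {E C h T : ℝ} {u : ℝ → Plane → Lor}

theorem measurable_slice (hu : IsLatticeApprox E C h T u) (t : ℝ) : Measurable (u t) :=
  hu.measurable.comp measurable_prodMk_left

theorem measurable_momentDensity : Measurable momentDensity := by
  unfold momentDensity; fun_prop

/-- The uniform bound for the integral of `fluxDensity` over a set of measure `v`, or over an
arbitrary set if `A = 0`. The shift by `z` makes it applicable to iterated translations. -/
theorem lintegral_fluxDensity_le (hu : IsLatticeApprox E C h T u) (hC : 0 ≤ C) (hE : 0 ≤ E)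
    {A v : ℝ} (hA : 0 ≤ A) (hv : 0 ≤ v) {K : Set Plane} (hK : A = 0 ∨ volume K ≤ ENNReal.ofReal v)
    (t : ℝ) (l : Fin 2) (z : Plane) :
    ∫⁻ x in K, ENNReal.ofReal (fluxDensity A h (u t (x + z)) (u t (x + z + h • basisVec l))) ≤
      ENNReal.ofReal (A * v + 400 * C + 4 * E) := by
  have hh := hu.mesh_pos
  have hm := hu.measurable_slice t
  have hΦ : ∀ y : Plane, ∫⁻ x, ENNReal.ofReal (momentDensity (u t (x + y))) ≤ ENNReal.ofReal C := by
    intro y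
    rw [lintegral_add_right_eq_self (fun x => ENNReal.ofReal (momentDensity (u t x))) y]
    exact hu.moment t
  have hc : ∫⁻ x, ENNReal.ofReal (chordSq (u t (x + z)) (u t (x + z + h • basisVec l)) / h ^ 2) ≤
      ENNReal.ofReal E := by
    rw [lintegral_add_right_eq_self (fun x => ENNReal.ofReal
      (chordSq (u t x) (u t (x + h • basisVec l)) / h ^ 2)) z]
    have e : ENNReal.ofReal E = ENNReal.ofReal (h ^ 2)⁻¹ * ENNReal.ofReal (h ^ 2 * E) := by
      rw [← ENNReal.ofReal_mul (by positivity)]; congr 1; field_simp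
    rw [e]
    refine le_trans ?_ (mul_le_mul_right (hu.energy t) _)
    rw [← lintegral_const_mul' _ _ ENNReal.ofReal_ne_top]
    refine lintegral_mono fun x => ?_
    rw [← ENNReal.ofReal_mul (by positivity)]
    refine ENNReal.ofReal_le_ofReal ?_
    rw [div_eq_inv_mul]
    gcongr
    exact Finset.single_le_sum (f := fun l => chordSq (u t x) (u t (x + h • basisVec l)))
      (fun l _ => chordSq_nonneg (hu.mem _ _) (hu.mem _ _)) (Finset.mem_univ l)
  have hmA : Measurable fun x : Plane => ENNReal.ofReal (momentDensity (u t (x + z))) :=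
    (measurable_momentDensity.comp (hm.comp (measurable_add_const z))).ennreal_ofReal
  have hmB : Measurable fun x : Plane =>
      ENNReal.ofReal (momentDensity (u t (x + (z + h • basisVec l)))) :=
    (measurable_momentDensity.comp (hm.comp (measurable_add_const _))).ennreal_ofReal
  calc ∫⁻ x in K, ENNReal.ofReal (fluxDensity A h (u t (x + z)) (u t (x + z + h • basisVec l)))
      = ∫⁻ x in K, (ENNReal.ofReal A + ENNReal.ofReal 200 * ENNReal.ofReal (momentDensity (u t (x + z)))
          + ENNReal.ofReal 200 * ENNReal.ofReal (momentDensity (u t (x + (z + h • basisVec l)))) +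
          ENNReal.ofReal 4 * ENNReal.ofReal
            (chordSq (u t (x + z)) (u t (x + z + h • basisVec l)) / h ^ 2)) := by
        refine lintegral_congr fun x => ?_
        have h3 := momentDensity_nonneg (hu.mem t (x + z))
        have h4 := momentDensity_nonneg (hu.mem t (x + (z + h • basisVec l)))
        have h5 : 0 ≤ chordSq (u t (x + z)) (u t (x + z + h • basisVec l)) / h ^ 2 :=
          div_nonneg (chordSq_nonneg (hu.mem _ _) (hu.mem _ _)) (by positivity)
        rw [← ENNReal.ofReal_mul (by norm_num), ← ENNReal.ofReal_mul (by norm_num),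
          ← ENNReal.ofReal_mul (by norm_num), ← ENNReal.ofReal_add hA (by positivity),
          ← ENNReal.ofReal_add (by positivity) (by positivity),
          ← ENNReal.ofReal_add (by positivity) (by positivity), fluxDensity, add_assoc x z]
        congr 1; ring
    _ = ENNReal.ofReal A * volume K +
          ENNReal.ofReal 200 * (∫⁻ x in K, ENNReal.ofReal (momentDensity (u t (x + z)))) +
          ENNReal.ofReal 200 *
            (∫⁻ x in K, ENNReal.ofReal (momentDensity (u t (x + (z + h • basisVec l))))) +
          ENNReal.ofReal 4 * ∫⁻ x in K, ENNReal.ofReal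
            (chordSq (u t (x + z)) (u t (x + z + h • basisVec l)) / h ^ 2) := by
        have m2 : Measurable fun x : Plane => ENNReal.ofReal A +
            ENNReal.ofReal 200 * ENNReal.ofReal (momentDensity (u t (x + z))) :=
          measurable_const.add (hmA.const_mul _)
        have m3 : Measurable fun x : Plane => ENNReal.ofReal A +
            ENNReal.ofReal 200 * ENNReal.ofReal (momentDensity (u t (x + z))) +
            ENNReal.ofReal 200 * ENNReal.ofReal (momentDensity (u t (x + (z + h • basisVec l)))) :=
          m2.add (hmB.const_mul _)
        rw [lintegral_add_left m3, lintegral_add_left m2, lintegral_add_left measurable_const,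
          lintegral_const, Measure.restrict_apply_univ,
          lintegral_const_mul' _ _ ENNReal.ofReal_ne_top,
          lintegral_const_mul' _ _ ENNReal.ofReal_ne_top,
          lintegral_const_mul' _ _ ENNReal.ofReal_ne_top]
    _ ≤ ENNReal.ofReal (A * v) + ENNReal.ofReal 200 * ENNReal.ofReal C +
          ENNReal.ofReal 200 * ENNReal.ofReal C + ENNReal.ofReal 4 * ENNReal.ofReal E := by
        gcongr
        · rcases hK with rfl | hK
          · simp
          · rw [ENNReal.ofReal_mul hA]; gcongr
        · exact (setLIntegral_le_lintegral _ _).trans (hΦ z)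
        · exact (setLIntegral_le_lintegral _ _).trans (hΦ _)
        · exact (setLIntegral_le_lintegral _ _).trans hc
    _ = _ := by
        rw [← ENNReal.ofReal_mul (by norm_num), ← ENNReal.ofReal_mul (by norm_num),
          ← ENNReal.ofReal_add (by positivity) (by positivity),
          ← ENNReal.ofReal_add (by positivity) (by positivity),
          ← ENNReal.ofReal_add (by positivity) (by positivity)]
        congr 1; ring

theorem lintegral_step_le (hu : IsLatticeApprox E C h T u) (hC : 0 ≤ C) (hE : 0 ≤ E)
    {v : ℝ} (hv : 0 ≤ v) {K : Set Plane} (hK : volume K ≤ ENNReal.ofReal v) (t : ℝ) (l : Fin 2)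
    (z : Plane) : ∫⁻ x in K, ‖u t (x + z + h • basisVec l) - u t (x + z)‖ₑ ≤
      ENNReal.ofReal (h * (128 * v + 400 * C + 4 * E)) := by
  have hh := hu.mesh_pos
  rw [ENNReal.ofReal_mul hh.le]
  refine le_trans ?_ (mul_le_mul_right (hu.lintegral_fluxDensity_le hC hE (by norm_num) hv
    (Or.inr hK) t l z) _)
  rw [← lintegral_const_mul' _ _ ENNReal.ofReal_ne_top]
  refine lintegral_mono fun x => ?_
  rw [← ofReal_norm, ← ENNReal.ofReal_mul hh.le]
  exact ENNReal.ofReal_le_ofReal (norm_sub_le_fluxDensity hh (hu.mem _ _) (hu.mem _ _))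

theorem lintegral_axis_le (hu : IsLatticeApprox E C h T u) (hC : 0 ≤ C) (hE : 0 ≤ E)
    {v : ℝ} (hv : 0 ≤ v) {K : Set Plane} (hK : volume K ≤ ENNReal.ofReal v) (t : ℝ) (l : Fin 2)
    (z : Plane) {a : ℝ} (ha : 0 ≤ a) :
    ∫⁻ x in K, ‖u t (x + z + a • basisVec l) - u t (x + z)‖ₑ ≤
      ENNReal.ofReal ((a + h) * (128 * v + 400 * C + 4 * E)) := by
  have hh := hu.mesh_pos
  set P := 128 * v + 400 * C + 4 * E
  have hP : 0 ≤ P := by positivity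
  have hm := hu.measurable_slice t
  calc ∫⁻ x in K, ‖u t (x + z + a • basisVec l) - u t (x + z)‖ₑ
      ≤ ∫⁻ x in K, ∑ k ∈ Finset.range ⌈a / h⌉₊,
          ‖u t (x + (z + (k * h) • basisVec l) + h • basisVec l) -
            u t (x + (z + (k * h) • basisVec l))‖ₑ := by
        refine lintegral_mono fun x => ?_
        simp only [← ofReal_norm]
        rw [← ENNReal.ofReal_sum_of_nonneg fun k _ => norm_nonneg _]
        refine ENNReal.ofReal_le_ofReal ?_
        simpa only [add_assoc] using hu.path t (x + z) l a ha
    _ = ∑ k ∈ Finset.range ⌈a / h⌉₊, ∫⁻ x in K,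
          ‖u t (x + (z + (k * h) • basisVec l) + h • basisVec l) -
            u t (x + (z + (k * h) • basisVec l))‖ₑ := by
        refine lintegral_finsetSum _ fun k _ => ?_
        fun_prop
    _ ≤ ∑ k ∈ Finset.range ⌈a / h⌉₊, ENNReal.ofReal (h * P) :=
        Finset.sum_le_sum fun k _ => hu.lintegral_step_le hC hE hv hK t l _
    _ = ENNReal.ofReal (⌈a / h⌉₊ * (h * P)) := by
        rw [Finset.sum_const, Finset.card_range, nsmul_eq_mul,
          ENNReal.ofReal_mul (p := (⌈a / h⌉₊ : ℝ)) (by positivity), ENNReal.ofReal_natCast]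
    _ ≤ _ := by
        refine ENNReal.ofReal_le_ofReal ?_
        have h1 : (⌈a / h⌉₊ : ℝ) ≤ a / h + 1 := (Nat.ceil_lt_add_one (by positivity)).le
        calc _ ≤ (a / h + 1) * (h * P) := by gcongr
          _ = _ := by field_simp

/-- Translations are uniformly continuous in `L¹` on sets of bounded measure, up to the mesh. -/
theorem lintegral_translate_le (hu : IsLatticeApprox E C h T u) (hC : 0 ≤ C) (hE : 0 ≤ E)
    {v : ℝ} (hv : 0 ≤ v) {K : Set Plane} (hK : volume K ≤ ENNReal.ofReal v) (t : ℝ)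
    (z : Plane) : ∫⁻ x in K, ‖u t (x + z) - u t x‖ₑ ≤
      ENNReal.ofReal (2 * (‖z‖ + h) * (128 * v + 400 * C + 4 * E)) := by
  have hh := hu.mesh_pos
  set P := 128 * v + 400 * C + 4 * E
  have hP : 0 ≤ P := by positivity
  have hm := hu.measurable_slice t
  have key : ∀ l (y : Plane) (a : ℝ), ∫⁻ x in K, ‖u t (x + y + a • basisVec l) - u t (x + y)‖ₑ ≤
      ENNReal.ofReal ((|a| + h) * P) := by
    intro l y a
    rcases le_total 0 a with ha | ha
    · rw [abs_of_nonneg ha]; exact hu.lintegral_axis_le hC hE hv hK t l y ha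
    · rw [abs_of_nonpos ha]
      have := hu.lintegral_axis_le hC hE hv hK t l (y + a • basisVec l) (a := -a) (by linarith)
      refine le_trans (le_of_eq (lintegral_congr fun x => ?_)) this
      rw [enorm_sub_rev, ← add_assoc x, neg_smul, add_neg_cancel_right]
  have hz : z = z 0 • basisVec 0 + z 1 • basisVec 1 := by
    ext k; fin_cases k <;> simp [basisVec]
  calc ∫⁻ x in K, ‖u t (x + z) - u t x‖ₑ
      ≤ ∫⁻ x in K, (‖u t (x + z 0 • basisVec 0 + z 1 • basisVec 1) - u t (x + z 0 • basisVec 0)‖ₑ +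
          ‖u t (x + 0 + z 0 • basisVec 0) - u t (x + 0)‖ₑ) := by
        refine lintegral_mono fun x => ?_
        conv_lhs => rw [hz, ← add_assoc]
        rw [add_zero]
        refine le_trans (le_of_eq ?_) (enorm_add_le _ _)
        rw [sub_add_sub_cancel]
    _ = (∫⁻ x in K, ‖u t (x + z 0 • basisVec 0 + z 1 • basisVec 1) - u t (x + z 0 • basisVec 0)‖ₑ) +
          ∫⁻ x in K, ‖u t (x + 0 + z 0 • basisVec 0) - u t (x + 0)‖ₑ := by
        refine lintegral_add_left ?_ _
        fun_prop
    _ ≤ ENNReal.ofReal ((|z 1| + h) * P) + ENNReal.ofReal ((|z 0| + h) * P) :=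
        add_le_add (key _ _ _) (key _ _ _)
    _ ≤ _ := by
        rw [← ENNReal.ofReal_add (by positivity) (by positivity)]
        refine ENNReal.ofReal_le_ofReal ?_
        have h0 : |z 0| ≤ ‖z‖ := PiLp.norm_apply_le z 0
        have h1 : |z 1| ≤ ‖z‖ := PiLp.norm_apply_le z 1
        nlinarith

end IsLatticeApprox

/-! ### The weak form of the lattice flow -/

instance : (volume : Measure (ℝ × Plane)).IsAddHaarMeasure := by
  rw [Measure.volume_eq_prod]; infer_instance

theorem integrable_smul_of_bound {X F : Type*} [TopologicalSpace X] [MeasurableSpace X]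
    [OpensMeasurableSpace X] [NormedAddCommGroup F] [NormedSpace ℝ F] {μ : Measure X}
    [IsFiniteMeasureOnCompacts μ] {φ : X → ℝ} (hφ : Continuous φ) (hφc : HasCompactSupport φ)
    {f : X → F} (hf : AEStronglyMeasurable f μ) {B : ℝ} (hB : ∀ x, ‖f x‖ ≤ B) :
    Integrable (fun x => φ x • f x) μ := by
  have h1 : Integrable φ μ := hφ.integrable_of_hasCompactSupport hφc
  refine (h1.norm.mul_const B).mono' (h1.aestronglyMeasurable.smul hf) (ae_of_all _ fun x => ?_)
  rw [norm_smul]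
  exact mul_le_mul_of_nonneg_left (hB x) (norm_nonneg _)

/-- Summation by parts for difference quotients. -/
theorem integral_smul_shift_sub {X F : Type*} [NormedAddCommGroup X] [MeasurableSpace X]
    [BorelSpace X] [NormedAddCommGroup F] [NormedSpace ℝ F] {μ : Measure X}
    [IsFiniteMeasureOnCompacts μ] [μ.IsAddRightInvariant] {φ : X → ℝ} (hφ : Continuous φ)
    (hφc : HasCompactSupport φ) {f : X → F} (hf : StronglyMeasurable f) {B : ℝ}
    (hB : ∀ x, ‖f x‖ ≤ B) (a : X) :
    ∫ x, φ x • (f (x + a) - f x) ∂μ = ∫ x, (φ (x - a) - φ x) • f x ∂μ := by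
  have hφ' : Continuous fun x => φ (x - a) := by fun_prop
  have hφc' : HasCompactSupport fun x => φ (x - a) :=
    hφc.comp_homeomorph (Homeomorph.subRight a)
  have hf' : StronglyMeasurable fun x => f (x + a) := hf.comp_measurable (measurable_add_const a)
  simp only [smul_sub, sub_smul]
  rw [integral_sub (integrable_smul_of_bound hφ hφc hf'.aestronglyMeasurable fun x => hB _)
      (integrable_smul_of_bound hφ hφc hf.aestronglyMeasurable hB),
    integral_sub (integrable_smul_of_bound hφ' hφc' hf.aestronglyMeasurable hB)
      (integrable_smul_of_bound hφ hφc hf.aestronglyMeasurable hB),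
    ← integral_add_right_eq_self (fun x => φ (x - a) • f x) a]
  simp only [add_sub_cancel_right]

/-- The discrete flux `η (u × D⁺ₗ u)`, written without the vanishing term `u × u`. -/
noncomputable def latticeFlux (h : ℝ) (u : Plane → Lor) (l : Fin 2) (x : Plane) : Lor :=
  h⁻¹ • eta *ᵥ (u x ⨯₃ u (x + h • basisVec l))

/-- The right-hand side of the lattice flow in divergence form. -/
noncomputable def latticeVelocity (h : ℝ) (u : Plane → Lor) (x : Plane) : Lor :=
  -∑ l, h⁻¹ • (latticeFlux h u l (x + -(h • basisVec l)) - latticeFlux h u l x)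

theorem latticeVelocity_eq (h : ℝ) (u : Plane → Lor) (x : Plane) : latticeVelocity h u x =
    (h⁻¹ ^ 2) • eta *ᵥ (u x ⨯₃ ∑ l, (u (x + h • basisVec l) + u (x - h • basisVec l))) := by
  ext j
  simp only [latticeVelocity, latticeFlux, Fin.sum_univ_two,
    ← sub_eq_add_neg, eta_mulVec_cross, Pi.smul_apply, Pi.neg_apply, Pi.add_apply, Pi.sub_apply,
    smul_eq_mul]
  fin_cases j <;> simp <;> ring

namespace IsLatticeApprox

variable {E C h T : ℝ} {u : ℝ → Plane → Lor}

theorem measurable_latticeFlux (hu : IsLatticeApprox E C h T u) (l : Fin 2) :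
    Measurable fun z : ℝ × Plane => latticeFlux h (u z.1) l z.2 := by
  have h1 := hu.measurable
  have h2 : Measurable fun z : ℝ × Plane => u z.1 (z.2 + h • basisVec l) :=
    h1.comp (measurable_fst.prodMk (measurable_snd.add_const _))
  have hp1 : ∀ j, Measurable fun z : ℝ × Plane => u z.1 z.2 j := fun j => measurable_pi_iff.1 h1 j
  have hp2 : ∀ j, Measurable fun z : ℝ × Plane => u z.1 (z.2 + h • basisVec l) j :=
    fun j => measurable_pi_iff.1 h2 j
  unfold latticeFlux
  simp only [eta_mulVec_cross]
  refine measurable_pi_iff.2 fun j => ?_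
  simp only [Pi.smul_apply, smul_eq_mul]
  refine measurable_const.mul ?_
  fin_cases j
  · exact (((hp1 1).mul (hp2 2)).sub ((hp1 2).mul (hp2 1))).neg
  · exact ((hp1 2).mul (hp2 0)).sub ((hp1 0).mul (hp2 2))
  · exact ((hp1 0).mul (hp2 1)).sub ((hp1 1).mul (hp2 0))

theorem bounded_latticeFlux (hu : IsLatticeApprox E C h T u) :
    ∃ B, ∀ t x l, ‖latticeFlux h (u t) l x‖ ≤ B := by
  obtain ⟨B, hB⟩ := hu.bounded
  have hB0 : 0 ≤ B := (norm_nonneg _).trans (hB 0 0)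
  refine ⟨‖h⁻¹‖ * (2 * B * B), fun t x l => ?_⟩
  rw [latticeFlux, norm_smul]
  gcongr
  refine (norm_eta_cross_le _ _).trans ?_
  gcongr <;> exact hB _ _

theorem measurable_latticeVelocity (hu : IsLatticeApprox E C h T u) :
    Measurable fun z : ℝ × Plane => latticeVelocity h (u z.1) z.2 := by
  unfold latticeVelocity
  have h1 : ∀ l, Measurable fun z : ℝ × Plane =>
      latticeFlux h (u z.1) l (z.2 + -(h • basisVec l)) := by
    intro l
    have hs : Measurable fun z : ℝ × Plane => (z.1, z.2 + -(h • basisVec l)) :=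
      measurable_fst.prodMk (measurable_snd.add_const _)
    have := (hu.measurable_latticeFlux l).comp hs
    simp only [Function.comp_def] at this
    exact this
  have h2 : ∀ l, Measurable fun z : ℝ × Plane => h⁻¹ •
      (latticeFlux h (u z.1) l (z.2 + -(h • basisVec l)) - latticeFlux h (u z.1) l z.2) := fun l =>
    measurable_pi_iff.2 fun j => measurable_const.mul
      ((measurable_pi_iff.1 (h1 l) j).sub (measurable_pi_iff.1 (hu.measurable_latticeFlux l) j))
  exact (Finset.measurable_fun_sum _ fun l _ => h2 l).neg

theorem bounded_latticeVelocity (hu : IsLatticeApprox E C h T u) :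
    ∃ B, ∀ t x, ‖latticeVelocity h (u t) x‖ ≤ B := by
  obtain ⟨B, hB⟩ := hu.bounded_latticeFlux
  refine ⟨∑ l : Fin 2, ‖h⁻¹‖ * (B + B), fun t x => ?_⟩
  rw [latticeVelocity, norm_neg]
  refine (norm_sum_le _ _).trans (Finset.sum_le_sum fun l _ => ?_)
  rw [norm_smul]
  gcongr
  exact (norm_sub_le _ _).trans (add_le_add (hB _ _ _) (hB _ _ _))

theorem hasDerivAt (hu : IsLatticeApprox E C h T u) {t : ℝ} (ht : t ∈ Set.Ioo (-T) T) {x : Plane}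
    (hx : ‖x‖ < T) : HasDerivAt (fun s => u s x) (latticeVelocity h (u t) x) t := by
  rw [latticeVelocity_eq]; exact hu.ode t ht x hx

/-- Equicontinuity in time of the spatial averages, for one component of the approximation and a
density dominating the corresponding component of the flux. -/
theorem abs_integral_sub_le (hu : IsLatticeApprox E C h T u) (hC : 0 ≤ C) (hE : 0 ≤ E)
    {φ : Plane → ℝ} (hφ : Continuous φ) (hφc : HasCompactSupport φ)
    (hφT : ∀ x, φ x ≠ 0 → ‖x‖ < T) {L : ℝ} (hL0 : 0 ≤ L) (hL : ∀ x y, |φ x - φ y| ≤ L * ‖x - y‖)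
    {A v : ℝ} (hA0 : 0 ≤ A) (hv : 0 ≤ v)
    (hvol : A = 0 ∨ volume (Function.support φ) ≤ ENNReal.ofReal v) (j : Fin 3)
    (hA : ∀ t l x, |latticeFlux h (u t) l x j| ≤
      fluxDensity A h (u t x) (u t (x + h • basisVec l)))
    {s t : ℝ} (hs : s ∈ Set.Ioo (-T) T) (ht : t ∈ Set.Ioo (-T) T) :
    |(∫ x, φ x * u t x j) - ∫ x, φ x * u s x j| ≤
      2 * L * (A * (2 * v) + 400 * C + 4 * E) * |t - s| := by
  have hh := hu.mesh_pos
  obtain ⟨B, hB⟩ := hu.bounded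
  obtain ⟨B', hB'⟩ := hu.bounded_latticeVelocity
  obtain ⟨B'', hB''⟩ := hu.bounded_latticeFlux
  have hmeas : ∀ t, Measurable fun x => u t x j := fun t => measurable_pi_iff.1 (hu.measurable_slice t) j
  have hmv : ∀ t, Measurable fun x => latticeVelocity h (u t) x j := fun t =>
    measurable_pi_iff.1 (hu.measurable_latticeVelocity.comp measurable_prodMk_left) j
  have hmf : ∀ t l, Measurable fun x => latticeFlux h (u t) l x j := fun t l =>
    measurable_pi_iff.1 ((hu.measurable_latticeFlux l).comp measurable_prodMk_left) j
  -- differentiation under the integral sign; outside of the support of `φ` the equation is not needed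
  have hderiv : ∀ t ∈ Set.Ioo (-T) T, HasDerivAt (fun t => ∫ x, φ x * u t x j)
      (∫ x, φ x * latticeVelocity h (u t) x j) t := by
    intro t ht
    refine (hasDerivAt_integral_of_dominated_loc_of_deriv_le (F := fun t x => φ x * u t x j)
      (F' := fun t x => φ x * latticeVelocity h (u t) x j) (bound := fun x => |φ x| * B')
      (isOpen_Ioo.mem_nhds ht) (Eventually.of_forall fun t => ?_) ?_ ?_ (ae_of_all _ ?_) ?_
      (ae_of_all _ ?_)).2
    · exact (hφ.measurable.mul (hmeas t)).aestronglyMeasurable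
    · exact integrable_smul_of_bound hφ hφc (hmeas t).aestronglyMeasurable
        fun x => (norm_le_pi_norm (u t x) j).trans (hB t x)
    · exact (hφ.measurable.mul (hmv t)).aestronglyMeasurable
    · intro x s _
      rw [Real.norm_eq_abs, abs_mul]
      gcongr
      exact (norm_le_pi_norm (latticeVelocity h (u s) x) j).trans (hB' s x)
    · exact ((hφ.integrable_of_hasCompactSupport hφc).norm.mul_const B')
    · intro x s hs
      by_cases h0 : φ x = 0
      · simp only [h0, zero_mul]; exact hasDerivAt_const _ _
      · exact ((hasDerivAt_pi.1 (hu.hasDerivAt hs (hφT x h0))) j).const_mul _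
  have hbound : ∀ t ∈ Set.Ioo (-T) T, ‖∫ x, φ x * latticeVelocity h (u t) x j‖ ≤
      2 * L * (A * (2 * v) + 400 * C + 4 * E) := by
    intro t _
    set P := A * (2 * v) + 400 * C + 4 * E
    have hP : 0 ≤ P := by positivity
    -- summation by parts moves the difference quotient onto the test function
    have e1 : ∫ x, φ x * latticeVelocity h (u t) x j =
        -∑ l, h⁻¹ * ∫ x, (φ (x + h • basisVec l) - φ x) * latticeFlux h (u t) l x j := by
      have e2 : ∀ l, ∫ x, (φ (x + h • basisVec l) - φ x) * latticeFlux h (u t) l x j =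
          ∫ x, φ x * (latticeFlux h (u t) l (x + -(h • basisVec l)) j - latticeFlux h (u t) l x j) := by
        intro l
        have := integral_smul_shift_sub (μ := (volume : Measure Plane)) hφ hφc
          (hmf t l).stronglyMeasurable (B := B'')
          (fun x => (norm_le_pi_norm (latticeFlux h (u t) l x) j).trans (hB'' t x l))
          (-(h • basisVec l))
        simp only [smul_eq_mul, sub_neg_eq_add] at this
        exact this.symm
      have hint : ∀ l, Integrable fun x => h⁻¹ * (φ x *
          (latticeFlux h (u t) l (x + -(h • basisVec l)) j - latticeFlux h (u t) l x j)) := by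
        intro l
        refine (integrable_smul_of_bound hφ hφc (B := B'' + B'') (Measurable.aestronglyMeasurable
          (Measurable.sub ((hmf t l).comp (measurable_add_const _)) (hmf t l))) fun x => ?_).const_mul _
        refine (norm_sub_le _ _).trans (add_le_add ?_ ?_)
        · exact (norm_le_pi_norm (latticeFlux h (u t) l _) j).trans (hB'' _ _ _)
        · exact (norm_le_pi_norm (latticeFlux h (u t) l x) j).trans (hB'' _ _ _)
      simp only [e2, ← integral_const_mul]
      rw [← integral_finsetSum _ fun l _ => hint l, ← integral_neg]
      refine integral_congr_ae (ae_of_all _ fun x => ?_)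
      simp only [latticeVelocity, Pi.neg_apply, Finset.sum_apply, Pi.smul_apply, Pi.sub_apply,
        smul_eq_mul, mul_neg, Finset.mul_sum, neg_inj]
      exact Finset.sum_congr rfl fun l _ => by ring
    have e3 : ∀ l, |h⁻¹ * ∫ x, (φ (x + h • basisVec l) - φ x) * latticeFlux h (u t) l x j| ≤ L * P := by
      intro l
      -- the difference quotient of `φ` vanishes outside of the support of `φ` and a translate of it
      set K : Set Plane := Function.support φ ∪ (fun x => x + h • basisVec l) ⁻¹' Function.support φ
      have hKv : A = 0 ∨ volume K ≤ ENNReal.ofReal (2 * v) := by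
        rcases hvol with h0 | h1
        · exact Or.inl h0
        · refine Or.inr ((measure_union_le _ _).trans ?_)
          rw [measure_preimage_add_right, two_mul, ENNReal.ofReal_add hv hv]
          exact add_le_add h1 h1
      rw [← integral_const_mul, ← Real.norm_eq_abs,
        ← ENNReal.ofReal_le_ofReal_iff (mul_nonneg hL0 hP), ofReal_norm]
      refine (enorm_integral_le_lintegral_enorm _).trans ?_
      have hsupp : ∀ x ∉ K, h⁻¹ * ((φ (x + h • basisVec l) - φ x) * latticeFlux h (u t) l x j) = 0 := by
        intro x hx
        simp only [K, Set.mem_union, Set.mem_preimage, Function.mem_support, not_or, not_not] at hx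
        simp [hx.1, hx.2]
      have hKm : MeasurableSet K :=
        (hφ.isOpen_support.measurableSet).union
          ((hφ.isOpen_support.measurableSet).preimage (measurable_add_const _))
      calc ∫⁻ x, ‖h⁻¹ * ((φ (x + h • basisVec l) - φ x) * latticeFlux h (u t) l x j)‖ₑ
          = ∫⁻ x in K, ‖h⁻¹ * ((φ (x + h • basisVec l) - φ x) * latticeFlux h (u t) l x j)‖ₑ := by
            rw [← lintegral_indicator hKm]
            refine lintegral_congr fun x => ?_
            by_cases hx : x ∈ K
            · simp [hx]
            · simp [hx, hsupp x hx]
        _ ≤ ∫⁻ x in K, ENNReal.ofReal L *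
              ENNReal.ofReal (fluxDensity A h (u t (x + 0)) (u t (x + 0 + h • basisVec l))) := by
            refine lintegral_mono fun x => ?_
            rw [← ofReal_norm, ← ENNReal.ofReal_mul hL0, add_zero]
            refine ENNReal.ofReal_le_ofReal ?_
            have h1 := hL (x + h • basisVec l) x
            rw [add_sub_cancel_left, norm_smul, norm_basisVec, mul_one, Real.norm_of_nonneg hh.le] at h1
            rw [norm_mul, norm_mul, Real.norm_eq_abs, Real.norm_eq_abs, Real.norm_eq_abs, abs_inv,
              abs_of_pos hh]
            calc h⁻¹ * (|φ (x + h • basisVec l) - φ x| * |latticeFlux h (u t) l x j|)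
                ≤ h⁻¹ * ((L * h) * fluxDensity A h (u t x) (u t (x + h • basisVec l))) := by
                  gcongr
                  exact hA t l x
              _ = _ := by field_simp
        _ = ENNReal.ofReal L * ∫⁻ x in K,
              ENNReal.ofReal (fluxDensity A h (u t (x + 0)) (u t (x + 0 + h • basisVec l))) :=
            lintegral_const_mul' _ _ ENNReal.ofReal_ne_top
        _ ≤ ENNReal.ofReal L * ENNReal.ofReal P := by
            gcongr
            exact hu.lintegral_fluxDensity_le hC hE hA0 (by positivity) hKv t l 0
        _ = _ := (ENNReal.ofReal_mul hL0).symm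
    rw [e1, norm_neg]
    refine (norm_sum_le _ _).trans ((Finset.sum_le_sum fun l _ => e3 l).trans (le_of_eq ?_))
    simp; ring
  have := Convex.norm_image_sub_le_of_norm_hasDerivWithin_le
    (fun t ht => (hderiv t ht).hasDerivWithinAt) hbound (convex_Ioo _ _) hs ht
  simpa only [Real.norm_eq_abs] using this

/-- The lattice flow tested against a space-time test function. -/
theorem integral_time_deriv (hu : IsLatticeApprox E C h T u) {φ : ℝ × Plane → ℝ}
    (hφ : ContDiff ℝ ∞ φ) (hφc : HasCompactSupport φ)
    (hφT : ∀ z ∈ tsupport φ, z.1 ∈ Set.Ioo (-T) T ∧ ‖z.2‖ < T) :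
    ∫ z, fderiv ℝ φ z (1, 0) • u z.1 z.2 =
      ∫ z, ∑ l, (h⁻¹ * (φ (z + (0, h • basisVec l)) - φ z)) • latticeFlux h (u z.1) l z.2 := by
  obtain ⟨B, hB⟩ := hu.bounded
  obtain ⟨B', hB'⟩ := hu.bounded_latticeVelocity
  obtain ⟨B'', hB''⟩ := hu.bounded_latticeFlux
  have hd : Continuous fun z => fderiv ℝ φ z (1, 0) :=
    (hφ.continuous_fderiv (by simp)).clm_apply continuous_const
  have hdc : HasCompactSupport fun z => fderiv ℝ φ z (1, 0) := by
    refine (hφc.fderiv ℝ).mono fun z hz => ?_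
    rw [Function.mem_support] at hz ⊢
    intro h0; exact hz (by rw [h0]; rfl)
  have i1 : Integrable fun z => fderiv ℝ φ z (1, 0) • u z.1 z.2 :=
    integrable_smul_of_bound hd hdc hu.measurable.aestronglyMeasurable fun z => hB _ _
  have i2 : Integrable fun z => φ z • latticeVelocity h (u z.1) z.2 :=
    integrable_smul_of_bound hφ.continuous hφc hu.measurable_latticeVelocity.aestronglyMeasurable
      fun z => hB' _ _
  -- the time derivative of `φ u` integrates to zero on every vertical line
  have key : ∫ z, (fderiv ℝ φ z (1, 0) • u z.1 z.2 + φ z • latticeVelocity h (u z.1) z.2) = 0 := by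
    have i3 : Integrable fun z => fderiv ℝ φ z (1, 0) • u z.1 z.2 +
        φ z • latticeVelocity h (u z.1) z.2 := i1.add i2
    have i0 : Integrable fun z => φ z • u z.1 z.2 :=
      integrable_smul_of_bound hφ.continuous hφc hu.measurable.aestronglyMeasurable fun z => hB _ _
    rw [Measure.volume_eq_prod] at i3 i0 ⊢
    rw [integral_prod_symm _ i3]
    refine integral_eq_zero_of_ae ?_
    filter_upwards [i3.prod_left_ae, i0.prod_left_ae] with x hx hx0
    refine integral_eq_zero_of_hasDerivAt_of_integrable (f := fun t => φ (t, x) • u t x)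
      (fun t => ?_) hx hx0
    have hφd : HasDerivAt (fun t => φ (t, x)) (fderiv ℝ φ (t, x) (1, 0)) t := by
      have h1 : HasFDerivAt φ (fderiv ℝ φ (t, x)) (t, x) :=
        (hφ.differentiable (by simp) _).hasFDerivAt
      exact h1.comp_hasDerivAt t ((hasDerivAt_id t).prodMk (hasDerivAt_const t x))
    by_cases hz : (t, x) ∈ tsupport φ
    · obtain ⟨ht, hx⟩ := hφT _ hz
      refine (hφd.smul (hu.hasDerivAt ht hx)).congr_deriv ?_
      rw [add_comm]
    · have hev := notMem_tsupport_iff_eventuallyEq.1 hz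
      have h0 : φ (t, x) = 0 := hev.self_of_nhds
      have h1 : fderiv ℝ φ (t, x) = 0 := by rw [hev.fderiv_eq]; simp
      simp only [h0, h1, zero_smul, zero_apply, add_zero]
      have hev' : (fun s => φ (s, x) • u s x) =ᶠ[𝓝 t] fun _ => 0 := by
        have hc : Tendsto (fun s : ℝ => (s, x)) (𝓝 t) (𝓝 (t, x)) :=
          (Continuous.prodMk_left x).tendsto t
        filter_upwards [hc.eventually hev] with s hs
        rw [hs]; simp
      exact (hasDerivAt_const t (0 : Lor)).congr_of_eventuallyEq hev'
  have hint : ∀ l, Integrable fun z : ℝ × Plane => h⁻¹ • (φ z • (latticeFlux h (u (z + -(0, h • basisVec l)).1) l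
      (z + -(0, h • basisVec l)).2 - latticeFlux h (u z.1) l z.2)) := by
    intro l
    have hm := hu.measurable_latticeFlux l
    refine (integrable_smul_of_bound hφ.continuous hφc (B := B'' + B'')
      (Measurable.aestronglyMeasurable (Measurable.sub (hm.comp (measurable_add_const _)) hm))
        fun z => ?_).smul h⁻¹
    exact (norm_sub_le _ _).trans (add_le_add (hB'' _ _ _) (hB'' _ _ _))
  have hint' : ∀ l, Integrable fun z : ℝ × Plane => (h⁻¹ * (φ (z + (0, h • basisVec l)) - φ z)) •
      latticeFlux h (u z.1) l z.2 := by
    intro l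
    have c1 : Continuous fun z => h⁻¹ * (φ (z + (0, h • basisVec l)) - φ z) := by
      have := hφ.continuous; fun_prop
    have c2 : HasCompactSupport fun z => h⁻¹ * (φ (z + (0, h • basisVec l)) - φ z) :=
      ((hφc.comp_homeomorph (Homeomorph.addRight ((0 : ℝ), h • basisVec l))).sub hφc).mul_left
    exact integrable_smul_of_bound c1 c2 (hu.measurable_latticeFlux l).aestronglyMeasurable
      fun z => hB'' _ _ _
  rw [integral_add i1 i2] at key
  rw [eq_neg_of_add_eq_zero_left key, ← integral_neg, integral_finsetSum _ fun l _ => hint' l]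
  have e : (fun z : ℝ × Plane => -(φ z • latticeVelocity h (u z.1) z.2)) = fun z => ∑ l, h⁻¹ • (φ z •
      (latticeFlux h (u (z + -(0, h • basisVec l)).1) l (z + -(0, h • basisVec l)).2 -
        latticeFlux h (u z.1) l z.2)) := by
    ext1 z
    simp only [latticeVelocity, smul_neg, neg_neg, Finset.smul_sum]
    refine Finset.sum_congr rfl fun l _ => ?_
    rw [smul_comm]
    simp
  rw [e, integral_finsetSum _ fun l _ => hint l]
  refine Finset.sum_congr rfl fun l _ => ?_
  rw [integral_smul, integral_smul_shift_sub (μ := (volume : Measure (ℝ × Plane)))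
    (f := fun z => latticeFlux h (u z.1) l z.2) hφ.continuous hφc
    (hu.measurable_latticeFlux l).stronglyMeasurable (fun z => hB'' _ _ _), ← integral_smul]
  simp only [sub_neg_eq_add, smul_smul]

end IsLatticeApprox

/-! ### Mollification -/

/-- A smooth bump function of radius `1 / (m + 1)` centred at the origin of the plane. -/
noncomputable def bump (m : ℕ) : ContDiffBump (0 : Plane) :=
  ⟨1 / (2 * (m + 1)), 1 / (m + 1), by positivity, by
    rw [div_lt_div_iff_of_pos_left one_pos (by positivity) (by positivity)]
    linarith [(Nat.cast_nonneg m : (0 : ℝ) ≤ m)]⟩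

/-- The standard mollifier of radius `1 / (m + 1)`. -/
noncomputable def rho (m : ℕ) : Plane → ℝ := (bump m).normed volume

theorem rho_nonneg (m : ℕ) (x : Plane) : 0 ≤ rho m x := (bump m).nonneg_normed x

theorem contDiff_rho (m : ℕ) : ContDiff ℝ ∞ (rho m) := (bump m).contDiff_normed

theorem continuous_rho (m : ℕ) : Continuous (rho m) := (bump m).continuous_normed

theorem hasCompactSupport_rho (m : ℕ) : HasCompactSupport (rho m) :=
  (bump m).hasCompactSupport_normed

theorem integral_rho (m : ℕ) : ∫ x, rho m x = 1 := (bump m).integral_normed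

theorem norm_lt_of_rho_ne_zero {m : ℕ} {x : Plane} (hx : rho m x ≠ 0) : ‖x‖ < 1 / (m + 1) := by
  have : x ∈ Function.support (rho m) := hx
  rw [rho, ContDiffBump.support_normed_eq] at this
  simpa [bump] using this

theorem norm_lt_one_of_rho_ne_zero {m : ℕ} {x : Plane} (hx : rho m x ≠ 0) : ‖x‖ < 1 := by
  refine (norm_lt_of_rho_ne_zero hx).trans_le ?_
  rw [div_le_one (by positivity)]
  linarith [(Nat.cast_nonneg m : (0 : ℝ) ≤ m)]

theorem lintegral_rho (m : ℕ) : ∫⁻ x, ENNReal.ofReal (rho m x) = 1 := by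
  rw [← ofReal_integral_eq_lintegral_ofReal
    ((continuous_rho m).integrable_of_hasCompactSupport (hasCompactSupport_rho m))
    (ae_of_all _ (rho_nonneg m)), integral_rho, ENNReal.ofReal_one]

theorem exists_rho_lipschitz (m : ℕ) : ∃ K : ℝ, 0 ≤ K ∧ ∀ x y, |rho m x - rho m y| ≤ K * ‖x - y‖ := by
  obtain ⟨K, hK⟩ := (contDiff_rho m).lipschitzWith_of_hasCompactSupport (hasCompactSupport_rho m)
    (by simp)
  refine ⟨K, K.2, fun x y => ?_⟩
  have := hK.dist_le_mul x y
  rwa [Real.dist_eq, dist_eq_norm] at this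

/-- The mollification of a function on the plane. -/
noncomputable def moll {F : Type*} [NormedAddCommGroup F] [NormedSpace ℝ F] (m : ℕ) (g : Plane → F)
    (x : Plane) : F := ∫ y, rho m (x - y) • g y

section moll

variable {F : Type*} [NormedAddCommGroup F] [NormedSpace ℝ F]

theorem hasCompactSupport_rho_sub (m : ℕ) (x : Plane) :
    HasCompactSupport fun y => rho m (x - y) :=
  (hasCompactSupport_rho m).comp_homeomorph (Homeomorph.subLeft x)

theorem integrable_rho_smul (m : ℕ) {g : Plane → F} (hg : LocallyIntegrable g) (x : Plane) :
    Integrable fun y => rho m (x - y) • g y :=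
  hg.integrable_smul_left_of_hasCompactSupport
    ((continuous_rho m).comp (by fun_prop)) (hasCompactSupport_rho_sub m x)

theorem moll_eq_convolution (m : ℕ) (g : Plane → F) :
    moll m g = MeasureTheory.convolution (rho m) g (ContinuousLinearMap.lsmul ℝ ℝ) volume := by
  ext x
  rw [convolution_eq_swap, moll]
  rfl

theorem integral_rho_sub (m : ℕ) (x : Plane) : ∫ y, rho m (x - y) = 1 := by
  rw [integral_sub_left_eq_self (rho m) volume x, integral_rho]

/-- Mollification changes a function in `L¹(K)` by at most the largest change under the
translations it averages over. -/
theorem lintegral_moll_sub_le [CompleteSpace F] (m : ℕ) {g : Plane → F} (hg : StronglyMeasurable g)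
    (hgl : LocallyIntegrable g) (K : Set Plane) {D : ENNReal}
    (hD : ∀ z : Plane, ‖z‖ < 1 / (m + 1) → ∫⁻ x in K, ‖g (x + z) - g x‖ₑ ≤ D) :
    ∫⁻ x in K, ‖moll m g x - g x‖ₑ ≤ D := by
  have h1 : ∀ x, moll m g x - g x = ∫ y, rho m (x - y) • (g y - g x) := by
    intro x
    have hi : Integrable fun y => rho m (x - y) • g x :=
      (((continuous_rho m).comp (by fun_prop)).integrable_of_hasCompactSupport
        (hasCompactSupport_rho_sub m x)).smul_const _
    simp only [smul_sub]
    rw [integral_sub (integrable_rho_smul m hgl x) hi, integral_smul_const, integral_rho_sub,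
      one_smul, moll]
  have h2 : ∀ x, ‖moll m g x - g x‖ₑ ≤ ∫⁻ z, ENNReal.ofReal (rho m z) * ‖g (x - z) - g x‖ₑ := by
    intro x
    rw [h1]
    refine (enorm_integral_le_lintegral_enorm _).trans (le_of_eq ?_)
    rw [← lintegral_sub_left_eq_self (fun z => ENNReal.ofReal (rho m z) * ‖g (x - z) - g x‖ₑ) x]
    refine lintegral_congr fun y => ?_
    rw [enorm_smul, sub_sub_cancel, Real.enorm_of_nonneg (rho_nonneg m _)]
  calc ∫⁻ x in K, ‖moll m g x - g x‖ₑ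
      ≤ ∫⁻ x in K, ∫⁻ z, ENNReal.ofReal (rho m z) * ‖g (x - z) - g x‖ₑ := lintegral_mono h2
    _ = ∫⁻ z, ∫⁻ x in K, ENNReal.ofReal (rho m z) * ‖g (x - z) - g x‖ₑ := by
        refine lintegral_lintegral_swap (Measurable.aemeasurable ?_)
        refine ((continuous_rho m).measurable.comp measurable_snd).ennreal_ofReal.mul ?_
        refine StronglyMeasurable.enorm ?_
        exact (hg.comp_measurable (measurable_fst.sub measurable_snd)).sub
          (hg.comp_measurable measurable_fst)
    _ ≤ ∫⁻ z, ENNReal.ofReal (rho m z) * D := by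
        refine lintegral_mono fun z => ?_
        rw [lintegral_const_mul' _ _ ENNReal.ofReal_ne_top]
        by_cases hz : rho m z = 0
        · simp [hz]
        · gcongr
          simp only [sub_eq_add_neg _ z]
          exact hD (-z) (by rw [norm_neg]; exact norm_lt_of_rho_ne_zero hz)
    _ = D := by
        rw [lintegral_mul_const _ (continuous_rho m).measurable.ennreal_ofReal, lintegral_rho,
          one_mul]

end moll

/-! ### Compactness -/

/-- Along an ultrafilter, an eventually equi-Lipschitz and pointwise bounded sequence is uniformly
Cauchy on totally bounded sets. -/
theorem exists_mem_ultrafilter_uniform_cauchy {X F : Type*} [PseudoMetricSpace X]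
    [NormedAddCommGroup F] [ProperSpace F] (𝓤 : Ultrafilter ℕ) {S : Set X} (hS : TotallyBounded S)
    (f : ℕ → X → F) (hb : ∀ p ∈ S, ∃ B, ∀ᶠ n in 𝓤, ‖f n p‖ ≤ B) {K : ℝ} (hK : 0 ≤ K)
    (hL : ∀ᶠ n in 𝓤, ∀ p ∈ S, ∀ q ∈ S, ‖f n p - f n q‖ ≤ K * dist p q) {ε : ℝ} (hε : 0 < ε) :
    ∃ A ∈ 𝓤, ∀ n ∈ A, ∀ n' ∈ A, ∀ p ∈ S, ‖f n p - f n' p‖ ≤ ε := by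
  -- pointwise limits exist along the ultrafilter, since bounded sets are relatively compact
  have hlim : ∀ p ∈ S, ∃ w, Tendsto (fun n => f n p) 𝓤 (𝓝 w) := by
    intro p hp
    obtain ⟨B, hB⟩ := hb p hp
    have hmem : Metric.closedBall (0 : F) B ∈ 𝓤.map fun n => f n p :=
      Ultrafilter.mem_map.2 (hB.mono fun n hn => by simpa using hn)
    obtain ⟨w, _, hw⟩ := (isCompact_closedBall (0 : F) B).ultrafilter_le_nhds
      (𝓤.map fun n => f n p) (le_principal_iff.2 hmem)
    exact ⟨w, hw⟩
  choose! w hw using hlim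
  -- a finite net on which the sequence is close to its limit determines it everywhere up to `ε`
  obtain ⟨t, htS, htf, hcov⟩ := totallyBounded_iff_subset.1 hS _
    (Metric.dist_mem_uniformity (show 0 < ε / (4 * (K + 1)) by positivity))
  have hnet : ∀ᶠ n in 𝓤, ∀ p ∈ t, ‖f n p - w p‖ ≤ ε / 4 := by
    rw [Filter.eventually_all_finite htf]
    intro p hp
    have := (hw p (htS hp)).eventually (Metric.closedBall_mem_nhds (w p) (show 0 < ε / 4 by positivity))
    filter_upwards [this] with n hn
    simpa [dist_eq_norm] using hn
  refine ⟨_, hL.and hnet, fun n hn n' hn' p hp => ?_⟩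
  obtain ⟨q, hq, hpq⟩ := Set.mem_iUnion₂.1 (hcov hp)
  have hpq' : K * dist p q ≤ ε / 4 := by
    have : dist p q < ε / (4 * (K + 1)) := hpq
    rw [lt_div_iff₀ (by positivity)] at this
    nlinarith [dist_nonneg (x := p) (y := q)]
  have e : f n p - f n' p = (f n p - f n q) + (f n q - w q) - (f n' q - w q) - (f n' p - f n' q) := by
    abel
  rw [e]
  have b1 := (hn.1 p hp q (htS hq)).trans hpq'
  have b2 := hn.2 q hq
  have b3 := (hn'.1 p hp q (htS hq)).trans hpq'
  have b4 := hn'.2 q hq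
  calc _ ≤ ‖f n p - f n q‖ + ‖f n q - w q‖ + ‖f n' q - w q‖ + ‖f n' p - f n' q‖ :=
        (norm_sub_le _ _).trans (add_le_add_left ((norm_sub_le _ _).trans
          (add_le_add_left (norm_add_le _ _) _)) _)
    _ ≤ ε := by linarith

namespace IsLatticeApprox

variable {E C h T : ℝ} {u : ℝ → Plane → Lor}

theorem locallyIntegrable_slice (hu : IsLatticeApprox E C h T u) (t : ℝ) :
    LocallyIntegrable (u t) := by
  obtain ⟨B, hB⟩ := hu.bounded
  exact (locallyIntegrable_const B).mono (hu.measurable_slice t).aestronglyMeasurable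
    (ae_of_all _ fun x => (hB t x).trans (le_abs_self _))

theorem lintegral_enorm_le (hu : IsLatticeApprox E C h T u) (hC : 0 ≤ C) {v : ℝ} (hv : 0 ≤ v)
    {K : Set Plane} (hK : volume K ≤ ENNReal.ofReal v) (t : ℝ) :
    ∫⁻ x in K, ‖u t x‖ₑ ≤ ENNReal.ofReal (v + C) := by
  calc ∫⁻ x in K, ‖u t x‖ₑ ≤ ∫⁻ x in K, (1 + ENNReal.ofReal (momentDensity (u t x))) := by
        refine lintegral_mono fun x => ?_
        rw [← ofReal_norm, ← ENNReal.ofReal_one, ← ENNReal.ofReal_add zero_le_one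
          (momentDensity_nonneg (hu.mem t x))]
        refine ENNReal.ofReal_le_ofReal ((norm_le_of_mem (hu.mem t x)).trans ?_)
        have : 0 ≤ u t x 0 - 1 := by linarith [one_le_of_mem (hu.mem t x)]
        unfold momentDensity
        linarith [pow_nonneg this 8]
    _ = volume K + ∫⁻ x in K, ENNReal.ofReal (momentDensity (u t x)) := by
        rw [lintegral_add_left measurable_const, lintegral_const, one_mul,
          Measure.restrict_apply_univ]
    _ ≤ ENNReal.ofReal v + ENNReal.ofReal C :=
        add_le_add hK ((setLIntegral_le_lintegral _ _).trans (hu.moment t))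
    _ = _ := (ENNReal.ofReal_add hv hC).symm

theorem lintegral_moll_sub (hu : IsLatticeApprox E C h T u) (hC : 0 ≤ C) (hE : 0 ≤ E)
    {v : ℝ} (hv : 0 ≤ v) {K : Set Plane} (hK : volume K ≤ ENNReal.ofReal v) (t : ℝ) (m : ℕ) :
    ∫⁻ x in K, ‖moll m (u t) x - u t x‖ₑ ≤
      ENNReal.ofReal (2 * (1 / (m + 1) + h) * (128 * v + 400 * C + 4 * E)) := by
  refine lintegral_moll_sub_le m (hu.measurable_slice t).stronglyMeasurable
    (hu.locallyIntegrable_slice t) K fun z hz => ?_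
  refine (hu.lintegral_translate_le hC hE hv hK t z).trans (ENNReal.ofReal_le_ofReal ?_)
  gcongr

/-- The volume of the unit disc. -/
noncomputable def discVolume : ℝ := (volume (Metric.ball (0 : Plane) 1)).toReal

theorem volume_ball_one (x : Plane) :
    volume (Metric.ball x 1) = ENNReal.ofReal discVolume := by
  rw [discVolume, ENNReal.ofReal_toReal measure_ball_lt_top.ne, Measure.addHaar_ball_center]

theorem discVolume_nonneg : 0 ≤ discVolume := ENNReal.toReal_nonneg

/-- The mollified approximations are equi-Lipschitz in time. -/
theorem norm_moll_sub_time_le (hu : IsLatticeApprox E C h T u) (hC : 0 ≤ C) (hE : 0 ≤ E) {m : ℕ}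
    {L : ℝ} (hL0 : 0 ≤ L) (hL : ∀ x y, |rho m x - rho m y| ≤ L * ‖x - y‖) {x : Plane}
    (hx : ‖x‖ + 1 ≤ T) {s t : ℝ} (hs : s ∈ Set.Ioo (-T) T) (ht : t ∈ Set.Ioo (-T) T) :
    ‖moll m (u t) x - moll m (u s) x‖ ≤
      2 * L * (128 * (2 * discVolume) + 400 * C + 4 * E) * |t - s| := by
  have hd := discVolume_nonneg
  have hcomp : ∀ t j, moll m (u t) x j = ∫ y, rho m (x - y) * u t y j := by
    intro t j
    have := (ContinuousLinearMap.proj (R := ℝ) (φ := fun _ : Fin 3 => ℝ) j).integral_comp_comm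
      (integrable_rho_smul m (hu.locallyIntegrable_slice t) x)
    exact this.symm
  refine (pi_norm_le_iff_of_nonneg (by positivity)).2 fun j => ?_
  rw [Pi.sub_apply, hcomp, hcomp, Real.norm_eq_abs]
  refine hu.abs_integral_sub_le hC hE (φ := fun y => rho m (x - y))
    ((continuous_rho m).comp (by fun_prop)) (hasCompactSupport_rho_sub m x) (fun y hy => ?_) hL0
    (fun y y' => ?_) (by norm_num) hd (Or.inr ?_) j (fun t l y => ?_) hs ht
  · have := norm_lt_one_of_rho_ne_zero hy
    have h2 : ‖y‖ ≤ ‖x‖ + ‖x - y‖ := by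
      calc ‖y‖ = ‖x - (x - y)‖ := by rw [sub_sub_cancel]
        _ ≤ _ := norm_sub_le _ _
    linarith
  · refine (hL _ _).trans (le_of_eq ?_)
    rw [sub_sub_sub_cancel_left, norm_sub_rev]
  · rw [← volume_ball_one x]
    refine measure_mono fun y hy => ?_
    rw [Metric.mem_ball, dist_eq_norm, norm_sub_rev]
    exact norm_lt_one_of_rho_ne_zero hy
  · exact (norm_le_pi_norm (latticeFlux h (u t) l y) j).trans
      (norm_flux_le_fluxDensity hu.mesh_pos (hu.mem _ _) (hu.mem _ _))

theorem norm_integral_smul_le (hu : IsLatticeApprox E C h T u) (hC : 0 ≤ C) {v : ℝ} (hv : 0 ≤ v)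
    {K : Set Plane} (hKm : MeasurableSet K) (hK : volume K ≤ ENNReal.ofReal v) (t : ℝ)
    {φ : Plane → ℝ} {b : ℝ} (hb0 : 0 ≤ b) (hb : ∀ y, |φ y| ≤ b) (hφ : ∀ y ∉ K, φ y = 0) :
    ‖∫ y, φ y • u t y‖ ≤ b * (v + C) := by
  rw [← ENNReal.ofReal_le_ofReal_iff (by positivity), ofReal_norm]
  calc ‖∫ y, φ y • u t y‖ₑ ≤ ∫⁻ y, ‖φ y • u t y‖ₑ := enorm_integral_le_lintegral_enorm _
    _ = ∫⁻ y in K, ‖φ y • u t y‖ₑ := by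
        rw [← lintegral_indicator hKm]
        refine lintegral_congr fun y => ?_
        by_cases hy : y ∈ K
        · simp [hy]
        · simp [hy, hφ y hy]
    _ ≤ ∫⁻ y in K, ENNReal.ofReal b * ‖u t y‖ₑ := by
        refine lintegral_mono fun y => ?_
        rw [enorm_smul, ← ofReal_norm (φ y)]
        gcongr
        exact hb y
    _ = ENNReal.ofReal b * ∫⁻ y in K, ‖u t y‖ₑ := lintegral_const_mul' _ _ ENNReal.ofReal_ne_top
    _ ≤ _ := by
        rw [ENNReal.ofReal_mul hb0]
        gcongr
        exact hu.lintegral_enorm_le hC hv hK t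

/-- The mollified approximations are equi-Lipschitz in space. -/
theorem norm_moll_sub_space_le (hu : IsLatticeApprox E C h T u) (hC : 0 ≤ C) {m : ℕ}
    {L : ℝ} (hL0 : 0 ≤ L) (hL : ∀ x y, |rho m x - rho m y| ≤ L * ‖x - y‖) (x y : Plane) (t : ℝ) :
    ‖moll m (u t) x - moll m (u t) y‖ ≤ L * (2 * discVolume + C) * ‖x - y‖ := by
  have hd := discVolume_nonneg
  have hl := hu.locallyIntegrable_slice t
  rw [moll, moll, ← integral_sub (integrable_rho_smul m hl x) (integrable_rho_smul m hl y)]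
  simp only [← sub_smul]
  refine (hu.norm_integral_smul_le hC (v := 2 * discVolume) (by positivity)
    (K := Metric.ball x 1 ∪ Metric.ball y 1) (Metric.isOpen_ball.union Metric.isOpen_ball).measurableSet
    ((measure_union_le _ _).trans ?_) t (b := L * ‖x - y‖) (by positivity) (fun z => ?_)
    fun z hz => ?_).trans (le_of_eq (by ring))
  · rw [volume_ball_one, volume_ball_one, ← ENNReal.ofReal_add hd hd, two_mul]
  · refine (hL _ _).trans (le_of_eq ?_)
    rw [sub_sub_sub_cancel_right]
  · have h1 : ∀ w, z ∉ Metric.ball w 1 → rho m (w - z) = 0 := by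
      intro w hw
      by_contra hc
      exact hw (by rw [Metric.mem_ball, dist_eq_norm, norm_sub_rev]; exact norm_lt_one_of_rho_ne_zero hc)
    simp only [Set.mem_union, not_or] at hz
    rw [h1 x hz.1, h1 y hz.2, sub_zero]

theorem exists_norm_moll_le (m : ℕ) (hC : 0 ≤ C) : ∃ B, ∀ h T u, IsLatticeApprox E C h T u →
    ∀ t x, ‖moll m (u t) x‖ ≤ B := by
  obtain ⟨b, hb⟩ := (hasCompactSupport_rho m).exists_bound_of_continuous (continuous_rho m)
  have hb0 : 0 ≤ b := (norm_nonneg _).trans (hb 0)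
  refine ⟨b * (discVolume + C), fun h T u hu t x => ?_⟩
  refine hu.norm_integral_smul_le hC discVolume_nonneg (K := Metric.ball x 1)
    measurableSet_ball (volume_ball_one x).le t hb0 (fun y => hb _) fun z hz => ?_
  by_contra hc
  exact hz (by rw [Metric.mem_ball, dist_eq_norm, norm_sub_rev]; exact norm_lt_one_of_rho_ne_zero hc)

end IsLatticeApprox

theorem contDiff_moll {F : Type*} [NormedAddCommGroup F] [NormedSpace ℝ F] [CompleteSpace F]
    (m : ℕ) {g : Plane → F} (hg : LocallyIntegrable g) : ContDiff ℝ ∞ (moll m g) := by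
  rw [moll_eq_convolution]
  exact (hasCompactSupport_rho m).contDiff_convolution_left _ (contDiff_rho m) hg

/-- Comparison of two functions in `L¹(K)` by means of their mollifications. -/
theorem lintegral_sub_le_of_moll {f g : Plane → Lor} (hf : Measurable f)
    (hg : Measurable g) (hfl : LocallyIntegrable f) (hgl : LocallyIntegrable g) {K : Set Plane}
    (hKm : MeasurableSet K) {m : ℕ} {v a b ε : ℝ} (hv : 0 ≤ v) (ha0 : 0 ≤ a) (hb0 : 0 ≤ b)
    (hε : 0 ≤ ε) (hK : volume K ≤ ENNReal.ofReal v)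
    (ha : ∫⁻ x in K, ‖moll m f x - f x‖ₑ ≤ ENNReal.ofReal a)
    (hb : ∫⁻ x in K, ‖moll m g x - g x‖ₑ ≤ ENNReal.ofReal b)
    (h : ∀ x ∈ K, ‖moll m f x - moll m g x‖ ≤ ε) :
    ∫⁻ x in K, ‖f x - g x‖ₑ ≤ ENNReal.ofReal (a + b + v * ε) := by
  have hmf : Measurable (moll m f) := (contDiff_moll m hfl).continuous.measurable
  have hmg : Measurable (moll m g) := (contDiff_moll m hgl).continuous.measurable
  calc ∫⁻ x in K, ‖f x - g x‖ₑ
      ≤ ∫⁻ x in K, (‖moll m f x - f x‖ₑ + (‖moll m g x - g x‖ₑ + ENNReal.ofReal ε)) := by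
        refine setLIntegral_mono' hKm fun x hx => ?_
        have e : f x - g x = -(moll m f x - f x) + ((moll m g x - g x) + (moll m f x - moll m g x)) := by
          abel
        rw [e]
        refine (enorm_add_le _ _).trans (add_le_add (enorm_neg _).le
          ((enorm_add_le _ _).trans (add_le_add le_rfl ?_)))
        rw [← ofReal_norm]
        exact ENNReal.ofReal_le_ofReal (h x hx)
    _ = (∫⁻ x in K, ‖moll m f x - f x‖ₑ) + ((∫⁻ x in K, ‖moll m g x - g x‖ₑ) +
          ENNReal.ofReal ε * volume K) := by
        rw [lintegral_add_left (by fun_prop), lintegral_add_left (by fun_prop), lintegral_const,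
          Measure.restrict_apply_univ]
    _ ≤ ENNReal.ofReal a + (ENNReal.ofReal b + ENNReal.ofReal ε * ENNReal.ofReal v) := by gcongr
    _ = _ := by
        rw [← ENNReal.ofReal_mul hε, ← ENNReal.ofReal_add hb0 (by positivity),
          ← ENNReal.ofReal_add ha0 (by positivity)]
        congr 1; ring

section Sequence

variable {E C : ℝ} {h : ℕ → ℝ} {u : ℕ → ℝ → Plane → Lor}

/-- The mollifier and the mesh can be chosen so fine that the mollification error is small. -/
theorem exists_nat_forall_mul_mollError_le {P δ : ℝ} (hP : 0 ≤ P) (hδ : 0 < δ)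
    (hh : ∀ n, h n ≤ (1 / 2) ^ n) :
    ∃ m n₀ : ℕ, ∀ n ≥ n₀, 2 * (1 / ((m : ℝ) + 1) + h n) * P ≤ δ := by
  obtain ⟨m, hm⟩ := exists_nat_one_div_lt (show 0 < δ / (4 * (P + 1)) by positivity)
  obtain ⟨n₀, hn₀⟩ := exists_pow_lt_of_lt_one (show 0 < δ / (4 * (P + 1)) by positivity)
    (show (1 / 2 : ℝ) < 1 by norm_num)
  refine ⟨m, n₀, fun n hn => ?_⟩
  have h1 : h n ≤ δ / (4 * (P + 1)) :=
    ((hh n).trans (pow_le_pow_of_le_one (by norm_num) (by norm_num) hn)).trans hn₀.le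
  calc 2 * (1 / ((m : ℝ) + 1) + h n) * P
      ≤ 2 * (δ / (4 * (P + 1)) + δ / (4 * (P + 1))) * (P + 1) := by
        gcongr; linarith
    _ = δ := by field_simp; ring

theorem exists_volume_le (k : ℝ) :
    ∃ v : ℝ, 0 ≤ v ∧ volume (Metric.ball (0 : Plane) k) ≤ ENNReal.ofReal v :=
  ⟨_, ENNReal.toReal_nonneg, (ENNReal.ofReal_toReal measure_ball_lt_top.ne).ge⟩

/-- Equicontinuity in time of the approximations, with values in `L¹` of a ball. -/
theorem exists_time_modulus (hC : 0 ≤ C) (hE : 0 ≤ E)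
    (hu : ∀ n, IsLatticeApprox E C (h n) (n + 1) (u n)) (hh : ∀ n, h n ≤ (1 / 2) ^ n) (k : ℕ)
    {δ : ℝ} (hδ : 0 < δ) : ∃ η > 0, ∃ n₀, ∀ n ≥ n₀, ∀ s ∈ Set.Icc (-(k : ℝ)) k,
      ∀ t ∈ Set.Icc (-(k : ℝ)) k, |t - s| ≤ η →
        ∫⁻ x in Metric.ball 0 k, ‖u n t x - u n s x‖ₑ ≤ ENNReal.ofReal δ := by
  obtain ⟨v, hv, hvol⟩ := exists_volume_le k
  set P := 128 * v + 400 * C + 4 * E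
  obtain ⟨m, n₁, hm⟩ := exists_nat_forall_mul_mollError_le (P := P) (by positivity)
    (show 0 < δ / 3 by positivity) hh
  obtain ⟨L, hL0, hL⟩ := exists_rho_lipschitz m
  have hd := IsLatticeApprox.discVolume_nonneg
  set Q := 2 * L * (128 * (2 * IsLatticeApprox.discVolume) + 400 * C + 4 * E)
  have hQ : 0 ≤ Q := by positivity
  refine ⟨δ / (3 * (v * Q + 1)), by positivity, max n₁ (k + 1), fun n hn s hs t ht hst => ?_⟩
  have hn1 : n₁ ≤ n := (le_max_left _ _).trans hn
  have hn2 : (k : ℝ) + 1 ≤ n := by exact_mod_cast (le_max_right _ _).trans hn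
  have hP : 0 ≤ P := by positivity
  have hhn := (hu n).mesh_pos
  -- compare with the mollifications, which are Lipschitz continuous in time
  have key := lintegral_sub_le_of_moll ((hu n).measurable_slice t) ((hu n).measurable_slice s)
    ((hu n).locallyIntegrable_slice t) ((hu n).locallyIntegrable_slice s)
    (measurableSet_ball (x := (0 : Plane)) (ε := (k : ℝ))) (m := m) hv (by positivity) (by positivity)
    (ε := Q * |t - s|) (by positivity) hvol ((hu n).lintegral_moll_sub hC hE hv hvol t m)
    ((hu n).lintegral_moll_sub hC hE hv hvol s m) (fun x hx => ?_)
  · refine key.trans (ENNReal.ofReal_le_ofReal ?_)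
    have h1 := hm n hn1
    have h2 : v * (Q * |t - s|) ≤ δ / 3 := by
      calc v * (Q * |t - s|) ≤ (v * Q + 1) * (δ / (3 * (v * Q + 1))) := by
            rw [← mul_assoc]; gcongr; linarith
        _ = δ / 3 := by field_simp
    linarith
  · refine (hu n).norm_moll_sub_time_le hC hE hL0 hL ?_ ⟨by linarith [hs.1], by linarith [hs.2]⟩
      ⟨by linarith [ht.1], by linarith [ht.2]⟩
    rw [mem_ball_zero_iff] at hx
    linarith

/-- Along an ultrafilter the approximations are Cauchy in `L¹` of a ball, uniformly for times in a
compact interval: the mollifications are equi-Lipschitz in space-time, and the mollification error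
is uniformly small. -/
theorem exists_mem_ultrafilter_cauchy (hC : 0 ≤ C) (hE : 0 ≤ E)
    (hu : ∀ n, IsLatticeApprox E C (h n) (n + 1) (u n)) (hh : ∀ n, h n ≤ (1 / 2) ^ n)
    {𝓤 : Ultrafilter ℕ} (h𝓤 : (𝓤 : Filter ℕ) ≤ atTop) (k : ℕ) {δ : ℝ} (hδ : 0 < δ) :
    ∃ A ∈ 𝓤, ∀ n ∈ A, ∀ n' ∈ A, ∀ t ∈ Set.Icc (-(k : ℝ)) k,
      ∫⁻ x in Metric.ball 0 k, ‖u n t x - u n' t x‖ₑ ≤ ENNReal.ofReal δ := by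
  obtain ⟨v, hv, hvol⟩ := exists_volume_le k
  set P := 128 * v + 400 * C + 4 * E
  have hP : 0 ≤ P := by positivity
  obtain ⟨m, n₁, hm⟩ := exists_nat_forall_mul_mollError_le (P := P) hP
    (show 0 < δ / 3 by positivity) hh
  obtain ⟨L, hL0, hL⟩ := exists_rho_lipschitz m
  have hd := IsLatticeApprox.discVolume_nonneg
  set Q := 2 * L * (128 * (2 * IsLatticeApprox.discVolume) + 400 * C + 4 * E)
  have hQ : 0 ≤ Q := by positivity
  set Q' := L * (2 * IsLatticeApprox.discVolume + C)
  have hQ' : 0 ≤ Q' := by positivity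
  obtain ⟨B, hB⟩ := IsLatticeApprox.exists_norm_moll_le (E := E) m hC
  -- the mollifications are equi-Lipschitz once the region where the flow holds contains the supports
  have hlip : ∀ᶠ n in (𝓤 : Filter ℕ), ∀ p ∈ Set.Icc (-(k : ℝ)) k ×ˢ Metric.ball (0 : Plane) k,
      ∀ q ∈ Set.Icc (-(k : ℝ)) k ×ˢ Metric.ball (0 : Plane) k,
      ‖moll m (u n p.1) p.2 - moll m (u n q.1) q.2‖ ≤ (Q + Q') * dist p q := by
    filter_upwards [h𝓤 (eventually_ge_atTop (k + 1))] with n hn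
    rintro ⟨t, x⟩ ⟨ht, hx⟩ ⟨s, y⟩ ⟨hs, hy⟩
    have hn2 : (k : ℝ) + 1 ≤ n := by exact_mod_cast hn
    simp only [Set.mem_Icc, mem_ball_zero_iff] at ht hx hs hy
    have b1 := (hu n).norm_moll_sub_time_le hC hE hL0 hL (x := x) (by linarith) (s := s) (t := t)
      ⟨by linarith [hs.1], by linarith [hs.2]⟩ ⟨by linarith [ht.1], by linarith [ht.2]⟩
    have b2 := (hu n).norm_moll_sub_space_le hC hL0 hL x y s
    have d1 : |t - s| ≤ dist (t, x) (s, y) := le_max_left (dist t s) (dist x y)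
    have d2 : ‖x - y‖ ≤ dist (t, x) (s, y) := by
      rw [← dist_eq_norm]; exact le_max_right (dist t s) (dist x y)
    calc ‖moll m (u n t) x - moll m (u n s) y‖
        ≤ ‖moll m (u n t) x - moll m (u n s) x‖ + ‖moll m (u n s) x - moll m (u n s) y‖ :=
          norm_sub_le_norm_sub_add_norm_sub _ _ _
      _ ≤ Q * dist (t, x) (s, y) + Q' * dist (t, x) (s, y) :=
          add_le_add (b1.trans (by gcongr)) (b2.trans (by gcongr))
      _ = _ := by ring
  obtain ⟨A, hA, hA'⟩ := exists_mem_ultrafilter_uniform_cauchy 𝓤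
    (S := Set.Icc (-(k : ℝ)) k ×ˢ Metric.ball (0 : Plane) k)
    ((isCompact_Icc.prod (isCompact_closedBall _ _)).totallyBounded.subset
      (Set.prod_mono_right Metric.ball_subset_closedBall))
    (fun n p => moll m (u n p.1) p.2)
    (fun p _ => ⟨B, Eventually.of_forall fun n => hB _ _ _ (hu n) _ _⟩) (K := Q + Q')
    (by positivity) hlip (show 0 < δ / (3 * (v + 1)) by positivity)
  refine ⟨A ∩ {n | n₁ ≤ n}, 𝓤.inter_mem hA (h𝓤 (eventually_ge_atTop n₁)),
    fun n hn n' hn' t ht => ?_⟩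
  have hhn := (hu n).mesh_pos
  have hhn' := (hu n').mesh_pos
  have key := lintegral_sub_le_of_moll ((hu n).measurable_slice t) ((hu n').measurable_slice t)
    ((hu n).locallyIntegrable_slice t) ((hu n').locallyIntegrable_slice t)
    (measurableSet_ball (x := (0 : Plane)) (ε := (k : ℝ))) (m := m) hv (by positivity)
    (by positivity) (ε := δ / (3 * (v + 1))) (by positivity) hvol
    ((hu n).lintegral_moll_sub hC hE hv hvol t m) ((hu n').lintegral_moll_sub hC hE hv hvol t m)
    (fun x hx => hA' n hn.1 n' hn'.1 (t, x) ⟨ht, hx⟩)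
  refine key.trans (ENNReal.ofReal_le_ofReal ?_)
  have h1 := hm n hn.2
  have h1' := hm n' hn'.2
  have h2 : v * (δ / (3 * (v + 1))) ≤ δ / 3 := by
    calc v * (δ / (3 * (v + 1))) ≤ (v + 1) * (δ / (3 * (v + 1))) := by gcongr; linarith
      _ = δ / 3 := by field_simp
  linarith

/-- If the increments of a sequence are summable in `L¹` of every ball, then it converges almost
everywhere. -/
theorem ae_exists_tendsto_of_increments {f : ℕ → Plane → Lor} (hf : ∀ n, Measurable (f n)) {k₀ : ℕ}
    (h : ∀ k ≥ k₀, ∫⁻ x in Metric.ball 0 (k : ℝ), ‖f (k + 1) x - f k x‖ₑ ≤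
      ENNReal.ofReal ((1 / 2) ^ k)) : ∀ᵐ x, ∃ w, Tendsto (fun n => f n x) atTop (𝓝 w) := by
  have hball : ∀ R : ℕ, ∀ᵐ x ∂(volume.restrict (Metric.ball (0 : Plane) R)),
      ∃ w, Tendsto (fun n => f n x) atTop (𝓝 w) := by
    intro R
    set k₁ := max k₀ R
    have hsum : ∫⁻ x in Metric.ball 0 (R : ℝ), ∑' k, ‖f (k + k₁ + 1) x - f (k + k₁) x‖ₑ ≠ ⊤ := by
      rw [lintegral_tsum fun k => by fun_prop]
      refine ne_top_of_le_ne_top (b := ∑' k : ℕ, ENNReal.ofReal ((1 / 2) ^ k)) ?_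
        (ENNReal.tsum_le_tsum fun k => ?_)
      · exact Summable.tsum_ofReal_ne_top summable_geometric_two
      · refine (lintegral_mono_set (Metric.ball_subset_ball ?_)).trans
          ((h (k + k₁) ((le_max_left k₀ R).trans (Nat.le_add_left _ _))).trans
          (ENNReal.ofReal_le_ofReal (pow_le_pow_of_le_one (by norm_num) (by norm_num)
            (Nat.le_add_right _ _))))
        exact_mod_cast (le_max_right k₀ R).trans (Nat.le_add_left _ _)
    filter_upwards [ae_lt_top (Measurable.tsum fun k => by fun_prop) hsum] with x hx
    have hc : CauchySeq fun k => f (k + k₁) x := by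
      refine cauchySeq_of_edist_le_of_tsum_ne_top _ (fun k => ?_) hx.ne
      rw [edist_comm, edist_eq_enorm_sub, show k.succ + k₁ = k + k₁ + 1 by omega]
    obtain ⟨w, hw⟩ := cauchySeq_tendsto_of_complete hc
    exact ⟨w, (tendsto_add_atTop_iff_nat k₁).1 hw⟩
  have hun : (⋃ R : ℕ, Metric.ball (0 : Plane) R) = Set.univ := Metric.iUnion_ball_nat 0
  rw [← Measure.restrict_univ (μ := (volume : Measure Plane)), ← hun, ae_restrict_iUnion_iff]
  exact hball

/-- Almost everywhere convergence from geometric bounds in `L¹` of every ball. -/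
theorem ae_tendsto_zero_of_summable {f : ℕ → Plane → Lor} (hf : ∀ n, Measurable (f n))
    (h : ∀ R : ℕ, ∃ B : ℝ, ∀ n, ∫⁻ x in Metric.ball 0 (R : ℝ), ‖f n x‖ₑ ≤
      ENNReal.ofReal ((1 / 2) ^ n * B)) : ∀ᵐ x, Tendsto (fun n => f n x) atTop (𝓝 0) := by
  have hball : ∀ R : ℕ, ∀ᵐ x ∂(volume.restrict (Metric.ball (0 : Plane) R)),
      Tendsto (fun n => f n x) atTop (𝓝 0) := by
    intro R
    obtain ⟨B, hB⟩ := h R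
    have hsum : ∫⁻ x in Metric.ball 0 (R : ℝ), ∑' k, ‖f k x‖ₑ ≠ ⊤ := by
      rw [lintegral_tsum fun k => by fun_prop]
      refine ne_top_of_le_ne_top (b := ∑' k : ℕ, ENNReal.ofReal ((1 / 2) ^ k * B)) ?_
        (ENNReal.tsum_le_tsum fun k => hB k)
      exact Summable.tsum_ofReal_ne_top (summable_geometric_two.mul_right B)
    filter_upwards [ae_lt_top (Measurable.tsum fun k => by fun_prop) hsum] with x hx
    have := ENNReal.tendsto_atTop_zero_of_tsum_ne_top hx.ne
    exact tendsto_zero_iff_enorm_tendsto_zero.2 this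
  have hun : (⋃ R : ℕ, Metric.ball (0 : Plane) R) = Set.univ := Metric.iUnion_ball_nat 0
  rw [← Measure.restrict_univ (μ := (volume : Measure Plane)), ← hun, ae_restrict_iUnion_iff]
  exact hball

/-- Compactness of a sequence of lattice approximations: a subsequence converges at every time
almost everywhere in space, also after a shift by the mesh, and the limit is continuous in time with
values in `L¹_loc`. -/
theorem exists_subseq_tendsto (hC : 0 ≤ C) (hE : 0 ≤ E)
    (hu : ∀ n, IsLatticeApprox E C (h n) (n + 1) (u n)) (hh : ∀ n, h n ≤ (1 / 2) ^ n) :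
    ∃ (σ : ℕ → ℕ) (U : ℝ → Plane → Lor), StrictMono σ ∧
      (Measurable fun z : ℝ × Plane => U z.1 z.2) ∧
      (∀ t, ∀ᵐ x, Tendsto (fun n => u (σ n) t x) atTop (𝓝 (U t x))) ∧
      (∀ t l, ∀ᵐ x, Tendsto (fun n => u (σ n) t (x + h (σ n) • basisVec l)) atTop (𝓝 (U t x))) ∧
      (∀ (k : ℕ) (δ : ℝ), 0 < δ → ∃ η > 0, ∀ s ∈ Set.Icc (-(k : ℝ)) k, ∀ t ∈ Set.Icc (-(k : ℝ)) k,
        |t - s| ≤ η → ∫⁻ x in Metric.ball 0 (k : ℝ), ‖U t x - U s x‖ₑ ≤ ENNReal.ofReal δ) := by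
  have h𝓤 : (hyperfilter ℕ : Filter ℕ) ≤ atTop := Nat.hyperfilter_le_atTop
  -- The diagonal sequence: all pairs of indices in `A k` are `2⁻ᵏ`-close on `[-k, k] × B(0, k)`, and
  -- `σ k` is taken in `A 0 ∩ … ∩ A k`, so that `σ k` and `σ (k + 1)` both lie in `A k`.
  choose A hA hA' using fun k : ℕ => exists_mem_ultrafilter_cauchy hC hE hu hh h𝓤 k
    (show (0 : ℝ) < (1 / 2) ^ k by positivity)
  have hfreq : ∀ k, ∃ᶠ n in atTop, ∀ i ≤ k, n ∈ A i := by
    intro k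
    have : ∀ᶠ n in (hyperfilter ℕ : Filter ℕ), ∀ i ∈ Set.Iic k, n ∈ A i :=
      (Filter.eventually_all_finite (Set.finite_Iic k)).2 fun i _ => hA i
    exact this.frequently.filter_mono h𝓤
  obtain ⟨σ, hσ, hσA⟩ := extraction_forall_of_frequently hfreq
  have hm : ∀ n t, Measurable (u n t) := fun n t => (hu n).measurable_slice t
  -- `limUnder` may take a meaningless value only on a null set of every time slice
  set U : ℝ → Plane → Lor := fun t x => limUnder atTop fun n => u (σ n) t x
  have hUm : Measurable fun z : ℝ × Plane => U z.1 z.2 :=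
    (StronglyMeasurable.limUnder fun n => (hu (σ n)).measurable.stronglyMeasurable).measurable
  have hlim : ∀ t, ∀ᵐ x, Tendsto (fun n => u (σ n) t x) atTop (𝓝 (U t x)) := by
    intro t
    obtain ⟨k₀, hk₀⟩ := exists_nat_ge |t|
    have := ae_exists_tendsto_of_increments (f := fun n => u (σ n) t) (fun n => hm _ t) (k₀ := k₀)
      fun k hk => hA' k (σ (k + 1)) (hσA (k + 1) k (Nat.le_succ k)) (σ k) (hσA k k le_rfl) t
        (abs_le.1 (hk₀.trans (by exact_mod_cast hk)))
    filter_upwards [this] with x ⟨w, hw⟩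
    simp only [U]
    rwa [hw.limUnder_eq]
  refine ⟨σ, U, hσ, hUm, hlim, fun t l => ?_, fun k δ hδ => ?_⟩
  · have := ae_tendsto_zero_of_summable
      (f := fun n x => u (σ n) t (x + h (σ n) • basisVec l) - u (σ n) t x) (fun n => by
        have := hm (σ n) t; fun_prop) fun R => by
      obtain ⟨v, hv, hvol⟩ := exists_volume_le R
      refine ⟨128 * v + 400 * C + 4 * E, fun n => ?_⟩
      have := (hu (σ n)).lintegral_step_le hC hE hv hvol t l 0
      simp only [add_zero] at this
      refine this.trans (ENNReal.ofReal_le_ofReal ?_)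
      gcongr
      exact (hh _).trans (pow_le_pow_of_le_one (by norm_num) (by norm_num) (hσ.id_le n))
    filter_upwards [this, hlim t] with x h1 h2
    simpa using h1.add h2
  -- the modulus passes to the limit by the lemma of Fatou
  · obtain ⟨η, hη, n₀, hn₀⟩ := exists_time_modulus hC hE hu hh k hδ
    refine ⟨η, hη, fun s hs t ht hst => ?_⟩
    calc ∫⁻ x in Metric.ball 0 (k : ℝ), ‖U t x - U s x‖ₑ
        ≤ ∫⁻ x in Metric.ball 0 (k : ℝ), liminf (fun n => ‖u (σ n) t x - u (σ n) s x‖ₑ) atTop := by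
          refine lintegral_mono_ae (ae_restrict_of_ae ?_)
          filter_upwards [hlim t, hlim s] with x h1 h2
          exact ((h1.sub h2).enorm.liminf_eq).ge
      _ ≤ liminf (fun n => ∫⁻ x in Metric.ball 0 (k : ℝ), ‖u (σ n) t x - u (σ n) s x‖ₑ) atTop :=
          lintegral_liminf_le fun n => by
            have := hm (σ n) t; have := hm (σ n) s; fun_prop
      _ ≤ ENNReal.ofReal δ := by
          refine liminf_le_of_frequently_le' (Eventually.frequently ?_)
          filter_upwards [eventually_ge_atTop n₀] with n hn
          exact hn₀ (σ n) (hn.trans (hσ.id_le n)) s hs t ht hst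

end Sequence

/-! ### Weak and strong convergence in `L²` -/

section L2

variable {X W : Type*} [MeasurableSpace X] {μ : Measure X} [NormedAddCommGroup W]

theorem eLpNorm_two_sq (f : X → W) : eLpNorm f 2 μ ^ 2 = ∫⁻ x, ‖f x‖ₑ ^ 2 ∂μ := by
  have := eLpNorm_nnreal_pow_eq_lintegral (μ := μ) (f := f) (p := 2) (by norm_num)
  rw [show ((2 : NNReal) : ENNReal) = 2 by norm_num, show ((2 : NNReal) : ℝ) = (2 : ℕ) by norm_num]
    at this
  simpa only [ENNReal.rpow_natCast] using this

theorem eLpNorm_two_le_iff {f : X → W} {B : ENNReal} :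
    eLpNorm f 2 μ ≤ B ↔ ∫⁻ x, ‖f x‖ₑ ^ 2 ∂μ ≤ B ^ 2 := by
  rw [← eLpNorm_two_sq, ENNReal.pow_le_pow_left_iff two_ne_zero]

/-- A sequence supported in a set of finite measure, bounded in `L⁴` and convergent almost
everywhere converges strongly in `L²`. -/
theorem tendsto_eLpNorm_of_bound_four {g : ℕ → X → W} {g' : X → W} {K : Set X}
    (hK : μ K < ⊤) (hg : ∀ n, AEStronglyMeasurable (g n) μ)
    (hgK : ∀ n, ∀ x ∉ K, g n x = 0)
    (hlim : ∀ᵐ x ∂μ, Tendsto (fun n => g n x) atTop (𝓝 (g' x))) (hg' : ∀ x ∉ K, g' x = 0)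
    {B : ENNReal} (hB : B ≠ ⊤) (hbd : ∀ n, ∫⁻ x, ‖g n x‖ₑ ^ 4 ∂μ ≤ B) :
    (∀ n, MemLp (g n) 2 μ) ∧ MemLp g' 2 μ ∧
      Tendsto (fun n => eLpNorm (g n - g') 2 μ) atTop (𝓝 0) := by
  have hg'm : AEStronglyMeasurable g' μ := aestronglyMeasurable_of_tendsto_ae atTop hg hlim
  have : IsFiniteMeasure (μ.restrict K) := ⟨by simpa using hK⟩
  have hsq : ∀ n, eLpNorm (g n) 2 μ ^ 2 ≤ μ K + B := by
    intro n
    rw [← eLpNorm_restrict_eq_of_support_subset (s := K)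
      (Function.support_subset_iff'.2 (hgK n)), eLpNorm_two_sq]
    calc ∫⁻ x in K, ‖g n x‖ₑ ^ 2 ∂μ ≤ ∫⁻ x in K, (1 + ‖g n x‖ₑ ^ 4) ∂μ := by
          refine lintegral_mono fun x => ?_
          rcases le_total (‖g n x‖ₑ) 1 with h | h
          · exact (pow_le_one₀ zero_le h).trans le_self_add
          · exact (pow_le_pow_right₀ h (by norm_num)).trans le_add_self
      _ = μ K + ∫⁻ x in K, ‖g n x‖ₑ ^ 4 ∂μ := by
          rw [lintegral_add_left measurable_const]; simp
      _ ≤ μ K + B := by gcongr; exact (setLIntegral_le_lintegral _ _).trans (hbd n)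
  obtain ⟨b, hb, hb'⟩ : ∃ b : ENNReal, b ≠ ⊤ ∧ ∀ n, eLpNorm (g n) 2 μ ≤ b := by
    refine ⟨1 + (μ K + B), by finiteness, fun n => ?_⟩
    rcases le_total (eLpNorm (g n) 2 μ) 1 with h | h
    · exact h.trans le_self_add
    · exact (le_self_pow₀ h two_ne_zero).trans ((hsq n).trans le_add_self)
  have hgn : ∀ n, MemLp (g n) 2 μ := fun n => ⟨hg n, (hb' n).trans_lt hb.lt_top⟩
  have hgl : MemLp g' 2 μ := ⟨hg'm, (Lp.eLpNorm_lim_le_liminf_eLpNorm hg g' hlim).trans_lt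
    ((liminf_le_of_frequently_le' (Frequently.of_forall hb')).trans_lt hb.lt_top)⟩
  refine ⟨hgn, hgl, ?_⟩
  -- the bound in `L⁴` implies uniform integrability of the squares, so that the theorem of Vitali applies
  have hui : UnifIntegrable g 2 (μ.restrict K) := by
    refine unifIntegrable_of (by norm_num) (by norm_num) (fun n => (hg n).restrict) fun ε hε => ?_
    obtain ⟨N, hN⟩ := exists_nat_ge (B.toReal / ε ^ 2)
    refine ⟨N + 1, fun n => ?_⟩
    rw [eLpNorm_two_le_iff, ← ENNReal.ofReal_pow hε.le]
    have hpt : ∀ x, ‖({x | ((N + 1 : NNReal)) ≤ ‖g n x‖₊}.indicator (g n)) x‖ₑ ^ 2 ≤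
        (N + 1 : ENNReal)⁻¹ * ‖g n x‖ₑ ^ 4 := by
      intro x
      by_cases hx : x ∈ {x | ((N + 1 : NNReal)) ≤ ‖g n x‖₊}
      · rw [Set.indicator_of_mem hx]
        have h1 : (N + 1 : ENNReal) ≤ ‖g n x‖ₑ := by
          have : ((N + 1 : NNReal) : ENNReal) ≤ ‖g n x‖₊ := by exact_mod_cast hx
          rw [enorm_eq_nnnorm]; simpa using this
        have h2 : (N + 1 : ENNReal) ≤ ‖g n x‖ₑ ^ 2 :=
          h1.trans (le_self_pow₀ (le_trans (by simp) h1) two_ne_zero)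
        calc ‖g n x‖ₑ ^ 2 = (N + 1 : ENNReal)⁻¹ * ((N + 1) * ‖g n x‖ₑ ^ 2) := by
              rw [← mul_assoc, ENNReal.inv_mul_cancel (by simp) (by finiteness), one_mul]
          _ ≤ (N + 1 : ENNReal)⁻¹ * (‖g n x‖ₑ ^ 2 * ‖g n x‖ₑ ^ 2) := by gcongr
          _ = _ := by ring
      · rw [Set.indicator_of_notMem hx]; simp
    calc ∫⁻ x in K, ‖({x | ((N + 1 : NNReal)) ≤ ‖g n x‖₊}.indicator (g n)) x‖ₑ ^ 2 ∂μ
        ≤ ∫⁻ x in K, (N + 1 : ENNReal)⁻¹ * ‖g n x‖ₑ ^ 4 ∂μ := lintegral_mono hpt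
      _ = (N + 1 : ENNReal)⁻¹ * ∫⁻ x in K, ‖g n x‖ₑ ^ 4 ∂μ :=
          lintegral_const_mul' _ _ (ENNReal.inv_ne_top.2 (by simp))
      _ ≤ (N + 1 : ENNReal)⁻¹ * B := by
          gcongr; exact (setLIntegral_le_lintegral _ _).trans (hbd n)
      _ ≤ ENNReal.ofReal (ε ^ 2) := by
          rw [mul_comm, ← div_eq_mul_inv]
          refine ENNReal.div_le_of_le_mul' ?_
          rw [← ENNReal.ofReal_toReal hB, show (N + 1 : ENNReal) = ENNReal.ofReal (N + 1) by
            rw [ENNReal.ofReal_add (by positivity) one_pos.le]; simp,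
            ← ENNReal.ofReal_mul (by positivity)]
          refine ENNReal.ofReal_le_ofReal ?_
          rw [div_le_iff₀ (by positivity)] at hN
          nlinarith [sq_nonneg ε]
  have := tendsto_Lp_finite_of_tendsto_ae (μ := μ.restrict K) (p := 2) (by norm_num) (by norm_num)
    (fun n => (hg n).restrict) (hgl.restrict K) hui (ae_restrict_of_ae hlim)
  refine this.congr fun n => eLpNorm_restrict_eq_of_support_subset
    (Function.support_subset_iff'.2 fun x hx => ?_)
  simp [hgK n x hx, hg' x hx]

/-- Under the same hypotheses as for `tendsto_eLpNorm_of_bound_four` the integrals converge. -/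
theorem tendsto_integral_of_bound_four [NormedSpace ℝ W] {g : ℕ → X → W} {g' : X → W} {K : Set X}
    (hK : μ K < ⊤) (hg : ∀ n, AEStronglyMeasurable (g n) μ)
    (hgK : ∀ n, ∀ x ∉ K, g n x = 0)
    (hlim : ∀ᵐ x ∂μ, Tendsto (fun n => g n x) atTop (𝓝 (g' x))) (hg' : ∀ x ∉ K, g' x = 0)
    {B : ENNReal} (hB : B ≠ ⊤) (hbd : ∀ n, ∫⁻ x, ‖g n x‖ₑ ^ 4 ∂μ ≤ B) :
    Integrable g' μ ∧ Tendsto (fun n => ∫ x, g n x ∂μ) atTop (𝓝 (∫ x, g' x ∂μ)) := by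
  obtain ⟨h1, h2, h3⟩ := tendsto_eLpNorm_of_bound_four hK hg hgK hlim hg' hB hbd
  have : IsFiniteMeasure (μ.restrict K) := ⟨by simpa using hK⟩
  have hi : ∀ {f : X → W}, MemLp f 2 μ → Integrable f (μ.restrict K) := fun hf =>
    memLp_one_iff_integrable.1 ((hf.restrict K).mono_exponent (by norm_num))
  have hi' : Integrable g' μ :=
    (integrableOn_iff_integrable_of_support_subset (Function.support_subset_iff'.2 hg')).1 (hi h2)
  refine ⟨hi', ?_⟩
  have key := tendsto_integral_of_L1' (μ := μ.restrict K) (l := atTop) (F := g) g' (hi h2).1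
    (Eventually.of_forall fun n => hi (h1 n)) ?_
  · rw [setIntegral_eq_integral_of_forall_compl_eq_zero hg'] at key
    exact key.congr fun n => setIntegral_eq_integral_of_forall_compl_eq_zero (hgK n)
  · have h4 : Tendsto (fun n => eLpNorm (g n - g') 2 μ *
        (μ.restrict K) Set.univ ^ (1 / (1 : ENNReal).toReal - 1 / (2 : ENNReal).toReal)) atTop
        (𝓝 0) := by
      have := ENNReal.Tendsto.mul_const (b := (μ.restrict K) Set.univ ^
        (1 / (1 : ENNReal).toReal - 1 / (2 : ENNReal).toReal)) h3
        (Or.inr (ENNReal.rpow_ne_top_of_nonneg (by norm_num) (measure_ne_top _ _)))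
      simpa using this
    refine tendsto_of_tendsto_of_tendsto_of_le_of_le tendsto_const_nhds h4 (fun _ => zero_le)
      fun n => ?_
    refine (eLpNorm_le_eLpNorm_mul_rpow_measure_univ (p := 1) (q := 2) (by norm_num)
      ((h1 n).sub h2).1.restrict).trans ?_
    gcongr
    exact Measure.restrict_le_self

variable [InnerProductSpace ℝ W]

theorem norm_integral_inner_le {f g : X → W} (hf : MemLp f 2 μ) (hg : MemLp g 2 μ) :
    |∫ x, inner ℝ (f x) (g x) ∂μ| ≤ (eLpNorm f 2 μ).toReal * (eLpNorm g 2 μ).toReal := by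
  have h := norm_inner_le_norm (𝕜 := ℝ) hf.toLp hg.toLp
  rw [L2.inner_def, Lp.norm_toLp, Lp.norm_toLp] at h
  refine le_trans (le_of_eq ?_) h
  rw [Real.norm_eq_abs]
  congr 1
  refine integral_congr_ae ?_
  filter_upwards [hf.coeFn_toLp, hg.coeFn_toLp] with x h1 h2
  rw [h1, h2]

theorem integrable_inner_of_memLp {f g : X → W} (hf : MemLp f 2 μ) (hg : MemLp g 2 μ) :
    Integrable (fun x => inner ℝ (f x) (g x)) μ := by
  refine (L2.integrable_inner (𝕜 := ℝ) hf.toLp hg.toLp).congr ?_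
  filter_upwards [hf.coeFn_toLp, hg.coeFn_toLp] with x h1 h2
  rw [h1, h2]

theorem integral_inner_self {f : X → W} (hf : MemLp f 2 μ) :
    ∫ x, inner ℝ (f x) (f x) ∂μ = (eLpNorm f 2 μ).toReal ^ 2 := by
  rw [← Lp.norm_toLp f hf, ← real_inner_self_eq_norm_sq, L2.inner_def]
  refine integral_congr_ae ?_
  filter_upwards [hf.coeFn_toLp] with x h1
  rw [h1]

/-- A bounded sequence in `L²` has a weak limit along any ultrafilter, and pairings with strongly
convergent sequences converge. -/
theorem exists_weak_limit [CompleteSpace W] (𝓤 : Ultrafilter ℕ) {f : ℕ → X → W}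
    (hf : ∀ n, MemLp (f n) 2 μ) {B : ℝ} (hB : 0 ≤ B)
    (hfB : ∀ n, eLpNorm (f n) 2 μ ≤ ENNReal.ofReal B) :
    ∃ y : X → W, StronglyMeasurable y ∧ MemLp y 2 μ ∧ ∀ (g : ℕ → X → W) (g' : X → W),
      (∀ n, MemLp (g n) 2 μ) → MemLp g' 2 μ →
      Tendsto (fun n => eLpNorm (g n - g') 2 μ) 𝓤 (𝓝 0) →
      Tendsto (fun n => ∫ x, inner ℝ (g n x) (f n x) ∂μ) 𝓤 (𝓝 (∫ x, inner ℝ (g' x) (y x) ∂μ)) := by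
  -- the theorem of Banach and Alaoglu in the dual of `L²`
  set D : ℕ → WeakDual ℝ (Lp W 2 μ) := fun n =>
    StrongDual.toWeakDual (InnerProductSpace.toDual ℝ (Lp W 2 μ) (hf n).toLp)
  have hD : ∀ n, D n ∈ WeakDual.toStrongDual ⁻¹' Metric.closedBall 0 B := by
    intro n
    have : ‖(hf n).toLp‖ ≤ B := by
      rw [Lp.norm_toLp]; exact ENNReal.toReal_le_of_le_ofReal hB (hfB n)
    have h2 : InnerProductSpace.toDual ℝ (Lp W 2 μ) (hf n).toLp ∈ Metric.closedBall 0 B := by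
      rw [mem_closedBall_zero_iff, LinearIsometryEquiv.norm_map]; exact this
    exact h2
  obtain ⟨Λ, -, hΛ⟩ := (WeakDual.isCompact_closedBall (𝕜 := ℝ) (E := Lp W 2 μ) 0 B).ultrafilter_le_nhds
    (𝓤.map D) (le_principal_iff.2 (Ultrafilter.mem_map.2 (univ_mem' hD)))
  set y := (InnerProductSpace.toDual ℝ (Lp W 2 μ)).symm (WeakDual.toStrongDual Λ)
  have hy : ∀ v : Lp W 2 μ, inner ℝ y v = Λ v := fun v => by
    simp [y]
  have hlim : ∀ v : Lp W 2 μ, Tendsto (fun n => inner ℝ (hf n).toLp v) 𝓤 (𝓝 (inner ℝ y v)) := by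
    intro v
    rw [hy]
    exact ((WeakDual.eval_continuous v).tendsto Λ).comp hΛ
  refine ⟨y, Lp.stronglyMeasurable y, Lp.memLp y, fun g g' hg hg' hgg => ?_⟩
  have h1 := hlim hg'.toLp
  have e1 : inner ℝ y hg'.toLp = ∫ x, inner ℝ (g' x) (y x) ∂μ := by
    rw [real_inner_comm, L2.inner_def]
    refine integral_congr_ae ?_
    filter_upwards [hg'.coeFn_toLp] with x h1
    rw [h1]
  have e2 : ∀ n, inner ℝ (hf n).toLp hg'.toLp = ∫ x, inner ℝ (g' x) (f n x) ∂μ := by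
    intro n
    rw [real_inner_comm, L2.inner_def]
    refine integral_congr_ae ?_
    filter_upwards [hg'.coeFn_toLp, (hf n).coeFn_toLp] with x h1 h2
    rw [h1, h2]
  simp only [e1, e2] at h1
  have h2 : Tendsto (fun n => ∫ x, inner ℝ ((g n - g') x) (f n x) ∂μ) 𝓤 (𝓝 0) := by
    have h3 : Tendsto (fun n => (eLpNorm (g n - g') 2 μ).toReal * B) 𝓤 (𝓝 0) := by
      have := ((ENNReal.tendsto_toReal ENNReal.zero_ne_top).comp hgg).mul_const B
      simpa using this
    refine squeeze_zero_norm (fun n => ?_) h3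
    refine (norm_integral_inner_le ((hg n).sub hg') (hf n)).trans ?_
    gcongr
    exact ENNReal.toReal_le_of_le_ofReal hB (hfB n)
  have h4 := h2.add h1
  rw [zero_add] at h4
  refine h4.congr fun n => ?_
  rw [← integral_add (integrable_inner_of_memLp ((hg n).sub hg') (hf n))
    (integrable_inner_of_memLp hg' (hf n))]
  refine integral_congr_ae (Eventually.of_forall fun x => ?_)
  simp [inner_sub_left]

end L2

/-! ### Limits of lattice approximations -/

/-- A sequence of lattice approximations with meshes tending to zero on space-time regions that
exhaust `ℝ × ℝ²`, together with a map `U` to which it converges almost everywhere at every time. -/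
structure IsLatticeLimit (E C : ℝ) (h T : ℕ → ℝ) (u : ℕ → ℝ → Plane → Lor) (U : ℝ → Plane → Lor) :
    Prop where
  approx : ∀ n, IsLatticeApprox E C (h n) (T n) (u n)
  mesh_le : ∀ n, h n ≤ 1
  mesh_tendsto : Tendsto h atTop (𝓝 0)
  time_tendsto : Tendsto T atTop atTop
  measurable : Measurable fun z : ℝ × Plane => U z.1 z.2
  tendsto : ∀ t, ∀ᵐ x, Tendsto (fun n => u n t x) atTop (𝓝 (U t x))
  tendsto_shift : ∀ t l, ∀ᵐ x, Tendsto (fun n => u n t (x + h n • basisVec l)) atTop (𝓝 (U t x))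

/-- The space-time box `[-R, R] × B̄(0, R)`. -/
def box (R : ℝ) : Set (ℝ × Plane) := Set.Icc (-R) R ×ˢ Metric.closedBall 0 R

theorem measurableSet_box (R : ℝ) : MeasurableSet (box R) :=
  measurableSet_Icc.prod measurableSet_closedBall

theorem isCompact_box (R : ℝ) : IsCompact (box R) := isCompact_Icc.prod (isCompact_closedBall _ _)

theorem exists_subset_box {K : Set (ℝ × Plane)} (hK : IsCompact K) : ∃ R ≥ 0, K ⊆ box R := by
  obtain ⟨R, hR⟩ := hK.isBounded.subset_closedBall (0 : ℝ × Plane)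
  refine ⟨max R 0, le_max_right _ _, fun z hz => ?_⟩
  have h1 : ‖z‖ ≤ max R 0 := (mem_closedBall_zero_iff.1 (hR hz)).trans (le_max_left _ _)
  exact ⟨abs_le.1 ((norm_fst_le z).trans h1), mem_closedBall_zero_iff.2 ((norm_snd_le z).trans h1)⟩

/-- A compactly supported function of class `C¹` on space-time vanishes outside a box, also after
translations by vectors of norm at most one. -/
theorem exists_box_of_hasCompactSupport {φ : ℝ × Plane → ℝ} (hφ : HasCompactSupport φ) :
    ∃ R ≥ 0, (∀ a : ℝ × Plane, ‖a‖ ≤ 1 → ∀ z ∉ box R, φ (z + a) = 0) := by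
  obtain ⟨R, hR0, hR⟩ := exists_subset_box hφ
  refine ⟨R + 1, by positivity, fun a ha z hz => image_eq_zero_of_notMem_tsupport fun h => hz ?_⟩
  obtain ⟨h1, h2⟩ := hR h
  have a1 := (norm_fst_le a).trans ha
  have a2 := (norm_snd_le a).trans ha
  rw [Real.norm_eq_abs, abs_le] at a1
  simp only [Prod.fst_add, Prod.snd_add, Set.mem_Icc, mem_closedBall_zero_iff] at h1 h2
  refine ⟨⟨by linarith, by linarith⟩, mem_closedBall_zero_iff.2 ?_⟩
  have : ‖z.2‖ ≤ ‖z.2 + a.2‖ + ‖a.2‖ := by simpa using norm_sub_le (z.2 + a.2) a.2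
  linarith

namespace IsLatticeApprox

variable {E C h T : ℝ} {u : ℝ → Plane → Lor}

theorem measurable_shift (hu : IsLatticeApprox E C h T u) (l : Fin 2) :
    Measurable fun z : ℝ × Plane => u z.1 (z.2 + h • basisVec l) :=
  hu.measurable.comp (by fun_prop : Measurable fun z : ℝ × Plane => (z.1, z.2 + h • basisVec l))

/-- Eighth moments over a box, uniformly in the approximation. The exponent is dictated by
`tendsto_eLpNorm_of_bound_four`, applied to coefficients of quadratic growth. -/
theorem lintegral_box_le (hu : IsLatticeApprox E C h T u) (R : ℝ) (l : Fin 2) :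
    ∫⁻ z in box R, ENNReal.ofReal ((u z.1 z.2 0 + u z.1 (z.2 + h • basisVec l) 0) ^ 8) ≤
      ENNReal.ofReal (2 ^ 15) * (2 * volume (Metric.closedBall (0 : Plane) R) +
        2 * ENNReal.ofReal C) * volume (Set.Icc (-R) R) := by
  have hm1 := hu.measurable
  have hm2 := hu.measurable_shift l
  have hmd := measurable_momentDensity
  have hc : Measurable fun v : Lor => v 0 := measurable_pi_apply 0
  have hmeas : Measurable fun z : ℝ × Plane =>
      ENNReal.ofReal ((u z.1 z.2 0 + u z.1 (z.2 + h • basisVec l) 0) ^ 8) :=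
    (((hc.comp hm1).add (hc.comp hm2)).pow_const 8).ennreal_ofReal
  have hslice : ∀ t, ∫⁻ x in Metric.closedBall 0 R,
      ENNReal.ofReal ((u t x 0 + u t (x + h • basisVec l) 0) ^ 8) ≤
      ENNReal.ofReal (2 ^ 15) * (2 * volume (Metric.closedBall (0 : Plane) R) +
        2 * ENNReal.ofReal C) := by
    intro t
    have hpt : ∀ x, ENNReal.ofReal ((u t x 0 + u t (x + h • basisVec l) 0) ^ 8) ≤
        ENNReal.ofReal (2 ^ 15) * (2 + (ENNReal.ofReal (momentDensity (u t x)) +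
          ENNReal.ofReal (momentDensity (u t (x + h • basisVec l))))) := by
      intro x
      have m1 := hu.mem t x
      have m2 := hu.mem t (x + h • basisVec l)
      have d1 := momentDensity_nonneg m1
      have d2 := momentDensity_nonneg m2
      have h2 : (2 : ENNReal) + ENNReal.ofReal (momentDensity (u t x) +
          momentDensity (u t (x + h • basisVec l))) = ENNReal.ofReal (2 + (momentDensity (u t x) +
          momentDensity (u t (x + h • basisVec l)))) := by
        rw [ENNReal.ofReal_add (by norm_num) (add_nonneg d1 d2)]; simp
      rw [← ENNReal.ofReal_add d1 d2, h2, ← ENNReal.ofReal_mul (by positivity)]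
      refine ENNReal.ofReal_le_ofReal ?_
      have p1 := pow_zero_le_momentDensity m1
      have p2 := pow_zero_le_momentDensity m2
      have := add_pow_le (zero_le_one.trans (one_le_of_mem m1))
        (zero_le_one.trans (one_le_of_mem m2)) 8
      norm_num at this ⊢
      linarith
    have hs := hu.measurable_slice t
    have hmm : Measurable fun x => ENNReal.ofReal (momentDensity (u t x)) :=
      (hmd.comp hs).ennreal_ofReal
    calc _ ≤ _ := lintegral_mono hpt
      _ = ENNReal.ofReal (2 ^ 15) * (2 * volume (Metric.closedBall (0 : Plane) R) +
          ((∫⁻ x in Metric.closedBall 0 R, ENNReal.ofReal (momentDensity (u t x))) +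
          ∫⁻ x in Metric.closedBall 0 R,
            ENNReal.ofReal (momentDensity (u t (x + h • basisVec l))))) := by
          rw [lintegral_const_mul' _ _ ENNReal.ofReal_ne_top, lintegral_add_left measurable_const,
            lintegral_add_left hmm]
          simp only [lintegral_const, Measure.restrict_apply MeasurableSet.univ, Set.univ_inter]
      _ ≤ ENNReal.ofReal (2 ^ 15) * (2 * volume (Metric.closedBall (0 : Plane) R) +
          (ENNReal.ofReal C + ENNReal.ofReal C)) := by
          gcongr
          · exact (setLIntegral_le_lintegral _ _).trans (hu.moment t)
          · refine (setLIntegral_le_lintegral _ _).trans ?_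
            rw [lintegral_add_right_eq_self fun x => ENNReal.ofReal (momentDensity (u t x))]
            exact hu.moment t
      _ = _ := by rw [two_mul (ENNReal.ofReal C)]
  rw [box, Measure.volume_eq_prod, ← Measure.prod_restrict, lintegral_prod _ hmeas.aemeasurable]
  calc _ ≤ ∫⁻ _ in Set.Icc (-R) R, ENNReal.ofReal (2 ^ 15) *
        (2 * volume (Metric.closedBall (0 : Plane) R) + 2 * ENNReal.ofReal C) :=
        lintegral_mono fun t => hslice t
    _ = _ := by rw [setLIntegral_const]

end IsLatticeApprox

/-- The coordinates of the difference quotients of `u` in the frame at the midpoint. The pair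
`(l, a)` stands for the `a`-th coordinate of the quotient in the direction `l`. -/
noncomputable def gradCoord (h : ℝ) (u : ℝ → Plane → Lor) (z : ℝ × Plane) :
    EuclideanSpace ℝ (Fin 2 × Fin 2) :=
  WithLp.toLp 2 fun p => frameCoord (midpt (u z.1 z.2) (u z.1 (z.2 + h • basisVec p.1)))
    (h⁻¹ • (u z.1 (z.2 + h • basisVec p.1) - u z.1 z.2)) p.2

theorem measurable_midpt : Measurable fun p : Lor × Lor => midpt p.1 p.2 := by
  have := continuous_lorentzForm.measurable
  unfold midpt
  fun_prop

theorem measurable_frame (a : Fin 2) : Measurable fun m : Lor => frame m a := by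
  have hc : ∀ i, Measurable fun m : Lor => m i := fun i => measurable_pi_apply i
  refine measurable_pi_iff.2 fun i => ?_
  have h1 : Measurable fun m : Lor => (![1, m 1 / (1 + m 0), m 2 / (1 + m 0)] : Lor) i := by
    have := hc 0
    have := hc 1
    have := hc 2
    fin_cases i <;> simp <;> fun_prop
  simp only [frame, Pi.add_apply, Pi.smul_apply, smul_eq_mul]
  exact ((hc _).mul h1).add measurable_const

theorem measurable_frameCoord (a : Fin 2) : Measurable fun p : Lor × Lor => frameCoord p.1 p.2 a := by
  have h1 : ∀ i, Measurable fun p : Lor × Lor => p.1 i := fun i =>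
    (measurable_pi_apply i).comp measurable_fst
  have h2 : ∀ i, Measurable fun p : Lor × Lor => p.2 i := fun i =>
    (measurable_pi_apply i).comp measurable_snd
  unfold frameCoord
  exact (h2 _).sub (((h1 _).mul (h2 _)).div (measurable_const.add (h1 _)))

namespace IsLatticeApprox

variable {E C h T : ℝ} {u : ℝ → Plane → Lor}

theorem measurable_gradCoord (hu : IsLatticeApprox E C h T u) : Measurable (gradCoord h u) := by
  have hm1 := hu.measurable
  refine (WithLp.measurable_toLp 2 _).comp (measurable_pi_iff.2 fun p => ?_)
  have hm2 := hu.measurable_shift p.1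
  exact (measurable_frameCoord p.2).comp
    ((measurable_midpt.comp (hm1.prodMk hm2)).prodMk ((hm2.sub hm1).const_smul h⁻¹))

theorem norm_gradCoord_sq (hu : IsLatticeApprox E C h T u) (z : ℝ × Plane) :
    ‖gradCoord h u z‖ ^ 2 =
      h⁻¹ ^ 2 * ∑ l, chordSq (u z.1 z.2) (u z.1 (z.2 + h • basisVec l)) := by
  rw [EuclideanSpace.norm_sq_eq, Fintype.sum_prod_type, Finset.mul_sum]
  refine Finset.sum_congr rfl fun l _ => ?_
  have m1 := hu.mem z.1 z.2
  have m2 := hu.mem z.1 (z.2 + h • basisVec l)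
  have := sum_frameCoord_sq (midpt_mem m1 m2) (lorentzForm_midpt_sub m1 m2 h⁻¹)
  simp only [gradCoord, Real.norm_eq_abs, sq_abs]
  rw [this]
  simp only [chordSq, lorentzForm_eq, Pi.smul_apply, Pi.sub_apply, smul_eq_mul]
  ring

theorem lintegral_gradCoord_le (hu : IsLatticeApprox E C h T u) (t : ℝ) :
    ∫⁻ x, ‖gradCoord h u (t, x)‖ₑ ^ 2 ≤ ENNReal.ofReal E := by
  have hh := hu.mesh_pos
  calc ∫⁻ x, ‖gradCoord h u (t, x)‖ₑ ^ 2
      = ∫⁻ x, ENNReal.ofReal (h⁻¹ ^ 2) *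
          ENNReal.ofReal (∑ l, chordSq (u t x) (u t (x + h • basisVec l))) := by
        refine lintegral_congr fun x => ?_
        rw [← ofReal_norm, ← ENNReal.ofReal_pow (norm_nonneg _), hu.norm_gradCoord_sq,
          ENNReal.ofReal_mul (by positivity)]
    _ = ENNReal.ofReal (h⁻¹ ^ 2) *
          ∫⁻ x, ENNReal.ofReal (∑ l, chordSq (u t x) (u t (x + h • basisVec l))) :=
        lintegral_const_mul' _ _ ENNReal.ofReal_ne_top
    _ ≤ ENNReal.ofReal (h⁻¹ ^ 2) * ENNReal.ofReal (h ^ 2 * E) := by gcongr; exact hu.energy t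
    _ = ENNReal.ofReal E := by
        rw [← ENNReal.ofReal_mul (by positivity)]; congr 1; field_simp

/-- The difference quotient expressed in the frame at the midpoint. -/
theorem sum_gradCoord_smul_frame (hu : IsLatticeApprox E C h T u) (z : ℝ × Plane) (l : Fin 2) :
    ∑ a, gradCoord h u z (l, a) • frame (midpt (u z.1 z.2) (u z.1 (z.2 + h • basisVec l))) a =
      h⁻¹ • (u z.1 (z.2 + h • basisVec l) - u z.1 z.2) :=
  sum_frameCoord_smul (midpt_mem (hu.mem _ _) (hu.mem _ _))
    (lorentzForm_midpt_sub (hu.mem _ _) (hu.mem _ _) h⁻¹)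

theorem sum_gradCoord_smul_cross (hu : IsLatticeApprox E C h T u) (z : ℝ × Plane) (l : Fin 2) :
    ∑ a, gradCoord h u z (l, a) • eta *ᵥ (u z.1 z.2 ⨯₃
      frame (midpt (u z.1 z.2) (u z.1 (z.2 + h • basisVec l))) a) =
      latticeFlux h (u z.1) l z.2 := by
  rw [latticeFlux, ← cross_sub_self, ← Matrix.mulVec_smul, ← map_smul (crossProduct (u z.1 z.2)),
    ← hu.sum_gradCoord_smul_frame z l]
  simp only [map_sum, map_smul, Matrix.mulVec_sum, Matrix.mulVec_smul]

end IsLatticeApprox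

namespace IsLatticeLimit

variable {E C : ℝ} {h T : ℕ → ℝ} {u : ℕ → ℝ → Plane → Lor} {U : ℝ → Plane → Lor}

theorem mem (hU : IsLatticeLimit E C h T u U) (t : ℝ) : ∀ᵐ x, U t x ∈ hyperbolicPlane := by
  filter_upwards [hU.tendsto t] with x hx
  exact isClosed_hyperbolicPlane.mem_of_tendsto hx
    (Eventually.of_forall fun n => (hU.approx n).mem t x)

theorem measurable_slice (hU : IsLatticeLimit E C h T u U) (t : ℝ) : Measurable (U t) :=
  hU.measurable.comp measurable_prodMk_left

theorem ae_mem (hU : IsLatticeLimit E C h T u U) :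
    ∀ᵐ z : ℝ × Plane, U z.1 z.2 ∈ hyperbolicPlane := by
  rw [Measure.volume_eq_prod, Measure.ae_prod_iff_ae_ae
    (hU.measurable isClosed_hyperbolicPlane.measurableSet)]
  exact Eventually.of_forall hU.mem

theorem ae_tendsto (hU : IsLatticeLimit E C h T u U) :
    ∀ᵐ z : ℝ × Plane, Tendsto (fun n => u n z.1 z.2) atTop (𝓝 (U z.1 z.2)) := by
  have hms : MeasurableSet {z : ℝ × Plane |
      Tendsto (fun n => u n z.1 z.2 - U z.1 z.2) atTop (𝓝 0)} :=
    measurableSet_tendsto _ fun n => (hU.approx n).measurable.sub hU.measurable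
  have : ∀ᵐ z : ℝ × Plane, Tendsto (fun n => u n z.1 z.2 - U z.1 z.2) atTop (𝓝 0) := by
    rw [Measure.volume_eq_prod, Measure.ae_prod_iff_ae_ae hms]
    refine Eventually.of_forall fun t => ?_
    filter_upwards [hU.tendsto t] with x hx
    exact tendsto_sub_nhds_zero_iff.2 hx
  filter_upwards [this] with z hz using tendsto_sub_nhds_zero_iff.1 hz

theorem ae_tendsto_shift (hU : IsLatticeLimit E C h T u U) (l : Fin 2) :
    ∀ᵐ z : ℝ × Plane, Tendsto (fun n => u n z.1 (z.2 + h n • basisVec l)) atTop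
      (𝓝 (U z.1 z.2)) := by
  have hms : MeasurableSet {z : ℝ × Plane |
      Tendsto (fun n => u n z.1 (z.2 + h n • basisVec l) - U z.1 z.2) atTop (𝓝 0)} :=
    measurableSet_tendsto _ fun n => ((hU.approx n).measurable_shift l).sub hU.measurable
  have : ∀ᵐ z : ℝ × Plane,
      Tendsto (fun n => u n z.1 (z.2 + h n • basisVec l) - U z.1 z.2) atTop (𝓝 0) := by
    rw [Measure.volume_eq_prod, Measure.ae_prod_iff_ae_ae hms]
    refine Eventually.of_forall fun t => ?_
    filter_upwards [hU.tendsto_shift t l] with x hx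
    exact tendsto_sub_nhds_zero_iff.2 hx
  filter_upwards [this] with z hz using tendsto_sub_nhds_zero_iff.1 hz

/-- The moment bound passes to the limit. -/
theorem lintegral_momentDensity_le (hU : IsLatticeLimit E C h T u U) (t : ℝ) :
    ∫⁻ x, ENNReal.ofReal (momentDensity (U t x)) ≤ ENNReal.ofReal C := by
  have hcont : Continuous momentDensity := by
    have := continuous_apply (A := fun _ : Fin 3 => ℝ) 0
    unfold momentDensity; fun_prop
  calc ∫⁻ x, ENNReal.ofReal (momentDensity (U t x))
      ≤ ∫⁻ x, liminf (fun n => ENNReal.ofReal (momentDensity (u n t x))) atTop := by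
        refine lintegral_mono_ae ?_
        filter_upwards [hU.tendsto t] with x hx
        exact ((ENNReal.continuous_ofReal.tendsto _).comp
          ((hcont.tendsto _).comp hx)).liminf_eq.ge
    _ ≤ liminf (fun n => ∫⁻ x, ENNReal.ofReal (momentDensity (u n t x))) atTop :=
        lintegral_liminf_le fun n =>
          (IsLatticeApprox.measurable_momentDensity.comp ((hU.approx n).measurable_slice t)).ennreal_ofReal
    _ ≤ ENNReal.ofReal C :=
        liminf_le_of_frequently_le' (Frequently.of_forall fun n => (hU.approx n).moment t)

end IsLatticeLimit

/-! ### Weak limits of the difference quotients -/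

namespace IsLatticeLimit

variable {E C : ℝ} {h T : ℕ → ℝ} {u : ℕ → ℝ → Plane → Lor} {U : ℝ → Plane → Lor}

/-- The coordinates multiplied by `(1 + t²)⁻¹`. At each time they are bounded in `L²` of the plane;
the weight makes them bounded in `L²` of space-time. -/
noncomputable def weightedCoord (h : ℝ) (u : ℝ → Plane → Lor) (z : ℝ × Plane) :
    EuclideanSpace ℝ (Fin 2 × Fin 2) := (1 + z.1 ^ 2)⁻¹ • gradCoord h u z

theorem measurable_weightedCoord {h T : ℝ} {u : ℝ → Plane → Lor} (hu : IsLatticeApprox E C h T u) :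
    Measurable (weightedCoord h u) :=
  (by fun_prop : Measurable fun z : ℝ × Plane => (1 + z.1 ^ 2)⁻¹).smul hu.measurable_gradCoord

theorem lintegral_weightedCoord_le {h T : ℝ} {u : ℝ → Plane → Lor}
    (hu : IsLatticeApprox E C h T u) (A : Set ℝ) :
    ∫⁻ z in A ×ˢ Set.univ, ‖weightedCoord h u z‖ₑ ^ 2 ≤
      ∫⁻ t in A, ENNReal.ofReal (((1 + t ^ 2)⁻¹) ^ 2 * E) := by
  rw [Measure.volume_eq_prod, ← Measure.prod_restrict, Measure.restrict_univ,
    lintegral_prod _ ((measurable_weightedCoord hu).enorm.pow_const 2).aemeasurable]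
  refine lintegral_mono fun t => ?_
  have hw : 0 ≤ (1 + t ^ 2)⁻¹ := by positivity
  calc ∫⁻ x, ‖weightedCoord h u (t, x)‖ₑ ^ 2
      = ∫⁻ x, ENNReal.ofReal (((1 + t ^ 2)⁻¹) ^ 2) * ‖gradCoord h u (t, x)‖ₑ ^ 2 := by
        refine lintegral_congr fun x => ?_
        rw [weightedCoord, enorm_smul, mul_pow, Real.enorm_of_nonneg hw, ENNReal.ofReal_pow hw]
    _ = ENNReal.ofReal (((1 + t ^ 2)⁻¹) ^ 2) * ∫⁻ x, ‖gradCoord h u (t, x)‖ₑ ^ 2 :=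
        lintegral_const_mul' _ _ ENNReal.ofReal_ne_top
    _ ≤ ENNReal.ofReal (((1 + t ^ 2)⁻¹) ^ 2) * ENNReal.ofReal E := by
        gcongr; exact hu.lintegral_gradCoord_le t
    _ = _ := by rw [← ENNReal.ofReal_mul (by positivity)]

theorem integrable_weight_sq : Integrable fun t : ℝ => ((1 + t ^ 2)⁻¹) ^ 2 := by
  refine integrable_inv_one_add_sq.mono' (by fun_prop) (Eventually.of_forall fun t => ?_)
  have h1 : (1 + t ^ 2)⁻¹ ≤ 1 := inv_le_one_of_one_le₀ (by nlinarith [sq_nonneg t])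
  have h0 : 0 ≤ (1 + t ^ 2)⁻¹ := by positivity
  rw [Real.norm_of_nonneg (by positivity)]
  nlinarith

theorem eLpNorm_weightedCoord_le (hE : 0 ≤ E) {h T : ℝ} {u : ℝ → Plane → Lor}
    (hu : IsLatticeApprox E C h T u) (A : Set ℝ) :
    eLpNorm (weightedCoord h u) 2 (volume.restrict (A ×ˢ Set.univ)) ≤
      ENNReal.ofReal √(∫ t in A, ((1 + t ^ 2)⁻¹) ^ 2 * E) := by
  rw [eLpNorm_two_le_iff]
  refine (lintegral_weightedCoord_le hu A).trans ?_
  have h0 : 0 ≤ ∫ t in A, ((1 + t ^ 2)⁻¹) ^ 2 * E := integral_nonneg fun t => by positivity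
  rw [← ENNReal.ofReal_pow (Real.sqrt_nonneg _), Real.sq_sqrt h0,
    ofReal_integral_eq_lintegral_ofReal (integrable_weight_sq.mul_const E).integrableOn
      (Eventually.of_forall fun t => by positivity)]

/-- The bound for the weak limit of the weighted coordinates at almost every time. -/
theorem ae_lintegral_le_of_weak_limit (hE : 0 ≤ E)
    (hu : ∀ n, IsLatticeApprox E C (h n) (T n) (u n)) {𝓤 : Filter ℕ} [𝓤.NeBot]
    {y : ℝ × Plane → EuclideanSpace ℝ (Fin 2 × Fin 2)} (hy : StronglyMeasurable y)
    (hy2 : MemLp y 2)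
    (hlim : ∀ g : ℝ × Plane → EuclideanSpace ℝ (Fin 2 × Fin 2), MemLp g 2 →
      Tendsto (fun n => ∫ z, inner ℝ (g z) (weightedCoord (h n) (u n) z)) 𝓤
        (𝓝 (∫ z, inner ℝ (g z) (y z)))) :
    ∀ᵐ t : ℝ, ∫⁻ x, ‖y (t, x)‖ₑ ^ 2 ≤ ENNReal.ofReal (((1 + t ^ 2)⁻¹) ^ 2 * E) := by
  have hym : Measurable fun z => ‖y z‖ₑ ^ 2 := hy.measurable.enorm.pow_const 2
  refine ae_le_of_forall_setLIntegral_le_of_sigmaFinite hym.lintegral_prod_right' fun A hA _ => ?_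
  set S : Set (ℝ × Plane) := A ×ˢ Set.univ
  have hS : MeasurableSet S := hA.prod MeasurableSet.univ
  -- testing with `y` itself, restricted to the times in `A`, gives `‖y‖² ≤ ‖y‖ b` there
  set g := S.indicator y
  have hg : MemLp g 2 := hy2.indicator hS
  set N := (eLpNorm g 2 volume).toReal
  set b := √(∫ t in A, ((1 + t ^ 2)⁻¹) ^ 2 * E)
  have h1 : ∫ z, inner ℝ (g z) (y z) = N ^ 2 := by
    rw [← integral_inner_self hg]
    refine integral_congr_ae (Eventually.of_forall fun z => ?_)
    by_cases hz : z ∈ S <;> simp [g, hz]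
  have h2 : ∀ n, ∫ z, inner ℝ (g z) (weightedCoord (h n) (u n) z) ≤ N * b := by
    intro n
    set f := S.indicator (weightedCoord (h n) (u n))
    have hfn : eLpNorm f 2 volume ≤ ENNReal.ofReal b := by
      rw [eLpNorm_indicator_eq_eLpNorm_restrict hS]
      exact eLpNorm_weightedCoord_le hE (hu n) A
    have hf : MemLp f 2 :=
      ⟨((measurable_weightedCoord (hu n)).indicator hS).aestronglyMeasurable,
        hfn.trans_lt ENNReal.ofReal_lt_top⟩
    have h3 := (le_abs_self _).trans (norm_integral_inner_le hg hf)
    refine le_trans (le_of_eq ?_) (h3.trans (mul_le_mul_of_nonneg_left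
      (ENNReal.toReal_le_of_le_ofReal (Real.sqrt_nonneg _) hfn) ENNReal.toReal_nonneg))
    refine integral_congr_ae (Eventually.of_forall fun z => ?_)
    by_cases hz : z ∈ S <;> simp [g, f, hz]
  have h3 : N ^ 2 ≤ N * b := by
    rw [← h1]
    exact le_of_tendsto (hlim g hg) (Eventually.of_forall h2)
  have hNb : N ≤ b := by
    rcases (ENNReal.toReal_nonneg : 0 ≤ N).eq_or_lt with h0 | h0
    · exact h0.symm.le.trans (Real.sqrt_nonneg _)
    · exact le_of_mul_le_mul_left (by rwa [← sq]) h0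
  have h4 : eLpNorm g 2 volume ≤ ENNReal.ofReal b := by
    rw [← ENNReal.ofReal_toReal hg.2.ne]; exact ENNReal.ofReal_le_ofReal hNb
  rw [eLpNorm_indicator_eq_eLpNorm_restrict hS, eLpNorm_two_le_iff] at h4
  have h0 : 0 ≤ ∫ t in A, ((1 + t ^ 2)⁻¹) ^ 2 * E := integral_nonneg fun t => by positivity
  rw [← ENNReal.ofReal_pow (Real.sqrt_nonneg _), Real.sq_sqrt h0,
    ofReal_integral_eq_lintegral_ofReal (integrable_weight_sq.mul_const E).integrableOn
      (Eventually.of_forall fun t => by positivity), Measure.volume_eq_prod, ← Measure.prod_restrict,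
    Measure.restrict_univ, lintegral_prod _ hym.aemeasurable] at h4
  exact h4

/-- A pair of vectors `B v w a` depending on two neighbouring values `v`, `w` of the map. The growth
is at most quadratic, which together with the eighth moments bounds it in `L⁴`, and it is continuous
at the diagonal, where the two values have the same limit. -/
structure IsCoefficient (κ : ℝ) (B : Lor → Lor → Fin 2 → Lor) : Prop where
  measurable : ∀ a, Measurable fun p : Lor × Lor => B p.1 p.2 a
  norm_le : ∀ v ∈ hyperbolicPlane, ∀ w ∈ hyperbolicPlane, ∀ a, ‖B v w a‖ ≤ κ * (v 0 + w 0) ^ 2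
  tendsto : ∀ v ∈ hyperbolicPlane, ∀ p q : ℕ → Lor, Tendsto p atTop (𝓝 v) →
    Tendsto q atTop (𝓝 v) → ∀ a, Tendsto (fun n => B (p n) (q n) a) atTop (𝓝 (B v v a))

theorem isCoefficient_frame : IsCoefficient 2 fun v w a => frame (midpt v w) a where
  measurable a := (measurable_frame a).comp measurable_midpt
  norm_le v hv w hw a := by
    have h1 := norm_frame_le (midpt_mem hv hw) a
    have h2 := midpt_zero_le hv hw
    have h3 := one_le_of_mem hv
    have h4 := one_le_of_mem hw
    nlinarith
  tendsto v hv p q hp hq a := by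
    rw [midpt_self hv]
    exact (continuousAt_frame hv a).tendsto.comp (tendsto_midpt hv hp hq)

theorem continuous_eta_cross : Continuous fun p : Lor × Lor => eta *ᵥ (p.1 ⨯₃ p.2) := by
  have hc : ∀ i, Continuous fun p : Lor × Lor => p.1 i := fun i =>
    (continuous_apply i).comp continuous_fst
  have hd : ∀ i, Continuous fun p : Lor × Lor => p.2 i := fun i =>
    (continuous_apply i).comp continuous_snd
  have h0 := hc 0
  have h1 := hc 1
  have h2 := hc 2
  have k0 := hd 0
  have k1 := hd 1
  have k2 := hd 2
  simp only [eta_mulVec_cross]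
  refine continuous_pi fun i => ?_
  fin_cases i <;> simp <;> fun_prop

theorem isCoefficient_cross :
    IsCoefficient 4 fun v w a => eta *ᵥ (v ⨯₃ frame (midpt v w) a) where
  measurable a := continuous_eta_cross.measurable.comp
    (measurable_fst.prodMk ((measurable_frame a).comp measurable_midpt))
  norm_le v hv w hw a := by
    have h1 := norm_frame_le (midpt_mem hv hw) a
    have h2 := midpt_zero_le hv hw
    have h3 := one_le_of_mem hv
    have h4 := one_le_of_mem hw
    have h5 := norm_le_of_mem hv
    calc _ ≤ 2 * ‖v‖ * ‖frame (midpt v w) a‖ := norm_eta_cross_le _ _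
      _ ≤ 2 * (v 0 + w 0) * (2 * (v 0 + w 0)) := by gcongr <;> linarith
      _ = _ := by ring
  tendsto v hv p q hp hq a := by
    rw [midpt_self hv]
    have h1 : Tendsto (fun n => frame (midpt (p n) (q n)) a) atTop (𝓝 (frame v a)) :=
      (continuousAt_frame hv a).tendsto.comp (tendsto_midpt hv hp hq)
    have h2 := Tendsto.comp (continuous_eta_cross.tendsto (v, frame v a)) (hp.prodMk_nhds h1)
    simp only [Function.comp_def] at h2
    exact h2

/-- Admissible sequences of scalar factors: bounded, supported in a fixed box, and pointwise
convergent. -/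
structure IsCutoff (R L : ℝ) (φ : ℕ → ℝ × Plane → ℝ) (φ' : ℝ × Plane → ℝ) : Prop where
  nonneg : 0 ≤ L
  measurable : ∀ n, Measurable (φ n)
  le : ∀ n z, |φ n z| ≤ L
  support : ∀ n, ∀ z ∉ box R, φ n z = 0
  tendsto : ∀ z, Tendsto (fun n => φ n z) atTop (𝓝 (φ' z))

theorem IsCutoff.support' {R L : ℝ} {φ : ℕ → ℝ × Plane → ℝ} {φ' : ℝ × Plane → ℝ}
    (hφ : IsCutoff R L φ φ') : ∀ z ∉ box R, φ' z = 0 := fun z hz =>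
  tendsto_nhds_unique (hφ.tendsto z) (by simp [hφ.support _ z hz])

/-- The vector which, paired with the weighted coordinates, gives the `j`-th component of
`φ • ∑ a, Yₗₐ • Bₐ`. -/
noncomputable def testVector (φ : ℝ × Plane → ℝ) (b : ℝ × Plane → Fin 2 → Lor) (l : Fin 2)
    (j : Fin 3) (z : ℝ × Plane) : EuclideanSpace ℝ (Fin 2 × Fin 2) :=
  WithLp.toLp 2 fun p => if p.1 = l then (1 + z.1 ^ 2) * φ z * b z p.2 j else 0

theorem inner_testVector (φ : ℝ × Plane → ℝ) (b : ℝ × Plane → Fin 2 → Lor) (l : Fin 2)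
    (j : Fin 3) (z : ℝ × Plane) (y : EuclideanSpace ℝ (Fin 2 × Fin 2)) :
    inner ℝ (testVector φ b l j z) y =
      (φ z • ∑ a, ((1 + z.1 ^ 2) * y (l, a)) • b z a) j := by
  simp only [testVector, PiLp.inner_apply, Fintype.sum_prod_type, RCLike.inner_apply,
    conj_trivial, Pi.smul_apply, Finset.sum_apply, smul_eq_mul, Finset.mul_sum]
  rw [Finset.sum_eq_single l (fun k _ hk => by simp [hk]) (by simp)]
  refine Finset.sum_congr rfl fun a _ => ?_
  simp only [if_true]
  ring

theorem norm_testVector_pow_four_le {φ : ℝ × Plane → ℝ} {b : ℝ × Plane → Fin 2 → Lor} {l : Fin 2}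
    {j : Fin 3} {z : ℝ × Plane} {R L q : ℝ} (hL : 0 ≤ L) (hz : z ∈ box R)
    (hφ : |φ z| ≤ L)
    (hb : ∀ a, ‖b z a‖ ≤ q) : ‖testVector φ b l j z‖ ^ 4 ≤ 4 * ((1 + R ^ 2) * L * q) ^ 4 := by
  have hzR : 1 + z.1 ^ 2 ≤ 1 + R ^ 2 := by
    have : |z.1| ≤ R := abs_le.2 hz.1
    have := sq_le_sq' (by linarith [neg_abs_le z.1]) ((le_abs_self _).trans this)
    linarith
  set c := (1 + R ^ 2) * L * q
  have hc : ∀ a, ‖(1 + z.1 ^ 2) * φ z * b z a j‖ ≤ c := by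
    intro a
    rw [norm_mul, norm_mul, Real.norm_of_nonneg (by positivity)]
    have := (norm_le_pi_norm (b z a) j).trans (hb a)
    exact mul_le_mul (mul_le_mul hzR hφ (abs_nonneg _) (by positivity)) this (norm_nonneg _)
      (by positivity)
  have h2 : ‖testVector φ b l j z‖ ^ 2 ≤ 2 * c ^ 2 := by
    rw [EuclideanSpace.norm_sq_eq, Fintype.sum_prod_type,
      Finset.sum_eq_single l (fun k _ hk => by simp [testVector, hk]) (by simp), Fin.sum_univ_two]
    have h0 := pow_le_pow_left₀ (norm_nonneg _) (hc 0) 2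
    have h1 := pow_le_pow_left₀ (norm_nonneg _) (hc 1) 2
    simp only [testVector, if_true]
    linarith
  calc ‖testVector φ b l j z‖ ^ 4 = (‖testVector φ b l j z‖ ^ 2) ^ 2 := by ring
    _ ≤ (2 * c ^ 2) ^ 2 := by gcongr
    _ = _ := by ring

theorem measurable_testVector {φ : ℝ × Plane → ℝ} {b : ℝ × Plane → Fin 2 → Lor} (l : Fin 2)
    (j : Fin 3) (hφ : Measurable φ) (hb : ∀ a, Measurable fun z => b z a) :
    Measurable (testVector φ b l j) := by
  refine (WithLp.measurable_toLp 2 _).comp (measurable_pi_iff.2 fun p => ?_)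
  have h1 : Measurable fun z : ℝ × Plane => (1 + z.1 ^ 2) * φ z * b z p.2 j :=
    ((by fun_prop : Measurable fun z : ℝ × Plane => 1 + z.1 ^ 2).mul hφ).mul
      ((measurable_pi_apply j).comp (hb p.2))
  by_cases hp : p.1 = l
  · simpa only [hp, if_true] using h1
  · simp only [hp, if_false]; exact measurable_const

/-- Strong convergence in `L²` of the test vectors, by the almost everywhere convergence of the maps
and their moments. -/
theorem tendsto_testVector (hU : IsLatticeLimit E C h T u U) {κ : ℝ} {B : Lor → Lor → Fin 2 → Lor}
    (hB : IsCoefficient κ B) {R L : ℝ} {φ : ℕ → ℝ × Plane → ℝ} {φ' : ℝ × Plane → ℝ}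
    (hφ : IsCutoff R L φ φ') (l : Fin 2) (j : Fin 3) :
    (∀ n, MemLp (testVector (φ n)
      (fun z => B (u n z.1 z.2) (u n z.1 (z.2 + h n • basisVec l))) l j) 2) ∧
    MemLp (testVector φ' (fun z => B (U z.1 z.2) (U z.1 z.2)) l j) 2 ∧
    Tendsto (fun n => eLpNorm (testVector (φ n)
      (fun z => B (u n z.1 z.2) (u n z.1 (z.2 + h n • basisVec l))) l j -
      testVector φ' (fun z => B (U z.1 z.2) (U z.1 z.2)) l j) 2 volume) atTop (𝓝 0) := by
  set D := ENNReal.ofReal (2 ^ 15) * (2 * volume (Metric.closedBall (0 : Plane) R) +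
        2 * ENNReal.ofReal C) * volume (Set.Icc (-R) R)
  have hD : D ≠ ⊤ := by
    have := measure_closedBall_lt_top (μ := (volume : Measure Plane)) (x := 0) (r := R)
    have h2 : volume (Set.Icc (-R) R) < ⊤ := isCompact_Icc.measure_lt_top
    simp only [D]
    finiteness
  -- a test vector vanishes together with its scalar factor
  have hzero : ∀ {ψ : ℝ × Plane → ℝ} {b : ℝ × Plane → Fin 2 → Lor} {z : ℝ × Plane}, ψ z = 0 →
      testVector ψ b l j z = 0 := by
    intro ψ b z hz
    ext p
    simp [testVector, hz]
  have hmeas : ∀ n, Measurable (testVector (φ n)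
      (fun z => B (u n z.1 z.2) (u n z.1 (z.2 + h n • basisVec l))) l j) := fun n =>
    measurable_testVector l j (hφ.measurable n) fun a => (hB.measurable a).comp
      ((hU.approx n).measurable.prodMk ((hU.approx n).measurable_shift l))
  refine tendsto_eLpNorm_of_bound_four (K := box R) (isCompact_box R).measure_lt_top
    (fun n => (hmeas n).aestronglyMeasurable) (fun n z hz => hzero (hφ.support n z hz)) ?_
    (fun z hz => hzero (hφ.support' z hz))
    (B := ENNReal.ofReal (4 * ((1 + R ^ 2) * L * κ) ^ 4) * D) (by finiteness) fun n => ?_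
  · filter_upwards [hU.ae_tendsto, hU.ae_tendsto_shift l, hU.ae_mem] with z h1 h2 h3
    refine ((PiLp.continuous_toLp 2 _).tendsto _).comp (tendsto_pi_nhds.2 fun p => ?_)
    by_cases hp : p.1 = l
    · simp only [hp, if_true]
      exact ((hφ.tendsto z).const_mul _).mul
        (((continuous_apply j).tendsto _).comp (hB.tendsto _ h3 _ _ h1 h2 p.2))
    · simp only [hp, if_false]; exact tendsto_const_nhds
  · have hu := hU.approx n
    calc _ = ∫⁻ z in box R, ‖testVector (φ n) (fun z => B (u n z.1 z.2)
            (u n z.1 (z.2 + h n • basisVec l))) l j z‖ₑ ^ 4 := by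
          rw [setLIntegral_eq_of_support_subset]
          refine Function.support_subset_iff'.2 fun z hz => ?_
          rw [hzero (hφ.support n z hz)]; simp
      _ ≤ ∫⁻ z in box R, ENNReal.ofReal (4 * ((1 + R ^ 2) * L * κ) ^ 4) *
            ENNReal.ofReal ((u n z.1 z.2 0 + u n z.1 (z.2 + h n • basisVec l) 0) ^ 8) := by
          refine setLIntegral_mono' (measurableSet_box R) fun z hz => ?_
          have p1 := one_le_of_mem (hu.mem z.1 z.2)
          rw [← ofReal_norm, ← ENNReal.ofReal_pow (norm_nonneg _),
            ← ENNReal.ofReal_mul (by have := hφ.nonneg; positivity)]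
          refine ENNReal.ofReal_le_ofReal ((norm_testVector_pow_four_le hφ.nonneg
            hz (hφ.le n z) fun a =>
              hB.norm_le _ (hu.mem _ _) _ (hu.mem _ _) a).trans (le_of_eq ?_))
          ring
      _ = ENNReal.ofReal (4 * ((1 + R ^ 2) * L * κ) ^ 4) * ∫⁻ z in box R,
            ENNReal.ofReal ((u n z.1 z.2 0 + u n z.1 (z.2 + h n • basisVec l) 0) ^ 8) :=
          lintegral_const_mul' _ _ ENNReal.ofReal_ne_top
      _ ≤ _ := by gcongr; exact hu.lintegral_box_le R l

/-- The limits `Yₗₐ` of the frame coordinates of the difference quotients: they obey the energy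
bound at almost every time, and pairings with coefficients pass to the limit. -/
theorem exists_coord (hU : IsLatticeLimit E C h T u U) (hE : 0 ≤ E) :
    ∃ Y : ℝ × Plane → EuclideanSpace ℝ (Fin 2 × Fin 2), Measurable Y ∧
      (∀ᵐ t : ℝ, ∫⁻ x, ‖Y (t, x)‖ₑ ^ 2 ≤ ENNReal.ofReal E) ∧
      ∀ {κ : ℝ} {B : Lor → Lor → Fin 2 → Lor}, IsCoefficient κ B →
      ∀ {R L : ℝ} {φ : ℕ → ℝ × Plane → ℝ} {φ' : ℝ × Plane → ℝ}, IsCutoff R L φ φ' → ∀ l : Fin 2,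
        Integrable (fun z => φ' z • ∑ a, Y z (l, a) • B (U z.1 z.2) (U z.1 z.2) a) ∧
        (∀ n, Integrable (fun z => φ n z • ∑ a, gradCoord (h n) (u n) z (l, a) •
          B (u n z.1 z.2) (u n z.1 (z.2 + h n • basisVec l)) a)) ∧
        Tendsto (fun n => ∫ z, φ n z • ∑ a, gradCoord (h n) (u n) z (l, a) •
          B (u n z.1 z.2) (u n z.1 (z.2 + h n • basisVec l)) a) (hyperfilter ℕ : Filter ℕ)
          (𝓝 (∫ z, φ' z • ∑ a, Y z (l, a) • B (U z.1 z.2) (U z.1 z.2) a)) := by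
  set b := √(∫ t : ℝ in Set.univ, ((1 + t ^ 2)⁻¹) ^ 2 * E)
  have hb : ∀ n, eLpNorm (weightedCoord (h n) (u n)) 2 volume ≤ ENNReal.ofReal b := fun n => by
    have := eLpNorm_weightedCoord_le hE (hU.approx n) Set.univ
    rwa [Set.univ_prod_univ, Measure.restrict_univ] at this
  have hf : ∀ n, MemLp (weightedCoord (h n) (u n)) 2 := fun n =>
    ⟨(measurable_weightedCoord (hU.approx n)).aestronglyMeasurable,
      (hb n).trans_lt ENNReal.ofReal_lt_top⟩
  obtain ⟨y, hy, hy2, hylim⟩ := exists_weak_limit (hyperfilter ℕ) hf (Real.sqrt_nonneg _) hb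
  have hyE := ae_lintegral_le_of_weak_limit (𝓤 := (hyperfilter ℕ : Filter ℕ)) hE hU.approx hy hy2
    fun g hg => hylim (fun _ => g) g (fun _ => hg) hg (by simp)
  -- the weight is removed again from the weak limit `y`
  have hw : ∀ z : ℝ × Plane, (1 + z.1 ^ 2) ≠ 0 := fun z => by positivity
  refine ⟨fun z => (1 + z.1 ^ 2) • y z, ?_, ?_, ?_⟩
  · exact (by fun_prop : Measurable fun z : ℝ × Plane => (1 + z.1 ^ 2)).smul hy.measurable
  · filter_upwards [hyE] with t ht
    have h0 : (0 : ℝ) ≤ 1 + t ^ 2 := by positivity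
    calc ∫⁻ x, ‖(1 + t ^ 2) • y (t, x)‖ₑ ^ 2
        = ∫⁻ x, ENNReal.ofReal ((1 + t ^ 2) ^ 2) * ‖y (t, x)‖ₑ ^ 2 := by
          refine lintegral_congr fun x => ?_
          rw [enorm_smul, mul_pow, Real.enorm_of_nonneg h0, ENNReal.ofReal_pow h0]
      _ = ENNReal.ofReal ((1 + t ^ 2) ^ 2) * ∫⁻ x, ‖y (t, x)‖ₑ ^ 2 :=
          lintegral_const_mul' _ _ ENNReal.ofReal_ne_top
      _ ≤ ENNReal.ofReal ((1 + t ^ 2) ^ 2) * ENNReal.ofReal (((1 + t ^ 2)⁻¹) ^ 2 * E) := by gcongr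
      _ = ENNReal.ofReal E := by
          rw [← ENNReal.ofReal_mul (by positivity)]; congr 1; field_simp
  · intro κ B hB R L φ φ' hφ l
    have key := fun j => hU.tendsto_testVector hB hφ l j
    have e1 : ∀ j n z, inner ℝ (testVector (φ n)
        (fun z => B (u n z.1 z.2) (u n z.1 (z.2 + h n • basisVec l))) l j z)
        (weightedCoord (h n) (u n) z) = (φ n z • ∑ a, gradCoord (h n) (u n) z (l, a) •
          B (u n z.1 z.2) (u n z.1 (z.2 + h n • basisVec l)) a) j := by
      intro j n z
      rw [inner_testVector]
      simp only [weightedCoord, PiLp.smul_apply, smul_eq_mul, mul_inv_cancel_left₀ (hw z)]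
    have e2 : ∀ j z, inner ℝ (testVector φ' (fun z => B (U z.1 z.2) (U z.1 z.2)) l j z) (y z) =
        (φ' z • ∑ a, ((1 + z.1 ^ 2) • y z) (l, a) • B (U z.1 z.2) (U z.1 z.2) a) j := by
      intro j z
      rw [inner_testVector]
      simp only [PiLp.smul_apply, smul_eq_mul]
    have i1 : ∀ n j, Integrable fun z => (φ n z • ∑ a, gradCoord (h n) (u n) z (l, a) •
          B (u n z.1 z.2) (u n z.1 (z.2 + h n • basisVec l)) a) j := fun n j => by
      simpa only [e1] using integrable_inner_of_memLp ((key j).1 n) (hf n)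
    have i2 : ∀ j, Integrable fun z =>
        (φ' z • ∑ a, ((1 + z.1 ^ 2) • y z) (l, a) • B (U z.1 z.2) (U z.1 z.2) a) j := fun j => by
      simpa only [e2] using integrable_inner_of_memLp (key j).2.1 hy2
    refine ⟨Integrable.of_eval i2, fun n => Integrable.of_eval (i1 n), tendsto_pi_nhds.2 fun j => ?_⟩
    rw [eval_integral i2]
    simp only [fun n => eval_integral (i1 n) j]
    have := hylim _ _ (key j).1 (key j).2.1 ((key j).2.2.mono_left Nat.hyperfilter_le_atTop)
    simpa only [e1, e2] using this

end IsLatticeLimit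

/-! ### The limit equation -/

namespace IsLatticeLimit

variable {E C : ℝ} {h T : ℕ → ℝ} {u : ℕ → ℝ → Plane → Lor} {U : ℝ → Plane → Lor}

theorem integrable_and_tendsto_integral_smul (hU : IsLatticeLimit E C h T u U) {R L : ℝ}
    {φ : ℕ → ℝ × Plane → ℝ} {φ' : ℝ × Plane → ℝ} (hφ : IsCutoff R L φ φ') :
    Integrable (fun z => φ' z • U z.1 z.2) ∧
    Tendsto (fun n => ∫ z, φ n z • u n z.1 z.2) atTop (𝓝 (∫ z, φ' z • U z.1 z.2)) := by
  set D := ENNReal.ofReal (2 ^ 15) * (2 * volume (Metric.closedBall (0 : Plane) R) +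
        2 * ENNReal.ofReal C) * volume (Set.Icc (-R) R)
  have hD : D ≠ ⊤ := by
    have := measure_closedBall_lt_top (μ := (volume : Measure Plane)) (x := 0) (r := R)
    have h2 : volume (Set.Icc (-R) R) < ⊤ := isCompact_Icc.measure_lt_top
    simp only [D]
    finiteness
  refine tendsto_integral_of_bound_four (K := box R) (isCompact_box R).measure_lt_top
    (fun n => ((hφ.measurable n).smul (hU.approx n).measurable).aestronglyMeasurable)
    (fun n z hz => by simp [hφ.support n z hz]) ?_ (fun z hz => by simp [hφ.support' z hz])
    (B := ENNReal.ofReal (L ^ 4) * D) (by finiteness) fun n => ?_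
  · filter_upwards [hU.ae_tendsto] with z hz using (hφ.tendsto z).smul hz
  · have hu := hU.approx n
    calc _ = ∫⁻ z in box R, ‖φ n z • u n z.1 z.2‖ₑ ^ 4 := by
          rw [setLIntegral_eq_of_support_subset]
          refine Function.support_subset_iff'.2 fun z hz => ?_
          simp [hφ.support n z hz]
      _ ≤ ∫⁻ z in box R, ENNReal.ofReal (L ^ 4) *
            ENNReal.ofReal ((u n z.1 z.2 0 + u n z.1 (z.2 + h n • basisVec 0) 0) ^ 8) := by
          refine lintegral_mono fun z => ?_
          have p1 := one_le_of_mem (hu.mem z.1 z.2)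
          have p2 := one_le_of_mem (hu.mem z.1 (z.2 + h n • basisVec 0))
          have p3 := norm_le_of_mem (hu.mem z.1 z.2)
          have := hφ.nonneg
          rw [← ofReal_norm, ← ENNReal.ofReal_pow (norm_nonneg _),
            ← ENNReal.ofReal_mul (by positivity), norm_smul, mul_pow]
          refine ENNReal.ofReal_le_ofReal ?_
          have q1 : ‖φ n z‖ ^ 4 ≤ L ^ 4 := by
            have := hφ.le n z; rw [Real.norm_eq_abs]; gcongr
          have q2 : ‖u n z.1 z.2‖ ^ 4 ≤
              (u n z.1 z.2 0 + u n z.1 (z.2 + h n • basisVec 0) 0) ^ 4 := by gcongr; linarith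
          have q3 : (u n z.1 z.2 0 + u n z.1 (z.2 + h n • basisVec 0) 0) ^ 4 ≤
              (u n z.1 z.2 0 + u n z.1 (z.2 + h n • basisVec 0) 0) ^ 8 :=
            pow_le_pow_right₀ (by linarith) (by norm_num)
          exact mul_le_mul q1 (q2.trans q3) (by positivity) (by positivity)
      _ = ENNReal.ofReal (L ^ 4) * ∫⁻ z in box R,
            ENNReal.ofReal ((u n z.1 z.2 0 + u n z.1 (z.2 + h n • basisVec 0) 0) ^ 8) :=
          lintegral_const_mul' _ _ ENNReal.ofReal_ne_top
      _ ≤ _ := by gcongr; exact hu.lintegral_box_le R 0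

theorem isCutoff_const {φ : ℝ × Plane → ℝ} (hφ : Continuous φ) (hc : HasCompactSupport φ) :
    ∃ R L, IsCutoff R L (fun _ => φ) φ := by
  obtain ⟨R, -, hR⟩ := exists_box_of_hasCompactSupport hc
  obtain ⟨L, hL⟩ := hφ.bounded_above_of_compact_support hc
  exact ⟨R, L, (norm_nonneg _).trans (hL 0), fun _ => hφ.measurable, fun _ z => hL z,
    fun _ z hz => by simpa using hR 0 (by simp) z hz, fun _ => tendsto_const_nhds⟩

theorem isCutoff_indicator {R : ℝ} :
    IsCutoff R 1 (fun _ => (box R).indicator 1) ((box R).indicator 1) where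
  nonneg := zero_le_one
  measurable _ := measurable_one.indicator (measurableSet_box R)
  le _ z := by by_cases hz : z ∈ box R <;> simp [hz]
  support _ z hz := by simp [hz]
  tendsto _ := tendsto_const_nhds

/-- Difference quotients of a test function form an admissible sequence of factors. -/
theorem isCutoff_quotient {φ : ℝ × Plane → ℝ} (hφ : ContDiff ℝ ∞ φ) (hc : HasCompactSupport φ)
    {h : ℕ → ℝ} (hpos : ∀ n, 0 < h n) (hle : ∀ n, h n ≤ 1) (hh : Tendsto h atTop (𝓝 0))
    {v : ℝ × Plane} (hv : ‖v‖ ≤ 1) :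
    ∃ R L, IsCutoff R L (fun n z => (h n)⁻¹ * (φ (z + h n • v) - φ z))
      (fun z => fderiv ℝ φ z v) := by
  obtain ⟨R, -, hR⟩ := exists_box_of_hasCompactSupport hc
  obtain ⟨L, hL⟩ := ContDiff.lipschitzWith_of_hasCompactSupport hc hφ (by simp)
  have hcont := hφ.continuous
  refine ⟨R, L, L.2, fun n => ?_, fun n z => ?_, fun n z hz => ?_, fun z => ?_⟩
  · exact (by fun_prop : Continuous fun z => (h n)⁻¹ * (φ (z + h n • v) - φ z)).measurable
  · have h1 := hL.dist_le_mul (z + h n • v) z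
    rw [Real.dist_eq, dist_eq_norm, add_sub_cancel_left, norm_smul,
      Real.norm_of_nonneg (hpos n).le] at h1
    rw [abs_mul, abs_of_pos (inv_pos.2 (hpos n)), inv_mul_le_iff₀ (hpos n)]
    calc _ ≤ L * (h n * ‖v‖) := h1
      _ ≤ L * (h n * 1) := by have := (hpos n).le; gcongr
      _ = _ := by ring
  · have h1 : ‖h n • v‖ ≤ 1 := by
      rw [norm_smul, Real.norm_of_nonneg (hpos n).le]
      exact mul_le_one₀ (hle n) (norm_nonneg _) hv
    have h0 := hR 0 (by simp) z hz
    rw [add_zero] at h0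
    simp [hR _ h1 z hz, h0]
  · have hd := (hφ.differentiable (by simp) z).hasFDerivAt
    have hinv : Tendsto (fun n => ‖(h n)⁻¹‖) atTop atTop := by
      have h0 : Tendsto h atTop (𝓝[>] 0) :=
        tendsto_nhdsWithin_iff.2 ⟨hh, Eventually.of_forall hpos⟩
      refine (tendsto_inv_nhdsGT_zero.comp h0).congr fun n => ?_
      rw [Real.norm_of_nonneg (inv_nonneg.2 (hpos n).le)]; rfl
    simpa using hd.lim v hinv

theorem flux_sum_smul (v : Lor) (y : Fin 2 → Fin 2 → ℝ) (b : Fin 2 → Lor) (l : Fin 2) :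
    flux v (fun k => ∑ a, y k a • b a) l = ∑ a, y l a • eta *ᵥ (v ⨯₃ b a) := by
  simp only [flux, map_sum, map_smul, Matrix.mulVec_sum, Matrix.mulVec_smul]

theorem gradNorm_sum_smul_frame {m : Lor} (hm : m ∈ hyperbolicPlane)
    (y : EuclideanSpace ℝ (Fin 2 × Fin 2)) :
    gradNorm (fun k => ∑ a, y (k, a) • frame m a) = ‖y‖ := by
  rw [gradNorm, EuclideanSpace.norm_eq, Fintype.sum_prod_type]
  congr 1
  refine Finset.sum_congr rfl fun l _ => ?_
  rw [lorentzForm_frame hm, abs_of_nonneg (by positivity)]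
  simp

theorem norm_basisVec_prod (l : Fin 2) : ‖((0, basisVec l) : ℝ × Plane)‖ ≤ 1 := by
  simp [Prod.norm_def, norm_basisVec]

theorem locallyIntegrable_of_box {F : Type*} [NormedAddCommGroup F] [NormedSpace ℝ F]
    {f : ℝ × Plane → F}
    (hf : ∀ R, Integrable fun z => (box R).indicator (1 : ℝ × Plane → ℝ) z • f z) :
    LocallyIntegrable f := by
  refine locallyIntegrable_iff.2 fun K hK => ?_
  obtain ⟨R, -, hR⟩ := exists_subset_box hK
  refine IntegrableOn.mono_set ?_ hR
  rw [← integrable_indicator_iff (measurableSet_box R)]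
  refine (hf R).congr (Eventually.of_forall fun z => ?_)
  by_cases hz : z ∈ box R <;> simp [hz]

theorem locallyIntegrable (hU : IsLatticeLimit E C h T u U) :
    LocallyIntegrable fun z : ℝ × Plane => U z.1 z.2 :=
  locallyIntegrable_of_box fun _ =>
    (hU.integrable_and_tendsto_integral_smul isCutoff_indicator).1

/-- The limit of lattice approximations is weakly differentiable in space on space-time and solves
the Schrödinger map equation in the sense of distributions. The gradient has the weak limits of the
coordinates as its coordinates in the frame at the limit map. -/
theorem exists_gradient (hU : IsLatticeLimit E C h T u U) (hE : 0 ≤ E) :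
    ∃ G : ℝ → Plane → Fin 2 → Lor,
      (∀ l, LocallyIntegrable fun z : ℝ × Plane => G z.1 z.2 l) ∧
      (∀ l, LocallyIntegrable fun z : ℝ × Plane => flux (U z.1 z.2) (G z.1 z.2) l) ∧
      (∀ᵐ t : ℝ, MemLp (fun x => gradNorm (G t x)) 2 ∧
        eLpNorm (fun x => gradNorm (G t x)) 2 volume ≤ ENNReal.ofReal √E) ∧
      (∀ φ : ℝ × Plane → ℝ, ContDiff ℝ ∞ φ → HasCompactSupport φ → ∀ l,
        ∫ z, fderiv ℝ φ z (0, EuclideanSpace.single l 1) • U z.1 z.2 =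
          -∫ z, φ z • G z.1 z.2 l) ∧
      (∀ φ : ℝ × Plane → ℝ, ContDiff ℝ ∞ φ → HasCompactSupport φ →
        ∫ z, fderiv ℝ φ z (1, 0) • U z.1 z.2 =
          ∫ z, ∑ l, fderiv ℝ φ z (0, EuclideanSpace.single l 1) •
            flux (U z.1 z.2) (G z.1 z.2) l) := by
  obtain ⟨Y, hY, hYE, hYlim⟩ := hU.exists_coord hE
  have hpos : ∀ n, 0 < h n := fun n => (hU.approx n).mesh_pos
  set G : ℝ → Plane → Fin 2 → Lor := fun t x l => ∑ a, Y (t, x) (l, a) • frame (U t x) a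
  -- in the limit both values agree, and the midpoint of a point with itself is that point
  have hG : ∀ (φ : ℝ × Plane → ℝ) l, (fun z => φ z • ∑ a, Y z (l, a) •
      frame (midpt (U z.1 z.2) (U z.1 z.2)) a) =ᵐ[volume] fun z => φ z • G z.1 z.2 l := by
    intro φ l
    filter_upwards [hU.ae_mem] with z hz
    rw [midpt_self hz]
  have hF : ∀ (φ : ℝ × Plane → ℝ) l, (fun z => φ z • ∑ a, Y z (l, a) • eta *ᵥ (U z.1 z.2 ⨯₃
      frame (midpt (U z.1 z.2) (U z.1 z.2)) a)) =ᵐ[volume]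
      fun z => φ z • flux (U z.1 z.2) (G z.1 z.2) l := by
    intro φ l
    filter_upwards [hU.ae_mem] with z hz
    rw [midpt_self hz]
    simp only [G]
    rw [flux_sum_smul (U z.1 z.2) (fun l a => Y (z.1, z.2) (l, a))]
  refine ⟨G, fun l => ?_, fun l => ?_, ?_, fun φ hφ hc l => ?_, fun φ hφ hc => ?_⟩
  · exact locallyIntegrable_of_box fun R =>
      (hYlim isCoefficient_frame isCutoff_indicator l).1.congr (hG _ l)
  · exact locallyIntegrable_of_box fun R =>
      (hYlim isCoefficient_cross isCutoff_indicator l).1.congr (hF _ l)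
  · filter_upwards [hYE] with t ht
    have hae : (fun x => gradNorm (G t x)) =ᵐ[volume] fun x => ‖Y (t, x)‖ := by
      filter_upwards [hU.mem t] with x hx using gradNorm_sum_smul_frame hx _
    have hle : eLpNorm (fun x => gradNorm (G t x)) 2 volume ≤ ENNReal.ofReal √E := by
      rw [eLpNorm_congr_ae hae, eLpNorm_norm, eLpNorm_two_le_iff,
        ← ENNReal.ofReal_pow (Real.sqrt_nonneg _), Real.sq_sqrt hE]
      exact ht
    exact ⟨⟨(hY.comp measurable_prodMk_left).norm.aestronglyMeasurable.congr hae.symm,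
      hle.trans_lt ENNReal.ofReal_lt_top⟩, hle⟩
  · obtain ⟨R, L, hcut⟩ := isCutoff_const hφ.continuous hc
    obtain ⟨R', L', hcut'⟩ := isCutoff_quotient hφ hc hpos hU.mesh_le hU.mesh_tendsto
      (v := -(0, basisVec l)) (by rw [norm_neg]; exact norm_basisVec_prod l)
    have l1 := (hYlim isCoefficient_frame hcut l).2.2
    have l2 := (hU.integrable_and_tendsto_integral_smul hcut').2.mono_left
      Nat.hyperfilter_le_atTop
    rw [integral_congr_ae (hG φ l)] at l1
    -- summation by parts turns the difference quotient of `u n` into one of `φ`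
    have heq : ∀ n, ∫ z, φ z • ∑ a, gradCoord (h n) (u n) z (l, a) •
        frame (midpt (u n z.1 z.2) (u n z.1 (z.2 + h n • basisVec l))) a =
        ∫ z, ((h n)⁻¹ * (φ (z + h n • -(0, basisVec l)) - φ z)) • u n z.1 z.2 := by
      intro n
      obtain ⟨B, hB⟩ := (hU.approx n).bounded
      have := integral_smul_shift_sub (μ := (volume : Measure (ℝ × Plane))) hφ.continuous hc
        (f := fun z : ℝ × Plane => u n z.1 z.2)
        (hU.approx n).measurable.stronglyMeasurable (fun z => hB z.1 z.2) (0, h n • basisVec l)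
      simp only [(hU.approx n).sum_gradCoord_smul_frame, mul_smul]
      rw [integral_smul]
      calc _ = (h n)⁻¹ • ∫ z : ℝ × Plane, φ z •
            (u n z.1 (z.2 + h n • basisVec l) - u n z.1 z.2) := by
            rw [← integral_smul]
            refine integral_congr_ae (Eventually.of_forall fun z => ?_)
            exact smul_comm _ _ _
        _ = _ := by
            congr 1
            simpa [sub_eq_add_neg] using this
    simp only [heq] at l1
    have := tendsto_nhds_unique l1 l2
    rw [this, ← integral_neg]
    refine integral_congr_ae (Eventually.of_forall fun z => ?_)
    simp only [map_neg, neg_smul, neg_neg, basisVec]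
  · have hc1 : Continuous fun z => fderiv ℝ φ z (1, 0) :=
      (hφ.continuous_fderiv (by simp)).clm_apply continuous_const
    have hc2 : HasCompactSupport fun z => fderiv ℝ φ z (1, 0) :=
      (hc.fderiv (𝕜 := ℝ)).comp_left (g := fun A : ℝ × Plane →L[ℝ] ℝ => A (1, 0)) rfl
    obtain ⟨R, L, hcut⟩ := isCutoff_const hc1 hc2
    have l1 := (hU.integrable_and_tendsto_integral_smul hcut).2.mono_left
      Nat.hyperfilter_le_atTop
    choose R' L' hcut' using fun l => isCutoff_quotient hφ hc hpos hU.mesh_le hU.mesh_tendsto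
      (v := (0, basisVec l)) (norm_basisVec_prod l)
    have hl := fun l => hYlim isCoefficient_cross (hcut' l) l
    have l2 := tendsto_finsetSum Finset.univ fun l _ => (hl l).2.2
    obtain ⟨R₀, -, hR₀⟩ := exists_subset_box hc
    -- eventually the support of `φ` lies where the lattice flow is satisfied
    have hev : ∀ᶠ n in (hyperfilter ℕ : Filter ℕ), ∫ z, fderiv ℝ φ z (1, 0) • u n z.1 z.2 =
        ∑ l, ∫ z, ((h n)⁻¹ * (φ (z + h n • (0, basisVec l)) - φ z)) •
          ∑ a, gradCoord (h n) (u n) z (l, a) • eta *ᵥ (u n z.1 z.2 ⨯₃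
            frame (midpt (u n z.1 z.2) (u n z.1 (z.2 + h n • basisVec l))) a) := by
      filter_upwards [Nat.hyperfilter_le_atTop (hU.time_tendsto.eventually_gt_atTop R₀)] with n hn
      rw [(hU.approx n).integral_time_deriv hφ hc fun z hz => ?_]
      · rw [← integral_finsetSum _ fun l _ => (hl l).2.1 n]
        refine integral_congr_ae (Eventually.of_forall fun z => Finset.sum_congr rfl fun l _ => ?_)
        simp only [(hU.approx n).sum_gradCoord_smul_cross, Prod.smul_mk, smul_zero]
      · obtain ⟨z1, z2⟩ := hR₀ hz
        exact ⟨⟨by linarith [z1.1], by linarith [z1.2]⟩,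
          (mem_closedBall_zero_iff.1 z2).trans_lt hn⟩
    rw [tendsto_nhds_unique (l1.congr' hev) l2]
    rw [← integral_finsetSum _ fun l _ => (hl l).1]
    have := fun l => hF (fun z => fderiv ℝ φ z (0, basisVec l)) l
    refine integral_congr_ae ?_
    filter_upwards [ae_all_iff.2 this] with z hz
    exact Finset.sum_congr rfl fun l _ => hz l

end IsLatticeLimit

/-! ### Weak gradients at almost every time -/

section Slices

variable {F : Type*} [NormedAddCommGroup F] [NormedSpace ℝ F]

theorem integrableOn_strip {f : ℝ × Plane → F} (hf : LocallyIntegrable f) {ψ : Plane → ℝ}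
    (hψ : Continuous ψ) (hψc : HasCompactSupport ψ) (k : ℝ) :
    IntegrableOn (fun z => ψ z.2 • f z) (Set.Icc (-k) k ×ˢ Set.univ) := by
  have hK : IsCompact (Set.Icc (-k) k ×ˢ tsupport ψ) := isCompact_Icc.prod hψc
  have h1 : IntegrableOn (fun z => ψ z.2 • f z) (Set.Icc (-k) k ×ˢ tsupport ψ) :=
    (hf.integrableOn_isCompact hK).continuousOn_smul (by fun_prop) hK
  refine h1.of_forall_sdiff_eq_zero (measurableSet_Icc.prod MeasurableSet.univ) fun z hz => ?_
  have : z.2 ∉ tsupport ψ := fun h => hz.2 ⟨hz.1.1, h⟩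
  rw [image_eq_zero_of_notMem_tsupport this, zero_smul]

theorem integrable_strip {f : ℝ × Plane → F} (hf : LocallyIntegrable f) {ψ : Plane → ℝ}
    (hψ : Continuous ψ) (hψc : HasCompactSupport ψ) (k : ℝ) :
    Integrable (fun z => ψ z.2 • f z)
      (((volume : Measure ℝ).restrict (Set.Icc (-k) k)).prod (volume : Measure Plane)) := by
  have := integrableOn_strip hf hψ hψc k
  rwa [IntegrableOn, Measure.volume_eq_prod, ← Measure.prod_restrict, Measure.restrict_univ] at this

theorem locallyIntegrable_slice_integral {f : ℝ × Plane → F} (hf : LocallyIntegrable f)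
    {ψ : Plane → ℝ} (hψ : Continuous ψ) (hψc : HasCompactSupport ψ) :
    LocallyIntegrable fun t : ℝ => ∫ x, ψ x • f (t, x) := by
  refine locallyIntegrable_iff.2 fun K hK => ?_
  obtain ⟨k, hk⟩ := hK.isBounded.subset_closedBall 0
  rw [Real.closedBall_eq_Icc, zero_sub, zero_add] at hk
  exact IntegrableOn.mono_set (integrable_strip hf hψ hψc k).integral_prod_left hk

theorem integral_smul_slice_integral {f : ℝ × Plane → F} (hf : LocallyIntegrable f) {χ : ℝ → ℝ}
    (hχ : Continuous χ) (hχc : HasCompactSupport χ) {ψ : Plane → ℝ} (hψ : Continuous ψ)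
    (hψc : HasCompactSupport ψ) :
    ∫ t, χ t • ∫ x, ψ x • f (t, x) = ∫ z, (χ z.1 * ψ z.2) • f z := by
  have hi : Integrable fun z => (χ z.1 * ψ z.2) • f z := by
    refine hf.integrable_smul_left_of_hasCompactSupport (by fun_prop) ?_
    refine HasCompactSupport.intro (hχc.prod hψc) fun z hz => ?_
    by_cases h : z.1 ∈ tsupport χ
    · have : z.2 ∉ tsupport ψ := fun h' => hz ⟨h, h'⟩
      rw [image_eq_zero_of_notMem_tsupport this, mul_zero]
    · rw [image_eq_zero_of_notMem_tsupport h, zero_mul]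
  rw [Measure.volume_eq_prod] at hi ⊢
  rw [integral_prod _ hi]
  refine integral_congr_ae (Eventually.of_forall fun t => ?_)
  simp only [mul_smul]
  rw [integral_smul]

end Slices

theorem ae_locallyIntegrable_slice {F : Type*} [NormedAddCommGroup F] {f : ℝ × Plane → F} (hf : LocallyIntegrable f) :
    ∀ᵐ t : ℝ, LocallyIntegrable fun x => f (t, x) := by
  have h1 : ∀ k : ℕ, ∀ᵐ t : ℝ, t ∈ Set.Icc (-(k : ℝ)) k →
      IntegrableOn (fun x => f (t, x)) (Metric.closedBall 0 k) := by
    intro k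
    have := hf.integrableOn_isCompact (isCompact_box k)
    rw [IntegrableOn, box, Measure.volume_eq_prod, ← Measure.prod_restrict] at this
    exact (ae_restrict_iff' measurableSet_Icc).1 this.prod_right_ae
  filter_upwards [ae_all_iff.2 h1] with t ht
  refine locallyIntegrable_iff.2 fun K hK => ?_
  obtain ⟨R, hR⟩ := hK.isBounded.subset_closedBall (0 : Plane)
  obtain ⟨k, hk⟩ := exists_nat_ge (max |t| R)
  exact (ht k (abs_le.1 ((le_max_left _ _).trans hk))).mono_set
    (hR.trans (Metric.closedBall_subset_closedBall ((le_max_right _ _).trans hk)))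

/-- A countable family of test functions which approximates, uniformly together with the first
derivatives and with control of the supports, all test functions supported in a given ball. -/
theorem exists_countable_dense_testFunctions (k : ℕ) :
    ∃ d : ℕ → Plane → ℝ, (∀ i, ContDiff ℝ ∞ (d i) ∧ tsupport (d i) ⊆ Metric.closedBall 0 k) ∧
      ∀ φ : Plane → ℝ, ContDiff ℝ ∞ φ → tsupport φ ⊆ Metric.closedBall 0 k → ∀ ε > 0, ∃ i,
        ∀ x ∈ Metric.closedBall (0 : Plane) k, ‖φ x - d i x‖ ≤ ε ∧
          ‖fderiv ℝ φ x - fderiv ℝ (d i) x‖ ≤ ε := by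
  set S : Type := {φ : Plane → ℝ // ContDiff ℝ ∞ φ ∧ tsupport φ ⊆ Metric.closedBall 0 k}
  have hfd : ∀ φ : S, Continuous fun x => fderiv ℝ φ.1 x := fun φ =>
    φ.2.1.continuous_fderiv (by simp)
  let J : S → C(Metric.closedBall (0 : Plane) k, ℝ × (Plane →L[ℝ] ℝ)) := fun φ =>
    ⟨fun x => (φ.1 x, fderiv ℝ φ.1 x), by
      have := φ.2.1.continuous
      have := hfd φ
      fun_prop⟩
  have : CompactSpace (Metric.closedBall (0 : Plane) k) :=
    isCompact_iff_compactSpace.1 (isCompact_closedBall _ _)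
  have : Nonempty (Set.range J) := ⟨⟨_, Set.mem_range_self
    ⟨fun _ => 0, contDiff_const, by simp [tsupport, Function.support_fun_zero]⟩⟩⟩
  choose d hd using fun i => (TopologicalSpace.denseSeq (Set.range J) i).2
  refine ⟨fun i => (d i).1, fun i => (d i).2, fun φ hφ hφs ε hε => ?_⟩
  have hdr := TopologicalSpace.denseRange_denseSeq (Set.range J)
  let p : Set.range J := ⟨J ⟨φ, hφ, hφs⟩, Set.mem_range_self _⟩
  obtain ⟨i, hi⟩ := (Metric.mem_closure_range_iff (α := Set.range J) (a := p)
    (e := TopologicalSpace.denseSeq (Set.range J))).1 (hdr p) ε hε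
  rw [Subtype.dist_eq, ← hd i] at hi
  refine ⟨i, fun x hx => ?_⟩
  have h1 := (ContinuousMap.dist_apply_le_dist (f := J ⟨φ, hφ, hφs⟩) (g := J (d i)) ⟨x, hx⟩).trans
    hi.le
  rw [dist_eq_norm] at h1
  exact ⟨(norm_fst_le _).trans h1, (norm_snd_le _).trans h1⟩

theorem fderiv_mul_prod {χ : ℝ → ℝ} {φ : Plane → ℝ} (hχ : ContDiff ℝ ∞ χ) (hφ : ContDiff ℝ ∞ φ)
    (z : ℝ × Plane) (v : Plane) :
    fderiv ℝ (fun z : ℝ × Plane => χ z.1 * φ z.2) z (0, v) = χ z.1 * fderiv ℝ φ z.2 v := by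
  have h1 := (hχ.differentiable (by simp) z.1).hasFDerivAt.comp z hasFDerivAt_fst
  have h2 := (hφ.differentiable (by simp) z.2).hasFDerivAt.comp z hasFDerivAt_snd
  have h3 := (h1.mul h2).fderiv
  have h4 : (fun z : ℝ × Plane => χ z.1 * φ z.2) = (χ ∘ Prod.fst) * (φ ∘ Prod.snd) := rfl
  rw [h4, h3]
  simp

/-- For a single test function in space the identity defining the weak gradient holds at almost every
time: test with its products with functions of time. The exceptional set depends on the test
function. -/
theorem integral_fderiv_add_eq_zero {U : ℝ → Plane → Lor} {G : ℝ → Plane → Fin 2 → Lor}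
    (hU : LocallyIntegrable fun z : ℝ × Plane => U z.1 z.2)
    (hG : ∀ l, LocallyIntegrable fun z : ℝ × Plane => G z.1 z.2 l)
    (hw : ∀ φ : ℝ × Plane → ℝ, ContDiff ℝ ∞ φ → HasCompactSupport φ → ∀ l,
      ∫ z, fderiv ℝ φ z (0, EuclideanSpace.single l 1) • U z.1 z.2 = -∫ z, φ z • G z.1 z.2 l)
    {φ : Plane → ℝ} (hφ : ContDiff ℝ ∞ φ) (hφc : HasCompactSupport φ) (l : Fin 2) :
    ∀ᵐ t : ℝ, (∫ x, fderiv ℝ φ x (EuclideanSpace.single l 1) • U t x) +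
      ∫ x, φ x • G t x l = 0 := by
  have hc1 : Continuous fun x => fderiv ℝ φ x (EuclideanSpace.single l 1) :=
    (hφ.continuous_fderiv (by simp)).clm_apply continuous_const
  have hc2 : HasCompactSupport fun x => fderiv ℝ φ x (EuclideanSpace.single l 1) :=
    (hφc.fderiv (𝕜 := ℝ)).comp_left
      (g := fun A : Plane →L[ℝ] ℝ => A (EuclideanSpace.single l 1)) rfl
  have L1 := locallyIntegrable_slice_integral hU hc1 hc2
  have L2 := locallyIntegrable_slice_integral (hG l) hφ.continuous hφc
  refine ae_eq_zero_of_integral_contDiff_smul_eq_zero (L1.add L2) fun χ hχ hχc => ?_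
  have I1 := L1.integrable_smul_left_of_hasCompactSupport hχ.continuous hχc
  have I2 := L2.integrable_smul_left_of_hasCompactSupport hχ.continuous hχc
  have hprod : HasCompactSupport fun z : ℝ × Plane => χ z.1 * φ z.2 := by
    refine HasCompactSupport.intro (hχc.prod hφc) fun z hz => ?_
    by_cases h : z.1 ∈ tsupport χ
    · have : z.2 ∉ tsupport φ := fun h' => hz ⟨h, h'⟩
      rw [image_eq_zero_of_notMem_tsupport this, mul_zero]
    · rw [image_eq_zero_of_notMem_tsupport h, zero_mul]
  have key := hw (fun z => χ z.1 * φ z.2)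
    ((hχ.comp contDiff_fst).mul (hφ.comp contDiff_snd)) hprod l
  simp only [fderiv_mul_prod hχ hφ] at key
  simp only [smul_add]
  rw [integral_add I1 I2, integral_smul_slice_integral hU hχ.continuous hχc hc1 hc2,
    integral_smul_slice_integral (hG l) hχ.continuous hχc hφ.continuous hφc, key, neg_add_cancel]

theorem norm_setIntegral_smul_sub_le {F : Type*} [NormedAddCommGroup F] [NormedSpace ℝ F]
    {K : Set Plane} (hK : MeasurableSet K) {f : Plane → F} (hf : IntegrableOn f K)
    {a b : Plane → ℝ} (ha : ∀ x ∉ K, a x = 0) (hb : ∀ x ∉ K, b x = 0)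
    (hai : Integrable fun x => a x • f x) (hbi : Integrable fun x => b x • f x) {ε : ℝ}
    (hab : ∀ x ∈ K, ‖a x - b x‖ ≤ ε) :
    ‖(∫ x, a x • f x) - ∫ x, b x • f x‖ ≤ ε * ∫ x in K, ‖f x‖ := by
  rw [← integral_sub hai hbi, ← setIntegral_eq_integral_of_forall_compl_eq_zero (s := K)
    (fun x hx => by rw [ha x hx, hb x hx]; simp), ← integral_const_mul]
  refine norm_integral_le_of_norm_le (hf.norm.const_mul ε) ?_
  filter_upwards [ae_restrict_mem hK] with x hx
  rw [← sub_smul, norm_smul]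
  exact mul_le_mul_of_nonneg_right (hab x hx) (norm_nonneg _)

/-- A weak gradient on space-time is a weak gradient in space at almost every time. The identity
holds at almost every time for countably many test functions, and by density for all others. -/
theorem ae_hasWeakGradient {U : ℝ → Plane → Lor} {G : ℝ → Plane → Fin 2 → Lor}
    (hU : LocallyIntegrable fun z : ℝ × Plane => U z.1 z.2)
    (hG : ∀ l, LocallyIntegrable fun z : ℝ × Plane => G z.1 z.2 l)
    (hw : ∀ φ : ℝ × Plane → ℝ, ContDiff ℝ ∞ φ → HasCompactSupport φ → ∀ l,
      ∫ z, fderiv ℝ φ z (0, EuclideanSpace.single l 1) • U z.1 z.2 = -∫ z, φ z • G z.1 z.2 l) :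
    ∀ᵐ t : ℝ, HasWeakGradient (U t) (G t) := by
  choose d hd hdense using exists_countable_dense_testFunctions
  have hcomp : ∀ {k : ℕ} {φ : Plane → ℝ}, tsupport φ ⊆ Metric.closedBall 0 k →
      HasCompactSupport φ := fun h =>
    (isCompact_closedBall _ _).of_isClosed_subset (isClosed_tsupport _) h
  have hz : ∀ (k i : ℕ) (l : Fin 2), ∀ᵐ t : ℝ,
      (∫ x, fderiv ℝ (d k i) x (EuclideanSpace.single l 1) • U t x) +
      ∫ x, d k i x • G t x l = 0 := fun k i l =>
    integral_fderiv_add_eq_zero hU hG hw (hd k i).1 (hcomp (hd k i).2) l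
  filter_upwards [ae_locallyIntegrable_slice hU,
    ae_all_iff.2 fun l => ae_locallyIntegrable_slice (hG l),
    ae_all_iff.2 fun k => ae_all_iff.2 fun i => ae_all_iff.2 fun l => hz k i l] with t h1 h2 h3
  refine ⟨h1, h2, fun φ hφ hφc l => ?_⟩
  obtain ⟨R, hR⟩ := hφc.isCompact.isBounded.subset_closedBall (0 : Plane)
  obtain ⟨k, hk⟩ := exists_nat_ge R
  have hφk : tsupport φ ⊆ Metric.closedBall 0 k :=
    hR.trans (Metric.closedBall_subset_closedBall hk)
  have hint : ∀ {ψ : Plane → ℝ}, ContDiff ℝ ∞ ψ → tsupport ψ ⊆ Metric.closedBall 0 k →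
      (Integrable fun x => fderiv ℝ ψ x (EuclideanSpace.single l 1) • U t x) ∧
      (Integrable fun x => ψ x • G t x l) ∧
      (∀ x ∉ Metric.closedBall (0 : Plane) k, fderiv ℝ ψ x (EuclideanSpace.single l 1) = 0) ∧
      (∀ x ∉ Metric.closedBall (0 : Plane) k, ψ x = 0) := by
    intro ψ hψ hψk
    refine ⟨h1.integrable_smul_left_of_hasCompactSupport
      ((hψ.continuous_fderiv (by simp)).clm_apply continuous_const)
      (((hcomp hψk).fderiv (𝕜 := ℝ)).comp_left
        (g := fun A : Plane →L[ℝ] ℝ => A (EuclideanSpace.single l 1)) rfl),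
      (h2 l).integrable_smul_left_of_hasCompactSupport hψ.continuous (hcomp hψk),
      fun x hx => ?_, fun x hx => image_eq_zero_of_notMem_tsupport fun h => hx (hψk h)⟩
    have : fderiv ℝ ψ x = 0 := image_eq_zero_of_notMem_tsupport fun h =>
      hx (hψk (tsupport_fderiv_subset ℝ h))
    rw [this]; rfl
  set M := (∫ x in Metric.closedBall 0 (k : ℝ), ‖U t x‖) +
    ∫ x in Metric.closedBall 0 (k : ℝ), ‖G t x l‖
  have hM : 0 ≤ M := by positivity
  have hle : ∀ ε > 0, ‖(∫ x, fderiv ℝ φ x (EuclideanSpace.single l 1) • U t x) +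
      ∫ x, φ x • G t x l‖ ≤ ε * M := by
    intro ε hε
    obtain ⟨i, hi⟩ := hdense k φ hφ hφk ε hε
    obtain ⟨a1, a2, a3, a4⟩ := hint hφ hφk
    obtain ⟨b1, b2, b3, b4⟩ := hint (hd k i).1 (hd k i).2
    have c1 := norm_setIntegral_smul_sub_le measurableSet_closedBall
      (h1.integrableOn_isCompact (isCompact_closedBall _ _)) a3 b3 a1 b1 (ε := ε) fun x hx => by
        rw [← sub_apply]
        refine (ContinuousLinearMap.le_opNorm _ _).trans ?_
        simpa using (hi x hx).2
    have c2 := norm_setIntegral_smul_sub_le measurableSet_closedBall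
      ((h2 l).integrableOn_isCompact (isCompact_closedBall _ _)) a4 b4 a2 b2 fun x hx =>
        (hi x hx).1
    have h0 := h3 k i l
    calc _ = ‖((∫ x, fderiv ℝ φ x (EuclideanSpace.single l 1) • U t x) -
          ∫ x, fderiv ℝ (d k i) x (EuclideanSpace.single l 1) • U t x) +
          ((∫ x, φ x • G t x l) - ∫ x, d k i x • G t x l)‖ := by
          congr 1
          rw [← sub_zero (_ + ∫ x, φ x • G t x l), ← h0]; abel
      _ ≤ _ := (norm_add_le _ _).trans (by rw [mul_add]; exact add_le_add c1 c2)
  have hzero : ‖(∫ x, fderiv ℝ φ x (EuclideanSpace.single l 1) • U t x) +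
      ∫ x, φ x • G t x l‖ ≤ 0 := by
    refine le_of_forall_pos_le_add fun δ hδ => ?_
    refine (hle (δ / (M + 1)) (by positivity)).trans ?_
    rw [zero_add, div_mul_eq_mul_div, div_le_iff₀ (by positivity)]
    nlinarith
  exact eq_neg_of_add_eq_zero_left (norm_le_zero_iff.1 hzero)

/-! ### Continuity in time and conservation of mass -/

/-- A smooth cutoff function, equal to one on the ball of radius `R` and supported in the ball of
radius `2R`. -/
noncomputable def cutoff (R : ℝ) (x : Plane) : ℝ :=
  (⟨1, 2, one_pos, one_lt_two⟩ : ContDiffBump (0 : Plane)) (R⁻¹ • x)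

theorem contDiff_cutoff (R : ℝ) : ContDiff ℝ ∞ (cutoff R) :=
  (ContDiffBump.contDiff _).comp (contDiff_const_smul _)

theorem cutoff_nonneg (R : ℝ) (x : Plane) : 0 ≤ cutoff R x := ContDiffBump.nonneg _

theorem cutoff_le_one (R : ℝ) (x : Plane) : cutoff R x ≤ 1 := ContDiffBump.le_one _

theorem cutoff_eq_one {R : ℝ} (hR : 0 < R) {x : Plane} (hx : ‖x‖ ≤ R) : cutoff R x = 1 := by
  refine ContDiffBump.one_of_mem_closedBall _ ?_
  rw [mem_closedBall_zero_iff, norm_smul, norm_inv, Real.norm_of_nonneg hR.le]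
  exact inv_mul_le_one_of_le₀ hx hR.le

theorem norm_lt_of_cutoff_ne_zero {R : ℝ} (hR : 0 < R) {x : Plane} (hx : cutoff R x ≠ 0) :
    ‖x‖ < 2 * R := by
  by_contra! h
  refine hx (ContDiffBump.zero_of_le_dist _ ?_)
  rw [dist_zero_right, norm_smul, norm_inv, Real.norm_of_nonneg hR.le, le_inv_mul_iff₀ hR]
  linarith

theorem hasCompactSupport_cutoff {R : ℝ} (hR : 0 < R) : HasCompactSupport (cutoff R) :=
  HasCompactSupport.intro (isCompact_closedBall (0 : Plane) (2 * R)) fun x hx => by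
    by_contra h
    exact hx (mem_closedBall_zero_iff.2 (norm_lt_of_cutoff_ne_zero hR h).le)

theorem exists_cutoff_lipschitz : ∃ L : ℝ, 0 ≤ L ∧ ∀ R > 0, ∀ x y,
    |cutoff R x - cutoff R y| ≤ L / R * ‖x - y‖ := by
  obtain ⟨L, hL⟩ := ContDiff.lipschitzWith_of_hasCompactSupport (𝕂 := ℝ) (n := 1)
    (ContDiffBump.hasCompactSupport (⟨1, 2, one_pos, one_lt_two⟩ : ContDiffBump (0 : Plane)))
    (ContDiffBump.contDiff _) one_ne_zero
  refine ⟨L, L.2, fun R hR x y => ?_⟩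
  have := hL.dist_le_mul (R⁻¹ • x) (R⁻¹ • y)
  rw [Real.dist_eq, dist_eq_norm, ← smul_sub, norm_smul, norm_inv, Real.norm_of_nonneg hR.le] at this
  refine this.trans (le_of_eq ?_)
  ring

theorem tendsto_cutoff (x : Plane) : Tendsto (fun n : ℕ => cutoff (n + 1) x) atTop (𝓝 1) := by
  obtain ⟨N, hN⟩ := exists_nat_ge ‖x‖
  refine tendsto_const_nhds.congr' ?_
  filter_upwards [eventually_ge_atTop N] with n hn
  rw [cutoff_eq_one (by positivity)]
  have : (N : ℝ) ≤ n := by exact_mod_cast hn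
  linarith

namespace IsLatticeLimit

variable {E C : ℝ} {h T : ℕ → ℝ} {u : ℕ → ℝ → Plane → Lor} {U : ℝ → Plane → Lor}

theorem lintegral_mass_le (hU : IsLatticeLimit E C h T u U) (t : ℝ) :
    ∫⁻ x, ‖U t x 0 - 1‖ₑ ≤ ENNReal.ofReal C := by
  refine le_trans (lintegral_mono_ae ?_) (hU.lintegral_momentDensity_le t)
  filter_upwards [hU.mem t] with x hx
  have := one_le_of_mem hx
  rw [Real.enorm_of_nonneg (by linarith)]
  refine ENNReal.ofReal_le_ofReal ?_
  rw [momentDensity]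
  have : 0 ≤ (U t x 0 - 1) ^ 8 := by positivity
  linarith

theorem integrable_mass (hU : IsLatticeLimit E C h T u U) (t : ℝ) :
    Integrable fun x => U t x 0 - 1 :=
  ⟨((measurable_pi_apply 0).comp (hU.measurable_slice t)).aestronglyMeasurable.sub
    aestronglyMeasurable_const, (hU.lintegral_mass_le t).trans_lt ENNReal.ofReal_lt_top⟩

/-- Convergence of averages at a fixed time. -/
theorem tendsto_integral_slice (hU : IsLatticeLimit E C h T u U) {φ : Plane → ℝ}
    (hφ : Continuous φ) (hφc : HasCompactSupport φ) (t : ℝ) :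
    Integrable (fun x => φ x * U t x 0) ∧
    Tendsto (fun n => ∫ x, φ x * u n t x 0) atTop (𝓝 (∫ x, φ x * U t x 0)) := by
  obtain ⟨L, hL⟩ := hφ.bounded_above_of_compact_support hφc
  have hc : Measurable fun v : Lor => v 0 := measurable_pi_apply 0
  have hK : volume (tsupport φ) < ⊤ := hφc.measure_lt_top
  have hz : ∀ x ∉ tsupport φ, φ x = 0 := fun x hx => image_eq_zero_of_notMem_tsupport hx
  refine tendsto_integral_of_bound_four (K := tsupport φ) hK
    (fun n => (hφ.measurable.mul
      (hc.comp ((hU.approx n).measurable_slice t))).aestronglyMeasurable)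
    (fun n x hx => by simp [hz x hx]) ?_ (fun x hx => by simp [hz x hx])
    (B := ENNReal.ofReal (L ^ 4 * 128) * (volume (tsupport φ) + ENNReal.ofReal C))
    (by finiteness) fun n => ?_
  · filter_upwards [hU.tendsto t] with x hx
    exact (((continuous_apply 0).tendsto _).comp hx).const_mul _
  · have hu := hU.approx n
    calc ∫⁻ x, ‖φ x * u n t x 0‖ₑ ^ 4 = ∫⁻ x in tsupport φ, ‖φ x * u n t x 0‖ₑ ^ 4 := by
          rw [setLIntegral_eq_of_support_subset]
          refine Function.support_subset_iff'.2 fun x hx => ?_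
          simp [hz x hx]
      _ ≤ ∫⁻ x in tsupport φ, ENNReal.ofReal (L ^ 4 * 128) *
            (1 + ENNReal.ofReal (momentDensity (u n t x))) := by
          refine lintegral_mono fun x => ?_
          have p1 := one_le_of_mem (hu.mem t x)
          have p2 := momentDensity_nonneg (hu.mem t x)
          have p3 := pow_zero_le_momentDensity (hu.mem t x)
          have hL0 := (norm_nonneg _).trans (hL x)
          have e1 : 1 + ENNReal.ofReal (momentDensity (u n t x)) =
              ENNReal.ofReal (1 + momentDensity (u n t x)) := by
            rw [ENNReal.ofReal_add zero_le_one p2, ENNReal.ofReal_one]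
          rw [e1, ← ofReal_norm, ← ENNReal.ofReal_pow (norm_nonneg _),
            ← ENNReal.ofReal_mul (by positivity), norm_mul, mul_pow]
          refine ENNReal.ofReal_le_ofReal ?_
          have q1 : ‖φ x‖ ^ 4 ≤ L ^ 4 := by have := hL x; gcongr
          have q2 : ‖u n t x 0‖ ^ 4 ≤ u n t x 0 ^ 8 := by
            rw [Real.norm_of_nonneg (by linarith)]
            exact pow_le_pow_right₀ p1 (by norm_num)
          calc _ ≤ L ^ 4 * (128 * (1 + momentDensity (u n t x))) :=
                mul_le_mul q1 (q2.trans p3) (by positivity) (by positivity)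
            _ = _ := by ring
      _ = ENNReal.ofReal (L ^ 4 * 128) * (volume (tsupport φ) +
            ∫⁻ x in tsupport φ, ENNReal.ofReal (momentDensity (u n t x))) := by
          rw [lintegral_const_mul' _ _ ENNReal.ofReal_ne_top, lintegral_add_left measurable_const]
          simp
      _ ≤ _ := by gcongr; exact (setLIntegral_le_lintegral _ _).trans (hu.moment t)

/-- Conservation of mass: the flux of `u₀ - 1` is integrable, so the mass in a large ball changes
little. -/
theorem integral_mass_eq (hU : IsLatticeLimit E C h T u U) (hC : 0 ≤ C) (hE : 0 ≤ E) (s t : ℝ) :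
    ∫ x, (U t x 0 - 1) = ∫ x, (U s x 0 - 1) := by
  obtain ⟨L, hL0, hL⟩ := exists_cutoff_lipschitz
  set P := 2 * L * (400 * C + 4 * E) * |t - s|
  have hloc : ∀ R : ℝ, 0 < R → |(∫ x, cutoff R x * U t x 0) - ∫ x, cutoff R x * U s x 0| ≤
      P / R := by
    intro R hR
    have hcont := (contDiff_cutoff R).continuous
    have hcs := hasCompactSupport_cutoff hR
    -- For the flux of the mass the constant in `fluxDensity` vanishes. Hence the growing support of the
    -- cutoff does not matter, and its Lipschitz constant gives the factor `1 / R`.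
    refine le_of_tendsto (((hU.tendsto_integral_slice hcont hcs t).2.sub
      (hU.tendsto_integral_slice hcont hcs s).2).abs) ?_
    filter_upwards [hU.time_tendsto.eventually_gt_atTop (max (2 * R) (max |s| |t|))] with n hn
    obtain ⟨n1, n2⟩ := max_lt_iff.1 hn
    obtain ⟨n3, n4⟩ := max_lt_iff.1 n2
    have := (hU.approx n).abs_integral_sub_le hC hE hcont hcs
      (fun x hx => (norm_lt_of_cutoff_ne_zero hR hx).trans n1) (L := L / R) (by positivity)
      (hL R hR) (A := 0) (v := 0) le_rfl le_rfl (Or.inl rfl) 0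
      (fun t l x => abs_flux_zero_le_fluxDensity (hU.approx n).mesh_pos ((hU.approx n).mem _ _)
        ((hU.approx n).mem _ _)) (abs_lt.1 n3) (abs_lt.1 n4)
    refine this.trans (le_of_eq ?_)
    simp only [P]
    ring
  have hlim : ∀ r, Tendsto (fun n : ℕ => ∫ x, cutoff (n + 1) x * (U r x 0 - 1)) atTop
      (𝓝 (∫ x, (U r x 0 - 1))) := by
    intro r
    refine tendsto_integral_of_dominated_convergence (fun x => ‖U r x 0 - 1‖) (fun n => ?_)
      (hU.integrable_mass r).norm (fun n => Eventually.of_forall fun x => ?_)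
      (Eventually.of_forall fun x => ?_)
    · exact (contDiff_cutoff _).continuous.aestronglyMeasurable.mul
        (hU.integrable_mass r).aestronglyMeasurable
    · rw [norm_mul, Real.norm_of_nonneg (cutoff_nonneg _ _)]
      exact mul_le_of_le_one_left (norm_nonneg _) (cutoff_le_one _ _)
    · simpa using (tendsto_cutoff x).mul_const (U r x 0 - 1)
  have hdiff := (hlim t).sub (hlim s)
  have hzero : Tendsto (fun n : ℕ => (∫ x, cutoff (n + 1) x * (U t x 0 - 1)) -
      ∫ x, cutoff (n + 1) x * (U s x 0 - 1)) atTop (𝓝 0) := by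
    refine squeeze_zero_norm (a := fun n : ℕ => P / (n + 1)) (fun n => ?_) ?_
    · have hR : (0 : ℝ) < n + 1 := by positivity
      have hcont := (contDiff_cutoff (n + 1)).continuous
      have hcs := hasCompactSupport_cutoff hR
      have hi := hcont.integrable_of_hasCompactSupport (μ := volume) hcs
      have e : ∀ r, ∫ x, cutoff (n + 1) x * (U r x 0 - 1) =
          (∫ x, cutoff (n + 1) x * U r x 0) - ∫ x, cutoff (n + 1) x := by
        intro r
        rw [← integral_sub (hU.tendsto_integral_slice hcont hcs r).1 hi]
        simp only [mul_sub, mul_one]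
      rw [e, e, sub_sub_sub_cancel_right, Real.norm_eq_abs]
      exact hloc _ hR
    · have := (tendsto_const_nhds (x := P)).mul tendsto_one_div_add_atTop_nhds_zero_nat
      simpa [div_eq_mul_inv] using this
  exact sub_eq_zero.1 (tendsto_nhds_unique hdiff hzero)

/-- Third moments of increments in time over a set, finite if the set has finite measure. -/
theorem lintegral_pow_three_sub_le (hU : IsLatticeLimit E C h T u U) {K : Set Plane}
    (s t : ℝ) : ∫⁻ x in K, ‖U t x - U s x‖ₑ ^ 3 ≤
      ENNReal.ofReal (2 ^ 15) * (2 * volume K + 2 * ENNReal.ofReal C) := by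
  have hm : ∀ r, Measurable fun x => ENNReal.ofReal (momentDensity (U r x)) := fun r =>
    (IsLatticeApprox.measurable_momentDensity.comp (hU.measurable_slice r)).ennreal_ofReal
  calc ∫⁻ x in K, ‖U t x - U s x‖ₑ ^ 3
      ≤ ∫⁻ x in K, ENNReal.ofReal (2 ^ 15) * (2 + (ENNReal.ofReal (momentDensity (U t x)) +
          ENNReal.ofReal (momentDensity (U s x)))) := by
        refine lintegral_mono_ae (ae_restrict_of_ae ?_)
        filter_upwards [hU.mem t, hU.mem s] with x m1 m2
        have d1 := momentDensity_nonneg m1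
        have d2 := momentDensity_nonneg m2
        have e1 : 2 + (ENNReal.ofReal (momentDensity (U t x)) +
            ENNReal.ofReal (momentDensity (U s x))) =
            ENNReal.ofReal (2 + (momentDensity (U t x) + momentDensity (U s x))) := by
          rw [ENNReal.ofReal_add zero_le_two (by positivity), ENNReal.ofReal_add d1 d2]; simp
        rw [e1, ← ofReal_norm, ← ENNReal.ofReal_pow (norm_nonneg _),
          ← ENNReal.ofReal_mul (by positivity)]
        refine ENNReal.ofReal_le_ofReal ?_
        have p1 := pow_zero_le_momentDensity m1
        have p2 := pow_zero_le_momentDensity m2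
        have o1 := one_le_of_mem m1
        have o2 := one_le_of_mem m2
        have q1 : ‖U t x - U s x‖ ≤ U t x 0 + U s x 0 :=
          (norm_sub_le _ _).trans (add_le_add (norm_le_of_mem m1) (norm_le_of_mem m2))
        have q2 : ‖U t x - U s x‖ ^ 3 ≤ (U t x 0 + U s x 0) ^ 8 :=
          (pow_le_pow_left₀ (norm_nonneg _) q1 3).trans
            (pow_le_pow_right₀ (by linarith) (by norm_num))
        have := add_pow_le (zero_le_one.trans o1) (zero_le_one.trans o2) 8
        norm_num at this ⊢
        linarith
    _ = ENNReal.ofReal (2 ^ 15) * (2 * volume K +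
          ((∫⁻ x in K, ENNReal.ofReal (momentDensity (U t x))) +
          ∫⁻ x in K, ENNReal.ofReal (momentDensity (U s x)))) := by
        rw [lintegral_const_mul' _ _ ENNReal.ofReal_ne_top, lintegral_add_left measurable_const,
          lintegral_add_left (hm t)]
        simp only [lintegral_const, Measure.restrict_apply MeasurableSet.univ, Set.univ_inter]
    _ ≤ ENNReal.ofReal (2 ^ 15) * (2 * volume K + (ENNReal.ofReal C + ENNReal.ofReal C)) := by
        gcongr
        · exact (setLIntegral_le_lintegral _ _).trans (hU.lintegral_momentDensity_le t)
        · exact (setLIntegral_le_lintegral _ _).trans (hU.lintegral_momentDensity_le s)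
    _ = _ := by rw [two_mul (ENNReal.ofReal C)]

theorem memLp_two (hU : IsLatticeLimit E C h T u U) {K : Set Plane} (hK : IsCompact K) (t : ℝ) :
    MemLp (U t) 2 (volume.restrict K) := by
  refine ⟨(hU.measurable_slice t).aestronglyMeasurable, ?_⟩
  have hm : Measurable fun x => ENNReal.ofReal (momentDensity (U t x)) :=
    (IsLatticeApprox.measurable_momentDensity.comp (hU.measurable_slice t)).ennreal_ofReal
  have key : eLpNorm (U t) 2 (volume.restrict K) ^ 2 < ⊤ := by
    rw [eLpNorm_two_sq]
    calc ∫⁻ x in K, ‖U t x‖ₑ ^ 2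
        ≤ ∫⁻ x in K, ENNReal.ofReal 128 * (1 + ENNReal.ofReal (momentDensity (U t x))) := by
          refine lintegral_mono_ae (ae_restrict_of_ae ?_)
          filter_upwards [hU.mem t] with x m1
          have d1 := momentDensity_nonneg m1
          have e1 : 1 + ENNReal.ofReal (momentDensity (U t x)) =
              ENNReal.ofReal (1 + momentDensity (U t x)) := by
            rw [ENNReal.ofReal_add zero_le_one d1, ENNReal.ofReal_one]
          rw [e1, ← ofReal_norm, ← ENNReal.ofReal_pow (norm_nonneg _),
            ← ENNReal.ofReal_mul (by positivity)]
          refine ENNReal.ofReal_le_ofReal (le_trans ?_ (pow_zero_le_momentDensity m1))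
          exact (pow_le_pow_left₀ (norm_nonneg _) (norm_le_of_mem m1) 2).trans
            (pow_le_pow_right₀ (one_le_of_mem m1) (by norm_num))
      _ = ENNReal.ofReal 128 * (volume K + ∫⁻ x in K, ENNReal.ofReal (momentDensity (U t x))) := by
          rw [lintegral_const_mul' _ _ ENNReal.ofReal_ne_top, lintegral_add_left measurable_const]
          simp
      _ ≤ ENNReal.ofReal 128 * (volume K + ENNReal.ofReal C) := by
          gcongr
          exact (setLIntegral_le_lintegral _ _).trans (hU.lintegral_momentDensity_le t)
      _ < ⊤ := by have := hK.measure_lt_top (μ := volume); finiteness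
  exact (ENNReal.pow_lt_top_iff.1 key).resolve_right two_ne_zero

/-- Continuity in `L¹` of every ball, locally uniformly in time. -/
def HasTimeModulus (U : ℝ → Plane → Lor) : Prop :=
  ∀ (k : ℕ) (δ : ℝ), 0 < δ → ∃ η > 0, ∀ s ∈ Set.Icc (-(k : ℝ)) k, ∀ t ∈ Set.Icc (-(k : ℝ)) k,
    |t - s| ≤ η → ∫⁻ x in Metric.ball 0 (k : ℝ), ‖U t x - U s x‖ₑ ≤ ENNReal.ofReal δ

theorem HasTimeModulus.eventually_le (hm : HasTimeModulus U) (s R : ℝ) {δ : ℝ} (hδ : 0 < δ) :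
    ∀ᶠ t in 𝓝 s, ∫⁻ x in Metric.ball 0 R, ‖U t x - U s x‖ₑ ≤ ENNReal.ofReal δ := by
  obtain ⟨k, hk⟩ := exists_nat_ge (max R (|s| + 1))
  obtain ⟨η, hη, h⟩ := hm k δ hδ
  obtain ⟨k1, k2⟩ := max_le_iff.1 hk
  filter_upwards [Metric.closedBall_mem_nhds s (show 0 < min η 1 by positivity)] with t ht
  rw [Metric.mem_closedBall, Real.dist_eq, le_min_iff] at ht
  refine (lintegral_mono_set (Metric.ball_subset_ball k1)).trans
    (h s (abs_le.1 (by linarith)) t (abs_le.1 ?_) ht.1)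
  have := abs_add_le (t - s) s
  rw [sub_add_cancel] at this
  linarith

/-- Continuity in `L²_loc`: interpolate between the modulus in `L¹_loc` and the higher moments. -/
theorem continuousInLp_two (hU : IsLatticeLimit E C h T u U) (hm : HasTimeModulus U)
    {K : Set Plane} (hK : IsCompact K) : ContinuousInLp 2 (volume.restrict K) U := by
  refine ⟨hU.memLp_two hK, fun s => ?_⟩
  obtain ⟨R, hR⟩ := hK.isBounded.subset_ball (0 : Plane)
  set D := ENNReal.ofReal (2 ^ 15) * (2 * volume K + 2 * ENNReal.ofReal C)
  have hD : D ≠ ⊤ := by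
    have := hK.measure_lt_top (μ := volume)
    simp only [D]; finiteness
  have key : ∀ ε : ℝ, 0 < ε → ∀ᶠ t in 𝓝 s,
      ∫⁻ x in K, ‖U t x - U s x‖ₑ ^ 2 ≤ ENNReal.ofReal ε := by
    intro ε hε
    -- `a² ≤ M a + a³ / M` for `a ≥ 0`; this `M` makes the contribution of the third moments at most
    -- `ε / 2`
    set M := 2 * (D.toReal + 1) / ε
    have hM : 0 < M := by have : 0 ≤ D.toReal := ENNReal.toReal_nonneg; positivity
    filter_upwards [hm.eventually_le s R (show 0 < ε / (2 * M) by positivity)] with t ht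
    have hmeas : Measurable fun x => ‖U t x - U s x‖ₑ :=
      ((hU.measurable_slice t).sub (hU.measurable_slice s)).enorm
    calc ∫⁻ x in K, ‖U t x - U s x‖ₑ ^ 2
        ≤ ∫⁻ x in K, (ENNReal.ofReal M * ‖U t x - U s x‖ₑ +
            ENNReal.ofReal M⁻¹ * ‖U t x - U s x‖ₑ ^ 3) := by
          refine lintegral_mono fun x => ?_
          rw [← ofReal_norm, ← ENNReal.ofReal_pow (norm_nonneg _),
            ← ENNReal.ofReal_pow (norm_nonneg _), ← ENNReal.ofReal_mul hM.le,
            ← ENNReal.ofReal_mul (by positivity), ← ENNReal.ofReal_add (by positivity)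
              (by positivity)]
          refine ENNReal.ofReal_le_ofReal ?_
          set a := ‖U t x - U s x‖
          have ha : 0 ≤ a := norm_nonneg _
          rcases le_total a M with h1 | h1
          · have : 0 ≤ M⁻¹ * a ^ 3 := by positivity
            nlinarith
          · have h2 : a ^ 2 ≤ M⁻¹ * a ^ 3 := by
              rw [le_inv_mul_iff₀ hM]
              nlinarith [sq_nonneg a]
            have : 0 ≤ M * a := by positivity
            linarith
      _ = ENNReal.ofReal M * (∫⁻ x in K, ‖U t x - U s x‖ₑ) +
            ENNReal.ofReal M⁻¹ * ∫⁻ x in K, ‖U t x - U s x‖ₑ ^ 3 := by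
          rw [lintegral_add_left (hmeas.const_mul _), lintegral_const_mul _ hmeas,
            lintegral_const_mul _ (hmeas.pow_const 3)]
      _ ≤ ENNReal.ofReal M * ENNReal.ofReal (ε / (2 * M)) + ENNReal.ofReal M⁻¹ * D := by
          gcongr
          · exact (lintegral_mono_set hR).trans ht
          · exact hU.lintegral_pow_three_sub_le s t
      _ ≤ ENNReal.ofReal ε := by
          rw [← ENNReal.ofReal_toReal hD, ← ENNReal.ofReal_mul hM.le,
            ← ENNReal.ofReal_mul (by positivity), ← ENNReal.ofReal_add (by positivity)
              (by positivity)]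
          refine ENNReal.ofReal_le_ofReal ?_
          have hD0 : 0 ≤ D.toReal := ENNReal.toReal_nonneg
          have e1 : M * (ε / (2 * M)) = ε / 2 := by field_simp
          have e2 : M⁻¹ * D.toReal ≤ ε / 2 := by
            rw [inv_mul_le_iff₀ hM]
            have : M * (ε / 2) = D.toReal + 1 := by simp only [M]; field_simp
            linarith
          linarith
  refine ENNReal.tendsto_nhds_zero.2 fun ε hε => ?_
  rcases eq_or_ne ε ⊤ with rfl | hε'
  · exact Eventually.of_forall fun _ => le_top
  · have h0 : 0 < ε.toReal := ENNReal.toReal_pos hε.ne' hε'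
    filter_upwards [key (ε.toReal ^ 2) (by positivity)] with t ht
    rw [eLpNorm_two_le_iff]
    rwa [ENNReal.ofReal_pow h0.le, ENNReal.ofReal_toReal hε'] at ht

/-- Continuity of the density `U₀ - 1` in `L¹`: the mass is constant, so convergence in `L¹_loc`
excludes both concentration and escape to infinity. -/
theorem continuousInLp_one (hU : IsLatticeLimit E C h T u U) (hC : 0 ≤ C) (hE : 0 ≤ E)
    (hm : HasTimeModulus U) : ContinuousInLp 1 volume (fun t x => U t x 0 - 1) := by
  have hi := hU.integrable_mass
  refine ⟨fun t => memLp_one_iff_integrable.2 (hi t), fun s => ?_⟩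
  have key : ∀ ε : ℝ, 0 < ε → ∀ᶠ t in 𝓝 s,
      ∫ x, ‖(U t x 0 - 1) - (U s x 0 - 1)‖ ≤ ε := by
    intro ε hε
    -- outside a large ball the mass at time `s` is small
    have htail : ∃ k : ℕ, ∫ x in (Metric.ball (0 : Plane) k)ᶜ, (U s x 0 - 1) ≤ ε / 4 := by
      have h1 : Tendsto (fun k : ℕ => ∫ x in Metric.ball (0 : Plane) k, (U s x 0 - 1)) atTop
          (𝓝 (∫ x, (U s x 0 - 1))) := by
        have := tendsto_setIntegral_of_monotone (μ := (volume : Measure Plane))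
          (f := fun x => U s x 0 - 1) (s := fun k : ℕ => Metric.ball (0 : Plane) k)
          (fun _ => measurableSet_ball)
          (fun i j hij => Metric.ball_subset_ball (by exact_mod_cast hij))
          (hi s).integrableOn
        rwa [Metric.iUnion_ball_nat, setIntegral_univ] at this
      obtain ⟨k, hk⟩ := (h1.eventually_const_le
        (show (∫ x, (U s x 0 - 1)) - ε / 4 < ∫ x, (U s x 0 - 1) by linarith)).exists
      refine ⟨k, ?_⟩
      have := integral_add_compl (measurableSet_ball (x := (0 : Plane)) (ε := (k : ℝ))) (hi s)
      linarith
    obtain ⟨k, hk⟩ := htail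
    filter_upwards [hm.eventually_le s k (show 0 < ε / 4 by positivity)] with t ht
    set f := fun x => (U t x 0 - 1) - (U s x 0 - 1)
    have hf : Integrable f := (hi t).sub (hi s)
    have hf0 : ∫ x, f x = 0 := by
      rw [integral_sub (hi t) (hi s), hU.integral_mass_eq hC hE s t, sub_self]
    -- the integral of `f` vanishes, so it is enough to bound its negative part
    have habs : ∀ x, ‖f x‖ = f x + 2 * max (-f x) 0 := by
      intro x
      rcases le_total 0 (f x) with h | h
      · rw [Real.norm_of_nonneg h, max_eq_right (by linarith)]; ring
      · rw [Real.norm_of_nonpos h, max_eq_left (by linarith)]; ring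
    have hneg : Integrable fun x => max (-f x) 0 := hf.neg.sup (integrable_zero _ _ _)
    have h1 : ∫ x, ‖f x‖ = 2 * ∫ x, max (-f x) 0 := by
      simp only [habs]
      rw [integral_add hf (hneg.const_mul 2), hf0, zero_add, integral_const_mul]
    have h2 : ∫ x in Metric.ball (0 : Plane) k, max (-f x) 0 ≤ ε / 4 := by
      calc _ ≤ ∫ x in Metric.ball (0 : Plane) k, ‖f x‖ := by
            refine integral_mono hneg.integrableOn hf.norm.integrableOn fun x => ?_
            exact max_le (neg_le_abs _) (abs_nonneg _)
        _ ≤ ε / 4 := by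
            rw [integral_norm_eq_lintegral_enorm hf.aestronglyMeasurable.restrict]
            refine ENNReal.toReal_le_of_le_ofReal (by positivity) (le_trans ?_ ht)
            refine lintegral_mono fun x => ?_
            have : f x = (U t x - U s x) 0 := by simp [f]
            rw [this, enorm_eq_nnnorm, enorm_eq_nnnorm]
            exact ENNReal.coe_le_coe.2 (nnnorm_le_pi_nnnorm (U t x - U s x) 0)
    -- the negative part of `f` is at most `U s x 0 - 1`, which has little mass outside of the ball
    have h3 : ∫ x in (Metric.ball (0 : Plane) k)ᶜ, max (-f x) 0 ≤ ε / 4 := by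
      refine le_trans (integral_mono_ae hneg.integrableOn (hi s).integrableOn
        (ae_restrict_of_ae ?_)) hk
      filter_upwards [hU.mem t, hU.mem s] with x m1 m2
      have := one_le_of_mem m1
      have := one_le_of_mem m2
      exact max_le (by simp only [f]; linarith) (by linarith)
    have h4 := integral_add_compl (measurableSet_ball (x := (0 : Plane)) (ε := (k : ℝ))) hneg
    linarith
  refine ENNReal.tendsto_nhds_zero.2 fun ε hε => ?_
  rcases eq_or_ne ε ⊤ with rfl | hε'
  · exact Eventually.of_forall fun _ => le_top
  · filter_upwards [key ε.toReal (ENNReal.toReal_pos hε.ne' hε')] with t ht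
    have hf : Integrable fun x => (U t x 0 - 1) - (U s x 0 - 1) := (hi t).sub (hi s)
    rw [eLpNorm_one_eq_lintegral_enorm, ← ofReal_integral_norm_eq_lintegral_enorm hf]
    exact (ENNReal.ofReal_le_ofReal ht).trans_eq (ENNReal.ofReal_toReal hε')

end IsLatticeLimit

/-! ### Convergence of mollifications and the weak chain rule -/

section Mollification

variable {F : Type*} [NormedAddCommGroup F]

theorem locallyIntegrable_norm {g : Plane → F} (hg : LocallyIntegrable g) :
    LocallyIntegrable fun x => ‖g x‖ :=
  hg.mono hg.aestronglyMeasurable.norm (Eventually.of_forall fun _ => (norm_norm _).le)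

/-- Continuity of translations in `L¹`. -/
theorem exists_lintegral_translate_le {g : Plane → F} (hg : Integrable g) {ε : ENNReal}
    (hε : 0 < ε) : ∃ δ > 0, ∀ z : Plane, ‖z‖ < δ → ∫⁻ x, ‖g (x + z) - g x‖ₑ ≤ ε := by
  have hg1 : MemLp g 1 := memLp_one_iff_integrable.2 hg
  have hmp : ∀ z : Plane, MeasurePreserving (fun x : Plane => x + z) volume volume := fun z =>
    measurePreserving_add_right volume z
  let τ : Plane → C(Plane, Plane) := fun z => ⟨fun x => x + z, by fun_prop⟩
  have hτ : Continuous τ := ContinuousMap.continuous_of_continuous_uncurry _ (by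
    change Continuous fun p : Plane × Plane => p.2 + p.1
    fun_prop)
  have hc := Continuous.compMeasurePreservingLp (p := 1) (E := F)
    (f := fun _ : Plane => hg1.toLp) continuous_const hτ hmp (by norm_num)
  have h0 := hc.tendsto 0
  rw [EMetric.tendsto_nhds_nhds] at h0
  obtain ⟨δ, hδ, h⟩ := h0 ε hε
  have hkey : ∀ z, Lp.compMeasurePreserving (τ z) (hmp z) hg1.toLp =
      (hg1.comp_measurePreserving (hmp z)).toLp := fun z => Lp.toLp_compMeasurePreserving hg1 (hmp z)
  obtain ⟨δ', hδ', hδδ⟩ : ∃ δ' : ℝ, 0 < δ' ∧ ENNReal.ofReal δ' ≤ δ := by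
    rcases eq_or_ne δ ⊤ with rfl | ht
    · exact ⟨1, one_pos, le_top⟩
    · exact ⟨δ.toReal, ENNReal.toReal_pos hδ.ne' ht, by rw [ENNReal.ofReal_toReal ht]⟩
  refine ⟨δ', hδ', fun z hz => ?_⟩
  have hz' : edist z 0 < δ := by
    rw [edist_eq_enorm_sub, sub_zero, ← ofReal_norm]
    exact ((ENNReal.ofReal_lt_ofReal_iff hδ').2 hz).trans_le hδδ
  have h1 := (h hz').le
  rw [hkey, hkey, Lp.edist_toLp_toLp, eLpNorm_one_eq_lintegral_enorm] at h1
  simpa [Function.comp_def] using h1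

variable [NormedSpace ℝ F]

/-- Mollifications converge in `L¹`. -/
theorem tendsto_lintegral_moll_sub [CompleteSpace F] {g : Plane → F} (hg : StronglyMeasurable g)
    (hgi : Integrable g) : Tendsto (fun m => ∫⁻ x, ‖moll m g x - g x‖ₑ) atTop (𝓝 0) := by
  refine ENNReal.tendsto_nhds_zero.2 fun ε hε => ?_
  obtain ⟨δ, hδ, h⟩ := exists_lintegral_translate_le hgi hε
  obtain ⟨N, hN⟩ := exists_nat_one_div_lt hδ
  filter_upwards [eventually_ge_atTop N] with m hm
  have h1 := lintegral_moll_sub_le m hg hgi.locallyIntegrable Set.univ (D := ε) fun z hz => by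
    rw [Measure.restrict_univ]
    exact h z (hz.trans ((one_div_le_one_div_of_le (by positivity) (by gcongr)).trans_lt hN))
  rwa [Measure.restrict_univ] at h1

theorem moll_congr_of_eqOn {g g' : Plane → F} {x : Plane} (m : ℕ)
    (h : ∀ y, ‖x - y‖ < 1 → g y = g' y) : moll m g x = moll m g' x := by
  refine integral_congr_ae (Eventually.of_forall fun y => ?_)
  by_cases hy : rho m (x - y) = 0
  · simp [hy]
  · simp only [h y (norm_lt_one_of_rho_ne_zero hy)]

theorem tendsto_lintegral_ball_moll_sub [CompleteSpace F] {g : Plane → F}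
    (hg : StronglyMeasurable g) (hgl : LocallyIntegrable g) (R : ℝ) :
    Tendsto (fun m => ∫⁻ x in Metric.ball 0 R, ‖moll m g x - g x‖ₑ) atTop (𝓝 0) := by
  set g' := (Metric.closedBall (0 : Plane) (R + 1)).indicator g
  have hg' : Integrable g' := (integrable_indicator_iff measurableSet_closedBall).2
    (hgl.integrableOn_isCompact (isCompact_closedBall _ _))
  have key := tendsto_lintegral_moll_sub (hg.indicator measurableSet_closedBall) hg'
  refine tendsto_of_tendsto_of_tendsto_of_le_of_le tendsto_const_nhds key (fun _ => zero_le)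
    fun m => ?_
  refine le_trans (le_of_eq ?_) (setLIntegral_le_lintegral (Metric.ball (0 : Plane) R) _)
  refine setLIntegral_congr_fun measurableSet_ball fun x hx => ?_
  rw [mem_ball_zero_iff] at hx
  have e1 : ∀ y, ‖x - y‖ < 1 → g y = g' y := fun y hy => by
    refine (Set.indicator_of_mem (mem_closedBall_zero_iff.2 ?_) g).symm
    have := norm_sub_le x (x - y)
    rw [sub_sub_cancel] at this
    linarith
  rw [moll_congr_of_eqOn m e1, e1 x (by simp)]

theorem ae_tendsto_moll [CompleteSpace F] {g : Plane → F} (hgl : LocallyIntegrable g) :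
    ∀ᵐ x, Tendsto (fun m => moll m g x) atTop (𝓝 (g x)) := by
  have hr : Tendsto (fun m => (bump m).rOut) atTop (𝓝 0) :=
    tendsto_one_div_add_atTop_nhds_zero_nat
  have := ContDiffBump.ae_convolution_tendsto_right_of_locallyIntegrable (μ := volume) hr (K := 2)
    (Eventually.of_forall fun m => by simp only [bump]; field_simp; norm_num) hgl
  filter_upwards [this] with x hx
  simp only [moll_eq_convolution]
  exact hx

theorem norm_moll_le {g : Plane → F} {B : ℝ} (hB : ∀ x, ‖g x‖ ≤ B) (m : ℕ) (x : Plane) :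
    ‖moll m g x‖ ≤ B := by
  have hi : Integrable fun y => rho m (x - y) :=
    ((continuous_rho m).comp (by fun_prop)).integrable_of_hasCompactSupport
        (hasCompactSupport_rho_sub m x)
  calc ‖moll m g x‖ ≤ ∫ y, rho m (x - y) * B := by
        refine norm_integral_le_of_norm_le (hi.mul_const B) (Eventually.of_forall fun y => ?_)
        rw [norm_smul, Real.norm_of_nonneg (rho_nonneg m _)]
        exact mul_le_mul_of_nonneg_left (hB y) (rho_nonneg m _)
    _ = B := by rw [integral_mul_const, integral_rho_sub, one_mul]

/-- Jensen's inequality for mollifications. -/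
theorem norm_moll_sq_le {g : Plane → F} (hg : LocallyIntegrable g)
    (hg2 : LocallyIntegrable fun x => ‖g x‖ ^ 2) (m : ℕ) (x : Plane) :
    ‖moll m g x‖ ^ 2 ≤ moll m (fun x => ‖g x‖ ^ 2) x := by
  set c := ‖moll m g x‖
  have i1 := integrable_rho_smul m hg x
  have i2 : Integrable fun y => rho m (x - y) * ‖g y‖ ^ 2 := integrable_rho_smul m hg2 x
  have i3 : Integrable fun y => rho m (x - y) :=
    ((continuous_rho m).comp (by fun_prop)).integrable_of_hasCompactSupport
        (hasCompactSupport_rho_sub m x)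
  have h1 : c ≤ ∫ y, rho m (x - y) * ‖g y‖ := by
    refine (norm_integral_le_integral_norm _).trans (le_of_eq (integral_congr_ae
      (Eventually.of_forall fun y => ?_)))
    simp only [norm_smul, Real.norm_of_nonneg (rho_nonneg m _)]
  have i1' : Integrable fun y => rho m (x - y) * ‖g y‖ := by
    refine i1.norm.congr (Eventually.of_forall fun y => ?_)
    simp only [norm_smul, Real.norm_of_nonneg (rho_nonneg m _)]
  -- integrate `2 c s ≤ s² + c²` against the mollifier
  have h2 : ∫ y, 2 * c * (rho m (x - y) * ‖g y‖) ≤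
      ∫ y, (rho m (x - y) * ‖g y‖ ^ 2 + rho m (x - y) * c ^ 2) := by
    refine integral_mono (i1'.const_mul _) (i2.add (i3.mul_const _)) fun y => ?_
    have := mul_nonneg (rho_nonneg m (x - y)) (sq_nonneg (‖g y‖ - c))
    simp only
    nlinarith
  rw [integral_const_mul, integral_add i2 (i3.mul_const _), integral_mul_const,
    integral_rho_sub, one_mul] at h2
  have hc : 0 ≤ c := norm_nonneg _
  have h3 : moll m (fun x => ‖g x‖ ^ 2) x = ∫ y, rho m (x - y) * ‖g y‖ ^ 2 := rfl
  rw [h3]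
  nlinarith

end Mollification

/-- `g` is the weak derivative of `f` in the direction `basisVec l`. -/
structure HasWeakDeriv {F : Type*} [NormedAddCommGroup F] [NormedSpace ℝ F] (l : Fin 2)
    (f g : Plane → F) : Prop where
  locallyIntegrable : LocallyIntegrable f
  locallyIntegrable_deriv : LocallyIntegrable g
  integral_eq : ∀ φ : Plane → ℝ, ContDiff ℝ ∞ φ → HasCompactSupport φ →
    ∫ x, fderiv ℝ φ x (basisVec l) • f x = -∫ x, φ x • g x

section WeakDeriv

variable {F : Type*} [NormedAddCommGroup F] [NormedSpace ℝ F]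

theorem continuous_fderiv_apply {φ : Plane → ℝ} (hφ : ContDiff ℝ ∞ φ) (v : Plane) :
    Continuous fun x => fderiv ℝ φ x v :=
  (hφ.continuous_fderiv (by simp)).clm_apply continuous_const

theorem hasCompactSupport_fderiv_apply {φ : Plane → ℝ} (hφ : HasCompactSupport φ) (v : Plane) :
    HasCompactSupport fun x => fderiv ℝ φ x v :=
  (hφ.fderiv (𝕜 := ℝ)).comp_left (g := fun A : Plane →L[ℝ] ℝ => A v) rfl

/-- Mollification commutes with weak differentiation. -/
theorem HasWeakDeriv.fderiv_moll [CompleteSpace F] {l : Fin 2} {f g : Plane → F}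
    (h : HasWeakDeriv l f g) (m : ℕ) (x : Plane) :
    fderiv ℝ (moll m f) x (basisVec l) = moll m g x := by
  have hρ : ContDiff ℝ 1 (rho m) := (contDiff_rho m).of_le (by simp)
  have h1 := (hasCompactSupport_rho m).hasFDerivAt_convolution_left (ContinuousLinearMap.lsmul ℝ ℝ)
    hρ h.locallyIntegrable x (μ := volume)
  rw [← moll_eq_convolution] at h1
  have hcs : HasCompactSupport (fderiv ℝ (rho m)) := (hasCompactSupport_rho m).fderiv (𝕜 := ℝ)
  have hcont : Continuous (fderiv ℝ (rho m)) := hρ.continuous_fderiv (by simp)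
  have hex : ConvolutionExistsAt (fderiv ℝ (rho m)) f x
      ((ContinuousLinearMap.lsmul ℝ ℝ).precompL Plane) volume :=
    hcs.convolutionExists_left _ hcont h.locallyIntegrable x
  have hex' := hex.integrable_swap
  rw [h1.fderiv, convolution_eq_swap, ContinuousLinearMap.integral_apply hex']
  simp only [ContinuousLinearMap.precompL_apply, ContinuousLinearMap.lsmul_apply]
  set φ : Plane → ℝ := fun y => rho m (x - y)
  have hφ : ContDiff ℝ ∞ φ := (contDiff_rho m).comp (contDiff_const.sub contDiff_id)
  have hd : ∀ y, fderiv ℝ φ y (basisVec l) = -fderiv ℝ (rho m) (x - y) (basisVec l) := by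
    intro y
    have := ((contDiff_rho m).differentiable (by simp) (x - y)).hasFDerivAt.comp y
      ((hasFDerivAt_id y).const_sub x)
    rw [show φ = rho m ∘ HSub.hSub x from rfl, this.fderiv]
    simp
  have key := h.integral_eq φ hφ (hasCompactSupport_rho_sub m x)
  simp only [hd, neg_smul] at key
  rw [integral_neg, neg_inj] at key
  exact key

/-- Passing to the limit in integrals against a test function. -/
theorem tendsto_integral_smul_of_ball {a : ℕ → Plane → F} {a' : Plane → F} {R : ℝ}
    (ha : ∀ m, IntegrableOn (a m) (Metric.ball 0 R)) (ha' : IntegrableOn a' (Metric.ball 0 R))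
    (h : Tendsto (fun m => ∫⁻ x in Metric.ball 0 R, ‖a m x - a' x‖ₑ) atTop (𝓝 0))
    {φ : Plane → ℝ} (hφ : Continuous φ) (hφc : HasCompactSupport φ)
    (hφR : ∀ x ∉ Metric.ball (0 : Plane) R, φ x = 0) :
    Tendsto (fun m => ∫ x, φ x • a m x) atTop (𝓝 (∫ x, φ x • a' x)) := by
  obtain ⟨B, hB⟩ := hφ.bounded_above_of_compact_support hφc
  have hi : ∀ {b : Plane → F}, IntegrableOn b (Metric.ball 0 R) →
      Integrable (fun x => φ x • b x) (volume.restrict (Metric.ball 0 R)) := fun hb =>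
    hb.bdd_smul B hφ.aestronglyMeasurable (Eventually.of_forall hB)
  have hset : ∀ b : Plane → F, ∫ x in Metric.ball 0 R, φ x • b x = ∫ x, φ x • b x := fun b =>
    setIntegral_eq_integral_of_forall_compl_eq_zero fun x hx => by rw [hφR x hx, zero_smul]
  have key := tendsto_integral_of_L1 (μ := volume.restrict (Metric.ball 0 R)) (l := atTop)
    (F := fun m x => φ x • a m x) (fun x => φ x • a' x) (hi ha').1
    (Eventually.of_forall fun m => hi (ha m)) ?_
  · simpa only [hset] using key
  · have h2 : Tendsto (fun m => ENNReal.ofReal B * ∫⁻ x in Metric.ball 0 R, ‖a m x - a' x‖ₑ) atTop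
        (𝓝 0) := by
      simpa using ENNReal.Tendsto.const_mul h (Or.inr ENNReal.ofReal_ne_top)
    refine tendsto_of_tendsto_of_tendsto_of_le_of_le tendsto_const_nhds h2 (fun _ => zero_le)
      fun m => ?_
    rw [← lintegral_const_mul' _ _ ENNReal.ofReal_ne_top]
    refine lintegral_mono fun x => ?_
    rw [← smul_sub, enorm_smul]
    gcongr
    rw [← ofReal_norm]
    exact ENNReal.ofReal_le_ofReal (hB x)

/-- The chain rule for a function of class `C¹` with bounded derivative. -/
theorem HasWeakDeriv.comp {l : Fin 2} {f g : Plane → Lor} (h : HasWeakDeriv l f g)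
    (hf : StronglyMeasurable f) (hg : StronglyMeasurable g) {Ψ : Lor → ℝ} (hΨ : ContDiff ℝ 1 Ψ)
    {L : NNReal} (hL : ∀ v, ‖fderiv ℝ Ψ v‖ ≤ L) :
    HasWeakDeriv l (fun x => Ψ (f x)) (fun x => fderiv ℝ Ψ (f x) (g x)) := by
  have hlip : LipschitzWith L Ψ := lipschitzWith_of_nnnorm_fderiv_le
    (hΨ.differentiable (by simp)) fun v => by exact_mod_cast hL v
  have hDc : Continuous (fderiv ℝ Ψ) := hΨ.continuous_fderiv (by simp)
  have hΨm : StronglyMeasurable fun x => Ψ (f x) := hΨ.continuous.comp_stronglyMeasurable hf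
  have happ : Continuous fun p : Lor × Lor => fderiv ℝ Ψ p.1 p.2 :=
    (hDc.comp continuous_fst).clm_apply continuous_snd
  have hDm : StronglyMeasurable fun x => fderiv ℝ Ψ (f x) (g x) :=
    happ.comp_stronglyMeasurable (hf.prodMk hg)
  have l1 : LocallyIntegrable fun x => Ψ (f x) := by
    have hmaj : LocallyIntegrable fun x => L * ‖f x‖ + ‖Ψ 0‖ :=
      ((locallyIntegrable_norm h.locallyIntegrable).smul (L : ℝ)).add (locallyIntegrable_const _)
    refine hmaj.mono hΨm.aestronglyMeasurable (Eventually.of_forall fun x => ?_)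
    have h1 := hlip.norm_sub_le (f x) 0
    rw [sub_zero] at h1
    have h2 := norm_sub_norm_le (Ψ (f x)) (Ψ 0)
    rw [Real.norm_of_nonneg (by positivity : 0 ≤ L * ‖f x‖ + ‖Ψ 0‖)]
    linarith
  have l2 : LocallyIntegrable fun x => fderiv ℝ Ψ (f x) (g x) := by
    have hmaj : LocallyIntegrable fun x => L * ‖g x‖ :=
      (locallyIntegrable_norm h.locallyIntegrable_deriv).smul (L : ℝ)
    refine hmaj.mono hDm.aestronglyMeasurable (Eventually.of_forall fun x => ?_)
    rw [Real.norm_of_nonneg (by positivity : 0 ≤ L * ‖g x‖)]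
    exact (ContinuousLinearMap.le_opNorm _ _).trans (by gcongr; exact hL _)
  refine ⟨l1, l2, fun φ hφ hφc => ?_⟩
  obtain ⟨R, hR⟩ := hφc.isCompact.isBounded.subset_ball (0 : Plane)
  have hz1 : ∀ x ∉ Metric.ball (0 : Plane) R, φ x = 0 := fun x hx =>
    image_eq_zero_of_notMem_tsupport fun h => hx (hR h)
  have hz2 : ∀ x ∉ Metric.ball (0 : Plane) R, fderiv ℝ φ x (basisVec l) = 0 := fun x hx => by
    have : fderiv ℝ φ x = 0 := image_eq_zero_of_notMem_tsupport fun h =>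
      hx (hR (tsupport_fderiv_subset ℝ h))
    rw [this]; rfl
  have hball : ∀ {F' : Type} [NormedAddCommGroup F'] {b : Plane → F'}, LocallyIntegrable b →
      IntegrableOn b (Metric.ball 0 R) := fun hb =>
    (hb.integrableOn_isCompact (isCompact_closedBall _ _)).mono_set Metric.ball_subset_closedBall
  have hv := fun m => contDiff_moll m h.locallyIntegrable
  have hw := fun m => contDiff_moll m h.locallyIntegrable_deriv
  have hΨv : ∀ m, ContDiff ℝ 1 fun x => Ψ (moll m f x) := fun m =>
    hΨ.comp ((hv m).of_le (by simp))
  have hcv : ∀ m, Continuous fun x => fderiv ℝ Ψ (moll m f x) (moll m g x) := fun m =>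
    happ.comp ((hv m).continuous.prodMk (hw m).continuous)
  -- the identity for the mollifications is the classical integration by parts
  have hid : ∀ m, ∫ x, fderiv ℝ φ x (basisVec l) • Ψ (moll m f x) =
      -∫ x, φ x • fderiv ℝ Ψ (moll m f x) (moll m g x) := by
    intro m
    have hd : ∀ x, fderiv ℝ (fun x => Ψ (moll m f x)) x (basisVec l) =
        fderiv ℝ Ψ (moll m f x) (moll m g x) := by
      intro x
      have := ((hΨ.differentiable (by simp) (moll m f x)).hasFDerivAt.comp x
        ((hv m).differentiable (by simp) x).hasFDerivAt).fderiv
      rw [show (fun x => Ψ (moll m f x)) = Ψ ∘ moll m f from rfl, this,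
        ContinuousLinearMap.comp_apply, h.fderiv_moll]
    have hφ1 := hφ.continuous
    have hΨ1 := (hΨv m).continuous
    have := integral_mul_fderiv_eq_neg_fderiv_mul_of_integrable (μ := (volume : Measure Plane))
      (f := φ) (g := fun x => Ψ (moll m f x)) (v := basisVec l)
      (((continuous_fderiv_apply hφ _).mul hΨ1).integrable_of_hasCompactSupport
        (hasCompactSupport_fderiv_apply hφc _).mul_right)
      (by simp only [hd]; exact (hφ1.mul (hcv m)).integrable_of_hasCompactSupport hφc.mul_right)
      ((hφ1.mul hΨ1).integrable_of_hasCompactSupport hφc.mul_right)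
      (fun x _ => hφ.differentiable (by simp) x)
      (fun x _ => (hΨv m).differentiable (by simp) x)
    simp only [hd] at this
    simp only [smul_eq_mul, this, neg_neg]
  have t1 := tendsto_integral_smul_of_ball (R := R) (a := fun m x => Ψ (moll m f x))
    (a' := fun x => Ψ (f x)) (fun m => hball (hΨv m).continuous.locallyIntegrable) (hball l1) ?_
    (continuous_fderiv_apply hφ (basisVec l)) (hasCompactSupport_fderiv_apply hφc _) hz2
  have t2 := tendsto_integral_smul_of_ball (R := R)
    (a := fun m x => fderiv ℝ Ψ (moll m f x) (moll m g x))
    (a' := fun x => fderiv ℝ Ψ (f x) (g x)) (fun m => hball (hcv m).locallyIntegrable) (hball l2) ?_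
    hφ.continuous hφc hz1
  · simp only [hid] at t1
    exact tendsto_nhds_unique t1 t2.neg
  · have a1 : Tendsto (fun m => (L : ENNReal) * ∫⁻ x in Metric.ball 0 R, ‖moll m g x - g x‖ₑ) atTop
        (𝓝 0) := by
      simpa using ENNReal.Tendsto.const_mul (a := (L : ENNReal))
        (tendsto_lintegral_ball_moll_sub hg h.locallyIntegrable_deriv R) (Or.inr (by simp))
    have a2 : Tendsto (fun m => ∫⁻ x in Metric.ball 0 R,
        ‖fderiv ℝ Ψ (moll m f x) (g x) - fderiv ℝ Ψ (f x) (g x)‖ₑ) atTop (𝓝 0) := by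
      have hgi := hball h.locallyIntegrable_deriv
      have := tendsto_lintegral_of_dominated_convergence
        (μ := volume.restrict (Metric.ball (0 : Plane) R))
        (F := fun m x => ‖fderiv ℝ Ψ (moll m f x) (g x) - fderiv ℝ Ψ (f x) (g x)‖ₑ)
        (f := fun _ => 0) (fun x => 2 * (L : ENNReal) * ‖g x‖ₑ) (fun m => ?_)
        (fun m => Eventually.of_forall fun x => ?_) ?_ ?_
      · simpa using this
      · exact ((happ.comp_stronglyMeasurable ((hv m).continuous.stronglyMeasurable.prodMk hg)).sub
          hDm).enorm
      · refine enorm_sub_le.trans ?_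
        have e : ∀ v, ‖fderiv ℝ Ψ v (g x)‖ₑ ≤ L * ‖g x‖ₑ := fun v => by
          rw [enorm_eq_nnnorm, enorm_eq_nnnorm]
          exact_mod_cast (ContinuousLinearMap.le_opNorm _ _).trans
            (mul_le_mul_of_nonneg_right (hL v) (norm_nonneg _))
        calc _ ≤ (L : ENNReal) * ‖g x‖ₑ + L * ‖g x‖ₑ := add_le_add (e _) (e _)
          _ = _ := by ring
      · rw [lintegral_const_mul' _ _ (by finiteness)]
        exact ENNReal.mul_ne_top (by finiteness) hgi.2.ne
      · filter_upwards [ae_restrict_of_ae (ae_tendsto_moll h.locallyIntegrable)] with x hx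
        have c1 : Tendsto (fun m => fderiv ℝ Ψ (moll m f x) (g x)) atTop
            (𝓝 (fderiv ℝ Ψ (f x) (g x))) :=
          ((hDc.clm_apply continuous_const).tendsto (f x)).comp hx
        have := (tendsto_sub_nhds_zero_iff.2 c1).enorm
        simpa using this
    have a3 := a1.add a2
    rw [add_zero] at a3
    refine tendsto_of_tendsto_of_tendsto_of_le_of_le tendsto_const_nhds a3 (fun _ => zero_le)
      fun m => ?_
    have hm1 : Measurable fun x => (L : ENNReal) * ‖moll m g x - g x‖ₑ :=
      (((hw m).continuous.stronglyMeasurable.sub hg).enorm).const_mul _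
    simp only
    rw [← lintegral_const_mul' _ _ (by finiteness), ← lintegral_add_left hm1]
    refine lintegral_mono fun x => ?_
    -- split the error between that of the derivative `g` and that of the point where `Ψ` is differentiated
    have e : fderiv ℝ Ψ (moll m f x) (moll m g x) - fderiv ℝ Ψ (f x) (g x) =
        fderiv ℝ Ψ (moll m f x) (moll m g x - g x) +
        (fderiv ℝ Ψ (moll m f x) (g x) - fderiv ℝ Ψ (f x) (g x)) := by rw [map_sub]; abel
    rw [e]
    refine (enorm_add_le _ _).trans ?_
    gcongr
    rw [enorm_eq_nnnorm, enorm_eq_nnnorm]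
    exact_mod_cast (ContinuousLinearMap.le_opNorm _ _).trans
      (mul_le_mul_of_nonneg_right (hL _) (norm_nonneg _))
  · have a1 : Tendsto (fun m => (L : ENNReal) * ∫⁻ x in Metric.ball 0 R, ‖moll m f x - f x‖ₑ) atTop
        (𝓝 0) := by
      simpa using ENNReal.Tendsto.const_mul (a := (L : ENNReal))
        (tendsto_lintegral_ball_moll_sub hf h.locallyIntegrable R) (Or.inr (by simp))
    refine tendsto_of_tendsto_of_tendsto_of_le_of_le tendsto_const_nhds a1 (fun _ => zero_le)
      fun m => ?_
    simp only
    rw [← lintegral_const_mul' _ _ (by finiteness)]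
    refine lintegral_mono fun x => ?_
    rw [enorm_eq_nnnorm, enorm_eq_nnnorm, ← ENNReal.coe_mul, ENNReal.coe_le_coe]
    exact hlip.norm_sub_le (moll m f x) (f x)

/-- Weak derivatives are unique. -/
theorem HasWeakDeriv.ae_eq [CompleteSpace F] {l : Fin 2} {f g g' : Plane → F}
    (h : HasWeakDeriv l f g) (h' : HasWeakDeriv l f g') : g =ᵐ[volume] g' := by
  refine ae_eq_of_integral_contDiff_smul_eq h.locallyIntegrable_deriv h'.locallyIntegrable_deriv
    fun φ hφ hφc => ?_
  have := (h.integral_eq φ hφ hφc).symm.trans (h'.integral_eq φ hφ hφc)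
  exact neg_inj.1 this

end WeakDeriv

/-! ### The disc model -/

/-- The height over the plane of the point of `ℍ²` with horizontal coordinates `(v₁, v₂)`. -/
noncomputable def height (v : Lor) : ℝ := √(1 + v 1 ^ 2 + v 2 ^ 2)

theorem height_pos (v : Lor) : 0 < height v := Real.sqrt_pos.2 (by positivity)

theorem height_eq {v : Lor} (hv : v ∈ hyperbolicPlane) : height v = v 0 := by
  obtain ⟨h, h0⟩ := mem_hyperbolicPlane.1 hv
  rw [height, ← h, Real.sqrt_sq h0.le]

theorem abs_le_height (v : Lor) (i : Fin 2) : |v i.succ| ≤ height v := by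
  refine Real.abs_le_sqrt ?_
  fin_cases i <;> simp <;> nlinarith [sq_nonneg (v 1), sq_nonneg (v 2)]

theorem hasFDerivAt_height (v : Lor) : HasFDerivAt height ((height v)⁻¹ •
    (v 1 • ContinuousLinearMap.proj (R := ℝ) (φ := fun _ : Fin 3 => ℝ) 1 +
      v 2 • ContinuousLinearMap.proj (R := ℝ) (φ := fun _ : Fin 3 => ℝ) 2)) v := by
  have hp : ∀ i : Fin 3, HasFDerivAt (fun v : Lor => v i)
      (ContinuousLinearMap.proj (R := ℝ) (φ := fun _ : Fin 3 => ℝ) i) v := fun i =>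
    (ContinuousLinearMap.proj (R := ℝ) (φ := fun _ : Fin 3 => ℝ) i).hasFDerivAt
  have h1 := ((hp 1).pow 2).add ((hp 2).pow 2)
  have h2 := (h1.const_add 1).sqrt (show 1 + (v 1 ^ 2 + v 2 ^ 2) ≠ 0 by positivity)
  have e : (fun y : Lor => √(1 + (y 1 ^ 2 + y 2 ^ 2))) = height := by
    ext y; rw [height, add_assoc]
  have e2 : √(1 + (v 1 ^ 2 + v 2 ^ 2)) = height v := by rw [height, add_assoc]
  simp only [Pi.add_apply] at h2
  refine (e ▸ h2).congr_fderiv ?_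
  ext ξ
  have := (height_pos v).ne'
  simp [e2]
  field_simp

theorem contDiff_height : ContDiff ℝ 1 height := by
  have hp : ∀ i : Fin 3, ContDiff ℝ 1 fun v : Lor => v i := fun i => contDiff_apply ℝ ℝ i
  have h1 := hp 1
  have h2 := hp 2
  exact ContDiff.sqrt (by fun_prop) fun v => by positivity

theorem fderiv_height_apply (v ξ : Lor) :
    fderiv ℝ height v ξ = (v 1 * ξ 1 + v 2 * ξ 2) / height v := by
  rw [(hasFDerivAt_height v).fderiv]
  simp [div_eq_inv_mul, mul_add]

theorem abs_fderiv_height_apply_le (v ξ : Lor) : |fderiv ℝ height v ξ| ≤ 2 * ‖ξ‖ := by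
  rw [fderiv_height_apply, abs_div, abs_of_pos (height_pos v), div_le_iff₀ (height_pos v)]
  have h1 := abs_le_height v 0
  have h2 := abs_le_height v 1
  have n1 := norm_le_pi_norm ξ 1
  have n2 := norm_le_pi_norm ξ 2
  rw [Real.norm_eq_abs] at n1 n2
  have m1 : |v 1 * ξ 1| ≤ height v * ‖ξ‖ := by
    rw [abs_mul]; exact mul_le_mul h1 n1 (abs_nonneg _) (height_pos v).le
  have m2 : |v 2 * ξ 2| ≤ height v * ‖ξ‖ := by
    rw [abs_mul]; exact mul_le_mul h2 n2 (abs_nonneg _) (height_pos v).le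
  linarith [abs_add_le (v 1 * ξ 1) (v 2 * ξ 2)]

theorem norm_fderiv_height_le (v : Lor) : ‖fderiv ℝ height v‖ ≤ (2 : NNReal) :=
  ContinuousLinearMap.opNorm_le_bound _ (by positivity) fun ξ => by
    simpa using abs_fderiv_height_apply_le v ξ

/-- The coordinates of the disc model, extended to all vectors by means of `height`. -/
noncomputable def discCoord (i : Fin 2) (v : Lor) : ℝ := v i.succ / (1 + height v)

theorem contDiff_discCoord (i : Fin 2) : ContDiff ℝ 1 (discCoord i) :=
  (contDiff_apply ℝ ℝ i.succ).div (contDiff_const.add contDiff_height) fun v => by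
    have := height_pos v; positivity

theorem fderiv_discCoord_apply (i : Fin 2) (v ξ : Lor) : fderiv ℝ (discCoord i) v ξ =
    ξ i.succ / (1 + height v) - v i.succ * fderiv ℝ height v ξ / (1 + height v) ^ 2 := by
  have hne : 1 + height v ≠ 0 := by have := height_pos v; positivity
  have hp : HasFDerivAt (fun v : Lor => v i.succ)
      (ContinuousLinearMap.proj (R := ℝ) (φ := fun _ : Fin 3 => ℝ) i.succ) v :=
    (ContinuousLinearMap.proj (R := ℝ) (φ := fun _ : Fin 3 => ℝ) i.succ).hasFDerivAt
  have hh : HasFDerivAt (fun v => 1 + height v) (fderiv ℝ height v) v :=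
    ((contDiff_height.differentiable (by simp) v).hasFDerivAt).const_add 1
  have h1 := hp.mul ((hasDerivAt_inv hne).comp_hasFDerivAt v hh)
  have e : ((fun v : Lor => v i.succ) * ((fun y : ℝ => y⁻¹) ∘ fun v => 1 + height v)) =
      discCoord i := by
    ext y; simp [discCoord, div_eq_mul_inv]
  rw [e] at h1
  rw [h1.fderiv]
  simp
  field_simp
  ring

theorem norm_fderiv_discCoord_le (i : Fin 2) (v : Lor) : ‖fderiv ℝ (discCoord i) v‖ ≤ (3 : NNReal) := by
  refine ContinuousLinearMap.opNorm_le_bound _ (by positivity) fun ξ => ?_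
  rw [fderiv_discCoord_apply, Real.norm_eq_abs]
  have h0 := height_pos v
  have hp : 0 < 1 + height v := by positivity
  have h1 : |ξ i.succ / (1 + height v)| ≤ ‖ξ‖ := by
    rw [abs_div, abs_of_pos hp, div_le_iff₀ hp]
    have := norm_le_pi_norm ξ i.succ
    rw [Real.norm_eq_abs] at this
    nlinarith [norm_nonneg ξ]
  have h2 : |v i.succ * fderiv ℝ height v ξ / (1 + height v) ^ 2| ≤ 2 * ‖ξ‖ := by
    rw [abs_div, abs_of_pos (by positivity : 0 < (1 + height v) ^ 2), div_le_iff₀ (by positivity),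
      abs_mul]
    have := mul_le_mul (abs_le_height v i) (abs_fderiv_height_apply_le v ξ) (abs_nonneg _) h0.le
    have hx := norm_nonneg ξ
    nlinarith [mul_nonneg h0.le hx, mul_nonneg (mul_nonneg h0.le h0.le) hx]
  have h3 := abs_sub (ξ i.succ / (1 + height v))
    (v i.succ * fderiv ℝ height v ξ / (1 + height v) ^ 2)
  simp only [NNReal.coe_ofNat]
  linarith

/-- In the disc model the length of a tangent vector of `ℍ²` is the conformal factor
`1 + v₀ = 2 / (1 - |p|²)` times the Euclidean length. -/
theorem sum_fderiv_discCoord_sq {v ξ : Lor} (hv : v ∈ hyperbolicPlane)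
    (hξ : ξ 0 = fderiv ℝ height v ξ) :
    (1 + v 0) ^ 2 * ∑ i, fderiv ℝ (discCoord i) v ξ ^ 2 = lorentzForm ξ ξ := by
  have h1 := one_le_of_mem hv
  have hne : v 0 ≠ 0 := by linarith
  have hne' : 1 + v 0 ≠ 0 := by linarith
  have ht : lorentzForm v ξ = 0 := by
    rw [fderiv_height_apply, height_eq hv] at hξ
    rw [lorentzForm_eq, hξ]
    field_simp
    ring
  rw [← sum_frameCoord_sq hv ht, Finset.mul_sum]
  refine Finset.sum_congr rfl fun i _ => ?_
  rw [fderiv_discCoord_apply, ← hξ, height_eq hv, frameCoord]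
  field_simp

/-- The point of the disc model corresponding to a point of `ℍ²`. -/
noncomputable def toDisc (v : Lor) : Plane := WithLp.toLp 2 fun i => discCoord i v

/-- The point of `ℍ²` corresponding to a point of the disc model. -/
noncomputable def ofDisc (p : Plane) : Lor :=
  (1 - ‖p‖ ^ 2)⁻¹ • ![1 + ‖p‖ ^ 2, 2 * p 0, 2 * p 1]

theorem plane_norm_sq (p : Plane) : ‖p‖ ^ 2 = p 0 ^ 2 + p 1 ^ 2 := by
  rw [EuclideanSpace.norm_sq_eq, Fin.sum_univ_two]; simp

theorem one_sub_norm_toDisc_sq {v : Lor} (hv : v ∈ hyperbolicPlane) :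
    1 - ‖toDisc v‖ ^ 2 = 2 / (1 + v 0) := by
  obtain ⟨h, h0⟩ := mem_hyperbolicPlane.1 hv
  have hne : 1 + v 0 ≠ 0 := by positivity
  rw [plane_norm_sq]
  simp only [toDisc, discCoord, height_eq hv, Fin.succ_zero_eq_one, Fin.succ_one_eq_two]
  field_simp
  linarith

theorem norm_toDisc_lt_one {v : Lor} (hv : v ∈ hyperbolicPlane) : ‖toDisc v‖ < 1 := by
  have h1 := one_sub_norm_toDisc_sq hv
  have h2 : 0 < 2 / (1 + v 0) := by have := hv.2; positivity
  exact (sq_lt_one_iff₀ (norm_nonneg _)).1 (by linarith)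

theorem ofDisc_toDisc {v : Lor} (hv : v ∈ hyperbolicPlane) : ofDisc (toDisc v) = v := by
  obtain ⟨h, h0⟩ := mem_hyperbolicPlane.1 hv
  have hne : 1 + v 0 ≠ 0 := by positivity
  have h1 := one_sub_norm_toDisc_sq hv
  have h2 : 1 + ‖toDisc v‖ ^ 2 = 2 - 2 / (1 + v 0) := by linarith
  rw [ofDisc, h1, h2]
  ext i
  fin_cases i <;> simp [toDisc, discCoord, height_eq hv] <;> field_simp
  ring

theorem ofDisc_zero_apply (p : Plane) : ofDisc p 0 = (1 + ‖p‖ ^ 2) / (1 - ‖p‖ ^ 2) := by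
  simp [ofDisc, div_eq_inv_mul]

theorem one_sub_norm_sq_pos {p : Plane} (hp : ‖p‖ < 1) : 0 < 1 - ‖p‖ ^ 2 := by
  have := (sq_lt_one_iff₀ (norm_nonneg p)).2 hp
  linarith

theorem ofDisc_mem {p : Plane} (hp : ‖p‖ < 1) : ofDisc p ∈ hyperbolicPlane := by
  have h1 := one_sub_norm_sq_pos hp
  refine mem_hyperbolicPlane.2 ⟨?_, by rw [ofDisc_zero_apply]; positivity⟩
  have h2 := plane_norm_sq p
  rw [ofDisc_zero_apply]
  simp only [ofDisc, Pi.smul_apply, smul_eq_mul, Matrix.cons_val_one, Matrix.cons_val_zero,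
    Matrix.cons_val]
  field_simp
  have h3 : p 1 ^ 2 = ‖p‖ ^ 2 - p 0 ^ 2 := by linarith
  linear_combination 4 * h2

theorem ofDisc_zero : ofDisc 0 = origin := by
  ext i
  fin_cases i <;> simp [ofDisc, origin]

/-- The excess `u₀ - 1` in terms of the disc model. -/
noncomputable def discMass (p : Plane) : ℝ := 2 * ‖p‖ ^ 2 / (1 - ‖p‖ ^ 2)

theorem ofDisc_zero_sub_one {p : Plane} (hp : ‖p‖ < 1) : ofDisc p 0 - 1 = discMass p := by
  have h1 := one_sub_norm_sq_pos hp
  rw [ofDisc_zero_apply, discMass]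
  field_simp
  ring

theorem chordSq_ofDisc {p q : Plane} (hp : ‖p‖ < 1) (hq : ‖q‖ < 1) :
    chordSq (ofDisc p) (ofDisc q) = 4 * ‖q - p‖ ^ 2 / ((1 - ‖p‖ ^ 2) * (1 - ‖q‖ ^ 2)) := by
  have h1 := one_sub_norm_sq_pos hp
  have h2 := one_sub_norm_sq_pos hq
  rw [chordSq_eq (ofDisc_mem hp) (ofDisc_mem hq), lorentzForm_eq, ofDisc_zero_apply,
    ofDisc_zero_apply]
  simp only [ofDisc, Pi.smul_apply, smul_eq_mul, Matrix.cons_val_one, Matrix.cons_val_zero,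
    Matrix.cons_val]
  have e := plane_norm_sq (q - p)
  simp only [PiLp.sub_apply] at e
  rw [e]
  field_simp
  rw [plane_norm_sq p, plane_norm_sq q]
  ring

/-- The conformal factor of the metric of the disc model. -/
noncomputable def conformalFactor (p : Plane) : ℝ := 4 / (1 - ‖p‖ ^ 2) ^ 2

theorem continuousOn_ofDisc : ContinuousOn ofDisc (Metric.ball 0 1) := by
  have hc : ∀ i : Fin 2, Continuous fun p : Plane => p i := fun i =>
    (EuclideanSpace.proj (𝕜 := ℝ) i).continuous
  have h0 := hc 0
  have h1 := hc 1
  have h2 : Continuous fun p : Plane => 1 - ‖p‖ ^ 2 := by fun_prop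
  refine ContinuousOn.smul (h2.continuousOn.inv₀ fun p hp => ?_)
    (Continuous.continuousOn (continuous_pi fun i => ?_))
  · exact (one_sub_norm_sq_pos (mem_ball_zero_iff.1 hp)).ne'
  · fin_cases i <;> simp <;> fun_prop

theorem measurable_ofDisc : Measurable ofDisc := by
  have hc : ∀ i : Fin 2, Measurable fun p : Plane => p i := fun i =>
    (EuclideanSpace.proj (𝕜 := ℝ) i).continuous.measurable
  have h0 := hc 0
  have h1 := hc 1
  have h2 : Measurable fun p : Plane => 1 - ‖p‖ ^ 2 := by fun_prop
  refine Measurable.smul h2.inv (measurable_pi_iff.2 fun i => ?_)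
  fin_cases i <;> simp <;> fun_prop

theorem one_sub_sq_le {r : ℝ} {p : Plane} (hp : ‖p‖ ≤ r) : 1 - r ^ 2 ≤ 1 - ‖p‖ ^ 2 := by
  have := pow_le_pow_left₀ (norm_nonneg p) hp 2
  linarith

theorem discMass_mono {p q : Plane} (hpq : ‖p‖ ≤ ‖q‖) (hq : ‖q‖ < 1) : discMass p ≤ discMass q := by
  have h1 := one_sub_norm_sq_pos hq
  have h2 := one_sub_sq_le hpq
  unfold discMass
  gcongr

theorem conformalFactor_mono {p q : Plane} (hpq : ‖p‖ ≤ ‖q‖) (hq : ‖q‖ < 1) :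
    conformalFactor p ≤ conformalFactor q := by
  have h1 := one_sub_norm_sq_pos hq
  have h2 := one_sub_sq_le hpq
  unfold conformalFactor
  gcongr

theorem discMass_le {r : ℝ} (hr : r < 1) {p : Plane} (hp : ‖p‖ ≤ r) :
    0 ≤ discMass p ∧ discMass p ≤ 2 / (1 - r ^ 2) := by
  have hr0 := (norm_nonneg p).trans hp
  have h1 : 0 < 1 - r ^ 2 := by nlinarith
  have h2 := one_sub_sq_le hp
  have h3 : ‖p‖ ^ 2 ≤ 1 := by linarith
  refine ⟨div_nonneg (by positivity) (by linarith), ?_⟩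
  unfold discMass
  gcongr
  linarith

theorem conformalFactor_le {r : ℝ} (hr : r < 1) {p : Plane} (hp : ‖p‖ ≤ r) :
    0 ≤ conformalFactor p ∧ conformalFactor p ≤ 4 / (1 - r ^ 2) ^ 2 := by
  have hr0 := (norm_nonneg p).trans hp
  have h1 : 0 < 1 - r ^ 2 := by nlinarith
  have h2 := one_sub_sq_le hp
  refine ⟨by unfold conformalFactor; positivity, ?_⟩
  unfold conformalFactor
  gcongr

theorem norm_ofDisc_le {r : ℝ} (hr : r < 1) {p : Plane} (hp : ‖p‖ ≤ r) :
    ‖ofDisc p‖ ≤ 1 + 2 / (1 - r ^ 2) := by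
  have h1 := norm_le_of_mem (ofDisc_mem (hp.trans_lt hr))
  have h2 := ofDisc_zero_sub_one (hp.trans_lt hr)
  have h3 := (discMass_le hr hp).2
  linarith

theorem continuousAt_discMass {p : Plane} (hp : ‖p‖ < 1) : ContinuousAt discMass p := by
  have h1 := (one_sub_norm_sq_pos hp).ne'
  unfold discMass
  exact ContinuousAt.div (by fun_prop) (by fun_prop) h1

theorem continuousAt_conformalFactor {p : Plane} (hp : ‖p‖ < 1) :
    ContinuousAt conformalFactor p := by
  have h1 := (one_sub_norm_sq_pos hp).ne'
  unfold conformalFactor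
  exact ContinuousAt.div (by fun_prop) (by fun_prop) (pow_ne_zero 2 h1)

theorem measurable_discMass : Measurable discMass := by unfold discMass; fun_prop

theorem measurable_conformalFactor : Measurable conformalFactor := by
  unfold conformalFactor; fun_prop

/-! ### Finite-energy maps in the disc model -/

theorem LocallyIntegrable.congr_ae {F : Type*} [NormedAddCommGroup F] {f g : Plane → F}
    (hf : LocallyIntegrable f) (h : f =ᵐ[volume] g) : LocallyIntegrable g :=
  hf.mono (hf.aestronglyMeasurable.congr h) (by filter_upwards [h] with x hx; rw [hx])

theorem HasWeakDeriv.congr_ae {F : Type*} [NormedAddCommGroup F] [NormedSpace ℝ F] {l : Fin 2}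
    {f g f' g' : Plane → F} (h : HasWeakDeriv l f g) (hf : f =ᵐ[volume] f')
    (hg : g =ᵐ[volume] g') : HasWeakDeriv l f' g' where
  locallyIntegrable := LocallyIntegrable.congr_ae h.locallyIntegrable hf
  locallyIntegrable_deriv := LocallyIntegrable.congr_ae h.locallyIntegrable_deriv hg
  integral_eq φ hφ hφc := by
    have e1 : ∫ x, fderiv ℝ φ x (basisVec l) • f' x = ∫ x, fderiv ℝ φ x (basisVec l) • f x :=
      integral_congr_ae (by filter_upwards [hf] with x hx; rw [hx])
    have e2 : ∫ x, φ x • g' x = ∫ x, φ x • g x :=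
      integral_congr_ae (by filter_upwards [hg] with x hx; rw [hx])
    rw [e1, e2, h.integral_eq φ hφ hφc]

theorem HasWeakDeriv.toLp {l : Fin 2} {f g : Plane → Fin 2 → ℝ}
    (h : ∀ i, HasWeakDeriv l (fun x => f x i) (fun x => g x i)) :
    HasWeakDeriv l (fun x => (WithLp.toLp 2 (f x) : Plane)) (fun x => WithLp.toLp 2 (g x)) := by
  have hl : ∀ {b : Plane → Fin 2 → ℝ}, (∀ i, LocallyIntegrable fun x => b x i) →
      LocallyIntegrable fun x => (WithLp.toLp 2 (b x) : Plane) := fun hb =>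
    locallyIntegrable_iff.2 fun K hK =>
      Integrable.of_eval_piLp fun i => (hb i).integrableOn_isCompact hK
  have h1 := hl fun i => (h i).locallyIntegrable
  have h2 := hl fun i => (h i).locallyIntegrable_deriv
  refine ⟨h1, h2, fun φ hφ hφc => ?_⟩
  ext i
  have i1 : ∀ i, Integrable fun x => (fderiv ℝ φ x (basisVec l) •
      (WithLp.toLp 2 (f x) : Plane)) i := fun i =>
    (h i).locallyIntegrable.integrable_smul_left_of_hasCompactSupport
      (continuous_fderiv_apply hφ _) (hasCompactSupport_fderiv_apply hφc _)
  have i2 : ∀ i, Integrable fun x => (φ x • (WithLp.toLp 2 (g x) : Plane)) i := fun i =>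
    (h i).locallyIntegrable_deriv.integrable_smul_left_of_hasCompactSupport hφ.continuous hφc
  rw [PiLp.neg_apply, eval_integral_piLp i1, eval_integral_piLp i2]
  exact (h i).integral_eq φ hφ hφc

/-- A weakly differentiable map into the unit disc whose image in `ℍ²` has energy at most `E` and
mass at most `M`; here `q l` is the weak derivative in the direction `basisVec l`. -/
structure IsDiscMap (E M : ℝ) (p : Plane → Plane) (q : Fin 2 → Plane → Plane) : Prop where
  measurable : StronglyMeasurable p
  measurable_deriv : ∀ l, StronglyMeasurable (q l)
  norm_lt_one : ∀ x, ‖p x‖ < 1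
  hasWeakDeriv : ∀ l, HasWeakDeriv l p (q l)
  energy : ∑ l, ∫⁻ x, ENNReal.ofReal (conformalFactor (p x) * ‖q l x‖ ^ 2) ≤ ENNReal.ofReal E
  mass : ∫⁻ x, ENNReal.ofReal (discMass (p x)) ≤ ENNReal.ofReal M

theorem conformalFactor_toDisc {v : Lor} (hv : v ∈ hyperbolicPlane) :
    conformalFactor (toDisc v) = (1 + v 0) ^ 2 := by
  have h0 := hv.2
  rw [conformalFactor, one_sub_norm_toDisc_sq hv]
  field_simp
  norm_num

/-- A map of the homogeneous Sobolev space is given in the disc model by a weakly differentiable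
map of the same energy. -/
theorem InHomogeneousH1.exists_isDiscMap {uStar : Plane → Lor} (hH1 : InHomogeneousH1 uStar)
    (hmass : Integrable (fun x => uStar x 0 - 1)) :
    ∃ (v : Plane → Lor) (E M : ℝ) (q : Fin 2 → Plane → Plane), 0 ≤ E ∧ 0 ≤ M ∧
      v =ᵐ[volume] uStar ∧ (∀ x, v x ∈ hyperbolicPlane) ∧ Measurable v ∧ LocallyIntegrable v ∧
      IsDiscMap E M (fun x => toDisc (v x)) q := by
  classical
  obtain ⟨hmem, G, ⟨hLI, hGI, hw⟩, hE⟩ := hH1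
  -- a representative that is measurable and has values in the hyperboloid everywhere
  set v₀ := hLI.aestronglyMeasurable.mk uStar
  have hv₀ : StronglyMeasurable v₀ := hLI.aestronglyMeasurable.stronglyMeasurable_mk
  have hv₀e : uStar =ᵐ[volume] v₀ := hLI.aestronglyMeasurable.ae_eq_mk
  set v : Plane → Lor := fun x => if v₀ x ∈ hyperbolicPlane then v₀ x else origin
  have hvm : Measurable v := Measurable.ite (hv₀.measurable isClosed_hyperbolicPlane.measurableSet)
    hv₀.measurable measurable_const
  have hvs : StronglyMeasurable v := hvm.stronglyMeasurable
  have hvmem : ∀ x, v x ∈ hyperbolicPlane := fun x => by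
    by_cases h : v₀ x ∈ hyperbolicPlane
    · simp only [v, h, if_true]
    · simp only [v, h, if_false, origin_mem]
  have hve : uStar =ᵐ[volume] v := by
    filter_upwards [hv₀e, hmem] with x h1 h2
    have h3 : v₀ x ∈ hyperbolicPlane := h1 ▸ h2
    simp only [v, h3, if_true, h1]
  set g : Fin 2 → Plane → Lor := fun l => (hGI l).aestronglyMeasurable.mk (fun x => G x l)
  have hg : ∀ l, StronglyMeasurable (g l) := fun l =>
    (hGI l).aestronglyMeasurable.stronglyMeasurable_mk
  have hge : ∀ l, (fun x => G x l) =ᵐ[volume] g l := fun l =>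
    (hGI l).aestronglyMeasurable.ae_eq_mk
  have hwd : ∀ l, HasWeakDeriv l v (g l) := fun l =>
    HasWeakDeriv.congr_ae ⟨hLI, hGI l, fun φ hφ hφc => hw φ hφ hφc l⟩ hve (hge l)
  -- the weak derivative is tangent to the hyperboloid
  have htan : ∀ l, ∀ᵐ x, g l x 0 = fderiv ℝ height (v x) (g l x) := by
    intro l
    have h1 := (hwd l).comp hvs (hg l) (Ψ := fun w => w 0) (L := 1) (contDiff_apply ℝ ℝ 0)
      fun w => by
        rw [show (fun w : Lor => w 0) =
          ContinuousLinearMap.proj (R := ℝ) (φ := fun _ : Fin 3 => ℝ) 0 from rfl,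
          ContinuousLinearMap.fderiv]
        exact ContinuousLinearMap.opNorm_le_bound _ (by positivity) fun ξ => by
          simpa using norm_le_pi_norm ξ 0
    have h2 := (hwd l).comp hvs (hg l) contDiff_height norm_fderiv_height_le
    simp only [fun x => height_eq (hvmem x)] at h2
    filter_upwards [h1.ae_eq h2] with x hx
    rw [← hx, show (fun w : Lor => w 0) =
      ContinuousLinearMap.proj (R := ℝ) (φ := fun _ : Fin 3 => ℝ) 0 from rfl,
      ContinuousLinearMap.fderiv]
    rfl
  set q : Fin 2 → Plane → Plane := fun l x =>
    WithLp.toLp 2 fun i => fderiv ℝ (discCoord i) (v x) (g l x)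
  have hpm : Measurable fun x => toDisc (v x) :=
    (WithLp.measurable_toLp 2 _).comp (measurable_pi_iff.2 fun i =>
      (contDiff_discCoord i).continuous.measurable.comp hvm)
  have hqm : ∀ l, Measurable (q l) := fun l =>
    (WithLp.measurable_toLp 2 _).comp (measurable_pi_iff.2 fun i => by
      have happ : Continuous fun p : Lor × Lor => fderiv ℝ (discCoord i) p.1 p.2 :=
        (((contDiff_discCoord i).continuous_fderiv (by simp)).comp continuous_fst).clm_apply
          continuous_snd
      exact happ.measurable.comp (hvm.prodMk (hg l).measurable))
  have hen : ∀ l, ∀ᵐ x, conformalFactor (toDisc (v x)) * ‖q l x‖ ^ 2 =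
      |lorentzForm (G x l) (G x l)| := by
    intro l
    filter_upwards [htan l, hge l] with x h1 h2
    rw [h2, conformalFactor_toDisc (hvmem x), EuclideanSpace.norm_sq_eq]
    simp only [q, Real.norm_eq_abs, sq_abs]
    have h3 := sum_fderiv_discCoord_sq (hvmem x) h1
    rw [h3, abs_of_nonneg]
    rw [← h3]
    positivity
  have hE2 : ∑ l, ∫⁻ x, ENNReal.ofReal (conformalFactor (toDisc (v x)) * ‖q l x‖ ^ 2) ≠ ⊤ := by
    have hm : ∀ l, Measurable fun x => ENNReal.ofReal (conformalFactor (toDisc (v x)) *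
        ‖q l x‖ ^ 2) := fun l =>
      ((measurable_conformalFactor.comp hpm).mul ((hqm l).norm.pow_const 2)).ennreal_ofReal
    have hfin : eLpNorm (fun x => gradNorm (G x)) 2 volume ^ 2 ≠ ⊤ :=
      ENNReal.pow_ne_top hE.2.ne
    rw [eLpNorm_two_sq] at hfin
    rw [← lintegral_finsetSum _ fun l _ => hm l]
    refine ne_of_eq_of_ne (lintegral_congr_ae ?_) hfin
    filter_upwards [ae_all_iff.2 hen] with x hx
    simp only [hx]
    have h0 : 0 ≤ ∑ l, |lorentzForm (G x l) (G x l)| := Finset.sum_nonneg fun _ _ => abs_nonneg _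
    rw [gradNorm, Real.enorm_of_nonneg (Real.sqrt_nonneg _), ← ENNReal.ofReal_pow
      (Real.sqrt_nonneg _), Real.sq_sqrt h0, ENNReal.ofReal_sum_of_nonneg fun _ _ => abs_nonneg _]
  have hmass2 : ∫⁻ x, ENNReal.ofReal (discMass (toDisc (v x))) ≠ ⊤ := by
    refine ne_of_eq_of_ne (lintegral_congr_ae ?_) hmass.2.ne
    filter_upwards [hve] with x hx
    have h1 := one_le_of_mem (hvmem x)
    rw [← ofDisc_zero_sub_one (norm_toDisc_lt_one (hvmem x)), ofDisc_toDisc (hvmem x), hx,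
      Real.enorm_of_nonneg (by linarith)]
  refine ⟨v, _, _, q, ENNReal.toReal_nonneg, ENNReal.toReal_nonneg, hve.symm, hvmem, hvm,
    LocallyIntegrable.congr_ae hLI hve, hpm.stronglyMeasurable, fun l => (hqm l).stronglyMeasurable,
    fun x => norm_toDisc_lt_one (hvmem x), fun l => ?_, (ENNReal.ofReal_toReal hE2).ge,
    (ENNReal.ofReal_toReal hmass2).ge⟩
  exact HasWeakDeriv.toLp fun i =>
    (hwd l).comp hvs (hg l) (contDiff_discCoord i) (norm_fderiv_discCoord_le i)

/-! ### Smooth approximation of the initial data -/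

/-- The mollification of `p`, contracted towards the origin of the disc by the factor `r` and cut off
at the radius `R`. In the disc model these operations preserve the target, as they would not for the
hyperboloid, and the last two decrease the conformal factor. -/
noncomputable def discApprox (r R : ℝ) (p : Plane → Plane) (m : ℕ) (x : Plane) : Plane :=
  (r * cutoff R x) • moll m p x

namespace IsDiscMap

variable {E M : ℝ} {p : Plane → Plane} {q : Fin 2 → Plane → Plane}

theorem integrable_sq (hp : IsDiscMap E M p q) : Integrable fun x => ‖p x‖ ^ 2 := by
  refine ⟨(hp.measurable.norm.measurable.pow_const 2).aestronglyMeasurable,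
    (lt_of_le_of_lt (lintegral_mono fun x => ?_) (hp.mass.trans_lt ENNReal.ofReal_lt_top))⟩
  have h1 := one_sub_norm_sq_pos (hp.norm_lt_one x)
  rw [Real.enorm_of_nonneg (by positivity)]
  refine ENNReal.ofReal_le_ofReal ?_
  rw [discMass, le_div_iff₀ h1]
  nlinarith [sq_nonneg ‖p x‖]

theorem lintegral_sq_le (hp : IsDiscMap E M p q) :
    ∫⁻ x, ENNReal.ofReal (‖p x‖ ^ 2) ≤ ENNReal.ofReal M := by
  refine le_trans (lintegral_mono fun x => ENNReal.ofReal_le_ofReal ?_) hp.mass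
  have h1 := one_sub_norm_sq_pos (hp.norm_lt_one x)
  rw [discMass, le_div_iff₀ h1]
  nlinarith [sq_nonneg ‖p x‖]

theorem lintegral_energy_lt_top (hp : IsDiscMap E M p q) (l : Fin 2) :
    ∫⁻ x, ENNReal.ofReal (conformalFactor (p x) * ‖q l x‖ ^ 2) < ⊤ :=
  lt_of_le_of_lt (Finset.single_le_sum (f := fun l => ∫⁻ x, ENNReal.ofReal
    (conformalFactor (p x) * ‖q l x‖ ^ 2)) (fun _ _ => zero_le) (Finset.mem_univ l))
    (hp.energy.trans_lt ENNReal.ofReal_lt_top)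

theorem sq_le_conformalFactor_mul {p : Plane} (hp : ‖p‖ < 1) (a : ℝ) :
    a ^ 2 ≤ conformalFactor p * a ^ 2 := by
  have h1 := one_sub_norm_sq_pos hp
  refine le_mul_of_one_le_left (sq_nonneg a) ?_
  rw [conformalFactor, le_div_iff₀ (by positivity)]
  nlinarith [sq_nonneg ‖p‖]

theorem integrable_deriv_sq (hp : IsDiscMap E M p q) (l : Fin 2) :
    Integrable fun x => ‖q l x‖ ^ 2 := by
  refine ⟨((hp.measurable_deriv l).norm.measurable.pow_const 2).aestronglyMeasurable,
    (lt_of_le_of_lt (lintegral_mono fun x => ?_) (hp.lintegral_energy_lt_top l))⟩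
  rw [Real.enorm_of_nonneg (by positivity)]
  exact ENNReal.ofReal_le_ofReal (sq_le_conformalFactor_mul (hp.norm_lt_one x) _)

theorem norm_moll_le_one (hp : IsDiscMap E M p q) (m : ℕ) (x : Plane) : ‖moll m p x‖ ≤ 1 :=
  norm_moll_le (fun x => (hp.norm_lt_one x).le) m x

theorem norm_discApprox_le (hp : IsDiscMap E M p q) {r R : ℝ} (hr : 0 ≤ r) (m : ℕ) (x : Plane) :
    ‖discApprox r R p m x‖ ≤ r := by
  rw [discApprox, norm_smul, Real.norm_of_nonneg (mul_nonneg hr (cutoff_nonneg _ _))]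
  calc _ ≤ r * 1 * 1 := by
        gcongr
        · exact cutoff_le_one _ _
        · exact hp.norm_moll_le_one m x
    _ = r := by ring

theorem norm_cutoff_smul_le (hp : IsDiscMap E M p q) {r R : ℝ} (hr : 0 ≤ r) (hr1 : r ≤ 1)
    (x : Plane) : ‖(r * cutoff R x) • p x‖ ≤ r ∧ ‖(r * cutoff R x) • p x‖ ≤ ‖p x‖ := by
  have h1 := cutoff_le_one R x
  have h2 := cutoff_nonneg R x
  have h3 : r * cutoff R x ≤ r := mul_le_of_le_one_right hr h1
  rw [norm_smul, Real.norm_of_nonneg (mul_nonneg hr h2)]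
  exact ⟨(mul_le_mul h3 (hp.norm_lt_one x).le (norm_nonneg _) hr).trans_eq (mul_one r),
    mul_le_of_le_one_left (norm_nonneg _) (h3.trans hr1)⟩

theorem contDiff_discApprox (hp : IsDiscMap E M p q) (r R : ℝ) (m : ℕ) :
    ContDiff ℝ ∞ (discApprox r R p m) :=
  (contDiff_const.mul (contDiff_cutoff R)).smul (contDiff_moll m (hp.hasWeakDeriv 0).locallyIntegrable)

theorem ae_tendsto_discApprox (hp : IsDiscMap E M p q) (r R : ℝ) :
    ∀ᵐ x, Tendsto (fun m => discApprox r R p m x) atTop (𝓝 ((r * cutoff R x) • p x)) := by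
  filter_upwards [ae_tendsto_moll (hp.hasWeakDeriv 0).locallyIntegrable] with x hx
  exact hx.const_smul _

theorem tendsto_lintegral_discMass (hp : IsDiscMap E M p q) {r R : ℝ} (hr : 0 ≤ r) (hr1 : r < 1)
    (hR : 0 < R) : Tendsto (fun m => ∫⁻ x, ENNReal.ofReal (discMass (discApprox r R p m x))) atTop
      (𝓝 (∫⁻ x, ENNReal.ofReal (discMass ((r * cutoff R x) • p x)))) := by
  refine tendsto_lintegral_of_dominated_convergence
    ((Metric.closedBall (0 : Plane) (2 * R)).indicator fun _ => ENNReal.ofReal (2 / (1 - r ^ 2)))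
    (fun m => (measurable_discMass.comp
      (hp.contDiff_discApprox r R m).continuous.measurable).ennreal_ofReal)
    (fun m => Eventually.of_forall fun x => ?_) ?_ ?_
  · by_cases hx : x ∈ Metric.closedBall (0 : Plane) (2 * R)
    · rw [Set.indicator_of_mem hx]
      exact ENNReal.ofReal_le_ofReal (discMass_le hr1 (hp.norm_discApprox_le hr m x)).2
    · have hz : cutoff R x = 0 := by
        by_contra h
        exact hx (mem_closedBall_zero_iff.2 (norm_lt_of_cutoff_ne_zero hR h).le)
      simp [discApprox, hz, discMass]
  · rw [lintegral_indicator measurableSet_closedBall, setLIntegral_const]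
    have := measure_closedBall_lt_top (μ := (volume : Measure Plane)) (x := 0) (r := 2 * R)
    finiteness
  · filter_upwards [hp.ae_tendsto_discApprox r R] with x hx
    exact (ENNReal.continuous_ofReal.tendsto _).comp
      ((continuousAt_discMass ((hp.norm_cutoff_smul_le hr hr1.le x).1.trans_lt hr1)).tendsto.comp hx)

theorem tendsto_lintegral_ofDisc_sub (hp : IsDiscMap E M p q) {r R : ℝ} (hr : 0 ≤ r) (hr1 : r < 1)
    (n : ℝ) : Tendsto (fun m => ∫⁻ x in Metric.ball 0 n,
      ‖ofDisc (discApprox r R p m x) - ofDisc ((r * cutoff R x) • p x)‖ₑ) atTop (𝓝 0) := by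
  have hm2 : Measurable fun x => ofDisc ((r * cutoff R x) • p x) :=
    measurable_ofDisc.comp (((contDiff_cutoff R).continuous.measurable.const_mul r).smul
      hp.measurable.measurable)
  have key := tendsto_lintegral_of_dominated_convergence
    (μ := volume.restrict (Metric.ball (0 : Plane) n)) (f := fun _ => 0)
    (F := fun m x => ‖ofDisc (discApprox r R p m x) - ofDisc ((r * cutoff R x) • p x)‖ₑ)
    (fun _ => ENNReal.ofReal (2 * (1 + 2 / (1 - r ^ 2))))
    (fun m => ((measurable_ofDisc.comp
      (hp.contDiff_discApprox r R m).continuous.measurable).sub hm2).enorm)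
    (fun m => Eventually.of_forall fun x => ?_) ?_ ?_
  · simpa using key
  · beta_reduce
    rw [← ofReal_norm]
    refine ENNReal.ofReal_le_ofReal ((norm_sub_le _ _).trans ?_)
    linarith [norm_ofDisc_le hr1 (hp.norm_discApprox_le (R := R) hr m x),
      norm_ofDisc_le hr1 (hp.norm_cutoff_smul_le (R := R) hr hr1.le x).1]
  · rw [setLIntegral_const]
    have := measure_ball_lt_top (μ := (volume : Measure Plane)) (x := 0) (r := n)
    finiteness
  · refine ae_restrict_of_ae ?_
    filter_upwards [hp.ae_tendsto_discApprox r R] with x hx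
    have hlt := (hp.norm_cutoff_smul_le (R := R) hr hr1.le x).1.trans_lt hr1
    have hcont : ContinuousAt ofDisc ((r * cutoff R x) • p x) :=
      continuousOn_ofDisc.continuousAt (Metric.isOpen_ball.mem_nhds (mem_ball_zero_iff.2 hlt))
    have := (tendsto_sub_nhds_zero_iff.2 (hcont.tendsto.comp hx)).enorm
    simpa using this

/-- The pointwise bound for the energy density of the approximations. The first term on the right
stems from the derivative of the cutoff, the factor 2 from `(a + b)² ≤ 2 a² + 2 b²`. -/
theorem conformalFactor_mul_fderiv_sq_le (hp : IsDiscMap E M p q) {r R K : ℝ} (hr : 0 ≤ r)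
    (hr1 : r < 1) (hR : 0 < R) (hK0 : 0 ≤ K)
    (hK : ∀ x y, |cutoff R x - cutoff R y| ≤ K / R * ‖x - y‖) (l : Fin 2) (m : ℕ) (x : Plane) :
    conformalFactor (discApprox r R p m x) * ‖fderiv ℝ (discApprox r R p m) x (basisVec l)‖ ^ 2 ≤
      8 / (1 - r ^ 2) ^ 2 * (K / R) ^ 2 * moll m (fun x => ‖p x‖ ^ 2) x +
      2 * (conformalFactor (discApprox r R p m x) * moll m (fun x => ‖q l x‖ ^ 2) x) := by
  have hl := (hp.hasWeakDeriv 0).locallyIntegrable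
  have hfd : fderiv ℝ (discApprox r R p m) x (basisVec l) =
      (r * cutoff R x) • moll m (q l) x + (r * fderiv ℝ (cutoff R) x (basisVec l)) • moll m p x := by
    have h1 : HasFDerivAt (fun x => r * cutoff R x) (r • fderiv ℝ (cutoff R) x) x :=
      (((contDiff_cutoff R).differentiable (by simp) x).hasFDerivAt).const_mul r
    have h2 := ((contDiff_moll m hl).differentiable (by simp) x).hasFDerivAt
    have h3 := (h1.smul h2).fderiv
    have h4 : discApprox r R p m = (fun x => r * cutoff R x) • moll m p := rfl
    rw [h4, h3]
    simp [(hp.hasWeakDeriv l).fderiv_moll]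
  have hχ : |fderiv ℝ (cutoff R) x (basisVec l)| ≤ K / R := by
    have h1 : ‖fderiv ℝ (cutoff R) x‖ ≤ K / R :=
      norm_fderiv_le_of_lip' ℝ (by positivity) (Eventually.of_forall fun y => hK y x)
    have h2 := (fderiv ℝ (cutoff R) x).le_opNorm (basisVec l)
    rw [norm_basisVec, mul_one] at h2
    exact h2.trans h1
  obtain ⟨c0, c1⟩ := conformalFactor_le hr1 (hp.norm_discApprox_le (R := R) hr m x)
  have hmp := norm_moll_sq_le hl hp.integrable_sq.locallyIntegrable m x
  have hmq := norm_moll_sq_le (hp.hasWeakDeriv l).locallyIntegrable_deriv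
    (hp.integrable_deriv_sq l).locallyIntegrable m x
  have hk1 := cutoff_le_one R x
  have hk0 := cutoff_nonneg R x
  have n1 : ‖(r * cutoff R x) • moll m (q l) x‖ ≤ ‖moll m (q l) x‖ := by
    rw [norm_smul, Real.norm_of_nonneg (by positivity)]
    exact mul_le_of_le_one_left (norm_nonneg _) (mul_le_one₀ hr1.le hk0 hk1)
  have n2 : ‖(r * fderiv ℝ (cutoff R) x (basisVec l)) • moll m p x‖ ≤
      K / R * ‖moll m p x‖ := by
    rw [norm_smul, norm_mul, Real.norm_of_nonneg hr, Real.norm_eq_abs]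
    have : r * |fderiv ℝ (cutoff R) x (basisVec l)| ≤ 1 * (K / R) :=
      mul_le_mul hr1.le hχ (abs_nonneg _) zero_le_one
    rw [one_mul] at this
    gcongr
  have n3 : ‖fderiv ℝ (discApprox r R p m) x (basisVec l)‖ ^ 2 ≤
      2 * ((K / R) ^ 2 * ‖moll m p x‖ ^ 2) + 2 * ‖moll m (q l) x‖ ^ 2 := by
    have h1 : ‖fderiv ℝ (discApprox r R p m) x (basisVec l)‖ ≤
        ‖moll m (q l) x‖ + K / R * ‖moll m p x‖ := by
      rw [hfd]; exact (norm_add_le _ _).trans (add_le_add n1 n2)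
    have h2 := pow_le_pow_left₀ (norm_nonneg _) h1 2
    nlinarith [sq_nonneg (‖moll m (q l) x‖ - K / R * ‖moll m p x‖)]
  set c := conformalFactor (discApprox r R p m x)
  calc _ ≤ c * (2 * ((K / R) ^ 2 * ‖moll m p x‖ ^ 2) + 2 * ‖moll m (q l) x‖ ^ 2) := by gcongr
    _ = c * (2 * ((K / R) ^ 2 * ‖moll m p x‖ ^ 2)) + 2 * (c * ‖moll m (q l) x‖ ^ 2) := by ring
    _ ≤ 4 / (1 - r ^ 2) ^ 2 * (2 * ((K / R) ^ 2 * moll m (fun x => ‖p x‖ ^ 2) x)) +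
        2 * (c * moll m (fun x => ‖q l x‖ ^ 2) x) := by gcongr
    _ = _ := by ring

theorem lintegral_moll_le {f : Plane → ℝ} (hf : Measurable f) (m : ℕ) :
    ∫⁻ x, ENNReal.ofReal (moll m f x) ≤
      (∫⁻ x, ENNReal.ofReal (f x)) + ∫⁻ x, ‖moll m f x - f x‖ₑ := by
  rw [← lintegral_add_left hf.ennreal_ofReal]
  refine lintegral_mono fun x => ?_
  calc ENNReal.ofReal (moll m f x) = ENNReal.ofReal (f x + (moll m f x - f x)) := by
        congr 1; ring
    _ ≤ ENNReal.ofReal (f x) + ENNReal.ofReal (moll m f x - f x) := ENNReal.ofReal_add_le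
    _ ≤ _ := by gcongr; exact Real.ofReal_le_enorm _

/-- The energy of the approximations is eventually controlled by the energy of the map and a cutoff
error. -/
theorem eventually_lintegral_energy_le (hp : IsDiscMap E M p q) {r R K : ℝ} (hr : 0 ≤ r)
    (hr1 : r < 1) (hR : 0 < R) (hK0 : 0 ≤ K)
    (hK : ∀ x y, |cutoff R x - cutoff R y| ≤ K / R * ‖x - y‖) (l : Fin 2) {ε : ℝ} (hε0 : 0 < ε)
    (hε : 8 / (1 - r ^ 2) ^ 2 * (K / R) ^ 2 * M < ε) :
    ∀ᶠ m in atTop, ∫⁻ x, ENNReal.ofReal (conformalFactor (discApprox r R p m x) *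
        ‖fderiv ℝ (discApprox r R p m) x (basisVec l)‖ ^ 2) ≤
      ENNReal.ofReal ε + 2 * ∫⁻ x, ENNReal.ofReal (conformalFactor (p x) * ‖q l x‖ ^ 2) := by
  set c := 8 / (1 - r ^ 2) ^ 2 * (K / R) ^ 2
  have hc : 0 ≤ c := by positivity
  set W := 4 / (1 - r ^ 2) ^ 2
  have hW : 0 ≤ W := by positivity
  have hmq := (hp.measurable_deriv l).norm.measurable.pow_const 2
  have hmp := hp.measurable.norm.measurable.pow_const 2
  set a : ℕ → ENNReal := fun m => ∫⁻ x, ‖moll m (fun x => ‖p x‖ ^ 2) x - ‖p x‖ ^ 2‖ₑ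
  set b : ℕ → ENNReal := fun m => ∫⁻ x, ‖moll m (fun x => ‖q l x‖ ^ 2) x - ‖q l x‖ ^ 2‖ₑ
  set d : ℕ → ENNReal := fun m => ∫⁻ x, ENNReal.ofReal
    (conformalFactor (discApprox r R p m x) * ‖q l x‖ ^ 2)
  have ha : Tendsto a atTop (𝓝 0) :=
    tendsto_lintegral_moll_sub hmp.stronglyMeasurable hp.integrable_sq
  have hb : Tendsto b atTop (𝓝 0) :=
    tendsto_lintegral_moll_sub hmq.stronglyMeasurable (hp.integrable_deriv_sq l)
  have hconf : ∀ m, Measurable fun x => conformalFactor (discApprox r R p m x) := fun m =>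
    measurable_conformalFactor.comp (hp.contDiff_discApprox r R m).continuous.measurable
  have hd : Tendsto d atTop (𝓝 (∫⁻ x, ENNReal.ofReal
      (conformalFactor ((r * cutoff R x) • p x) * ‖q l x‖ ^ 2))) := by
    refine tendsto_lintegral_of_dominated_convergence
      (fun x => ENNReal.ofReal W * ENNReal.ofReal (‖q l x‖ ^ 2))
      (fun m => ((hconf m).mul hmq).ennreal_ofReal)
      (fun m => Eventually.of_forall fun x => ?_) ?_ ?_
    · beta_reduce
      rw [← ENNReal.ofReal_mul hW]
      refine ENNReal.ofReal_le_ofReal ?_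
      have := (conformalFactor_le hr1 (hp.norm_discApprox_le (R := R) hr m x)).2
      gcongr
    · rw [lintegral_const_mul' _ _ ENNReal.ofReal_ne_top]
      refine ENNReal.mul_ne_top ENNReal.ofReal_ne_top ?_
      refine ne_of_eq_of_ne (lintegral_congr fun x => ?_) (hp.integrable_deriv_sq l).2.ne
      rw [Real.enorm_of_nonneg (by positivity)]
    · filter_upwards [hp.ae_tendsto_discApprox r R] with x hx
      have := (continuousAt_conformalFactor
        ((hp.norm_cutoff_smul_le (R := R) hr hr1.le x).1.trans_lt hr1)).tendsto.comp hx
      exact (ENNReal.continuous_ofReal.tendsto _).comp (this.mul_const _)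
  have hdle : ∫⁻ x, ENNReal.ofReal (conformalFactor ((r * cutoff R x) • p x) * ‖q l x‖ ^ 2) ≤
      ∫⁻ x, ENNReal.ofReal (conformalFactor (p x) * ‖q l x‖ ^ 2) := by
    refine lintegral_mono fun x => ENNReal.ofReal_le_ofReal ?_
    have := conformalFactor_mono (hp.norm_cutoff_smul_le (R := R) hr hr1.le x).2 (hp.norm_lt_one x)
    gcongr
  -- `a m` and `b m` are the mollification errors; the conformal factor in front of the second is bounded
  -- by `W`
  have hbound : ∀ m, ∫⁻ x, ENNReal.ofReal (conformalFactor (discApprox r R p m x) *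
        ‖fderiv ℝ (discApprox r R p m) x (basisVec l)‖ ^ 2) ≤
      ENNReal.ofReal c * (ENNReal.ofReal M + a m) + 2 * (d m + ENNReal.ofReal W * b m) := by
    intro m
    have hpt : ∀ x, ENNReal.ofReal (conformalFactor (discApprox r R p m x) *
        ‖fderiv ℝ (discApprox r R p m) x (basisVec l)‖ ^ 2) ≤
        ENNReal.ofReal c * ENNReal.ofReal (moll m (fun x => ‖p x‖ ^ 2) x) +
        2 * (ENNReal.ofReal (conformalFactor (discApprox r R p m x) * ‖q l x‖ ^ 2) +
          ENNReal.ofReal W * ‖moll m (fun x => ‖q l x‖ ^ 2) x - ‖q l x‖ ^ 2‖ₑ) := by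
      intro x
      have h1 := hp.conformalFactor_mul_fderiv_sq_le hr hr1 hR hK0 hK l m x
      obtain ⟨c0, c1⟩ := conformalFactor_le hr1 (hp.norm_discApprox_le (R := R) hr m x)
      set k := conformalFactor (discApprox r R p m x)
      set y := moll m (fun x => ‖q l x‖ ^ 2) x
      have h2 : k * y ≤ k * ‖q l x‖ ^ 2 + W * |y - ‖q l x‖ ^ 2| := by
        have h3 : k * (y - ‖q l x‖ ^ 2) ≤ W * |y - ‖q l x‖ ^ 2| :=
          (mul_le_mul_of_nonneg_left (le_abs_self _) c0).trans (by gcongr)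
        linarith
      refine (ENNReal.ofReal_le_ofReal (h1.trans (add_le_add_right
        (mul_le_mul_of_nonneg_left h2 zero_le_two) _))).trans ?_
      refine ENNReal.ofReal_add_le.trans ?_
      rw [ENNReal.ofReal_mul hc, ENNReal.ofReal_mul zero_le_two]
      gcongr
      · simp
      · refine ENNReal.ofReal_add_le.trans ?_
        rw [ENNReal.ofReal_mul hW, ← Real.enorm_eq_ofReal_abs]
    have hm1 : Measurable fun x => ENNReal.ofReal c *
        ENNReal.ofReal (moll m (fun x => ‖p x‖ ^ 2) x) :=
      ((contDiff_moll m hp.integrable_sq.locallyIntegrable).continuous.measurable.ennreal_ofReal).const_mul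
        _
    have hm2 : Measurable fun x => ENNReal.ofReal
        (conformalFactor (discApprox r R p m x) * ‖q l x‖ ^ 2) :=
      ((hconf m).mul hmq).ennreal_ofReal
    refine (lintegral_mono hpt).trans ?_
    rw [lintegral_add_left hm1, lintegral_const_mul' _ _ ENNReal.ofReal_ne_top,
      lintegral_const_mul' _ _ (by norm_num), lintegral_add_left hm2,
      lintegral_const_mul' _ _ ENNReal.ofReal_ne_top]
    gcongr
    exact (lintegral_moll_le hmp m).trans (by gcongr; exact hp.lintegral_sq_le)
  have hlim : Tendsto (fun m => ENNReal.ofReal c * (ENNReal.ofReal M + a m) +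
      2 * (d m + ENNReal.ofReal W * b m)) atTop (𝓝 (ENNReal.ofReal c * (ENNReal.ofReal M + 0) +
      2 * ((∫⁻ x, ENNReal.ofReal (conformalFactor ((r * cutoff R x) • p x) * ‖q l x‖ ^ 2)) +
        ENNReal.ofReal W * 0))) := by
    refine Tendsto.add (ENNReal.Tendsto.const_mul (tendsto_const_nhds.add ha)
      (Or.inr ENNReal.ofReal_ne_top)) (ENNReal.Tendsto.const_mul (hd.add
      (ENNReal.Tendsto.const_mul hb (Or.inr ENNReal.ofReal_ne_top))) (Or.inr (by norm_num)))
  -- the inequality is strict in the limit `m → ∞`, because of the strict bound for the cutoff error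
  have hlt : ENNReal.ofReal c * (ENNReal.ofReal M + 0) +
      2 * ((∫⁻ x, ENNReal.ofReal (conformalFactor ((r * cutoff R x) • p x) * ‖q l x‖ ^ 2)) +
        ENNReal.ofReal W * 0) <
      ENNReal.ofReal ε + 2 * ∫⁻ x, ENNReal.ofReal (conformalFactor (p x) * ‖q l x‖ ^ 2) := by
    rw [add_zero, mul_zero, add_zero]
    refine ENNReal.add_lt_add_of_lt_of_le ?_ ?_ (by gcongr)
    · have := (hdle.trans_lt (hp.lintegral_energy_lt_top l)).ne
      finiteness
    · rw [← ENNReal.ofReal_mul hc]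
      exact (ENNReal.ofReal_lt_ofReal_iff hε0).2 hε
  filter_upwards [hlim.eventually_lt_const hlt] with m hm
  exact (hbound m).trans hm.le

end IsDiscMap

theorem measurable_toDisc : Measurable toDisc :=
  (WithLp.measurable_toLp 2 _).comp (measurable_pi_iff.2 fun i =>
    (contDiff_discCoord i).continuous.measurable)

/-- Contracting a map towards the origin of the disc changes it little in `L¹(B(0, n))`. -/
theorem tendsto_lintegral_ofDisc_smul_sub {v : Plane → Lor} (hv : Measurable v)
    (hvi : LocallyIntegrable v) (hmem : ∀ x, v x ∈ hyperbolicPlane) (n : ℝ) :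
    Tendsto (fun r : ℝ => ∫⁻ x in Metric.ball 0 n, ‖ofDisc (r • toDisc (v x)) - v x‖ₑ)
      (𝓝[<] 1) (𝓝 0) := by
  have hpm : Measurable fun x => toDisc (v x) := measurable_toDisc.comp hv
  have h01 : ∀ᶠ r : ℝ in 𝓝[<] 1, r ∈ Set.Ioo (0 : ℝ) 1 := Ioo_mem_nhdsLT zero_lt_one
  have key := tendsto_lintegral_filter_of_dominated_convergence
    (μ := volume.restrict (Metric.ball (0 : Plane) n)) (l := 𝓝[<] (1 : ℝ)) (f := fun _ => 0)
    (F := fun r x => ‖ofDisc (r • toDisc (v x)) - v x‖ₑ)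
    (fun x => 2 * ‖v x‖ₑ)
    (Eventually.of_forall fun r => ((measurable_ofDisc.comp (hpm.const_smul r)).sub hv).enorm)
    (h01.mono fun r hr => Eventually.of_forall fun x => ?_) ?_ ?_
  · simpa using key
  · have h1 := norm_toDisc_lt_one (hmem x)
    have h2 : ‖r • toDisc (v x)‖ ≤ ‖toDisc (v x)‖ := by
      rw [norm_smul, Real.norm_of_nonneg hr.1.le]
      exact mul_le_of_le_one_left (norm_nonneg _) hr.2.le
    have h3 := discMass_mono h2 h1
    rw [← ofDisc_zero_sub_one h1, ← ofDisc_zero_sub_one (h2.trans_lt h1),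
      ofDisc_toDisc (hmem x)] at h3
    have h4 : ‖ofDisc (r • toDisc (v x))‖ ≤ ‖v x‖ := by
      refine (norm_le_of_mem (ofDisc_mem (h2.trans_lt h1))).trans ?_
      exact (by linarith : ofDisc (r • toDisc (v x)) 0 ≤ v x 0).trans
        ((le_abs_self _).trans (norm_le_pi_norm (v x) 0))
    change ‖ofDisc (r • toDisc (v x)) - v x‖ₑ ≤ 2 * ‖v x‖ₑ
    refine (enorm_sub_le).trans ?_
    rw [two_mul]
    gcongr
    exact enorm_le_iff_norm_le.2 h4
  · rw [lintegral_const_mul' _ _ (by norm_num)]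
    refine ENNReal.mul_ne_top (by norm_num) ?_
    have := (hvi.integrableOn_isCompact (isCompact_closedBall (0 : Plane) n)).mono_set
      Metric.ball_subset_closedBall
    exact this.2.ne
  · refine Eventually.of_forall fun x => ?_
    have hlt := norm_toDisc_lt_one (hmem x)
    have hcont : ContinuousAt ofDisc (toDisc (v x)) :=
      continuousOn_ofDisc.continuousAt (Metric.isOpen_ball.mem_nhds (mem_ball_zero_iff.2 hlt))
    have h1 : Tendsto (fun r : ℝ => r • toDisc (v x)) (𝓝[<] 1) (𝓝 (toDisc (v x))) := by
      have : Tendsto (fun r : ℝ => r • toDisc (v x)) (𝓝 1) (𝓝 ((1 : ℝ) • toDisc (v x))) :=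
        tendsto_id.smul_const _
      rw [one_smul] at this
      exact this.mono_left nhdsWithin_le_nhds
    have h2 := hcont.tendsto.comp h1
    rw [ofDisc_toDisc (hmem x)] at h2
    have := (tendsto_sub_nhds_zero_iff.2 h2).enorm
    simpa using this

theorem hasCompactSupport_discApprox {r R : ℝ} (hR : 0 < R) (p : Plane → Plane) (m : ℕ) :
    HasCompactSupport (discApprox r R p m) :=
  HasCompactSupport.intro (isCompact_closedBall (0 : Plane) (2 * R)) fun x hx => by
    have hz : cutoff R x = 0 := by
      by_contra h
      exact hx (mem_closedBall_zero_iff.2 (norm_lt_of_cutoff_ne_zero hR h).le)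
    simp [discApprox, hz]

/-- A finite-energy map is approximated, with control of mass and energy, by maps given in the disc
model by smooth compactly supported functions. -/
theorem IsDiscMap.exists_smooth {E M : ℝ} {v : Plane → Lor} {q : Fin 2 → Plane → Plane}
    (hp : IsDiscMap E M (fun x => toDisc (v x)) q) (hv : Measurable v)
    (hvi : LocallyIntegrable v) (hmem : ∀ x, v x ∈ hyperbolicPlane) (hE : 0 ≤ E) (hM : 0 ≤ M)
    (n : ℝ) {δ : ENNReal} (hδ : 0 < δ) :
    ∃ (P : Plane → Plane) (r : ℝ), ContDiff ℝ ∞ P ∧ HasCompactSupport P ∧ r < 1 ∧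
      (∀ x, ‖P x‖ ≤ r) ∧
      ∑ l, ∫⁻ x, ENNReal.ofReal (conformalFactor (P x) * ‖fderiv ℝ P x (basisVec l)‖ ^ 2) ≤
        ENNReal.ofReal (2 * E + 1) ∧
      ∫⁻ x, ENNReal.ofReal (discMass (P x)) ≤ ENNReal.ofReal (M + 1) ∧
      ∫⁻ x in Metric.ball 0 n, ‖ofDisc (P x) - v x‖ₑ ≤ δ := by
  have hδ2 : 0 < δ / 2 := ENNReal.half_pos hδ.ne'
  obtain ⟨K, hK0, hK⟩ := exists_cutoff_lipschitz
  have h01 : ∀ᶠ r : ℝ in 𝓝[<] 1, r ∈ Set.Ioo (0 : ℝ) 1 := Ioo_mem_nhdsLT zero_lt_one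
  -- the contraction `r` is chosen first, then the radius `R`, then the mollification `m`
  obtain ⟨r, hrδ, hr0, hr1⟩ := (((tendsto_lintegral_ofDisc_smul_sub hv hvi hmem n).eventually_lt_const
    hδ2).and h01).exists
  have hlim : Tendsto (fun R : ℝ => 8 / (1 - r ^ 2) ^ 2 * (K / R) ^ 2 * M) atTop (𝓝 0) := by
    have h1 : Tendsto (fun R : ℝ => K / R) atTop (𝓝 0) := tendsto_const_nhds.div_atTop tendsto_id
    simpa using ((h1.pow 2).const_mul (8 / (1 - r ^ 2) ^ 2)).mul_const M
  obtain ⟨R, hRε, hRn, hR1⟩ := ((hlim.eventually_lt_const (show (0 : ℝ) < 1 / 2 by norm_num)).and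
    ((eventually_ge_atTop n).and (eventually_ge_atTop 1))).exists
  have hR0 : 0 < R := by linarith
  have hen := fun l => hp.eventually_lintegral_energy_le hr0.le hr1 hR0 hK0 (hK R hR0) l
    (show (0 : ℝ) < 1 / 2 by norm_num) hRε
  have hmass : ∀ᶠ m in atTop, ∫⁻ x, ENNReal.ofReal
      (discMass (discApprox r R (fun x => toDisc (v x)) m x)) < ENNReal.ofReal (M + 1) := by
    refine (hp.tendsto_lintegral_discMass hr0.le hr1 hR0).eventually_lt_const ?_
    refine lt_of_le_of_lt ((lintegral_mono fun x => ENNReal.ofReal_le_ofReal ?_).trans hp.mass)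
      ((ENNReal.ofReal_lt_ofReal_iff (by positivity)).2 (lt_add_one M))
    exact discMass_mono (hp.norm_cutoff_smul_le hr0.le hr1.le x).2 (hp.norm_lt_one x)
  have hL1 := (hp.tendsto_lintegral_ofDisc_sub (R := R) hr0.le hr1 n).eventually_lt_const hδ2
  obtain ⟨m, hm1, hm2, hm3⟩ := ((eventually_all.2 hen).and (hmass.and hL1)).exists
  refine ⟨discApprox r R (fun x => toDisc (v x)) m, r, hp.contDiff_discApprox r R m, ?_, hr1,
    fun x => hp.norm_discApprox_le hr0.le m x, ?_, hm2.le, ?_⟩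
  · exact hasCompactSupport_discApprox hR0 _ m
  · refine (Finset.sum_le_sum fun l _ => hm1 l).trans ?_
    rw [Finset.sum_add_distrib, ← Finset.mul_sum]
    have h1 : ∑ _l : Fin 2, ENNReal.ofReal (1 / 2) = ENNReal.ofReal 1 := by
      rw [Fin.sum_univ_two, ← ENNReal.ofReal_add (by norm_num) (by norm_num)]
      norm_num
    rw [h1, ENNReal.ofReal_add (by positivity) zero_le_one, add_comm,
      ENNReal.ofReal_mul zero_le_two, ENNReal.ofReal_ofNat]
    gcongr
    exact hp.energy
  · have hm : Measurable fun x => ofDisc (discApprox r R (fun x => toDisc (v x)) m x) -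
        ofDisc (r • toDisc (v x)) :=
      (measurable_ofDisc.comp (hp.contDiff_discApprox r R m).continuous.measurable).sub
        (measurable_ofDisc.comp ((measurable_toDisc.comp hv).const_smul r))
    have h1 : ∫⁻ x in Metric.ball 0 n, ‖ofDisc (discApprox r R (fun x => toDisc (v x)) m x) -
        ofDisc (r • toDisc (v x))‖ₑ < δ / 2 := by
      refine lt_of_eq_of_lt (setLIntegral_congr_fun measurableSet_ball fun x hx => ?_) hm3
      have hx' : ‖x‖ ≤ R := (mem_ball_zero_iff.1 hx).le.trans hRn
      simp only [cutoff_eq_one hR0 hx', mul_one]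
    calc _ ≤ ∫⁻ x in Metric.ball 0 n, (‖ofDisc (discApprox r R (fun x => toDisc (v x)) m x) -
          ofDisc (r • toDisc (v x))‖ₑ + ‖ofDisc (r • toDisc (v x)) - v x‖ₑ) := by
          refine lintegral_mono fun x => ?_
          rw [← sub_add_sub_cancel (ofDisc (discApprox r R (fun x => toDisc (v x)) m x))
            (ofDisc (r • toDisc (v x))) (v x)]
          exact enorm_add_le _ _
      _ ≤ δ / 2 + δ / 2 := by
          rw [lintegral_add_left hm.enorm]
          gcongr
      _ = δ := ENNReal.add_halves δ

/-! ### Sampling of smooth maps on the lattice -/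

/-- The site of the lattice of mesh `h` with label `i`. -/
noncomputable def site (h : ℝ) (i : ℤ × ℤ) : Plane := !₂[h * i.1, h * i.2]

/-- The corner of the cell of side `h` containing `x`. -/
noncomputable def snap (h : ℝ) (x : Plane) : Plane := site h (cell h x)

theorem site_add_step (h : ℝ) (i : ℤ × ℤ) (l : Fin 2) :
    site h (i + step l) = site h i + h • basisVec l := by
  ext k
  fin_cases l <;> fin_cases k <;> simp [site, step, basisVec, mul_add]

theorem measurable_snap (h : ℝ) : Measurable (snap h) :=
  (Measurable.of_discrete (f := site h)).comp (measurable_cell h)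

theorem norm_snap_sub_le {h : ℝ} (hh : 0 < h) (x : Plane) : ‖snap h x - x‖ ≤ 2 * h := by
  have key : ∀ y : ℝ, |h * (⌊y / h⌋ : ℝ) - y| ≤ h := fun y => by
    have e : h * (y / h) = y := by field_simp
    have h1 := mul_le_mul_of_nonneg_left (Int.floor_le (y / h)) hh.le
    have h2 := mul_le_mul_of_nonneg_left (Int.lt_floor_add_one (y / h)).le hh.le
    rw [abs_le]
    constructor <;> linarith
  have h0 := sq_le_sq' (abs_le.1 (key (x 0))).1 (abs_le.1 (key (x 0))).2
  have h1 := sq_le_sq' (abs_le.1 (key (x 1))).1 (abs_le.1 (key (x 1))).2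
  refine abs_le_of_sq_le_sq' ?_ (by positivity) |>.2
  rw [plane_norm_sq]
  simp only [snap, site, cell, PiLp.sub_apply, Matrix.cons_val_zero,
    Matrix.cons_val_one]
  nlinarith

theorem tendsto_snap (x : Plane) : Tendsto (fun h => snap h x) (𝓝[>] 0) (𝓝 x) := by
  rw [tendsto_iff_norm_sub_tendsto_zero]
  have h1 : Tendsto (fun h : ℝ => 2 * h) (𝓝[>] 0) (𝓝 0) := by
    have : Tendsto (fun h : ℝ => 2 * h) (𝓝 0) (𝓝 (2 * 0)) := tendsto_id.const_mul 2
    rw [mul_zero] at this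
    exact this.mono_left nhdsWithin_le_nhds
  exact squeeze_zero' (Eventually.of_forall fun h => norm_nonneg _)
    (eventually_mem_nhdsWithin.mono fun h hh => norm_snap_sub_le hh x) h1

theorem tendsto_snap_add (x : Plane) (l : Fin 2) :
    Tendsto (fun h => snap h x + h • basisVec l) (𝓝[>] 0) (𝓝 x) := by
  have h1 : Tendsto (fun h : ℝ => h • basisVec l) (𝓝 0) (𝓝 ((0 : ℝ) • basisVec l)) :=
    tendsto_id.smul_const _
  simpa using (tendsto_snap x).add (h1.mono_left nhdsWithin_le_nhds)

/-- The difference quotient at the corner of the cell converges to the derivative: the base point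
moves with `h`, so strict differentiability is needed. -/
theorem tendsto_slope_snap {P : Plane → Plane} (hP : ContDiff ℝ ∞ P) (x : Plane) (l : Fin 2) :
    Tendsto (fun h : ℝ => h⁻¹ • (P (snap h x + h • basisVec l) - P (snap h x))) (𝓝[>] 0)
      (𝓝 (fderiv ℝ P x (basisVec l))) := by
  have hd : HasStrictFDerivAt P (fderiv ℝ P x) x := hP.contDiffAt.hasStrictFDerivAt (by simp)
  have h1 := hd.isLittleO.comp_tendsto ((tendsto_snap_add x l).prodMk_nhds (tendsto_snap x))
  have h2 : (fun h : ℝ => P (snap h x + h • basisVec l) - P (snap h x) -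
      h • fderiv ℝ P x (basisVec l)) =o[𝓝[>] 0] fun h : ℝ => h := by
    refine (h1.congr_left fun h => ?_).trans_isBigO (Asymptotics.isBigO_of_le _ fun h => ?_)
    · simp
    · simp [norm_smul, norm_basisVec]
  rw [← tendsto_sub_nhds_zero_iff]
  have h3 := h2.tendsto_inv_smul_nhds_zero
  refine h3.congr' (eventually_mem_nhdsWithin.mono fun h hh => ?_)
  rw [smul_sub, inv_smul_smul₀ (ne_of_gt hh)]

/-- Dominated convergence for bounded functions with supports in a fixed ball. -/
theorem tendsto_lintegral_of_bounded {g : ℝ → Plane → ℝ} {g₀ : Plane → ℝ} {D S : ℝ}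
    (hm : ∀ h, Measurable (g h)) (hD : ∀ h ∈ Set.Ioc (0 : ℝ) 1, ∀ x, g h x ≤ D)
    (hS : ∀ h ∈ Set.Ioc (0 : ℝ) 1, ∀ x, S ≤ ‖x‖ → g h x = 0)
    (hlim : ∀ x, Tendsto (fun h => g h x) (𝓝[>] 0) (𝓝 (g₀ x))) :
    Tendsto (fun h => ∫⁻ x, ENNReal.ofReal (g h x)) (𝓝[>] 0) (𝓝 (∫⁻ x, ENNReal.ofReal (g₀ x))) := by
  have h01 : ∀ᶠ h : ℝ in 𝓝[>] 0, h ∈ Set.Ioc (0 : ℝ) 1 := Ioc_mem_nhdsGT zero_lt_one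
  refine tendsto_lintegral_filter_of_dominated_convergence
    ((Metric.ball (0 : Plane) S).indicator fun _ => ENNReal.ofReal D)
    (Eventually.of_forall fun h => (hm h).ennreal_ofReal)
    (h01.mono fun h hh => Eventually.of_forall fun x => ?_) ?_ (Eventually.of_forall fun x =>
      (ENNReal.continuous_ofReal.tendsto _).comp (hlim x))
  · by_cases hx : x ∈ Metric.ball (0 : Plane) S
    · rw [Set.indicator_of_mem hx]
      exact ENNReal.ofReal_le_ofReal (hD h hh x)
    · have : S ≤ ‖x‖ := not_lt.1 fun h => hx (mem_ball_zero_iff.2 h)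
      simp [hS h hh x this]
  · rw [lintegral_indicator measurableSet_ball, setLIntegral_const]
    have := measure_ball_lt_top (μ := (volume : Measure Plane)) (x := 0) (r := S)
    finiteness

/-- Smooth maps of the plane into the disc of radius `r` with support in the ball of radius `S`. -/
structure IsSmoothDiscMap (r S : ℝ) (P : Plane → Plane) : Prop where
  contDiff : ContDiff ℝ ∞ P
  lt_one : r < 1
  norm_le : ∀ x, ‖P x‖ ≤ r
  eq_zero : ∀ x, S ≤ ‖x‖ → P x = 0

namespace IsSmoothDiscMap

variable {r S : ℝ} {P : Plane → Plane}

theorem norm_lt_one (hP : IsSmoothDiscMap r S P) (x : Plane) : ‖P x‖ < 1 :=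
  (hP.norm_le x).trans_lt hP.lt_one

theorem tendsto_comp_snap (hP : IsSmoothDiscMap r S P) (x : Plane) :
    Tendsto (fun h => P (snap h x)) (𝓝[>] 0) (𝓝 (P x)) :=
  (hP.contDiff.continuous.tendsto x).comp (tendsto_snap x)

theorem comp_snap_eq_zero (hP : IsSmoothDiscMap r S P) {h : ℝ} (hh : h ∈ Set.Ioc (0 : ℝ) 1)
    {x : Plane} (hx : S + 3 ≤ ‖x‖) : P (snap h x) = 0 ∧ ∀ l, P (snap h x + h • basisVec l) = 0 := by
  have h1 := norm_snap_sub_le hh.1 x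
  have h2 : ‖x‖ ≤ ‖snap h x‖ + ‖snap h x - x‖ := by
    simpa using norm_sub_le (snap h x) (snap h x - x)
  have h3 := hh.2
  refine ⟨hP.eq_zero _ (by linarith), fun l => hP.eq_zero _ ?_⟩
  have h4 : ‖h • basisVec l‖ = h := by rw [norm_smul, norm_basisVec, mul_one,
    Real.norm_of_nonneg hh.1.le]
  have h5 : ‖snap h x‖ ≤ ‖snap h x + h • basisVec l‖ + ‖h • basisVec l‖ := by
    simpa using norm_sub_le (snap h x + h • basisVec l) (h • basisVec l)
  linarith

theorem measurable_comp_snap (hP : IsSmoothDiscMap r S P) (h : ℝ) :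
    Measurable fun x => P (snap h x) :=
  hP.contDiff.continuous.measurable.comp (measurable_snap h)

theorem tendsto_mass (hP : IsSmoothDiscMap r S P) :
    Tendsto (fun h => ∫⁻ x, ENNReal.ofReal (discMass (P (snap h x)))) (𝓝[>] 0)
      (𝓝 (∫⁻ x, ENNReal.ofReal (discMass (P x)))) := by
  refine tendsto_lintegral_of_bounded (D := 2 / (1 - r ^ 2)) (S := S + 3)
    (fun h => measurable_discMass.comp (hP.measurable_comp_snap h))
    (fun h _ x => (discMass_le hP.lt_one (hP.norm_le _)).2) (fun h hh x hx => ?_) fun x =>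
      (continuousAt_discMass (hP.norm_lt_one x)).tendsto.comp (hP.tendsto_comp_snap x)
  simp [(hP.comp_snap_eq_zero hh hx).1, discMass]

theorem tendsto_dist (hP : IsSmoothDiscMap r S P) :
    Tendsto (fun h => ∫⁻ x, ENNReal.ofReal ‖ofDisc (P (snap h x)) - ofDisc (P x)‖) (𝓝[>] 0)
      (𝓝 0) := by
  have key := tendsto_lintegral_of_bounded (D := 2 * (1 + 2 / (1 - r ^ 2))) (S := max (S + 3) S)
    (g := fun h x => ‖ofDisc (P (snap h x)) - ofDisc (P x)‖) (g₀ := fun _ => 0)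
    (fun h => ((measurable_ofDisc.comp (hP.measurable_comp_snap h)).sub
      (measurable_ofDisc.comp hP.contDiff.continuous.measurable)).norm) (fun h _ x => ?_)
    (fun h hh x hx => ?_) fun x => ?_
  · simpa using key
  · refine (norm_sub_le _ _).trans ?_
    linarith [norm_ofDisc_le hP.lt_one (hP.norm_le (snap h x)),
      norm_ofDisc_le hP.lt_one (hP.norm_le x)]
  · rw [(hP.comp_snap_eq_zero hh ((le_max_left _ _).trans hx)).1,
      hP.eq_zero x ((le_max_right _ _).trans hx), sub_self, norm_zero]
  · have hcont : ContinuousAt ofDisc (P x) := continuousOn_ofDisc.continuousAt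
      (Metric.isOpen_ball.mem_nhds (mem_ball_zero_iff.2 (hP.norm_lt_one x)))
    simpa using (tendsto_sub_nhds_zero_iff.2
      (hcont.tendsto.comp (hP.tendsto_comp_snap x))).norm

/-- The lattice energy of the samples converges to the Dirichlet energy in the disc model. -/
theorem tendsto_energy (hP : IsSmoothDiscMap r S P) (l : Fin 2) :
    Tendsto (fun h : ℝ => ∫⁻ x, ENNReal.ofReal ((h⁻¹) ^ 2 *
      chordSq (ofDisc (P (snap h x))) (ofDisc (P (snap h x + h • basisVec l))))) (𝓝[>] 0)
      (𝓝 (∫⁻ x, ENNReal.ofReal (conformalFactor (P x) * ‖fderiv ℝ P x (basisVec l)‖ ^ 2))) := by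
  have hPc := hP.contDiff.continuous
  have hsupp : HasCompactSupport P := HasCompactSupport.intro (isCompact_closedBall (0 : Plane) S)
    fun x hx => hP.eq_zero x (not_le.1 fun h => hx (mem_closedBall_zero_iff.2 h)).le
  obtain ⟨K, hK⟩ := ContDiff.lipschitzWith_of_hasCompactSupport hsupp hP.contDiff (by simp)
  have hr0 : 0 ≤ r := (norm_nonneg _).trans (hP.norm_le 0)
  have hr2 : 0 < 1 - r ^ 2 := by nlinarith [hP.lt_one]
  have e : ∀ (h : ℝ) (x : Plane), (h⁻¹) ^ 2 * chordSq (ofDisc (P (snap h x)))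
      (ofDisc (P (snap h x + h • basisVec l))) =
      4 * ‖h⁻¹ • (P (snap h x + h • basisVec l) - P (snap h x))‖ ^ 2 /
        ((1 - ‖P (snap h x)‖ ^ 2) * (1 - ‖P (snap h x + h • basisVec l)‖ ^ 2)) := fun h x => by
    rw [chordSq_ofDisc (hP.norm_lt_one _) (hP.norm_lt_one _), norm_smul, mul_pow,
      Real.norm_eq_abs, sq_abs]
    ring
  have hmeas : ∀ a b c : Plane → ℝ, Measurable a → Measurable b → Measurable c →
      Measurable fun x => 4 * a x ^ 2 / ((1 - b x ^ 2) * (1 - c x ^ 2)) := fun a b c _ _ _ => by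
    fun_prop
  simp only [e]
  refine tendsto_lintegral_of_bounded
    (g := fun h x => 4 * ‖h⁻¹ • (P (snap h x + h • basisVec l) - P (snap h x))‖ ^ 2 /
      ((1 - ‖P (snap h x)‖ ^ 2) * (1 - ‖P (snap h x + h • basisVec l)‖ ^ 2))) (D := 4 * K ^ 2 / ((1 - r ^ 2) * (1 - r ^ 2))) (S := S + 3)
    (fun h => ?_) (fun h hh x => ?_) (fun h hh x hx => ?_) fun x => ?_
  · have m1 := hP.measurable_comp_snap h
    have m2 : Measurable fun x => P (snap h x + h • basisVec l) :=
      hPc.measurable.comp ((measurable_snap h).add_const _)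
    have m3 : Measurable fun x => ‖h⁻¹ • (P (snap h x + h • basisVec l) - P (snap h x))‖ :=
      (Measurable.const_smul (m2.sub m1) h⁻¹).norm
    exact hmeas _ _ _ m3 m1.norm m2.norm
  · have h1 := one_sub_sq_le (hP.norm_le (snap h x))
    have h2 := one_sub_sq_le (hP.norm_le (snap h x + h • basisVec l))
    have h3 : ‖h⁻¹ • (P (snap h x + h • basisVec l) - P (snap h x))‖ ≤ K := by
      have := hK.dist_le_mul (snap h x + h • basisVec l) (snap h x)
      rw [dist_eq_norm, dist_eq_norm, add_sub_cancel_left, norm_smul, norm_basisVec, mul_one,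
        Real.norm_of_nonneg hh.1.le] at this
      rw [norm_smul, norm_inv, Real.norm_of_nonneg hh.1.le]
      exact inv_mul_le_of_le_mul₀ hh.1.le K.2 (by linarith)
    have h4 := hr2.le.trans h1
    gcongr
  · obtain ⟨h1, h2⟩ := hP.comp_snap_eq_zero hh hx
    simp [h1, h2 l]
  · have h1 := ((tendsto_slope_snap hP.contDiff x l).norm.pow 2).const_mul 4
    have h2 := ((hP.tendsto_comp_snap x).norm.pow 2).const_sub 1
    have h3 := (((hPc.tendsto x).comp (tendsto_snap_add x l)).norm.pow 2).const_sub 1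
    have h4 := (one_sub_norm_sq_pos (hP.norm_lt_one x)).ne'
    have h5 := h1.div (h2.mul h3) (mul_ne_zero h4 h4)
    refine h5.congr' ?_ |>.trans_eq ?_
    · exact Eventually.of_forall fun h => rfl
    · rw [conformalFactor]
      congr 1
      field_simp

end IsSmoothDiscMap

/-! ### Lattice data and the conclusion -/

theorem IsSmoothDiscMap.exists_site_eq_zero {r S : ℝ} {P : Plane → Plane}
    (hP : IsSmoothDiscMap r S P) {h : ℝ} (hh : 0 < h) :
    ∃ V : Finset (ℤ × ℤ), ∀ i ∉ V, P (site h i) = 0 := by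
  obtain ⟨N, hN⟩ := exists_nat_ge (S / h)
  refine ⟨Finset.Icc (-(N : ℤ)) N ×ˢ Finset.Icc (-(N : ℤ)) N, fun i hi => hP.eq_zero _ ?_⟩
  by_contra! hlt
  refine hi (Finset.mem_product.2 ?_)
  have key : ∀ (m : ℤ) (k : Fin 2), site h i k = h * m → m ∈ Finset.Icc (-(N : ℤ)) N := by
    intro m k hk
    have h1 : |h * (m : ℝ)| ≤ ‖site h i‖ := by
      rw [← hk, ← Real.norm_eq_abs]; exact PiLp.norm_apply_le _ k
    rw [abs_mul, abs_of_pos hh] at h1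
    have h2 : |(m : ℝ)| ≤ N := by
      refine le_trans ?_ hN
      rw [le_div_iff₀ hh]; linarith
    rw [Finset.mem_Icc]
    exact ⟨by exact_mod_cast (abs_le.1 h2).1, by exact_mod_cast (abs_le.1 h2).2⟩
  exact ⟨key i.1 0 (by simp [site]), key i.2 1 (by simp [site])⟩

/-- Finitely supported lattice data of fine mesh approximating a finite-energy map. -/
theorem IsDiscMap.exists_lattice_data {E M : ℝ} {v : Plane → Lor} {q : Fin 2 → Plane → Plane}
    (hp : IsDiscMap E M (fun x => toDisc (v x)) q) (hv : Measurable v)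
    (hvi : LocallyIntegrable v) (hmem : ∀ x, v x ∈ hyperbolicPlane) (hE : 0 ≤ E) (hM : 0 ≤ M)
    (n : ℝ) {δ : ℝ} (hδ : 0 < δ) :
    ∃ (h : ℝ) (V : Finset (ℤ × ℤ)) (a : ℤ × ℤ → Lor), 0 < h ∧ h ≤ δ ∧
      (∀ i, a i ∈ hyperbolicPlane) ∧ (∀ i ∉ V, a i = origin) ∧
      ∫⁻ x, ENNReal.ofReal (a (cell h x) 0 - 1) ≤ ENNReal.ofReal (M + 2) ∧
      ∫⁻ x, ENNReal.ofReal (∑ l, chordSq (a (cell h x)) (a (cell h x + step l))) ≤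
        ENNReal.ofReal (h ^ 2 * (2 * E + 2)) ∧
      ∫⁻ x in Metric.ball 0 n, ‖a (cell h x) - v x‖ₑ ≤ ENNReal.ofReal δ := by
  have hδ2 : 0 < ENNReal.ofReal (δ / 2) := ENNReal.ofReal_pos.2 (by positivity)
  obtain ⟨P, r, hPc, hPs, hr1, hPr, hPE, hPM, hPL⟩ :=
    hp.exists_smooth hv hvi hmem hE hM n hδ2
  obtain ⟨S, hS⟩ := hPs.isBounded.subset_ball (0 : Plane)
  have hP : IsSmoothDiscMap r S P := ⟨hPc, hr1, hPr, fun x hx =>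
    image_eq_zero_of_notMem_tsupport fun h => not_lt.2 hx (mem_ball_zero_iff.1 (hS h))⟩
  have e1 := hP.tendsto_mass.eventually_lt_const (hPM.trans_lt
    ((ENNReal.ofReal_lt_ofReal_iff (by positivity)).2 (show M + 1 < M + 2 by linarith)))
  have e2 := hP.tendsto_dist.eventually_lt_const hδ2
  have e3 := (tendsto_finsetSum Finset.univ fun l _ => hP.tendsto_energy l).eventually_lt_const
    (hPE.trans_lt ((ENNReal.ofReal_lt_ofReal_iff (by positivity)).2
      (show 2 * E + 1 < 2 * E + 2 by linarith)))
  have e4 : ∀ᶠ h : ℝ in 𝓝[>] 0, h ∈ Set.Ioc 0 δ := Ioc_mem_nhdsGT hδ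
  obtain ⟨h, h1, h2, h3, h0, hhδ⟩ := (e1.and (e2.and (e3.and e4))).exists
  obtain ⟨V, hV⟩ := hP.exists_site_eq_zero h0
  have hPm : ∀ x, ofDisc (P x) ∈ hyperbolicPlane := fun x => ofDisc_mem (hP.norm_lt_one x)
  -- sample the smooth map at the corners of the cells
  refine ⟨h, V, fun i => ofDisc (P (site h i)), h0, hhδ, fun i => hPm _,
    fun i hi => by simp only [hV i hi, ofDisc_zero], ?_, ?_, ?_⟩
  · refine le_trans (le_of_eq (lintegral_congr fun x => ?_)) h1.le
    rw [ofDisc_zero_sub_one (hP.norm_lt_one _)]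
    rfl
  · have hm : ∀ l, Measurable fun x => ENNReal.ofReal ((h⁻¹) ^ 2 *
        chordSq (ofDisc (P (snap h x))) (ofDisc (P (snap h x + h • basisVec l)))) := fun l => by
      have m1 : Measurable fun i => ENNReal.ofReal ((h⁻¹) ^ 2 *
        chordSq (ofDisc (P (site h i))) (ofDisc (P (site h i + h • basisVec l)))) :=
        Measurable.of_discrete
      exact m1.comp (measurable_cell h)
    rw [ENNReal.ofReal_mul (by positivity)]
    calc _ = ∫⁻ x, ENNReal.ofReal (h ^ 2) * ∑ l, ENNReal.ofReal ((h⁻¹) ^ 2 *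
          chordSq (ofDisc (P (snap h x))) (ofDisc (P (snap h x + h • basisVec l)))) := by
          refine lintegral_congr fun x => ?_
          have hnn : ∀ l ∈ Finset.univ, 0 ≤ (h⁻¹) ^ 2 * chordSq (ofDisc (P (snap h x)))
              (ofDisc (P (snap h x + h • basisVec l))) := fun l _ =>
            mul_nonneg (by positivity) (chordSq_nonneg (hPm _) (hPm _))
          rw [← ENNReal.ofReal_sum_of_nonneg hnn, ← ENNReal.ofReal_mul (by positivity),
            ← Finset.mul_sum, ← mul_assoc, ← mul_pow, mul_inv_cancel₀ h0.ne', one_pow, one_mul]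
          simp only [site_add_step, snap]
      _ = ENNReal.ofReal (h ^ 2) * ∑ l, ∫⁻ x, ENNReal.ofReal ((h⁻¹) ^ 2 *
          chordSq (ofDisc (P (snap h x))) (ofDisc (P (snap h x + h • basisVec l)))) := by
          rw [lintegral_const_mul' _ _ ENNReal.ofReal_ne_top,
            lintegral_finsetSum _ fun l _ => hm l]
      _ ≤ _ := by gcongr
  · have m1 : Measurable fun x => ‖ofDisc (P (snap h x)) - ofDisc (P x)‖ₑ :=
      ((measurable_ofDisc.comp (hP.measurable_comp_snap h)).sub
        (measurable_ofDisc.comp hPc.continuous.measurable)).enorm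
    calc _ ≤ ∫⁻ x in Metric.ball 0 n, (‖ofDisc (P (snap h x)) - ofDisc (P x)‖ₑ +
          ‖ofDisc (P x) - v x‖ₑ) := by
          refine lintegral_mono fun x => ?_
          change ‖ofDisc (P (snap h x)) - v x‖ₑ ≤ _
          rw [← sub_add_sub_cancel (ofDisc (P (snap h x))) (ofDisc (P x)) (v x)]
          exact enorm_add_le _ _
      _ ≤ ENNReal.ofReal (δ / 2) + ENNReal.ofReal (δ / 2) := by
          rw [lintegral_add_left m1]
          refine add_le_add ((setLIntegral_le_lintegral _ _).trans ?_) hPL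
          simpa only [ofReal_norm] using h2.le
      _ = ENNReal.ofReal δ := by
          rw [← ENNReal.ofReal_add (by positivity) (by positivity), add_halves]

/-- Almost everywhere convergence from summable bounds in `L¹` of growing balls. -/
theorem ae_tendsto_zero_of_lintegral_ball_le {f : ℕ → Plane → Lor} (hf : ∀ n, Measurable (f n))
    (h : ∀ n : ℕ, ∫⁻ x in Metric.ball 0 (n : ℝ), ‖f n x‖ₑ ≤ ENNReal.ofReal ((1 / 2) ^ n)) :
    ∀ᵐ x, Tendsto (fun n => f n x) atTop (𝓝 0) := by
  -- on the ball of radius `R` the bound holds from the index `R` on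
  have key : ∀ R : ℕ, ∀ᵐ x, Tendsto (fun n =>
      (Metric.ball (0 : Plane) R).indicator (f (n + R)) x) atTop (𝓝 0) := fun R => by
    refine ae_tendsto_zero_of_summable (fun n => (hf _).indicator measurableSet_ball)
      fun R' => ⟨1, fun n => ?_⟩
    calc _ ≤ ∫⁻ x, ‖(Metric.ball (0 : Plane) R).indicator (f (n + R)) x‖ₑ :=
          setLIntegral_le_lintegral _ _
      _ = ∫⁻ x in Metric.ball 0 (R : ℝ), ‖f (n + R) x‖ₑ := by
          rw [← lintegral_indicator measurableSet_ball]
          simp only [enorm_indicator_eq_indicator_enorm]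
      _ ≤ ∫⁻ x in Metric.ball 0 ((n + R : ℕ) : ℝ), ‖f (n + R) x‖ₑ :=
          lintegral_mono_set (Metric.ball_subset_ball (by push_cast; linarith [n.cast_nonneg (α := ℝ)]))
      _ ≤ _ := (h _).trans (ENNReal.ofReal_le_ofReal (by
          rw [mul_one]
          exact pow_le_pow_of_le_one (by norm_num) (by norm_num) (Nat.le_add_right n R)))
  filter_upwards [ae_all_iff.2 key] with x hx
  obtain ⟨R, hR⟩ := exists_nat_gt ‖x‖
  have := hx R
  simp only [Set.indicator_of_mem (mem_ball_zero_iff.2 hR)] at this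
  exact (tendsto_add_atTop_iff_nat R).1 this

/-- Lattice approximations, subsequentially convergent, of a finite-energy map. -/
theorem IsDiscMap.exists_isLatticeLimit {E M : ℝ} {v : Plane → Lor} {q : Fin 2 → Plane → Plane}
    (hp : IsDiscMap E M (fun x => toDisc (v x)) q) (hv : Measurable v)
    (hvi : LocallyIntegrable v) (hmem : ∀ x, v x ∈ hyperbolicPlane) (hE : 0 ≤ E) (hM : 0 ≤ M) :
    ∃ (E' C : ℝ) (h T : ℕ → ℝ) (u : ℕ → ℝ → Plane → Lor) (U : ℝ → Plane → Lor), 0 ≤ E' ∧ 0 ≤ C ∧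
      IsLatticeLimit E' C h T u U ∧ IsLatticeLimit.HasTimeModulus U ∧ U 0 =ᵐ[volume] v := by
  set E' := 2 * E + 2
  set C := momentConst E' * (M + 2)
  have hE' : 0 ≤ E' := by positivity
  have hC : 0 ≤ C := by
    have : 0 ≤ momentConst E' := by unfold momentConst; positivity
    positivity
  have hpow : ∀ n : ℕ, (0 : ℝ) < (1 / 2) ^ n := fun n => by positivity
  -- mesh and error at most `2⁻ⁿ`, and the flow on a region of size `n + 1`
  choose h V a h0 hh ha haV haM haE haL using fun n : ℕ =>
    hp.exists_lattice_data hv hvi hmem hE hM n (hpow n)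
  choose u hu hu0 using fun n : ℕ => exists_isLatticeApprox (T := n + 1) (h0 n) (by positivity) hE'
    (by positivity) (ha n) (haV n) (haM n) (haE n)
  obtain ⟨σ, U, hσ, hUm, hUt, hUs, hmod⟩ := exists_subseq_tendsto hC hE' hu hh
  have hσt := hσ.tendsto_atTop
  have hlim0 : Tendsto h atTop (𝓝 0) :=
    squeeze_zero (fun n => (h0 n).le) hh
      (tendsto_pow_atTop_nhds_zero_of_lt_one (by norm_num) (by norm_num))
  refine ⟨E', C, fun n => h (σ n), fun n => (σ n : ℝ) + 1, fun n => u (σ n), U, hE', hC,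
    ⟨fun n => hu _, fun n => (hh _).trans (pow_le_one₀ (by norm_num) (by norm_num)),
      hlim0.comp hσt, ?_, hUm, hUt, hUs⟩, hmod, ?_⟩
  · exact tendsto_atTop_add_const_right _ _ (tendsto_natCast_atTop_atTop.comp hσt)
  · have hconv := ae_tendsto_zero_of_lintegral_ball_le (f := fun n x => a n (cell (h n) x) - v x)
      (fun n => ((Measurable.of_discrete (f := a n)).comp (measurable_cell _)).sub hv) haL
    filter_upwards [hUt 0, hconv] with x h1 h2
    have h3 : Tendsto (fun n => u (σ n) 0 x - v x) atTop (𝓝 0) := by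
      simp only [hu0]
      exact h2.comp hσt
    exact tendsto_nhds_unique h1 (tendsto_sub_nhds_zero_iff.1 h3)

theorem theorem4p4 (uStar : Plane → Lor) (hH1 : InHomogeneousH1 uStar)
    (hmass : Integrable (fun x => uStar x 0 - 1)) :
    ∃ (u : ℝ → Plane → Lor) (G : ℝ → Plane → Fin 2 → Lor),
      IsGlobalWeakSolution u G ∧
      u 0 =ᵐ[volume] uStar ∧
      (∃ C : NNReal, ∀ᵐ t : ℝ, MemLp (fun x => gradNorm (G t x)) 2 ∧
        eLpNorm (fun x => gradNorm (G t x)) 2 volume ≤ C) ∧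
      (∀ K : Set Plane, IsCompact K → ContinuousInLp 2 (volume.restrict K) u) ∧
      ContinuousInLp 1 volume (fun t x => u t x 0 - 1) := by
  obtain ⟨v, E₀, M, q, hE₀, hM, hve, hvmem, hvm, hvi, hp⟩ := hH1.exists_isDiscMap hmass
  obtain ⟨E, C, h, T, w, U, hE, hC, hU, hmod, hU0⟩ :=
    hp.exists_isLatticeLimit hvm hvi hvmem hE₀ hM
  obtain ⟨G, hG, hF, hGE, hGw, heq⟩ := hU.exists_gradient hE
  exact ⟨U, G, ⟨hU.mem, hU.locallyIntegrable, hG, ae_hasWeakGradient hU.locallyIntegrable hG hGw,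
    hF, heq⟩, hU0.trans hve, ⟨Real.toNNReal √E, hGE⟩, fun K hK => hU.continuousInLp_two hmod hK,
    hU.continuousInLp_one hC hE hmod⟩
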